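/- Conventions. A supermanifold is a second countable Hausdorff space with a sheaf of (super)commutative real superalgebras that is locally isomorphic to $\mathbb{R}^{p|q}=(\mathbb{R}^p, C^\infty\otimes\Lambda(q))$, where $p|q$ may depend on the connected component; morphisms are morphisms of spaces with a sheaf of superalgebras, and $\mathsf{SMfd}$ is the resulting category. Manifolds (second countable, Hausdorff, smooth, possibly of different dimensions on different components) are the purely even supermanifolds. Let $0\le n<\infty$. A Lie $n$-groupoid is a simplicial manifold $X$ such that for all $m\ge 1$ and $0\le k\le m$ the presheaf $\operatorname{Hom}(\Lambda^m_k,X)$ on manifolds is represented by a manifold $X_{m,k}$, and the natural map $X_m\to X_{m,k}$ is a surjective submersion, which is a diffeomorphism if $m>n$. Let $D=\mathbb{R}^{0|1}$ be the odd line and let $P$ be the nerve of the pair groupoid of $D$, so $P_k=D^{k+1}$. The 1-jet of $X$ is the presheaf on $\mathsf{SMfd}$ $$\underline{\hom}(P,X)\colon T\longmapsto \hom(P\times T,X),$$ where $T$ is regarded as a constant simplicial supermanifold. The monoid $D^D\colon T\mapsto\hom(D\times T,D)$, with product $g_1\cdot g_2=g_2\circ(g_1,\mathrm{pr}_T)$,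 acts naturally on it by acting on every factor $D$ of $P_k=D^{k+1}$, that is, $g\cdot f=f\circ(P(g),\mathrm{pr}_T)$. An NQ-manifold (higher Lie algebroid) is a supermanifold with an action of the monoid $D^D$ such that $-1\in D^D$, that is, $\delta\mapsto-\delta$, acts as the parity involution (the identity on points and $a\mapsto(-1)^{|a|}a$ on functions). Theorem (Ševera's representability theorem). Let $X$ be a Lie $n$-groupoid. Then the presheaf $\underline{\hom}(P,X)$ is representable by a supermanifold, and the natural action of $D^D$ makes the representing supermanifold an NQ-manifold: there are an NQ-manifold $M$ and an isomorphism of presheaves $\hom(-,M)\cong\underline{\hom}(P,X)$ that is equivariant for the actions of $D^D$. -/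

import Mathlib

open CategoryTheory Opposite TopologicalSpace AlgebraicGeometry MonoidalCategory CartesianMonoidalCategory
open scoped Simplicial

noncomputable section
namespace Supergeometry

/-- A (super)commutative real superalgebra. -/
structure SuperAlg : Type 1 where
  carrier : Type
  [ring : Ring carrier]
  [algebra : Algebra ℝ carrier]
  part : ZMod 2 → Submodule ℝ carrier
  [gradedMonoid : SetLike.GradedMonoid part]
  isCompl : IsCompl (part 0) (part 1)
  supercomm : ∀ (i j : ZMod 2) (a b : carrier), a ∈ part i → b ∈ part j →
    a * b = (-1 : ℤˣ) ^ (i * j) • (b * a)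

namespace SuperAlg

instance : CoeSort SuperAlg Type := ⟨carrier⟩
attribute [instance] SuperAlg.ring SuperAlg.algebra SuperAlg.gradedMonoid

/-- A homomorphism of superalgebras: a parity preserving homomorphism of unital algebras. -/
@[ext]
structure Hom (A B : SuperAlg) where
  toAlgHom : A →ₐ[ℝ] B
  map_mem : ∀ (i : ZMod 2) (a : A), a ∈ A.part i → toAlgHom a ∈ B.part i

instance : Category SuperAlg where
  Hom := Hom
  id A := ⟨AlgHom.id ℝ A, fun _ _ h => h⟩
  comp f g := ⟨g.toAlgHom.comp f.toAlgHom, fun i a h => g.map_mem i _ (f.map_mem i a h)⟩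

@[ext]
theorem hom_ext {A B : SuperAlg} {f g : A ⟶ B} (h : ∀ a, f.toAlgHom a = g.toAlgHom a) : f = g :=
  Hom.ext (AlgHom.ext h)

@[simp] theorem id_apply (A : SuperAlg) (a : A) : Hom.toAlgHom (𝟙 A) a = a := rfl

@[simp] theorem comp_apply {A B C : SuperAlg} (f : A ⟶ B) (g : B ⟶ C) (a : A) :
    Hom.toAlgHom (f ≫ g) a = g.toAlgHom (f.toAlgHom a) := rfl

/-- The linear map `a ↦ (-1)^|a| a`. -/
def parityLin (A : SuperAlg) : A →ₗ[ℝ] A :=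
  Submodule.projection _ _ A.isCompl - Submodule.projection _ _ A.isCompl.symm

theorem exists_parts (A : SuperAlg) (a : A) :
    ∃ x ∈ A.part 0, ∃ y ∈ A.part 1, a = x + y :=
  ⟨_, Submodule.projection_apply_mem A.isCompl a, _,
    Submodule.projection_apply_mem A.isCompl.symm a,
    (Submodule.projection_add_projection_eq_self A.isCompl a).symm⟩

theorem parityLin_even (A : SuperAlg) {a : A} (h : a ∈ A.part 0) : A.parityLin a = a := by
  have h1 := Submodule.projection_apply_left A.isCompl ⟨a, h⟩
  have h2 := Submodule.projection_apply_right A.isCompl.symm ⟨a, h⟩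
  simp only [parityLin, LinearMap.sub_apply]
  rw [h1, h2, sub_zero]

theorem parityLin_odd (A : SuperAlg) {a : A} (h : a ∈ A.part 1) : A.parityLin a = -a := by
  have h1 := Submodule.projection_apply_right A.isCompl ⟨a, h⟩
  have h2 := Submodule.projection_apply_left A.isCompl.symm ⟨a, h⟩
  simp only [parityLin, LinearMap.sub_apply]
  rw [h1, h2, zero_sub]

theorem mul_mem_part (A : SuperAlg) {i j k : ZMod 2} (h : i + j = k) {a b : A}
    (ha : a ∈ A.part i) (hb : b ∈ A.part j) : a * b ∈ A.part k :=
  h ▸ SetLike.mul_mem_graded ha hb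

theorem parityLin_mul (A : SuperAlg) (a b : A) :
    A.parityLin (a * b) = A.parityLin a * A.parityLin b := by
  obtain ⟨x, hx, y, hy, rfl⟩ := A.exists_parts a
  obtain ⟨z, hz, w, hw, rfl⟩ := A.exists_parts b
  have e1 := A.parityLin_even (A.mul_mem_part (k := 0) (by decide) hx hz)
  have e2 := A.parityLin_odd (A.mul_mem_part (k := 1) (by decide) hx hw)
  have e3 := A.parityLin_odd (A.mul_mem_part (k := 1) (by decide) hy hz)
  have e4 := A.parityLin_even (A.mul_mem_part (k := 0) (by decide) hy hw)
  simp only [add_mul, mul_add, map_add, e1, e2, e3, e4, A.parityLin_even hx, A.parityLin_even hz,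
    A.parityLin_odd hy, A.parityLin_odd hw, neg_mul, mul_neg]
  abel

/-- The parity involution `a ↦ (-1)^|a| a` of a superalgebra. -/
def parity (A : SuperAlg) : A ⟶ A where
  toAlgHom := AlgHom.ofLinearMap A.parityLin
    (A.parityLin_even SetLike.GradedOne.one_mem) A.parityLin_mul
  map_mem := by
    intro i a h
    fin_cases i
    · exact (A.parityLin_even h).symm ▸ h
    · exact (A.parityLin_odd h).symm ▸ (A.part 1).neg_mem h

theorem parity_naturality {A B : SuperAlg} (f : A ⟶ B) : f ≫ B.parity = A.parity ≫ f := by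
  ext a
  obtain ⟨x, hx, y, hy, rfl⟩ := A.exists_parts a
  change B.parityLin (f.toAlgHom (x + y)) = f.toAlgHom (A.parityLin (x + y))
  simp only [map_add, A.parityLin_even hx, A.parityLin_odd hy, map_neg,
    B.parityLin_even (f.map_mem 0 x hx), B.parityLin_odd (f.map_mem 1 y hy)]

end SuperAlg

/-- The Grassmann algebra on `q` odd generators. -/
abbrev Grassmann (q : ℕ) : Type := ExteriorAlgebra ℝ (Fin q → ℝ)

/-- The decomposition of the Grassmann algebra into even and odd elements. -/
abbrev Grassmann.part (q : ℕ) (i : ZMod 2) : Submodule ℝ (Grassmann q) :=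
  CliffordAlgebra.evenOdd (0 : QuadraticForm ℝ (Fin q → ℝ)) i

theorem Grassmann.supercomm {q : ℕ} (i j : ZMod 2) (a b : Grassmann q)
    (ha : a ∈ Grassmann.part q i) (hb : b ∈ Grassmann.part q j) :
    a * b = (-1 : ℤˣ) ^ (i * j) • (b * a) := by
  have h := CliffordAlgebra.map_mul_map_of_isOrtho_of_mem_evenOdd
    (QuadraticMap.Isometry.id (0 : QuadraticForm ℝ (Fin q → ℝ)))
    (QuadraticMap.Isometry.id (0 : QuadraticForm ℝ (Fin q → ℝ)))
    (fun x y => by simp [QuadraticMap.IsOrtho]) a b ha hb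
  rw [mul_comm j i] at h
  simpa [CliffordAlgebra.map_id] using h

instance Grassmann.instFinite (q : ℕ) : Module.Finite ℝ (Grassmann q) :=
  Module.Finite.of_basis (Pi.basisFun ℝ (Fin q)).ExteriorAlgebra

section Smooth
open scoped Manifold ContDiff

/-- A Grassmann-algebra valued function on an open subset of `ℝ^p` is smooth if all its
coordinates are smooth; that is, its composite with every linear functional is smooth. -/
def IsSmooth {p q : ℕ} {U : Opens (Fin p → ℝ)} (f : U → Grassmann q) : Prop :=
  ∀ φ : Module.Dual ℝ (Grassmann q),
    ContMDiff 𝓘(ℝ, Fin p → ℝ) 𝓘(ℝ, ℝ) ∞ (fun x => φ (f x))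

theorem IsSmooth.linear {p q r : ℕ} {U : Opens (Fin p → ℝ)} {f : U → Grassmann q}
    (hf : IsSmooth f) (L : Grassmann q →ₗ[ℝ] Grassmann r) : IsSmooth (fun x => L (f x)) :=
  fun φ => hf (φ.comp L)

theorem IsSmooth.const {p q : ℕ} {U : Opens (Fin p → ℝ)} (c : Grassmann q) :
    IsSmooth (fun _ : U => c) := fun _ => contMDiff_const

theorem IsSmooth.add {p q : ℕ} {U : Opens (Fin p → ℝ)} {f g : U → Grassmann q}
    (hf : IsSmooth f) (hg : IsSmooth g) : IsSmooth (f + g) := fun φ => by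
  simp only [Pi.add_apply, map_add]
  exact (hf φ).add (hg φ)

theorem IsSmooth.mul {p q : ℕ} {U : Opens (Fin p → ℝ)} {f g : U → Grassmann q}
    (hf : IsSmooth f) (hg : IsSmooth g) : IsSmooth (f * g) := fun φ => by
  let b := Module.finBasis ℝ (Grassmann q)
  have key : (fun x => φ ((f * g) x)) = fun x =>
      ∑ i, ∑ j, b.coord i (f x) * b.coord j (g x) * φ (b i * b j) := by
    funext x
    conv_lhs => rw [Pi.mul_apply, ← b.sum_repr (f x), ← b.sum_repr (g x), Finset.sum_mul_sum]
    simp only [map_sum, smul_mul_smul_comm, map_smul, smul_eq_mul, Module.Basis.coord_apply]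
  rw [key]
  exact contMDiff_finsetSum fun i _ => contMDiff_finsetSum fun j _ =>
    ((hf (b.coord i)).mul (hg (b.coord j))).mul contMDiff_const

theorem IsSmooth.comp {p p' q : ℕ} {U : Opens (Fin p → ℝ)} {V : Opens (Fin p' → ℝ)}
    {f : U → Grassmann q} (hf : IsSmooth f) (h : V → U)
    (hh : ContMDiff 𝓘(ℝ, Fin p' → ℝ) 𝓘(ℝ, Fin p → ℝ) ∞ h) : IsSmooth (f ∘ h) :=
  fun φ => (hf φ).comp hh

theorem isSmooth_of_local {p q : ℕ} {U : Opens (Fin p → ℝ)} {f : U → Grassmann q}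
    (h : ∀ x : U, ∃ (V : Opens (Fin p → ℝ)) (hVU : V ≤ U), x.1 ∈ V ∧
      IsSmooth (fun y : V => f (Opens.inclusion hVU y))) : IsSmooth f := by
  intro φ x
  obtain ⟨V, hVU, hx, hV⟩ := h x
  have := (contDiffWithinAt_localInvariantProp (I := 𝓘(ℝ, Fin p → ℝ)) (I' := 𝓘(ℝ, ℝ))
    ∞).liftPropAt_iff_comp_inclusion hVU (fun x => φ (f x)) ⟨x.1, hx⟩
  exact this.2 (hV φ ⟨x.1, hx⟩)

/-- The algebra `C^∞(U) ⊗ Λ(q)`, realised as smooth functions `U → Λ(q)`. -/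
def smoothSections (p q : ℕ) (U : Opens (Fin p → ℝ)) : Subalgebra ℝ (U → Grassmann q) where
  carrier := {f | IsSmooth f}
  mul_mem' := IsSmooth.mul
  add_mem' := IsSmooth.add
  algebraMap_mem' c := IsSmooth.const (algebraMap ℝ (Grassmann q) c)

/-- The superalgebra `C^∞(U) ⊗ Λ(q)`, with parity induced from `Λ(q)`. -/
def stdSections (p q : ℕ) (U : Opens (Fin p → ℝ)) : SuperAlg where
  carrier := smoothSections p q U
  part i :=
    { carrier := {f | ∀ x, f.1 x ∈ Grassmann.part q i}
      add_mem' := fun hf hg x => add_mem (hf x) (hg x)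
      zero_mem' := fun _ => zero_mem _
      smul_mem' := fun c _ hf x => Submodule.smul_mem _ c (hf x) }
  gradedMonoid :=
    { one_mem := fun _ => SetLike.GradedOne.one_mem (A := Grassmann.part q)
      mul_mem := fun _ _ _ _ hf hg x =>
        SetLike.GradedMul.mul_mem (A := Grassmann.part q) (hf x) (hg x) }
  isCompl := by
    have hc := CliffordAlgebra.evenOdd_isCompl (0 : QuadraticForm ℝ (Fin q → ℝ))
    refine isCompl_iff.2 ⟨Submodule.disjoint_def.2 fun f h0 h1 => ?_, ?_⟩
    · refine Subtype.ext (funext fun x => ?_)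
      exact Submodule.disjoint_def.1 hc.disjoint _ (h0 x) (h1 x)
    · refine codisjoint_iff.2 (eq_top_iff.2 fun f _ => ?_)
      refine Submodule.mem_sup.2 ⟨⟨_, f.2.linear (Submodule.projection _ _ hc)⟩,
        fun x => Submodule.projection_apply_mem hc _, ⟨_, f.2.linear (Submodule.projection _ _ hc.symm)⟩,
        fun x => Submodule.projection_apply_mem hc.symm _, Subtype.ext (funext fun x => ?_)⟩
      exact Submodule.projection_add_projection_eq_self hc (f.1 x)
  supercomm i j f g hf hg :=
    Subtype.ext (funext fun x => Grassmann.supercomm i j _ _ (hf x) (hg x))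

/-- Pullback of Grassmann-valued functions along a smooth map `h` of the base, followed by an even
algebra homomorphism of Grassmann algebras applied to the values. -/
def stdSections.pull {p p' q q' : ℕ} {U : Opens (Fin p → ℝ)} {V : Opens (Fin p' → ℝ)}
    (h : V → U) (hh : ContMDiff 𝓘(ℝ, Fin p' → ℝ) 𝓘(ℝ, Fin p → ℝ) ∞ h)
    (L : Grassmann q →ₐ[ℝ] Grassmann q')
    (hL : ∀ i a, a ∈ Grassmann.part q i → L a ∈ Grassmann.part q' i) :
    stdSections p q U ⟶ stdSections p' q' V where
  toAlgHom :=
    { toFun := fun f => ⟨fun x => L (f.1 (h x)), (f.2.comp h hh).linear L.toLinearMap⟩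
      map_one' := Subtype.ext (funext fun _ => map_one L)
      map_mul' := fun _ _ => Subtype.ext (funext fun _ => map_mul L _ _)
      map_zero' := Subtype.ext (funext fun _ => map_zero L)
      map_add' := fun _ _ => Subtype.ext (funext fun _ => map_add L _ _)
      commutes' := fun c => Subtype.ext (funext fun _ => L.commutes c) }
  map_mem i _ hf x := hL i _ (hf (h x))

theorem contMDiff_restrict {p p' : ℕ} (A : (Fin p → ℝ) →L[ℝ] (Fin p' → ℝ)) (U : Opens (Fin p' → ℝ))
    (V : Opens (Fin p → ℝ)) (h : ∀ x : V, A x.1 ∈ U) :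
    ContMDiff 𝓘(ℝ, Fin p → ℝ) 𝓘(ℝ, Fin p' → ℝ) ∞ (fun x : V => (⟨A x.1, h x⟩ : U)) :=
  (ContMDiff.subtypeVal_comp_iff _ _).1 (A.contDiff.contMDiff.comp contMDiff_subtype_val)

/-- The presheaf `U ↦ C^∞(U) ⊗ Λ(q)` on `ℝ^p`. -/
def stdPresheaf (p q : ℕ) : TopCat.Presheaf SuperAlg (TopCat.of (Fin p → ℝ)) where
  obj U := stdSections p q U.unop
  map i := stdSections.pull (Opens.inclusion i.unop.le) (contMDiff_inclusion i.unop.le)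
    (AlgHom.id ℝ _) (fun _ _ h => h)
  map_id _ := rfl
  map_comp _ _ := rfl

end Smooth

theorem stdPresheaf_isSheaf (p q : ℕ) : (stdPresheaf p q).IsSheaf := by
  intro E U S hS x hx
  have hS' : ∀ y : U, ∃ (V : Opens (Fin p → ℝ)) (i : V ⟶ U), S i ∧ y.1 ∈ V := fun y => by
    obtain ⟨V, i, hi, hy⟩ := hS y.1 y.2
    exact ⟨V, i, hi, hy⟩
  choose V i hi hV using hS'
  -- the value of a local section at a point does not depend on the section
  have key : ∀ (e : E) (y : U) (W : Opens (Fin p → ℝ)) (j : W ⟶ U) (hj : S j) (hy : y.1 ∈ W),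
      ((x (i y) (hi y)).toAlgHom e).1 ⟨y.1, hV y⟩ = ((x j hj).toAlgHom e).1 ⟨y.1, hy⟩ := by
    intro e y W j hj hy
    have h := hx (Y₁ := V y) (Y₂ := W) (Z := V y ⊓ W) (homOfLE inf_le_left) (homOfLE inf_le_right)
      (hi y) hj (Subsingleton.elim _ _)
    have h2 := congrArg (fun (f : E ⟶ stdSections p q (V y ⊓ W)) =>
      (f.toAlgHom e).1 ⟨y.1, hV y, hy⟩) h
    exact h2
  refine ⟨(⟨{ toFun := fun e => ⟨fun y => ((x (i y) (hi y)).toAlgHom e).1 ⟨y.1, hV y⟩, ?_⟩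
              map_one' := ?_
              map_mul' := ?_
              map_zero' := ?_
              map_add' := ?_
              commutes' := ?_ }, ?_⟩ : E ⟶ stdSections p q U), ?_, ?_⟩
  · refine isSmooth_of_local fun y => ⟨V y, (i y).le, hV y, ?_⟩
    have : (fun z : V y => ((x (i (Opens.inclusion (i y).le z)) (hi _)).toAlgHom e).1 ⟨z.1, hV _⟩) =
        ((x (i y) (hi y)).toAlgHom e).1 := by
      funext z
      exact key e (Opens.inclusion (i y).le z) (V y) (i y) (hi y) z.2
    exact this ▸ ((x (i y) (hi y)).toAlgHom e).2
  · refine Subtype.ext (funext fun y => ?_)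
    exact congrArg (fun s : stdSections p q (V y) => s.1 ⟨y.1, hV y⟩)
      (map_one (x (i y) (hi y)).toAlgHom)
  · refine fun a b => Subtype.ext (funext fun y => ?_)
    exact congrArg (fun s : stdSections p q (V y) => s.1 ⟨y.1, hV y⟩)
      (map_mul (x (i y) (hi y)).toAlgHom a b)
  · refine Subtype.ext (funext fun y => ?_)
    exact congrArg (fun s : stdSections p q (V y) => s.1 ⟨y.1, hV y⟩)
      (map_zero (x (i y) (hi y)).toAlgHom)
  · refine fun a b => Subtype.ext (funext fun y => ?_)
    exact congrArg (fun s : stdSections p q (V y) => s.1 ⟨y.1, hV y⟩)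
      (map_add (x (i y) (hi y)).toAlgHom a b)
  · refine fun c => Subtype.ext (funext fun y => ?_)
    exact congrArg (fun s : stdSections p q (V y) => s.1 ⟨y.1, hV y⟩)
      ((x (i y) (hi y)).toAlgHom.commutes c)
  · exact fun k a ha y => (x (i y) (hi y)).map_mem k a ha ⟨y.1, hV y⟩
  · intro W j hj
    refine SuperAlg.hom_ext fun e => Subtype.ext (funext fun y => ?_)
    exact key e ⟨y.1, j.le y.2⟩ W j hj y.2
  · intro g hg
    refine SuperAlg.hom_ext fun e => Subtype.ext (funext fun y => ?_)
    have h := hg (i y) (hi y)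
    exact congrArg (fun (f : E ⟶ stdSections p q (V y)) => (f.toAlgHom e).1 ⟨y.1, hV y⟩) h

/-- The standard supermanifold `ℝ^{p|q}`, as a space with a sheaf of superalgebras. -/
def stdSpace (p q : ℕ) : SheafedSpace SuperAlg where
  carrier := TopCat.of (Fin p → ℝ)
  presheaf := stdPresheaf p q
  IsSheaf := stdPresheaf_isSheaf p q

theorem map_mem_part {q q' : ℕ} (L : (Fin q → ℝ) →ₗ[ℝ] (Fin q' → ℝ)) (i : ZMod 2)
    (a : Grassmann q) (ha : a ∈ Grassmann.part q i) :
    ExteriorAlgebra.map L a ∈ Grassmann.part q' i := by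
  have h : (Grassmann.part q i).map (ExteriorAlgebra.map L).toLinearMap ≤ Grassmann.part q' i := by
    simp only [Grassmann.part, CliffordAlgebra.evenOdd, Submodule.map_iSup]
    refine iSup_mono fun j => ?_
    rw [Submodule.map_pow]
    refine pow_le_pow_left' ?_ _
    rintro _ ⟨_, ⟨v, rfl⟩, rfl⟩
    exact ⟨L v, (ExteriorAlgebra.map_apply_ι L v).symm⟩
  exact h ⟨a, ha, rfl⟩

/-- The morphism `ℝ^{p|q} ⟶ ℝ^{p'|q'}` which is the linear map `A` on the even coordinates and
pulls the odd coordinates of `ℝ^{p'|q'}` back by the linear map `L`. -/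
def stdMap {p q p' q' : ℕ} (A : (Fin p → ℝ) →L[ℝ] (Fin p' → ℝ))
    (L : (Fin q' → ℝ) →ₗ[ℝ] (Fin q → ℝ)) : stdSpace p q ⟶ stdSpace p' q' :=
  InducedCategory.homMk
    { base := TopCat.ofHom ⟨A, A.continuous⟩
      c :=
        { app := fun U => stdSections.pull
            (V := (Opens.map (TopCat.ofHom (⟨A, A.continuous⟩ : C((Fin p → ℝ), (Fin p' → ℝ))))).obj
              U.unop)
            (fun x => ⟨A x.1, x.2⟩)
            (contMDiff_restrict A _ _ fun x => x.2)
            (ExteriorAlgebra.map L) (map_mem_part L)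
          naturality := fun _ _ _ => rfl } }

/-- The parity involution of a space with a sheaf of superalgebras: the identity on points, and
`a ↦ (-1)^|a| a` on functions. -/
def parityInvolution (M : SheafedSpace SuperAlg) : M ⟶ M :=
  InducedCategory.homMk
    { base := 𝟙 _
      c :=
        { app := fun U => (M.presheaf.obj U).parity
          naturality := fun _ _ f => SuperAlg.parity_naturality (M.presheaf.map f) } }

/-! ### Supermanifolds and manifolds -/

/-- `M` has, around every point, a chart to an open part of some `ℝ^{p|q}` with `S p q`. -/
def HasCharts (S : ℕ → ℕ → Prop) (M : SheafedSpace SuperAlg) : Prop :=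
  ∀ x : M, ∃ (p q : ℕ) (U : Opens M) (V : Opens (stdSpace p q)), S p q ∧ x ∈ U ∧
    Nonempty (M.restrict U.isOpenEmbedding ≅ (stdSpace p q).restrict V.isOpenEmbedding)

/-- Supermanifolds: second countable Hausdorff spaces with a sheaf of superalgebras locally
isomorphic to `ℝ^{p|q}`, where `p|q` may depend on the connected component. -/
def isSupermanifold : ObjectProperty (SheafedSpace SuperAlg) := fun M =>
  T2Space M ∧ SecondCountableTopology M ∧ HasCharts (fun _ _ => True) M

/-- Smooth manifolds, as ringed spaces: the purely even supermanifolds. The dimension may depend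
on the connected component. -/
def isManifold : ObjectProperty (SheafedSpace SuperAlg) := fun M =>
  T2Space M ∧ SecondCountableTopology M ∧ HasCharts (fun _ q => q = 0) M

theorem isManifold_le : isManifold ≤ isSupermanifold := fun _ h =>
  ⟨h.1, h.2.1, fun x => by
    obtain ⟨p, q, U, V, -, hU, e⟩ := h.2.2 x
    exact ⟨p, q, U, V, trivial, hU, e⟩⟩

/-- The category of supermanifolds; morphisms are all morphisms of spaces with a sheaf of
superalgebras. -/
abbrev SMfd := isSupermanifold.FullSubcategory

/-- The category of smooth manifolds. -/
abbrev Mfd := isManifold.FullSubcategory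

/-- The inclusion of manifolds into supermanifolds. -/
abbrev Mfd.toSMfd : Mfd ⥤ SMfd := ObjectProperty.ιOfLE isManifold_le

theorem stdSpace_isSupermanifold (p q : ℕ) : isSupermanifold (stdSpace p q) :=
  ⟨inferInstanceAs (T2Space (Fin p → ℝ)), inferInstanceAs (SecondCountableTopology (Fin p → ℝ)),
    fun _ => ⟨p, q, ⊤, ⊤, trivial, trivial, ⟨Iso.refl _⟩⟩⟩

/-- The supermanifold `ℝ^{p|q}`. -/
def std (p q : ℕ) : SMfd := ⟨stdSpace p q, stdSpace_isSupermanifold p q⟩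

/-- The odd line `D = ℝ^{0|1}`. -/
abbrev oddLine : SMfd := std 0 1

/-- Multiplication by `r` on the odd line; it pulls the odd coordinate `δ` back to `r δ`. -/
def oddLine.scale (r : ℝ) : oddLine ⟶ oddLine :=
  ObjectProperty.homMk (stdMap (ContinuousLinearMap.id ℝ _) (r • LinearMap.id))

/-- The parity involution of a supermanifold. -/
def SMfd.parity (M : SMfd) : M ⟶ M := ObjectProperty.homMk (parityInvolution M.obj)

/-- The projection `ℝ^{p|q} × ℝ^{s|t} = ℝ^{p+s|q+t} ⟶ ℝ^{p|q}`. -/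
def stdProj (p q s t : ℕ) : stdSpace (p + s) (q + t) ⟶ stdSpace p q :=
  stdMap (ContinuousLinearMap.pi fun i => ContinuousLinearMap.proj (Fin.castAdd s i))
    (LinearMap.pi (Fin.addCases (fun j => LinearMap.proj j) (fun _ => 0)))

/-- A morphism `f : M ⟶ N` is a submersion if around every point it is, in suitable charts `φ` of
`M` and `ψ` of `N`, the projection `ℝ^{p|q} × ℝ^{s|t} ⟶ ℝ^{p|q}`. Here `g` is the restriction of
`f` to the domains of the charts. -/
def IsSubmersion {M N : SheafedSpace SuperAlg} (f : M ⟶ N) : Prop :=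
  ∀ x : M, ∃ (p q s t : ℕ) (U : Opens M) (V : Opens N) (U' : Opens (stdSpace (p + s) (q + t)))
    (V' : Opens (stdSpace p q))
    (φ : M.restrict U.isOpenEmbedding ≅ (stdSpace (p + s) (q + t)).restrict U'.isOpenEmbedding)
    (ψ : N.restrict V.isOpenEmbedding ≅ (stdSpace p q).restrict V'.isOpenEmbedding)
    (g : M.restrict U.isOpenEmbedding ⟶ N.restrict V.isOpenEmbedding), x ∈ U ∧
    g ≫ N.ofRestrict V.isOpenEmbedding = M.ofRestrict U.isOpenEmbedding ≫ f ∧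
    g ≫ ψ.hom ≫ (stdSpace p q).ofRestrict V'.isOpenEmbedding =
      φ.hom ≫ (stdSpace (p + s) (q + t)).ofRestrict U'.isOpenEmbedding ≫ stdProj p q s t

/-- A surjective submersion. -/
def IsSurjectiveSubmersion {M N : SheafedSpace SuperAlg} (f : M ⟶ N) : Prop :=
  IsSubmersion f ∧ Function.Surjective f.hom.base

/-! ### Lie `n`-groupoids -/

section Kan
universe v u
variable {C : Type u} [Category.{v} C]

/-- The simplicial set `hom(Z, X_•)`. -/
abbrev points (X : SimplicialObject C) (Z : C) : SSet.{v} := X ⋙ coyoneda.obj (op Z)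

/-- For a simplicial set `S` and a simplicial object `X`, the presheaf `Hom(S, X)`; its `Z`-points
are the simplicial maps from `S` to `hom(Z, X_•)`. -/
def HomSSet (S : SSet.{v}) (X : SimplicialObject C) : Cᵒᵖ ⥤ Type v where
  obj Z := S ⟶ points X Z.unop
  map u := ↾fun a => a ≫ Functor.whiskerLeft X (coyoneda.map u.unop.op)

/-- The universal horn: the `X_m`-point of `Hom(Λ[m, k], X)` which restricts the universal
`m`-simplex of `X` to the horn. -/
def universalHorn (X : SimplicialObject C) (m : ℕ) (k : Fin (m + 1)) :
    (HomSSet (Λ[m, k] : SSet.{v}) X).obj (op (X _⦋m⦌)) :=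
  Λ[m, k].ι ≫ SSet.yonedaEquiv.symm (𝟙 (X _⦋m⦌))

end Kan

/-- A Lie `n`-groupoid is a simplicial manifold `X` such that, for `m ≥ 1` and `0 ≤ k ≤ m`, the
presheaf `X_{m,k} = Hom(Λ[m, k], X)` is (represented by) a manifold and the natural map
`X_m ⟶ X_{m,k}` is a surjective submersion, and a diffeomorphism if `m > n`. -/
def IsLieGroupoid (n : ℕ) (X : SimplicialObject Mfd) : Prop :=
  ∀ (m : ℕ) (k : Fin (m + 1)), 1 ≤ m →
    ∃ (H : Mfd) (r : (HomSSet Λ[m, k] X).RepresentableBy H),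
      IsSurjectiveSubmersion (r.homEquiv.symm (universalHorn X m k)).hom ∧
      (n < m → IsIso (r.homEquiv.symm (universalHorn X m k)))

/-! ### Internal homs of presheaves -/

section Presheaf
universe v u
variable {C : Type u} [Category.{v} C]

/-- The `T`-points of `D^D`: the morphisms `D × T ⟶ D`, where the product is formed in presheaves
on `C`. -/
abbrev EndPoints (D T : C) : Type (max u v) := yoneda.obj D ⊗ yoneda.obj T ⟶ yoneda.obj D

/-- Pullback of `T`-points of `D^D` along `u : S ⟶ T`. -/
def EndPoints.pullback {D S T : C} (u : S ⟶ T) (g : EndPoints D T) : EndPoints D S :=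
  yoneda.obj D ◁ yoneda.map u ≫ g

/-- The monoid structure on the `T`-points of `D^D`; the product of `g₁` and `g₂` is
`g₂ ∘ (g₁, pr_T)`. -/
instance EndPoints.instMonoid (D T : C) : Monoid (EndPoints D T) where
  one := fst _ _
  mul g₁ g₂ := lift g₁ (snd _ _) ≫ g₂
  one_mul g := by
    change lift (fst _ _) (snd _ _) ≫ g = g
    rw [lift_fst_snd, Category.id_comp]
  mul_one g := by
    change lift g (snd _ _) ≫ fst _ _ = g
    simp
  mul_assoc a b c := by
    change lift (lift a (snd _ _) ≫ b) (snd _ _) ≫ c = lift a (snd _ _) ≫ lift b (snd _ _) ≫ c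
    rw [← Category.assoc, comp_lift, lift_snd]

/-- The nerve of the pair groupoid of an object `D`: in degree `k` it is `D^{k+1}`, the product
being formed in presheaves on `C`. -/
def pairNerve (D : C) : SimplexCategoryᵒᵖ ⥤ Cᵒᵖ ⥤ Type v where
  obj k :=
    { obj := fun Z => Fin (k.unop.len + 1) → (Z.unop ⟶ D)
      map := fun u => ↾fun d i => u.unop ≫ d i }
  map α := { app := fun _ => ↾fun d i => d (α.unop.toOrderHom i) }

/-- The product `P × T` of a simplicial presheaf with an object `T` of `C`, which is regarded as a
constant simplicial object. -/
abbrev prodObj (P : SimplexCategoryᵒᵖ ⥤ Cᵒᵖ ⥤ Type v) (T : C) :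
    SimplexCategoryᵒᵖ ⥤ Cᵒᵖ ⥤ Type v :=
  P ⊗ (Functor.const _).obj (yoneda.obj T)

/-- The presheaf `T ↦ hom(P × T, Y)`. -/
def simplicialHom (P Y : SimplexCategoryᵒᵖ ⥤ Cᵒᵖ ⥤ Type v) : Cᵒᵖ ⥤ Type (max u v) where
  obj T := prodObj P T.unop ⟶ Y
  map u := ↾fun a => P ◁ (Functor.const _).map (yoneda.map u.unop) ≫ a

/-- A `T`-point `g` of `D^D` acts on all vertices of the nerve `P` of the pair groupoid of `D`. -/
def pairNerveMap {D T : C} (g : EndPoints D T) : prodObj (pairNerve D) T ⟶ pairNerve D where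
  app k :=
    { app := fun Z => ↾fun x i => g.app Z (x.1 i, x.2)
      naturality := fun Z W u => by
        ext x
        funext i
        exact ConcreteCategory.congr_hom (C := Type v) (g.naturality u)
          (show (Z.unop ⟶ D) × (Z.unop ⟶ T) from (x.1 i, x.2)) }
  naturality k l α := rfl

/-- The natural action of `D^D` on `hom(P, Y)`, with `P` the nerve of the pair groupoid of `D`:
`g` sends `f` to `f ∘ (P(g), pr_T)`. -/
def pairNerveAct {D T : C} {Y : SimplexCategoryᵒᵖ ⥤ Cᵒᵖ ⥤ Type v} (g : EndPoints D T)
    (f : (simplicialHom (pairNerve D) Y).obj (op T)) :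
    (simplicialHom (pairNerve D) Y).obj (op T) :=
  lift (pairNerveMap g) (snd (pairNerve D) ((Functor.const _).obj (yoneda.obj T))) ≫
    (show prodObj (pairNerve D) T ⟶ Y from f)

end Presheaf

/-! ### NQ-manifolds and the 1-jet -/

/-- The `T`-point of `D^D` given by the real number `r`, acting on `D` by multiplication. -/
def EndPoints.scalar (T : SMfd) (r : ℝ) : EndPoints oddLine T :=
  fst _ _ ≫ yoneda.map (oddLine.scale r)

/-- An NQ-manifold: a supermanifold with an action of the monoid `D^D`, for `D` the odd line
(described on `T`-points, naturally in `T`), such that `-1` acts as the parity involution. -/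
structure NQManifold where
  space : SMfd
  act : ∀ {T : SMfd}, EndPoints oddLine T → (T ⟶ space) → (T ⟶ space)
  act_natural : ∀ {S T : SMfd} (u : S ⟶ T) (g : EndPoints oddLine T) (f : T ⟶ space),
    act (g.pullback u) (u ≫ f) = u ≫ act g f
  one_act : ∀ {T : SMfd} (f : T ⟶ space), act 1 f = f
  mul_act : ∀ {T : SMfd} (g h : EndPoints oddLine T) (f : T ⟶ space),
    act (g * h) f = act g (act h f)
  neg_one_act : ∀ {T : SMfd} (f : T ⟶ space), act (EndPoints.scalar T (-1)) f = f ≫ space.parity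

/-- The 1-jet of a simplicial manifold `X`: the presheaf `T ↦ hom(P × T, X)` on supermanifolds,
where `P` is the nerve of the pair groupoid of the odd line. -/
def oneJet (X : SimplicialObject Mfd) : SMfdᵒᵖ ⥤ Type 1 :=
  simplicialHom (pairNerve oddLine) (X ⋙ Mfd.toSMfd ⋙ yoneda)

/-- The natural action of `D^D` on the 1-jet. -/
def oneJetAct (X : SimplicialObject Mfd) {T : SMfd} (g : EndPoints oddLine T)
    (f : (oneJet X).obj (op T)) : (oneJet X).obj (op T) :=
  pairNerveAct g f

end Supergeometry
end

open Supergeometry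

/-! Everything is phrased in terms of T-points. A T-point of the 1-jet is a natural family of
simplices f_k(d_0,…,d_k) of X, with odd parameters d_i, compatible with faces and degeneracies.
Since f_k(d_0,…,d_k) is the 0-th face of f_{k+1}(0,d_0,…,d_k), only the simplices B_k(d_1,…,d_k)
with first vertex zero matter; they are compatible with the faces 1,…,k and with all degeneracies,
and every such sequence comes from a jet (`jetFam_injective`, `jetFam_surjective`).

This makes the 1-jet the limit of a tower. Once B_k is known, the faces 1,…,k+1 of B_{k+1} form a
horn, so B_{k+1} is a lift of a given family through the submersion from X_{k+1} to horns without
face 0, with prescribed values on degenerate tuples of parameters. If k ≥ n this map is invertible,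
so B_n determines all of the sequence (`jetIso`), and only finitely many steps remain, starting from
X_0.

Consider one step. Odd parameters vanish at points, so whether B_{k+1} lies in a given chart of the
submersion depends only on B_k at zero parameters (`Fam.bmap_eq`). In the chart a simplex is a horn
together with s even coordinates, and these coordinates are functions of d_1,…,d_{k+1}. Functions of
odd parameters are polynomials in them. Hence values prescribed consistently on degenerate tuples
extend (`exists_extension`), and a family vanishing on degenerate tuples (d_1 = 0 or d_i = d_{i+1})
is v·θ_1⋯θ_{k+1} for a unique v (`exists_top`, `eq_zero_of_mul_thetas`). As the coordinates are
even, v has parity k+1. So the extensions of B_k form, locally, a torsor under s-tuples of functions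
of parity k+1, that is, under morphisms to ℝ^{s|0} or ℝ^{0|s} (`exists_diff`, `exists_isExt_diff`,
`exists_classifier`). A local extension serves as origin and gives fibre coordinates
(`exists_jets_coord`); a sheaf with fibre coordinates over a supermanifold is representable by
gluing (`Over.representable`).

Two foundations are needed. First, morphisms to ℝ^{p|q} are the same as p even and q odd functions
(`std_hom_ext`, `exists_hom_std`): uniqueness follows from Hadamard's lemma and the nilpotency of
the augmentation ideal, existence from a finite Taylor expansion. Secondly, the hypothesis describes
horns with values in manifolds, while horns with values in supermanifolds are needed. They are built
face by face as fibre products along submersions (`IsHornObj.exists_succ`, `hornSub`) and then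
compared with the given ones (`isSub_horn`).

The action of D^D is transported along the representation. That -1 acts as parity follows by
naturality along the parity of the test object: it is -1 on the odd line and trivial on the
manifolds X_k (`oneJetAct_neg_one`). -/

noncomputable section
namespace Supergeometry
open CategoryTheory.Limits

/-! ### Superalgebras as a concrete category with limits -/

namespace SuperAlg

instance (A B : SuperAlg) : FunLike (Hom A B) A B where
  coe f := f.toAlgHom
  coe_injective _ _ h := Hom.ext (DFunLike.coe_injective h)

instance (A B : SuperAlg) : AlgHomClass (Hom A B) ℝ A B where
  map_mul f := map_mul f.toAlgHom
  map_one f := map_one f.toAlgHom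
  map_add f := map_add f.toAlgHom
  map_zero f := map_zero f.toAlgHom
  commutes f := f.toAlgHom.commutes

instance : ConcreteCategory SuperAlg Hom where
  hom f := f
  ofHom f := f

theorem hom_ext' {A B : SuperAlg} {f g : A ⟶ B} (h : ∀ a, f a = g a) : f = g := hom_ext h

/-- Only the parity of the inverse needs an argument: the two homogeneous components of a preimage
map to those of the image, so by injectivity one of them vanishes when the image is homogeneous. -/
instance : (forget SuperAlg).ReflectsIsomorphisms where
  reflects {A B} f hf := by
    have hb : Function.Bijective f.toAlgHom := (isIso_iff_bijective _).1 hf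
    let e := AlgEquiv.ofBijective f.toAlgHom hb
    refine ⟨(⟨e.symm.toAlgHom, fun i b hb' => ?_⟩ : B ⟶ A), ?_, ?_⟩
    · obtain ⟨a, rfl⟩ := e.surjective b
      change e.symm (e a) ∈ _
      rw [e.symm_apply_apply]
      obtain ⟨x, hx, y, hy, rfl⟩ := A.exists_parts a
      have hfx := f.map_mem 0 x hx
      have hfy := f.map_mem 1 y hy
      have hab : f.toAlgHom x + f.toAlgHom y ∈ B.part i := by
        rw [← map_add]; exact hb'
      have hd := Submodule.disjoint_def.1 B.isCompl.disjoint
      fin_cases i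
      · have h0 : f.toAlgHom y = 0 := hd _ ((B.part 0).add_mem_iff_right hfx |>.1 hab) hfy
        have : y = 0 := hb.1 (by rw [h0, map_zero])
        subst this; rw [add_zero]; exact hx
      · have h0 : f.toAlgHom x = 0 := hd _ hfx ((B.part 1).add_mem_iff_left hfy |>.1 hab)
        have : x = 0 := hb.1 (by rw [h0, map_zero])
        subst this; rw [zero_add]; exact hy
    · exact hom_ext fun a => e.symm_apply_apply a
    · exact hom_ext fun b => e.apply_symm_apply b

section Limits
variable {J : Type} [SmallCategory J] (F : J ⥤ SuperAlg)

/-- Compatible families of elements of a diagram of superalgebras. -/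
def limSubalgebra : Subalgebra ℝ (∀ j, F.obj j) where
  carrier := {x | ∀ ⦃i j⦄ (f : i ⟶ j), (F.map f).toAlgHom (x i) = x j}
  mul_mem' hx hy i j f := by simp [hx f, hy f]
  add_mem' hx hy i j f := by simp [hx f, hy f]
  algebraMap_mem' c i j f := (F.map f).toAlgHom.commutes c

/-- The limit of a diagram of superalgebras. -/
def lim : SuperAlg where
  carrier := limSubalgebra F
  part i :=
    { carrier := {x | ∀ j, x.1 j ∈ (F.obj j).part i}
      add_mem' := fun hf hg x => add_mem (hf x) (hg x)
      zero_mem' := fun _ => zero_mem _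
      smul_mem' := fun c _ hf x => Submodule.smul_mem _ c (hf x) }
  gradedMonoid :=
    { one_mem := fun j => SetLike.GradedOne.one_mem (A := (F.obj j).part)
      mul_mem := fun _ _ _ _ hf hg j =>
        SetLike.GradedMul.mul_mem (A := (F.obj j).part) (hf j) (hg j) }
  isCompl := by
    refine isCompl_iff.2 ⟨Submodule.disjoint_def.2 fun f h0 h1 => ?_, ?_⟩
    · refine Subtype.ext (funext fun j => ?_)
      exact Submodule.disjoint_def.1 (F.obj j).isCompl.disjoint _ (h0 j) (h1 j)
    · refine codisjoint_iff.2 (eq_top_iff.2 fun x _ => ?_)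
      -- Homogeneous components of a compatible family are again compatible, because parity commutes
      -- with the transition maps: they are half the sum and half the difference of `x` and its
      -- parity transform `p`.
      have hpar : ∀ ⦃i j⦄ (f : i ⟶ j) (a : F.obj i),
          (F.map f).toAlgHom ((F.obj i).parityLin a) = (F.obj j).parityLin ((F.map f).toAlgHom a) :=
        fun i j f a => (congrArg (fun g : F.obj i ⟶ F.obj j => g.toAlgHom a)
          (parity_naturality (F.map f))).symm
      let p : limSubalgebra F := ⟨fun j => (F.obj j).parityLin (x.1 j), fun i j f => by
        rw [hpar, x.2 f]⟩
      have key : ∀ j, ∃ a ∈ (F.obj j).part 0, ∃ b ∈ (F.obj j).part 1,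
          x.1 j = a + b ∧ p.1 j = a - b := fun j => by
        obtain ⟨a, ha, b, hb, h⟩ := (F.obj j).exists_parts (x.1 j)
        refine ⟨a, ha, b, hb, h, ?_⟩
        change (F.obj j).parityLin (x.1 j) = _
        rw [h, map_add, parityLin_even _ ha, parityLin_odd _ hb, sub_eq_add_neg]
      refine Submodule.mem_sup.2 ⟨(2⁻¹ : ℝ) • (x + p), fun j => ?_, (2⁻¹ : ℝ) • (x - p),
        fun j => ?_, ?_⟩
      · obtain ⟨a, ha, b, hb, h1, h2⟩ := key j
        have : ((2⁻¹ : ℝ) • (x + p)).1 j = a := by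
          change (2⁻¹ : ℝ) • (x.1 j + p.1 j) = a
          rw [h1, h2, add_add_sub_cancel, ← two_smul ℝ a, smul_smul]; norm_num
        rw [this]; exact ha
      · obtain ⟨a, ha, b, hb, h1, h2⟩ := key j
        have : ((2⁻¹ : ℝ) • (x - p)).1 j = b := by
          change (2⁻¹ : ℝ) • (x.1 j - p.1 j) = b
          rw [h1, h2, add_sub_sub_cancel, ← two_smul ℝ b, smul_smul]; norm_num
        rw [this]; exact hb
      · rw [← smul_add, add_add_sub_cancel, ← two_smul ℝ x, smul_smul]; norm_num
  supercomm i j f g hf hg :=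
    Subtype.ext (funext fun k => (F.obj k).supercomm i j _ _ (hf k) (hg k))

/-- The projections from the limit. -/
def limπ (j : J) : lim F ⟶ F.obj j where
  toAlgHom := (Pi.evalAlgHom ℝ (fun j => (F.obj j : Type)) j).comp (limSubalgebra F).val
  map_mem _ _ h := h j

/-- The limit cone. -/
def limCone : Cone F where
  pt := lim F
  π := { app := limπ F
         naturality := fun _ _ f => hom_ext fun x => (x.2 f).symm }

/-- The limit cone is a limit. -/
def limConeIsLimit : IsLimit (limCone F) where
  lift s := (⟨(AlgHom.codRestrict (AlgHom.pi
      (fun j => Hom.toAlgHom (s.π.app j))) (limSubalgebra F)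
      (fun a _ j f => congrArg (fun g : s.pt ⟶ F.obj j => g.toAlgHom a) (s.w f))),
    fun i a ha j => (s.π.app j).map_mem i a ha⟩ : s.pt ⟶ lim F)
  fac _ _ := rfl
  uniq s _ h := hom_ext fun a => Subtype.ext (funext fun j =>
    congrArg (fun g : s.pt ⟶ F.obj j => g.toAlgHom a) (h j))

instance : HasLimits SuperAlg := ⟨fun _ _ => ⟨fun F => HasLimit.mk ⟨limCone F, limConeIsLimit F⟩⟩⟩

instance : PreservesLimits (forget SuperAlg) :=
  ⟨⟨fun {F} => preservesLimit_of_preserves_limit_cone (limConeIsLimit F)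
    { lift := fun s => ↾fun a => (⟨fun j => (s.π.app j : s.pt → F.obj j) a, fun i j f =>
          congrFun (congrArg (fun g : s.pt ⟶ (F ⋙ forget SuperAlg).obj j => (g : s.pt → F.obj j))
            (s.w f)) a⟩ :
          limSubalgebra F)
      fac := fun s j => rfl
      uniq := fun s m h => by
        ext a
        refine Subtype.ext (funext fun j => ?_)
        exact congrFun (congrArg
          (fun g : s.pt ⟶ (F ⋙ forget SuperAlg).obj j => (g : s.pt → F.obj j)) (h j)) a }⟩⟩

end Limits
end SuperAlg

/-- Spaces with a sheaf of superalgebras. -/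
abbrev SuperSpace := SheafedSpace.{1, 0, 0} SuperAlg

/-! ### Calculus of restriction and pullback of sections -/

section Pull
variable {X Y Z : SuperSpace}

theorem preimage_mono (f : X ⟶ Y) {V V' : Opens Y} (h : V' ≤ V) :
    (Opens.map f.hom.base).obj V' ≤ (Opens.map f.hom.base).obj V := fun _ hx => h hx

theorem le_preimage_comp (f : X ⟶ Y) (g : Y ⟶ Z) {U : Opens Z} {V : Opens Y} {W : Opens X}
    (h : V ≤ (Opens.map g.hom.base).obj U) (h' : W ≤ (Opens.map f.hom.base).obj V) :
    W ≤ (Opens.map (f ≫ g).hom.base).obj U := fun _ hx => h (h' hx)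

/-- Restriction of sections. -/
def res (X : SuperSpace) {V W : Opens X} (h : W ≤ V) :
    X.presheaf.obj (op V) ⟶ X.presheaf.obj (op W) := X.presheaf.map (homOfLE h).op

/-- Pullback of sections along a morphism, followed by restriction. -/
def pull (f : X ⟶ Y) {V : Opens Y} {W : Opens X} (h : W ≤ (Opens.map f.hom.base).obj V) :
    Y.presheaf.obj (op V) ⟶ X.presheaf.obj (op W) :=
  f.hom.c.app (op V) ≫ res X h

theorem res_self {V : Opens X} (h : V ≤ V) : res X h = 𝟙 _ := X.presheaf.map_id _

theorem res_res {U V W : Opens X} (h : W ≤ V) (h' : V ≤ U) :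
    res X h' ≫ res X h = res X (h.trans h') := (X.presheaf.map_comp _ _).symm

theorem pull_congr {f g : X ⟶ Y} (e : f = g) {V : Opens Y} {W : Opens X}
    (h : W ≤ (Opens.map f.hom.base).obj V) (h' : W ≤ (Opens.map g.hom.base).obj V) :
    pull f h = pull g h' := by
  subst e; rfl

theorem pull_res (f : X ⟶ Y) {V : Opens Y} {W W' : Opens X}
    (h : W ≤ (Opens.map f.hom.base).obj V) (h' : W' ≤ W) :
    pull f h ≫ res X h' = pull f (h'.trans h) := by
  simp only [pull, Category.assoc, res_res]

theorem c_res (f : X ⟶ Y) {V V' : Opens Y} (h : V' ≤ V)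
    (h' : (Opens.map f.hom.base).obj V' ≤ (Opens.map f.hom.base).obj V) :
    res Y h ≫ f.hom.c.app (op V') = f.hom.c.app (op V) ≫ res X h' :=
  f.hom.c.naturality (homOfLE h).op

theorem res_pull (f : X ⟶ Y) {V V' : Opens Y} {W : Opens X} (h' : V' ≤ V)
    (h : W ≤ (Opens.map f.hom.base).obj V') :
    res Y h' ≫ pull f h = pull f (h.trans (preimage_mono f h')) := by
  unfold pull
  rw [← Category.assoc, c_res f h' (preimage_mono f h'), Category.assoc, res_res]

theorem pull_pull (f : X ⟶ Y) (g : Y ⟶ Z) {U : Opens Z} {V : Opens Y} {W : Opens X}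
    (h : V ≤ (Opens.map g.hom.base).obj U) (h' : W ≤ (Opens.map f.hom.base).obj V) :
    pull g h ≫ pull f h' = pull (f ≫ g) (le_preimage_comp f g h h') := by
  rw [pull, Category.assoc, res_pull]
  rfl

theorem pull_pull_apply (f : X ⟶ Y) (g : Y ⟶ Z) {U : Opens Z} {V : Opens Y} {W : Opens X}
    (h : V ≤ (Opens.map g.hom.base).obj U) (h' : W ≤ (Opens.map f.hom.base).obj V)
    (s : Z.presheaf.obj (op U)) :
    pull f h' (pull g h s) = pull (f ≫ g) (le_preimage_comp f g h h') s := by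
  rw [← pull_pull f g h h']; rfl

theorem pull_id {V W : Opens X} (h : W ≤ V) :
    pull (𝟙 X) (V := V) h = res X h := by
  unfold pull
  exact Category.id_comp _

theorem hom_ext_pull {f g : X ⟶ Y} (hb : f.hom.base = g.hom.base)
    (h : ∀ (V : Opens Y) (W : Opens X) (h : W ≤ (Opens.map f.hom.base).obj V)
      (h' : W ≤ (Opens.map g.hom.base).obj V), pull f h = pull g h') : f = g := by
  obtain ⟨⟨fb, fc⟩⟩ := f
  obtain ⟨⟨gb, gc⟩⟩ := g
  obtain rfl : fb = gb := hb
  congr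
  ext V s
  have := h V _ le_rfl le_rfl
  simp only [pull, res_self] at this
  exact congrArg (fun φ => φ s) (((Category.comp_id _).symm.trans this).trans (Category.comp_id _))

/-- For the literal image of `W` this is the definition of an open immersion up to a restriction
between equal open sets. Leaving `V` free up to an equality of sets avoids transport along
equalities of opens later. -/
theorem isIso_pull (f : X ⟶ Y) [H : SheafedSpace.IsOpenImmersion f] {V : Opens Y} {W : Opens X}
    (h : W ≤ (Opens.map f.hom.base).obj V) (hV : (V : Set Y) = f.hom.base '' W) :
    IsIso (pull f h) := by
  obtain rfl : V = H.base_open.functor.obj W := Opens.ext hV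
  have h1 : IsIso (f.hom.c.app (op (H.base_open.functor.obj W))) := H.c_iso W
  have e : W = (Opens.map f.hom.base).obj (H.base_open.functor.obj W) :=
    Opens.ext (Set.preimage_image_eq _ H.base_open.injective).symm
  have h2 : IsIso (res X h) := by
    have : (homOfLE h) = eqToHom e := rfl
    unfold res
    rw [this]
    infer_instance
  unfold pull
  infer_instance

/-- Pullback along the composite factors through pullback along `g`; two of the three maps of
sections are invertible, hence so is the third. It shows that factorisations of open immersions
through open immersions are open immersions. -/
theorem isOpenImmersion_of_comp (f : X ⟶ Y) (g : Y ⟶ Z) [Hg : SheafedSpace.IsOpenImmersion g]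
    [Hfg : SheafedSpace.IsOpenImmersion (f ≫ g)] : SheafedSpace.IsOpenImmersion f where
  base_open := Topology.IsOpenEmbedding.of_comp f.hom.base Hg.base_open Hfg.base_open
  c_iso U := by
    have hf : Topology.IsOpenEmbedding f.hom.base :=
      Topology.IsOpenEmbedding.of_comp f.hom.base Hg.base_open Hfg.base_open
    set V := hf.functor.obj U with hVdef
    have e : U = (Opens.map f.hom.base).obj V :=
      Opens.ext (Set.preimage_image_eq _ hf.injective).symm
    have hVi : ∀ V, V ≤ (Opens.map g.hom.base).obj (Hg.base_open.functor.obj V) :=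
      fun V x hx => ⟨x, hx, rfl⟩
    have h1 := isIso_pull g (hVi V) rfl
    have h2 := isIso_pull (f ≫ g) (V := Hg.base_open.functor.obj V) (W := U)
      (fun x hx => ⟨f.hom.base x, ⟨x, hx, rfl⟩, rfl⟩) (by
        ext z
        constructor
        · rintro ⟨_, ⟨x, hx, rfl⟩, rfl⟩
          exact ⟨x, hx, rfl⟩
        · rintro ⟨x, hx, rfl⟩
          exact ⟨_, ⟨x, hx, rfl⟩, rfl⟩)
    rw [← pull_pull f g (V := V) (hVi V) e.le] at h2
    have h3 : IsIso (pull f e.le) := IsIso.of_isIso_comp_left (pull g (hVi V)) _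
    have h4 : IsIso (res X e.le) := by
      have : (homOfLE e.le) = eqToHom e := rfl
      unfold res
      rw [this]
      infer_instance
    have h3' : IsIso (f.hom.c.app (op V) ≫ res X e.le) := h3
    exact IsIso.of_isIso_comp_right _ (res X e.le)

end Pull

/-! ### Charts as open immersions, and open subspaces -/

section Charts
variable {S : ℕ → ℕ → Prop} {M X : SuperSpace}

theorem hasCharts_iff : HasCharts S M ↔ ∀ x : M, ∃ (p q : ℕ) (V : Opens (stdSpace p q))
    (f : (stdSpace p q).restrict V.isOpenEmbedding ⟶ M), S p q ∧ SheafedSpace.IsOpenImmersion f ∧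
      x ∈ Set.range f.hom.base := by
  refine forall_congr' fun x => ⟨?_, ?_⟩
  · rintro ⟨p, q, U, V, hS, hx, ⟨e⟩⟩
    refine ⟨p, q, V, e.inv ≫ M.ofRestrict U.isOpenEmbedding, hS, inferInstance, ?_⟩
    refine ⟨e.hom.hom.base ⟨x, hx⟩, ?_⟩
    have : e.inv.hom.base (e.hom.hom.base ⟨x, hx⟩) = ⟨x, hx⟩ :=
      congrArg (fun g : M.restrict U.isOpenEmbedding ⟶ M.restrict U.isOpenEmbedding =>
        g.hom.base ⟨x, hx⟩) e.hom_inv_id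
    change (M.ofRestrict U.isOpenEmbedding).hom.base (e.inv.hom.base (e.hom.hom.base ⟨x, hx⟩)) = x
    rw [this]; rfl
  · rintro ⟨p, q, V, f, hS, hf, hx⟩
    refine ⟨p, q, ⟨Set.range f.hom.base, hf.base_open.isOpen_range⟩, V, hS, hx, ⟨?_⟩⟩
    refine SheafedSpace.isoMk (PresheafedSpace.IsOpenImmersion.isoOfRangeEq
      (M.ofRestrict _).hom f.hom ?_)
    exact Subtype.range_coe

theorem HasCharts.of_isOpenImmersion (g : X ⟶ M) [Hg : SheafedSpace.IsOpenImmersion g]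
    (h : HasCharts S M) : HasCharts S X := by
  rw [hasCharts_iff] at h ⊢
  intro x
  obtain ⟨p, q, V, f, hS, hf, y, hy⟩ := h (g.hom.base x)
  -- The chart of `M` is shrunk to the part that lands in the image of `g`, so that it lifts to `X`.
  let V' : Opens (stdSpace p q) := V.isOpenEmbedding.functor.obj
    ⟨f.hom.base ⁻¹' Set.range g.hom.base, hf.base_open.continuous.isOpen_preimage _
      Hg.base_open.isOpen_range⟩
  have hV' : V' ≤ V := by rintro _ ⟨v, -, rfl⟩; exact v.2
  have hii : Set.range ((stdSpace p q).ofRestrict V'.isOpenEmbedding).hom.base ⊆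
      Set.range ((stdSpace p q).ofRestrict V.isOpenEmbedding).hom.base := by
    rintro _ ⟨v, rfl⟩
    exact ⟨⟨v.1, hV' v.2⟩, rfl⟩
  let i : ((stdSpace p q).restrict V'.isOpenEmbedding).toPresheafedSpace ⟶
      ((stdSpace p q).restrict V.isOpenEmbedding).toPresheafedSpace :=
    PresheafedSpace.IsOpenImmersion.lift ((stdSpace p q).ofRestrict V.isOpenEmbedding).hom
      ((stdSpace p q).ofRestrict V'.isOpenEmbedding).hom hii
  let i' : (stdSpace p q).restrict V'.isOpenEmbedding ⟶ (stdSpace p q).restrict V.isOpenEmbedding :=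
    InducedCategory.homMk i
  have hi : i' ≫ (stdSpace p q).ofRestrict V.isOpenEmbedding =
      (stdSpace p q).ofRestrict V'.isOpenEmbedding :=
    InducedCategory.hom_ext (PresheafedSpace.IsOpenImmersion.lift_fac _ _ hii)
  have hib : ∀ v, (i'.hom.base v : V).1 = v.1 := fun v =>
    congrArg (fun k : (stdSpace p q).restrict V'.isOpenEmbedding ⟶ stdSpace p q => k.hom.base v) hi
  have : SheafedSpace.IsOpenImmersion (i' ≫ (stdSpace p q).ofRestrict V.isOpenEmbedding) := by
    rw [hi]; infer_instance
  have hi' : SheafedSpace.IsOpenImmersion i' :=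
    isOpenImmersion_of_comp i' ((stdSpace p q).ofRestrict V.isOpenEmbedding)
  have hr : Set.range (i' ≫ f).hom.base ⊆ Set.range g.hom.base := by
    rintro _ ⟨v, rfl⟩
    obtain ⟨w, hw, hwv⟩ := v.2
    have : i'.hom.base v = w := Subtype.ext ((hib v).trans hwv.symm)
    change f.hom.base (i'.hom.base v) ∈ _
    rw [this]; exact hw
  let k : (stdSpace p q).restrict V'.isOpenEmbedding ⟶ X :=
    InducedCategory.homMk (PresheafedSpace.IsOpenImmersion.lift g.hom (i' ≫ f).hom hr)
  have hk : k ≫ g = i' ≫ f := InducedCategory.hom_ext (PresheafedSpace.IsOpenImmersion.lift_fac _ _ hr)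
  have : SheafedSpace.IsOpenImmersion (k ≫ g) := by rw [hk]; infer_instance
  refine ⟨p, q, V', k, hS, isOpenImmersion_of_comp k g, ⟨y.1, ⟨y, ⟨x, hy.symm⟩, rfl⟩⟩, ?_⟩
  apply Hg.base_open.injective
  have h1 : g.hom.base (k.hom.base ⟨y.1, ⟨y, ⟨x, hy.symm⟩, rfl⟩⟩) = f.hom.base (i'.hom.base _) :=
    congrArg (fun l : (stdSpace p q).restrict V'.isOpenEmbedding ⟶ M => l.hom.base
      ⟨y.1, ⟨y, ⟨x, hy.symm⟩, rfl⟩⟩) hk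
  exact h1.trans ((congrArg f.hom.base (Subtype.ext (hib _))).trans hy)

theorem isSupermanifold_of_isOpenImmersion (g : X ⟶ M) [Hg : SheafedSpace.IsOpenImmersion g]
    (h : isSupermanifold M) : isSupermanifold X :=
  have := h.1
  have := h.2.1
  ⟨Hg.base_open.isEmbedding.t2Space, Hg.base_open.isEmbedding.secondCountableTopology,
    h.2.2.of_isOpenImmersion g⟩

end Charts

/-! ### Gluing of sections and of homomorphisms into sections -/

section Sheaf
variable {X : SuperSpace} {ι : Type} {W : Opens X} {Wi : ι → Opens X}

theorem ofArrows_mem (hle : ∀ i, Wi i ≤ W) (hcov : ∀ x ∈ W, ∃ i, x ∈ Wi i) :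
    Sieve.ofArrows _ (fun i => homOfLE (hle i)) ∈ Opens.grothendieckTopology X W := by
  intro x hx
  obtain ⟨i, hi⟩ := hcov x hx
  exact ⟨Wi i, homOfLE (hle i), Sieve.ofArrows_mk _ _ i, hi⟩

theorem sheaf_hom_ext (hle : ∀ i, Wi i ≤ W) (hcov : ∀ x ∈ W, ∃ i, x ∈ Wi i) {E : SuperAlg}
    {φ ψ : E ⟶ X.presheaf.obj (op W)} (h : ∀ i, φ ≫ res X (hle i) = ψ ≫ res X (hle i)) : φ = ψ :=
  Presheaf.IsSheaf.hom_ext_ofArrows X.IsSheaf _ (ofArrows_mem hle hcov) h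

theorem sheaf_hom_glue (hle : ∀ i, Wi i ≤ W) (hcov : ∀ x ∈ W, ∃ i, x ∈ Wi i) {E : SuperAlg}
    (φ : ∀ i, E ⟶ X.presheaf.obj (op (Wi i)))
    (h : ∀ i j (Q : Opens X) (hi : Q ≤ Wi i) (hj : Q ≤ Wi j), φ i ≫ res X hi = φ j ≫ res X hj) :
    ∃ ψ : E ⟶ X.presheaf.obj (op W), ∀ i, ψ ≫ res X (hle i) = φ i :=
  ⟨Presheaf.IsSheaf.amalgamateOfArrows X.IsSheaf _ (ofArrows_mem hle hcov) φ
    (fun _ i j a b _ => h i j _ a.le b.le),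
    Presheaf.IsSheaf.amalgamateOfArrows_map X.IsSheaf _ (ofArrows_mem hle hcov) φ _⟩

theorem section_ext (hle : ∀ i, Wi i ≤ W) (hcov : ∀ x ∈ W, ∃ i, x ∈ Wi i)
    {s t : X.presheaf.obj (op W)} (h : ∀ i, res X (hle i) s = res X (hle i) t) : s = t :=
  TopCat.Sheaf.eq_of_locally_eq' ⟨X.presheaf, X.IsSheaf⟩ Wi W (fun i => homOfLE (hle i))
    (fun x hx => by
      obtain ⟨i, hi⟩ := hcov x hx
      exact Opens.mem_iSup.2 ⟨i, hi⟩) s t h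

end Sheaf

/-! ### Open immersions and gluing of morphisms of supermanifolds -/

namespace SMfd

/-- The underlying map of a morphism of supermanifolds. -/
def bmap {S T : SMfd} (f : S ⟶ T) (x : S.obj) : T.obj := f.hom.hom.base x

theorem continuous_bmap {S T : SMfd} (f : S ⟶ T) : Continuous (bmap f) :=
  f.hom.hom.base.hom.continuous

@[simp] theorem bmap_comp {S T R : SMfd} (f : S ⟶ T) (g : T ⟶ R) (x : S.obj) :
    bmap (f ≫ g) x = bmap g (bmap f x) := rfl

@[simp] theorem bmap_id {S : SMfd} (x : S.obj) : bmap (𝟙 S) x = x := rfl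

/-- Open immersions of supermanifolds. -/
class IsOpenImm {S T : SMfd} (f : S ⟶ T) : Prop where
  out : SheafedSpace.IsOpenImmersion f.hom

instance IsOpenImm.inst {S T : SMfd} (f : S ⟶ T) [h : IsOpenImm f] :
    SheafedSpace.IsOpenImmersion f.hom := h.out

instance {S T : SMfd} (f : S ⟶ T) [IsIso f] : IsOpenImm f :=
  ⟨inferInstance⟩

instance {S T R : SMfd} (f : S ⟶ T) (g : T ⟶ R) [IsOpenImm f] [IsOpenImm g] : IsOpenImm (f ≫ g) :=
  ⟨inferInstanceAs (SheafedSpace.IsOpenImmersion (f.hom ≫ g.hom))⟩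

theorem IsOpenImm.isOpenEmbedding {S T : SMfd} (f : S ⟶ T) [h : IsOpenImm f] :
    Topology.IsOpenEmbedding (bmap f) := h.out.base_open

instance IsOpenImm.mono {S T : SMfd} (f : S ⟶ T) [IsOpenImm f] : Mono f :=
  (isSupermanifold.ι).mono_of_mono_map (inferInstanceAs (Mono f.hom))

/-- Morphisms landing in the range of an open immersion factor through it. -/
def lift {X Y Z : SMfd} (f : X ⟶ Z) [IsOpenImm f] (g : Y ⟶ Z)
    (H : ∀ y, bmap g y ∈ Set.range (bmap f)) : Y ⟶ X :=
  ObjectProperty.homMk (InducedCategory.homMk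
    (PresheafedSpace.IsOpenImmersion.lift f.hom.hom g.hom.hom (Set.range_subset_iff.2 H)))

@[simp]
theorem lift_fac {X Y Z : SMfd} (f : X ⟶ Z) [IsOpenImm f] (g : Y ⟶ Z)
    (H : ∀ y, bmap g y ∈ Set.range (bmap f)) : lift f g H ≫ f = g :=
  ObjectProperty.hom_ext _ (InducedCategory.hom_ext
    (PresheafedSpace.IsOpenImmersion.lift_fac f.hom.hom g.hom.hom (Set.range_subset_iff.2 H)))

theorem bmap_lift {X Y Z : SMfd} (f : X ⟶ Z) [IsOpenImm f] (g : Y ⟶ Z)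
    (H : ∀ y, bmap g y ∈ Set.range (bmap f)) (y : Y.obj) : bmap f (bmap (lift f g H) y) = bmap g y := by
  rw [← bmap_comp, lift_fac]

/-- The open sub-supermanifold on an open subset. -/
def restr (T : SMfd) (U : Opens T.obj) : SMfd :=
  ⟨T.obj.restrict U.isOpenEmbedding,
    isSupermanifold_of_isOpenImmersion (T.obj.ofRestrict U.isOpenEmbedding) T.property⟩

/-- The inclusion of an open sub-supermanifold. -/
def restrι (T : SMfd) (U : Opens T.obj) : restr T U ⟶ T :=
  ObjectProperty.homMk (T.obj.ofRestrict U.isOpenEmbedding)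

instance (T : SMfd) (U : Opens T.obj) : IsOpenImm (restrι T U) :=
  ⟨inferInstanceAs (SheafedSpace.IsOpenImmersion (T.obj.ofRestrict U.isOpenEmbedding))⟩

theorem range_restrι (T : SMfd) (U : Opens T.obj) : Set.range (bmap (restrι T U)) = U :=
  Subtype.range_coe

theorem bmap_restrι_mem (T : SMfd) (U : Opens T.obj) (x) : bmap (restrι T U) x ∈ U := x.2

/-- The image of an open immersion. -/
def opensRange {S T : SMfd} (f : S ⟶ T) [IsOpenImm f] : Opens T.obj :=
  ⟨Set.range (bmap f), (IsOpenImm.isOpenEmbedding f).isOpen_range⟩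

/-- The preimage of an open subset. -/
def preim {S T : SMfd} (f : S ⟶ T) (U : Opens T.obj) : Opens S.obj :=
  ⟨bmap f ⁻¹' U, U.2.preimage (continuous_bmap f)⟩

/-- A presheaf on supermanifolds which is a sheaf for open covers. -/
def IsLocal (J : SMfdᵒᵖ ⥤ Type*) : Prop :=
  ∀ (T : SMfd) (ι : Type) (T' : ι → SMfd) (e : ∀ i, T' i ⟶ T) (_ : ∀ i, IsOpenImm (e i)),
    (∀ x, ∃ i, x ∈ Set.range (bmap (e i))) → ∀ s : ∀ i, J.obj (op (T' i)),
    (∀ (i j : ι) (S : SMfd) (a : S ⟶ T' i) (b : S ⟶ T' j), a ≫ e i = b ≫ e j →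
      J.map a.op (s i) = J.map b.op (s j)) → ∃! t : J.obj (op T), ∀ i, J.map (e i).op t = s i

section Glue
variable {T Y : SMfd} {ι : Type} {T' : ι → SMfd} (e : ∀ i, T' i ⟶ T) [∀ i, IsOpenImm (e i)]
  (hcov : ∀ x, ∃ i, x ∈ Set.range (bmap (e i)))

-- Sections over an open set are tested on the images of the cover, and there pullback along `e i`
-- is invertible, so that it may be cancelled.
include hcov in
theorem hom_ext_of_cover {g g' : T ⟶ Y} (h : ∀ i, e i ≫ g = e i ≫ g') : g = g' := by
  refine ObjectProperty.hom_ext _ (hom_ext_pull ?_ ?_)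
  · ext x
    obtain ⟨i, y, rfl⟩ := hcov x
    exact congrArg (fun k => bmap k y) (h i)
  · intro V W h1 h2
    let Vi : ∀ i, Opens (T' i).obj := fun i => preim (e i) W
    let Wi : ι → Opens T.obj := fun i => (IsOpenImm.isOpenEmbedding (e i)).functor.obj (Vi i)
    have hle : ∀ i, Wi i ≤ W := by rintro i _ ⟨y, hy, rfl⟩; exact hy
    refine sheaf_hom_ext hle (fun x hx => ?_) fun i => ?_
    · obtain ⟨i, y, rfl⟩ := hcov x
      exact ⟨i, y, hx, rfl⟩
    · have hVi : Vi i ≤ (Opens.map (e i).hom.hom.base).obj (Wi i) := fun y hy => ⟨y, hy, rfl⟩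
      have := isIso_pull (e i).hom hVi rfl
      rw [← cancel_mono (pull (e i).hom hVi), pull_res, pull_res, pull_pull, pull_pull]
      have hh : (e i).hom ≫ g.hom = (e i).hom ≫ g'.hom := congrArg (fun k => k.hom) (h i)
      exact pull_congr hh _ _

variable (f : ∀ i, T' i ⟶ Y)
  (hc : ∀ (i j : ι) (S : SMfd) (a : S ⟶ T' i) (b : S ⟶ T' j), a ≫ e i = b ≫ e j →
      a ≫ f i = b ≫ f j)

-- The intersection of the two images is a test object for `hc`, and a single point of it lies over
-- both `y` and `y'`.
include hc in
theorem glue_bmap_eq {i j : ι} {y : (T' i).obj} {y' : (T' j).obj} (h : bmap (e i) y = bmap (e j) y') :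
    bmap (f i) y = bmap (f j) y' := by
  let U : Opens T.obj := opensRange (e i) ⊓ opensRange (e j)
  let a := lift (e i) (restrι T U) fun z => (bmap_restrι_mem T U z).1
  let b := lift (e j) (restrι T U) fun z => (bmap_restrι_mem T U z).2
  let z : (restr T U).obj := ⟨bmap (e i) y, ⟨y, rfl⟩, ⟨y', h.symm⟩⟩
  have ha : bmap a z = y := (IsOpenImm.isOpenEmbedding (e i)).injective (bmap_lift _ _ _ _)
  have hb : bmap b z = y' :=
    (IsOpenImm.isOpenEmbedding (e j)).injective ((bmap_lift _ _ _ _).trans h)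
  have := congrArg (fun k => bmap k z) (hc i j _ a b ((lift_fac _ _ _).trans (lift_fac _ _ _).symm))
  rw [← ha, ← hb]
  exact this

-- On the image of `e i` the comorphism must be pullback along `f i` followed by the inverse of
-- pullback along `e i`. These homomorphisms agree on overlaps and glue by the sheaf property.
include hcov hc in
theorem exists_glue : ∃ g : T ⟶ Y, ∀ i, e i ≫ g = f i := by
  choose I P hP using hcov
  let G : T.obj → Y.obj := fun x => bmap (f (I x)) (P x)
  have hG : ∀ i y, G (bmap (e i) y) = bmap (f i) y := fun i y =>
    glue_bmap_eq e f hc (hP _)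
  have hGc : Continuous G := by
    refine ⟨fun V hV => ?_⟩
    have : G ⁻¹' V = ⋃ i, bmap (e i) '' (bmap (f i) ⁻¹' V) := by
      ext x
      simp only [Set.mem_iUnion]
      constructor
      · intro hx
        refine ⟨I x, P x, hx, hP x⟩
      · rintro ⟨i, y, hy, rfl⟩
        change G _ ∈ V
        rw [hG]; exact hy
    rw [this]
    exact isOpen_iUnion fun i => (IsOpenImm.isOpenEmbedding (e i)).isOpenMap _
      (hV.preimage (continuous_bmap _))
  let Gt : (T.obj : TopCat) ⟶ (Y.obj : TopCat) := TopCat.ofHom ⟨G, hGc⟩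
  let Vi : ∀ (V : Opens Y.obj) i, Opens (T' i).obj := fun V i => preim (f i) V
  let Wi : ∀ (_ : Opens Y.obj) (_ : ι), Opens T.obj := fun V i =>
    (IsOpenImm.isOpenEmbedding (e i)).functor.obj (Vi V i)
  have hVi : ∀ V i, Vi V i ≤ (Opens.map (e i).hom.hom.base).obj (Wi V i) :=
    fun V i y hy => ⟨y, hy, rfl⟩
  have hle : ∀ V i, Wi V i ≤ (Opens.map Gt).obj V := by
    rintro V i _ ⟨y, hy, rfl⟩
    change G _ ∈ V
    erw [hG]; exact hy
  have hcv : ∀ V, ∀ x ∈ (Opens.map Gt).obj V, ∃ i, x ∈ Wi V i := fun V x hx =>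
    ⟨I x, P x, hx, hP x⟩
  have hiso : ∀ V i, IsIso (pull (e i).hom (hVi V i)) := fun V i => isIso_pull (e i).hom _ rfl
  have hiVi : ∀ V i, Vi V i ≤ (Opens.map (f i).hom.hom.base).obj V := fun V i => le_rfl
  have hex : ∀ V : Opens Y.obj, ∃ ψ : Y.obj.presheaf.obj (op V) ⟶
      T.obj.presheaf.obj (op ((Opens.map Gt).obj V)), ∀ i,
      ψ ≫ res T.obj (hle V i) = pull (f i).hom (hiVi V i) ≫ inv (pull (e i).hom (hVi V i)) := by
    intro V
    refine sheaf_hom_glue (hle V) (hcv V) _ fun i j Q hi hj => ?_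
    let q := restrι T Q
    have hq : (⊤ : Opens (restr T Q).obj) ≤ (Opens.map q.hom.hom.base).obj Q :=
      fun z _ => bmap_restrι_mem T Q z
    have := isIso_pull q.hom hq (by
      change (Q : Set T.obj) = bmap q '' Set.univ
      rw [Set.image_univ, range_restrι])
    rw [← cancel_mono (pull q.hom hq)]
    -- Read on the open subspace `Q`, the inverse disappears: the `i`-th candidate is pullback along
    -- a lift of the inclusion through `e i`, followed by `f i`. Two candidates can then be compared
    -- by `hc`.
    have key : ∀ i (hi : Q ≤ Wi V i), ∃ a : restr T Q ⟶ T' i, a ≫ e i = q ∧ ∃ h',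
        ((pull (f i).hom (hiVi V i) ≫ inv (pull (e i).hom (hVi V i))) ≫ res T.obj hi) ≫
          pull q.hom hq = pull (a.hom ≫ (f i).hom) h' := by
      intro i hi
      have hr : ∀ z, bmap q z ∈ Set.range (bmap (e i)) := fun z => by
        obtain ⟨y, -, hy⟩ := hi (bmap_restrι_mem T Q z)
        exact ⟨y, hy⟩
      have hae : lift (e i) q hr ≫ e i = q := lift_fac _ _ _
      have ha : (⊤ : Opens (restr T Q).obj) ≤
          (Opens.map (lift (e i) q hr).hom.hom.base).obj (Vi V i) := fun z _ => by
        obtain ⟨y, hy, hyz⟩ := hi (bmap_restrι_mem T Q z)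
        have : bmap (lift (e i) q hr) z = y :=
          (IsOpenImm.isOpenEmbedding (e i)).injective ((bmap_lift _ _ _ _).trans hyz.symm)
        change bmap (lift (e i) q hr) z ∈ Vi V i
        rw [this]; exact hy
      refine ⟨lift (e i) q hr, hae, le_preimage_comp _ (f i).hom (hiVi V i) ha, ?_⟩
      have hae' : q.hom = (lift (e i) q hr).hom ≫ (e i).hom := congrArg (fun k => k.hom) hae.symm
      rw [Category.assoc, res_pull, Category.assoc, pull_congr hae' _
        (le_preimage_comp _ (e i).hom (hVi V i) ha)]
      have h1 := pull_pull (lift (e i) q hr).hom (e i).hom (hVi V i) ha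
      have h2 := pull_pull (lift (e i) q hr).hom (f i).hom (hiVi V i) ha
      refine Eq.trans ?_ h2
      refine congrArg (fun k => _ ≫ k) ?_
      rw [IsIso.inv_comp_eq]
      exact h1.symm
    obtain ⟨a, ha, h1, h2⟩ := key i hi
    obtain ⟨b, hb, h3, h4⟩ := key j hj
    rw [h2, h4]
    have hh : a.hom ≫ (f i).hom = b.hom ≫ (f j).hom :=
      congrArg (fun k => k.hom) (hc i j _ a b (ha.trans hb.symm))
    exact pull_congr hh _ _
  choose ψ hψ using hex
  have hψ' : ∀ V i, ∀ h, ψ V ≫ pull (e i).hom (W := Vi V i) h = pull (f i).hom (hiVi V i) := by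
    intro V i h
    have := congrArg (fun k => k ≫ pull (e i).hom (hVi V i)) (hψ V i)
    simp only [Category.assoc, IsIso.inv_hom_id, Category.comp_id, res_pull] at this
    exact this
  let gc : Y.obj.presheaf ⟶ Gt _* T.obj.presheaf :=
    { app := fun V => ψ V.unop
      naturality := fun V V' u => by
        refine sheaf_hom_ext (hle V'.unop) (hcv V'.unop) fun i => ?_
        rw [← cancel_mono (pull (e i).hom (hVi V'.unop i))]
        rw [Category.assoc, res_pull, Category.assoc, hψ', Category.assoc]
        have e1 : Y.obj.presheaf.map u = res Y.obj u.unop.le := rfl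
        have hm : (Opens.map Gt).obj V'.unop ≤ (Opens.map Gt).obj V.unop :=
          fun x hx => u.unop.le hx
        have e2 : (Gt _* T.obj.presheaf).map u = res T.obj hm := rfl
        have hm' : Vi V'.unop i ≤ Vi V.unop i := fun x hx => u.unop.le hx
        rw [e1, e2, res_pull, Category.assoc, res_pull, res_pull]
        have := hψ' V.unop i (fun y hy => hle V.unop i ⟨y, hy, rfl⟩)
        have := congrArg (fun k => k ≫ res (T' i).obj hm') this
        simp only [Category.assoc, pull_res] at this
        exact this.symm.trans (congrArg (fun k => ψ V.unop ≫ k) (pull_res _ _ _)) }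
  refine ⟨ObjectProperty.homMk (InducedCategory.homMk ⟨Gt, gc⟩), fun i => ?_⟩
  refine ObjectProperty.hom_ext _ (hom_ext_pull ?_ ?_)
  · ext y
    exact hG i y
  · intro V W h1 h2
    have h3 : Vi V i ≤ (Opens.map (e i).hom.hom.base).obj ((Opens.map Gt).obj V) :=
      fun y hy => hle V i ⟨y, hy, rfl⟩
    have h4 : W ≤ Vi V i := h2
    have := congrArg (fun k => k ≫ res (T' i).obj h4) (hψ' V i h3)
    simp only [Category.assoc, pull_res] at this
    refine Eq.trans ?_ this
    exact Category.assoc _ _ _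

end Glue

end SMfd

/-! ### Hadamard's lemma -/

section Hadamard
open MeasureTheory Set
open scoped ContDiff Topology

/-- The integral is the value at 0 of the convolution of the indicator of (0,1] with t ↦ χ(t)
g(y,-t), and convolutions with a smooth, uniformly compactly supported family are smooth in the
parameter. -/
theorem contDiff_integral_param {E : Type*} [NormedAddCommGroup E] [NormedSpace ℝ E]
    {g : E → ℝ → ℝ} (hg : ContDiff ℝ ∞ (fun z : E × ℝ => g z.1 z.2)) :
    ContDiff ℝ ∞ (fun y => ∫ t in (0 : ℝ)..1, g y t) := by
  -- The cutoff is 1 on [-2,2], which contains every -t with t in (0,1], and vanishes outside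
  -- [-3,3].
  let χ : ContDiffBump (0 : ℝ) := ⟨2, 3, by norm_num, by norm_num⟩
  let f : ℝ → ℝ := indicator (Ioc 0 1) 1
  let G : E → ℝ → ℝ := fun y u => χ u * g y (-u)
  have hf : LocallyIntegrable f volume :=
    ((integrable_indicator_iff measurableSet_Ioc).2
      (integrableOn_const (by simp))).locallyIntegrable
  have hG : ContDiffOn ℝ ∞ (Function.uncurry G) (univ ×ˢ univ) := by
    rw [univ_prod_univ]
    refine ContDiff.contDiffOn ?_
    exact (χ.contDiff.comp contDiff_snd).mul (hg.comp (contDiff_fst.prodMk contDiff_snd.neg))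
  have key := contDiffOn_convolution_right_with_param_comp (n := ⊤) (μ := volume)
    (ContinuousLinearMap.mul ℝ ℝ) (v := fun _ : E => (0 : ℝ)) contDiffOn_const isOpen_univ
    (isCompact_closedBall (0 : ℝ) 3)
    (g := G) (fun p x _ hx => by
      have : χ x = 0 := χ.zero_of_le_dist (by
        rw [Metric.mem_closedBall, not_le] at hx; exact hx.le)
      simp [G, this]) hf hG
  rw [contDiffOn_univ] at key
  refine Eq.mp (congrArg (ContDiff ℝ ∞) (funext fun y => ?_)) key
  symm
  rw [intervalIntegral.integral_of_le zero_le_one, ← integral_indicator measurableSet_Ioc]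
  unfold MeasureTheory.convolution
  refine integral_congr_ae (Filter.Eventually.of_forall fun t => ?_)
  simp only [ContinuousLinearMap.mul_apply', f, G, indicator_apply, zero_sub, neg_neg]
  split_ifs with ht
  · have : χ (-t) = 1 := χ.one_of_mem_closedBall (by
      rw [Metric.mem_closedBall, dist_zero_right, norm_neg, Real.norm_eq_abs, abs_of_pos ht.1]
      exact ht.2.trans (by norm_num))
    rw [this]; simp
  · simp

/-- Integrate the derivative of `g` along the segment from `a` to `y`; `k i` is the integral of the
i-th partial derivative. -/
theorem hadamard {p : ℕ} {g : (Fin p → ℝ) → ℝ} (hg : ContDiff ℝ ∞ g) (a : Fin p → ℝ) :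
    ∃ k : Fin p → (Fin p → ℝ) → ℝ, (∀ i, ContDiff ℝ ∞ (k i)) ∧
      ∀ y, g y = g a + ∑ i, (y i - a i) * k i y := by
  have hd : ContDiff ℝ ∞ (fun z : ((Fin p → ℝ) × ℝ) => fderiv ℝ g (a + z.2 • (z.1 - a))) :=
    (hg.fderiv_right (m := ∞) (by simp)).comp
      (contDiff_const.add (contDiff_snd.smul (contDiff_fst.sub contDiff_const)))
  refine ⟨fun i y => ∫ t in (0 : ℝ)..1, fderiv ℝ g (a + t • (y - a)) (Pi.single i 1),
    fun i => contDiff_integral_param (hd.clm_apply contDiff_const), fun y => ?_⟩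
  have hcont : ∀ v : Fin p → ℝ, Continuous fun t : ℝ => fderiv ℝ g (a + t • (y - a)) v := fun v =>
    (hd.continuous.comp (Continuous.prodMk_right y)).clm_apply continuous_const
  have h1 : ∀ t : ℝ, HasDerivAt (fun t : ℝ => g (a + t • (y - a)))
      (fderiv ℝ g (a + t • (y - a)) (y - a)) t := fun t => by
    have h2 : HasDerivAt (fun t : ℝ => a + t • (y - a)) (y - a) t := by
      simpa using ((hasDerivAt_id t).smul_const (y - a)).const_add a
    exact ((hg.differentiable (by simp)).differentiableAt.hasFDerivAt).comp_hasDerivAt t h2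
  have h3 := intervalIntegral.integral_eq_sub_of_hasDerivAt (a := 0) (b := 1)
    (fun t _ => h1 t) ((hcont _).intervalIntegrable _ _)
  simp only [one_smul, zero_smul, add_zero, add_sub_cancel] at h3
  rw [eq_sub_iff_add_eq, add_comm] at h3
  rw [← h3]
  congr 1
  have h4 : ∀ t : ℝ, fderiv ℝ g (a + t • (y - a)) (y - a) =
      ∑ i, (y i - a i) * fderiv ℝ g (a + t • (y - a)) (Pi.single i 1) := fun t => by
    refine (LinearMap.pi_apply_eq_sum_univ (fderiv ℝ g (a + t • (y - a))).toLinearMap _).trans ?_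
    refine Finset.sum_congr rfl fun i _ => ?_
    rw [smul_eq_mul, Pi.sub_apply]
    refine congrArg (fun v => _ * (fderiv ℝ g (a + t • (y - a))) v) (funext fun j => ?_)
    simp [Pi.single_apply, eq_comm]
  simp_rw [h4]
  rw [intervalIntegral.integral_finsetSum fun i _ =>
    ((hcont _).const_mul _ |>.intervalIntegrable _ _)]
  simp

end Hadamard

/-! ### Nilpotency of the augmentation ideal -/

namespace Grassmann
variable {r : ℕ}

/-- The body (augmentation) of an element of a Grassmann algebra. -/
def body (r : ℕ) : Grassmann r →ₐ[ℝ] ℝ := ExteriorAlgebra.algebraMapInv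

@[simp] theorem body_algebraMap (c : ℝ) : body r (algebraMap ℝ _ c) = c :=
  ExteriorAlgebra.algebraMap_leftInverse _ c

@[simp] theorem body_ι (v : Fin r → ℝ) : body r (ExteriorAlgebra.ι ℝ v) = 0 := by
  simp [body, ExteriorAlgebra.algebraMapInv]

/-- The augmentation ideal, as a subspace. -/
def aug (r : ℕ) : Submodule ℝ (Grassmann r) := LinearMap.ker (body r).toLinearMap

theorem mem_aug {x : Grassmann r} : x ∈ aug r ↔ body r x = 0 := Iff.rfl

/-- The augmentation ideal is generated, as a right ideal, by the odd generators. -/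
theorem sub_body_mem (x : Grassmann r) :
    x - algebraMap ℝ _ (body r x) ∈ (LinearMap.range (ExteriorAlgebra.ι ℝ (M := Fin r → ℝ))) *
      (⊤ : Submodule ℝ (Grassmann r)) := by
  induction x using ExteriorAlgebra.induction with
  | algebraMap c => simp
  | ι v =>
    rw [body_ι, map_zero, sub_zero, ← mul_one (ExteriorAlgebra.ι ℝ v)]
    exact Submodule.mul_mem_mul ⟨v, rfl⟩ Submodule.mem_top
  | mul a b ha hb =>
    have : a * b - algebraMap ℝ _ (body r (a * b)) = (a - algebraMap ℝ _ (body r a)) * b +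
        body r a • (b - algebraMap ℝ _ (body r b)) := by
      rw [map_mul, map_mul, smul_sub, Algebra.smul_def, Algebra.smul_def]; noncomm_ring
    rw [this]
    refine add_mem ?_ (Submodule.smul_mem _ _ hb)
    have := Submodule.mul_mem_mul ha (Submodule.mem_top : b ∈ (⊤ : Submodule ℝ (Grassmann r)))
    rw [mul_assoc] at this
    have h : LinearMap.range (ExteriorAlgebra.ι ℝ (M := Fin r → ℝ)) * (⊤ * ⊤) ≤
        LinearMap.range (ExteriorAlgebra.ι ℝ (M := Fin r → ℝ)) * ⊤ := mul_le_mul_right le_top _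
    exact h this
  | add a b ha hb =>
    rw [map_add, map_add, add_sub_add_comm]
    exact add_mem ha hb

theorem exists_parts (x : Grassmann r) : ∃ a ∈ part r 0, ∃ b ∈ part r 1, x = a + b := by
  have hc := CliffordAlgebra.evenOdd_isCompl (0 : QuadraticForm ℝ (Fin r → ℝ))
  exact ⟨_, Submodule.projection_apply_mem hc x, _, Submodule.projection_apply_mem hc.symm x,
    (Submodule.projection_add_projection_eq_self hc x).symm⟩

theorem ι_mem_part (v : Fin r → ℝ) : ExteriorAlgebra.ι ℝ v ∈ part r 1 :=
  CliffordAlgebra.ι_mem_evenOdd_one _ v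

theorem even_comm {a b : Grassmann r} (ha : a ∈ part r 0) : a * b = b * a := by
  obtain ⟨x, hx, y, hy, rfl⟩ := exists_parts b
  have h1 := supercomm 0 0 a x ha hx
  have h2 := supercomm 0 1 a y ha hy
  simp only [zero_mul, uzpow_zero, one_smul] at h1 h2
  rw [mul_add, add_mul, h1, h2]

theorem odd_anticomm {a b : Grassmann r} (ha : a ∈ part r 1) (hb : b ∈ part r 1) :
    a * b = -(b * a) := by
  have h1 := supercomm 1 1 a b ha hb
  have : ((-1 : ℤˣ) ^ ((1 : ZMod 2) * 1)) = -1 := by rw [mul_one]; exact uzpow_one _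
  rw [this] at h1
  simpa using h1

/-- Generators commute with even and anticommute with odd elements, so arbitrary factors can be
moved to the right of them. This bounds powers of the augmentation ideal by powers of the space of
generators. -/
theorem top_mul_range_le :
    (⊤ : Submodule ℝ (Grassmann r)) * LinearMap.range (ExteriorAlgebra.ι ℝ (M := Fin r → ℝ)) ≤
      LinearMap.range (ExteriorAlgebra.ι ℝ (M := Fin r → ℝ)) * ⊤ := by
  rw [Submodule.mul_le]
  rintro x - _ ⟨v, rfl⟩
  obtain ⟨a, ha, b, hb, rfl⟩ := exists_parts x
  rw [add_mul, even_comm ha, odd_anticomm hb (ι_mem_part v), ← mul_neg, ← mul_add]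
  exact Submodule.mul_mem_mul ⟨v, rfl⟩ Submodule.mem_top

theorem aug_pow_le (N : ℕ) : (aug r) ^ N ≤
    (LinearMap.range (ExteriorAlgebra.ι ℝ (M := Fin r → ℝ))) ^ N * ⊤ := by
  set R := LinearMap.range (ExteriorAlgebra.ι ℝ (M := Fin r → ℝ))
  have h1 : aug r ≤ R * ⊤ := fun x hx => by
    have := sub_body_mem x
    rwa [mem_aug.1 hx, map_zero, sub_zero] at this
  have h2 : ∀ N : ℕ, (⊤ : Submodule ℝ (Grassmann r)) * R ^ N ≤ R ^ N * ⊤ := by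
    intro N
    induction N with
    | zero => simp
    | succ N ih =>
      calc ⊤ * R ^ (N + 1) = (⊤ * R ^ N) * R := by rw [pow_succ, mul_assoc]
        _ ≤ (R ^ N * ⊤) * R := mul_le_mul_left ih _
        _ = R ^ N * (⊤ * R) := mul_assoc _ _ _
        _ ≤ R ^ N * (R * ⊤) := mul_le_mul_right top_mul_range_le _
        _ = _ := by rw [pow_succ, mul_assoc]
  induction N with
  | zero =>
    rw [pow_zero, pow_zero, one_mul]; exact le_top
  | succ N ih =>
    calc aug r ^ (N + 1) = aug r ^ N * aug r := pow_succ _ _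
      _ ≤ (R ^ N * ⊤) * (R * ⊤) := mul_le_mul' ih h1
      _ = R ^ N * ((⊤ * R) * ⊤) := by simp only [mul_assoc]
      _ ≤ R ^ N * ((R * ⊤) * ⊤) :=
        mul_le_mul_right (mul_le_mul_left top_mul_range_le _) _
      _ ≤ R ^ N * (R * ⊤) := by
        rw [mul_assoc R]
        exact mul_le_mul_right (mul_le_mul_right le_top _) _
      _ = _ := by rw [pow_succ, mul_assoc]

/-- Any `r + 1` vectors in `ℝ^r` are linearly dependent, and an alternating map vanishes on them. -/
theorem range_pow : (LinearMap.range (ExteriorAlgebra.ι ℝ (M := Fin r → ℝ))) ^ (r + 1) = ⊥ := by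
  refine (ExteriorAlgebra.ιMulti_span_fixedDegree ℝ (M := Fin r → ℝ) (r + 1)).symm.trans ?_
  rw [Submodule.span_eq_bot]
  rintro _ ⟨v, rfl⟩
  refine AlternatingMap.map_linearDependent _ v fun h => ?_
  have := h.fintype_card_le_finrank
  simp at this

theorem aug_pow : (aug r) ^ (r + 1) = ⊥ := by
  have := aug_pow_le (r := r) (r + 1)
  rwa [range_pow, Submodule.bot_mul, le_bot_iff] at this

theorem pow_eq_zero {x : Grassmann r} (hx : body r x = 0) : x ^ (r + 1) = 0 := by
  have := Submodule.pow_mem_pow (aug r) (mem_aug.2 hx) (r + 1)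
  rwa [aug_pow, Submodule.mem_bot] at this

end Grassmann

/-! ### Morphisms to ℝ^{p|q} are determined by their coordinates -/

section Sections
open scoped Manifold ContDiff
variable {p q : ℕ}

/-- A smooth real function as a section of the structure sheaf of `ℝ^{p|q}`. -/
def scal (q : ℕ) (W : Opens (Fin p → ℝ)) {g : (Fin p → ℝ) → ℝ} (hg : ContDiff ℝ ∞ g) :
    smoothSections p q W :=
  ⟨fun y => algebraMap ℝ _ (g y.1), fun φ => by
    have : (fun x : W => φ (algebraMap ℝ (Grassmann q) (g x.1))) = fun x => g x.1 * φ 1 := by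
      funext x
      rw [Algebra.algebraMap_eq_smul_one, map_smul, smul_eq_mul]
    rw [this]
    exact (hg.contMDiff.comp contMDiff_subtype_val).mul contMDiff_const⟩

/-- A constant section. -/
def cst (W : Opens (Fin p → ℝ)) : Grassmann q →ₐ[ℝ] smoothSections p q W where
  toFun a := ⟨fun _ => a, IsSmooth.const a⟩
  map_one' := rfl
  map_mul' _ _ := rfl
  map_zero' := rfl
  map_add' _ _ := rfl
  commutes' _ := rfl

/-- Restriction of sections of the structure sheaf of `ℝ^{p|q}`. -/
def sres {W W' : Opens (Fin p → ℝ)} (h : W' ≤ W) : smoothSections p q W →ₐ[ℝ] smoothSections p q W' :=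
  ((stdPresheaf p q).map (homOfLE h).op).toAlgHom

theorem coord_smooth (i : Fin p) : ContDiff ℝ ∞ (fun y : Fin p → ℝ => y i) := contDiff_apply _ _ i

/-- Local functions extend, near a point, to global functions. -/
theorem exists_extension (W : Opens (Fin p → ℝ)) (u : Fin p → ℝ) (hu : u ∈ W) (f : W → ℝ)
    (hf : ContMDiff 𝓘(ℝ, Fin p → ℝ) 𝓘(ℝ, ℝ) ∞ f) (O : Opens (Fin p → ℝ)) (hO : u ∈ O) :
    ∃ (G : (Fin p → ℝ) → ℝ) (_ : ContDiff ℝ ∞ G) (W' : Opens (Fin p → ℝ)) (h : W' ≤ W),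
      u ∈ W' ∧ W' ≤ O ∧ ∀ y (hy : y ∈ W'), G y = f ⟨y, h hy⟩ := by
  classical
  obtain ⟨ε, hε, hball⟩ := Metric.isOpen_iff.1 (W ⊓ O).2 u ⟨hu, hO⟩
  let χ : ContDiffBump u := ⟨ε / 4, ε / 2, by positivity, by linarith⟩
  let F : (Fin p → ℝ) → ℝ := fun y => if h : y ∈ W then f ⟨y, h⟩ else 0
  have hF : ∀ y : W, F y.1 = f y := fun y => dif_pos y.2
  have hFs : ∀ y ∈ W, ContDiffAt ℝ ∞ F y := fun y hy => by
    rw [← contMDiffAt_iff_contDiffAt]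
    refine (contMDiffAt_subtype_iff (x := (⟨y, hy⟩ : W))).1 ?_
    exact (funext hF : (fun x : W => F x.1) = f) ▸ hf ⟨y, hy⟩
  have hsub : Metric.closedBall u (ε / 2) ⊆ (W ⊓ O : Opens (Fin p → ℝ)) :=
    (Metric.closedBall_subset_ball (by linarith)).trans hball
  have hin : Metric.ball u (ε / 4) ⊆ (W ⊓ O : Opens (Fin p → ℝ)) :=
    (Metric.ball_subset_ball (by linarith)).trans hball
  refine ⟨fun y => χ y * F y, contDiff_iff_contDiffAt.2 fun y => ?_,
    ⟨Metric.ball u (ε / 4), Metric.isOpen_ball⟩, fun y hy => (hin hy).1,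
    Metric.mem_ball_self (by positivity), fun y hy => (hin hy).2, fun y hy => ?_⟩
  · by_cases hy : y ∈ Metric.closedBall u (ε / 2)
    · exact χ.contDiffAt.mul (hFs y (hsub hy).1)
    · refine (contDiffAt_const (c := (0 : ℝ))).congr_of_eventuallyEq ?_
      filter_upwards [Metric.isClosed_closedBall.isOpen_compl.mem_nhds hy] with z hz
      rw [χ.zero_of_le_dist, zero_mul]
      simp only [Set.mem_compl_iff, Metric.mem_closedBall, not_le] at hz
      exact hz.le
  · change χ y * F y = _
    rw [χ.one_of_mem_closedBall (Metric.ball_subset_closedBall hy), one_mul]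
    exact dif_pos _

end Sections

/-- A point of `ℝ^{p|q}` with values in a Grassmann algebra, located at `u`. -/
structure GPoint (p q r : ℕ) (u : Fin p → ℝ) where
  ev : ∀ W : Opens (Fin p → ℝ), u ∈ W → smoothSections p q W →ₐ[ℝ] Grassmann r
  ev_res : ∀ {W W' : Opens (Fin p → ℝ)} (h : W' ≤ W) (hu : u ∈ W') (s : smoothSections p q W),
    ev W' hu (sres h s) = ev W (h hu) s

namespace GPoint
open scoped Manifold ContDiff
variable {p q r : ℕ} {u u' : Fin p → ℝ}

/-- If the body were c ≠ u_i, then x_i - c would be invertible on the neighbourhood y_i ≠ c of `u`,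
although its value has body zero. So the location of a point can be read off from its coordinates.
-/
theorem body_coord (γ : GPoint p q r u) (i : Fin p) :
    Grassmann.body r (γ.ev ⊤ trivial (scal q ⊤ (coord_smooth i))) = u i := by
  by_contra hne
  set c := Grassmann.body r (γ.ev ⊤ trivial (scal q ⊤ (coord_smooth i))) with hc
  let W : Opens (Fin p → ℝ) := ⟨{y | y i ≠ c}, isOpen_ne_fun (continuous_apply i) continuous_const⟩
  have hW : u ∈ W := fun h => hne h.symm
  let s : smoothSections p q W := scal q W (coord_smooth i) - algebraMap ℝ _ c
  let t : smoothSections p q W := ⟨fun y => algebraMap ℝ _ (y.1 i - c)⁻¹, fun φ => by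
    have : (fun x : W => φ (algebraMap ℝ (Grassmann q) (x.1 i - c)⁻¹)) =
        fun x => (x.1 i - c)⁻¹ * φ 1 := by
      funext x
      rw [Algebra.algebraMap_eq_smul_one, map_smul, smul_eq_mul]
    rw [this]
    refine ContMDiff.mul ?_ contMDiff_const
    intro x
    refine ContMDiffAt.inv₀ ?_ (sub_ne_zero.2 x.2)
    exact (((coord_smooth i).sub contDiff_const).contMDiff.comp contMDiff_subtype_val) x⟩
  have hst : s * t = 1 := Subtype.ext (funext fun y => by
    change (algebraMap ℝ (Grassmann q) (y.1 i) - algebraMap ℝ _ c) * algebraMap ℝ _ (y.1 i - c)⁻¹ = 1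
    rw [← map_sub, ← map_mul, mul_inv_cancel₀ (sub_ne_zero.2 y.2), map_one])
  have h1 := congrArg (fun z => Grassmann.body r (γ.ev W hW z)) hst
  simp only [map_mul, map_one] at h1
  have h2 : Grassmann.body r (γ.ev W hW s) = 0 := by
    change Grassmann.body r (γ.ev W hW (scal q W (coord_smooth i) - algebraMap ℝ _ c)) = 0
    rw [map_sub, map_sub, AlgHom.commutes, Grassmann.body_algebraMap, sub_eq_zero, hc]
    exact congrArg _ (γ.ev_res (le_top (a := W)) hW (scal q ⊤ (coord_smooth i)))
  rw [h2, zero_mul] at h1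
  exact zero_ne_one h1

theorem base_eq (γ : GPoint p q r u) (γ' : GPoint p q r u')
    (h : ∀ i, γ.ev ⊤ trivial (scal q ⊤ (coord_smooth i)) =
      γ'.ev ⊤ trivial (scal q ⊤ (coord_smooth i))) : u = u' :=
  funext fun i => by rw [← γ.body_coord, ← γ'.body_coord, h]

/-- By Hadamard at `u`, g = g(u) + Σ (x_i - u_i) k_i. Both points give the factors x_i - u_i the
same nilpotent value, so the difference for `g` lies one step deeper in the filtration than the
differences for the `k i`. -/
theorem scal_sub_mem (γ γ' : GPoint p q r u)
    (h : ∀ i, γ.ev ⊤ trivial (scal q ⊤ (coord_smooth i)) =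
      γ'.ev ⊤ trivial (scal q ⊤ (coord_smooth i))) (N : ℕ) :
    ∀ {g : (Fin p → ℝ) → ℝ} (hg : ContDiff ℝ ∞ g),
      γ.ev ⊤ trivial (scal q ⊤ hg) - γ'.ev ⊤ trivial (scal q ⊤ hg) ∈
        Grassmann.aug r ^ N * ⊤ := by
  induction N with
  | zero => simp
  | succ N ih =>
    intro g hg
    obtain ⟨k, hk, hgk⟩ := hadamard hg u
    have e : scal q ⊤ hg = algebraMap ℝ _ (g u) +
        ∑ i, (scal q ⊤ (coord_smooth i) - algebraMap ℝ _ (u i)) * scal q ⊤ (hk i) := by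
      refine Subtype.ext (funext fun y => ?_)
      have hs : ∀ t : Fin p → smoothSections p q ⊤, (∑ i, t i).1 y = ∑ i, (t i).1 y := fun t => by
        rw [AddSubmonoidClass.coe_finsetSum, Finset.sum_apply]
      refine Eq.trans ?_ (congrArg (algebraMap ℝ (Grassmann q) (g u) + ·) (hs _)).symm
      change algebraMap ℝ _ (g y.1) = _
      rw [hgk y.1, map_add, map_sum]
      refine congrArg _ (Finset.sum_congr rfl fun i _ => ?_)
      change algebraMap ℝ (Grassmann q) _ = (algebraMap ℝ (Grassmann q) (y.1 i) -
        algebraMap ℝ (Grassmann q) (u i)) * algebraMap ℝ (Grassmann q) _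
      rw [← map_sub, ← map_mul]
    rw [e]
    simp only [map_add, map_sum, map_mul, AlgHom.commutes]
    rw [add_sub_add_left_eq_sub, ← Finset.sum_sub_distrib]
    refine sum_mem fun i _ => ?_
    have : γ'.ev ⊤ trivial (scal q ⊤ (coord_smooth i) - algebraMap ℝ _ (u i)) =
      γ.ev ⊤ trivial (scal q ⊤ (coord_smooth i) - algebraMap ℝ _ (u i)) := by
      rw [map_sub, map_sub, h, AlgHom.commutes, AlgHom.commutes]
    rw [this, ← mul_sub, pow_succ', mul_assoc]
    refine Submodule.mul_mem_mul ?_ (ih (hk i))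
    rw [Grassmann.mem_aug, map_sub, map_sub, body_coord, AlgHom.commutes,
      Grassmann.body_algebraMap, sub_self]

/-- Near `u` every section is a sum of products of a scalar function and a constant. Scalars are
handled by `scal_sub_mem` with `N = r + 1`, where the filtration is zero; constants are generated by
the odd coordinates. -/
theorem ext_of_coord (γ γ' : GPoint p q r u)
    (h : ∀ i, γ.ev ⊤ trivial (scal q ⊤ (coord_smooth i)) =
      γ'.ev ⊤ trivial (scal q ⊤ (coord_smooth i)))
    (h' : ∀ j, γ.ev ⊤ trivial (cst ⊤ (ExteriorAlgebra.ι ℝ (Pi.single j 1))) =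
      γ'.ev ⊤ trivial (cst ⊤ (ExteriorAlgebra.ι ℝ (Pi.single j 1))))
    (W : Opens (Fin p → ℝ)) (hu : u ∈ W) (s : smoothSections p q W) :
    γ.ev W hu s = γ'.ev W hu s := by
  have hscal : ∀ {g : (Fin p → ℝ) → ℝ} (hg : ContDiff ℝ ∞ g),
      γ.ev ⊤ trivial (scal q ⊤ hg) = γ'.ev ⊤ trivial (scal q ⊤ hg) := fun hg => by
    have := scal_sub_mem γ γ' h (r + 1) hg
    rwa [Grassmann.aug_pow, Submodule.bot_mul, Submodule.mem_bot, sub_eq_zero] at this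
  have hcst : (γ.ev ⊤ trivial).comp (cst ⊤) = (γ'.ev ⊤ trivial).comp (cst ⊤) := by
    refine ExteriorAlgebra.hom_ext ((Pi.basisFun ℝ (Fin q)).ext fun j => ?_)
    rw [Pi.basisFun_apply]
    exact h' j
  let b := Module.finBasis ℝ (Grassmann q)
  -- Coefficient functions are extended one at a time, because each extension shrinks the
  -- neighbourhood on which it agrees with the given function.
  have hex : ∀ T : Finset (Fin (Module.finrank ℝ (Grassmann q))),
      ∃ (G : Fin (Module.finrank ℝ (Grassmann q)) → (Fin p → ℝ) → ℝ) (_ : ∀ i, ContDiff ℝ ∞ (G i))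
      (W' : Opens (Fin p → ℝ)) (h : W' ≤ W), u ∈ W' ∧
        ∀ i ∈ T, ∀ y (hy : y ∈ W'), G i y = b.coord i (s.1 ⟨y, h hy⟩) := by
    intro T
    induction T using Finset.induction_on with
    | empty => exact ⟨fun _ _ => 0, fun _ => contDiff_const, W, le_rfl, hu, fun _ h => by simp at h⟩
    | insert i T hi ih =>
      obtain ⟨G, hG, W', hW', hu', hGs⟩ := ih
      obtain ⟨G1, hG1, W1, hW1, hu1, hle, hGs1⟩ := exists_extension W u hu
        (fun y => b.coord i (s.1 y)) (s.2 _) W' hu'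
      refine ⟨Function.update G i G1, fun j => ?_, W1, hW1, hu1, fun j hj y hy => ?_⟩
      · by_cases hji : j = i
        · subst hji; simpa using hG1
        · simpa [hji] using hG j
      · by_cases hji : j = i
        · subst hji; simpa using hGs1 y hy
        · simpa [hji] using hGs j ((Finset.mem_insert.1 hj).resolve_left hji) y (hle hy)
  obtain ⟨G, hG, W', hW', hu', hGs⟩ := hex Finset.univ
  have e : sres hW' s = ∑ i, sres le_top (scal q ⊤ (hG i)) * sres le_top (cst ⊤ (b i)) := by
    refine Subtype.ext (funext fun y => ?_)
    rw [AddSubmonoidClass.coe_finsetSum, Finset.sum_apply]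
    refine (b.sum_repr _).symm.trans (Finset.sum_congr rfl fun i _ => ?_)
    rw [Algebra.smul_def]
    exact congrArg (fun c => algebraMap ℝ _ c * b i) (hGs i (Finset.mem_univ _) y.1 y.2).symm
  rw [← γ.ev_res hW' hu', ← γ'.ev_res hW' hu', e]
  simp only [map_sum, map_mul, ev_res]
  refine Finset.sum_congr rfl fun i _ => ?_
  rw [hscal]
  exact congrArg _ (DFunLike.congr_fun hcst (b i))

end GPoint

namespace SMfd
open scoped Manifold ContDiff

/-- Global functions on a supermanifold. -/
abbrev Γ (S : SMfd) : SuperAlg := S.obj.presheaf.obj (op ⊤)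

theorem top_le_preimage {S T : SMfd} (f : S ⟶ T) :
    (⊤ : Opens S.obj) ≤ (Opens.map f.hom.hom.base).obj ⊤ := fun _ _ => trivial

/-- Pullback of global functions. -/
def pb {S T : SMfd} (f : S ⟶ T) : Γ T ⟶ Γ S := pull f.hom (top_le_preimage f)

theorem pb_comp {S T R : SMfd} (f : S ⟶ T) (g : T ⟶ R) (s : Γ R) : pb (f ≫ g) s = pb f (pb g s) :=
  (pull_pull_apply f.hom g.hom (top_le_preimage g) (top_le_preimage f) s).symm

@[simp] theorem pb_id {S : SMfd} (s : Γ S) : pb (𝟙 S) s = s := by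
  have : pb (𝟙 S) = 𝟙 _ := (pull_id le_top).trans (res_self _)
  rw [this]; rfl

/-- The even coordinates on `ℝ^{p|q}`. -/
def coordX (p q : ℕ) (i : Fin p) : Γ (std p q) := scal q ⊤ (coord_smooth i)

/-- The odd coordinates on `ℝ^{p|q}`. -/
def coordT (p q : ℕ) (j : Fin q) : Γ (std p q) := cst ⊤ (ExteriorAlgebra.ι ℝ (Pi.single j 1))

theorem coordX_mem (p q : ℕ) (i : Fin p) : coordX p q i ∈ (Γ (std p q)).part 0 := fun y => by
  change algebraMap ℝ _ (y.1 i) ∈ _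
  rw [Algebra.algebraMap_eq_smul_one]
  exact Submodule.smul_mem _ _ (SetLike.GradedOne.one_mem (A := Grassmann.part q))

theorem coordT_mem (p q : ℕ) (j : Fin q) : coordT p q j ∈ (Γ (std p q)).part 1 :=
  fun _ => Grassmann.ι_mem_part _

/-- Evaluation of sections over an open part of `ℝ^{m|r}` at a point. -/
def evR {m r : ℕ} {O : Opens (std m r).obj} (W : Opens (restr (std m r) O).obj)
    (v : (restr (std m r) O).obj) (hv : v ∈ W) :
    (restr (std m r) O).obj.presheaf.obj (op W) →ₐ[ℝ] Grassmann r :=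
  (Pi.evalAlgHom ℝ (fun _ : (O.isOpenEmbedding.functor.obj W : Opens (Fin m → ℝ)) => Grassmann r)
    ⟨v.1, v, hv, rfl⟩).comp (smoothSections m r _).val

theorem evR_ext {m r : ℕ} {O : Opens (std m r).obj} {W : Opens (restr (std m r) O).obj}
    {s t : (restr (std m r) O).obj.presheaf.obj (op W)} (h : ∀ v hv, evR W v hv s = evR W v hv t) :
    s = t := by
  refine Subtype.ext (funext fun y => ?_)
  obtain ⟨v, hvW, hvy⟩ := y.2
  have := h v hvW
  obtain ⟨y, hy⟩ := y
  subst hvy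
  exact this

/-- The point of `ℝ^{p|q}` obtained from a point of an open part of `ℝ^{m|r}`. -/
def gpoint {m r p q : ℕ} {O : Opens (std m r).obj} (f : restr (std m r) O ⟶ std p q)
    (v : (restr (std m r) O).obj) : GPoint p q r (bmap f v) where
  ev W hW := (evR ((Opens.map f.hom.hom.base).obj W) v hW).comp (f.hom.hom.c.app (op W)).toAlgHom
  ev_res {_ W'} h hu s :=
    congrArg (fun φ => evR ((Opens.map f.hom.hom.base).obj W') v hu (SuperAlg.Hom.toAlgHom φ s))
      (f.hom.hom.c.naturality (homOfLE h).op)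

theorem gpoint_top {m r p q : ℕ} {O : Opens (std m r).obj} (f : restr (std m r) O ⟶ std p q)
    (v : (restr (std m r) O).obj) (s : Γ (std p q)) :
    (gpoint f v).ev ⊤ trivial s = evR ⊤ v trivial (pb f s) := rfl

theorem std_hom_ext_of_open {m r p q : ℕ} {O : Opens (std m r).obj}
    {f g : restr (std m r) O ⟶ std p q}
    (hx : ∀ i, pb f (coordX p q i) = pb g (coordX p q i))
    (ht : ∀ j, pb f (coordT p q j) = pb g (coordT p q j)) : f = g := by
  have h1 : ∀ v i, (gpoint f v).ev ⊤ trivial (coordX p q i) =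
      (gpoint g v).ev ⊤ trivial (coordX p q i) := fun v i => by rw [gpoint_top, gpoint_top, hx]
  have h2 : ∀ v i, (gpoint f v).ev ⊤ trivial (coordT p q i) =
      (gpoint g v).ev ⊤ trivial (coordT p q i) := fun v i => by rw [gpoint_top, gpoint_top, ht]
  have hb : ∀ v, bmap f v = bmap g v := fun v => GPoint.base_eq _ _ (h1 v)
  -- The two points of `ℝ^{p|q}` are located at propositionally equal places; with a free location
  -- `u` the equality can be substituted.
  have key : ∀ (v : (restr (std m r) O).obj) (u : Fin p → ℝ) (hu : u = bmap f v) (γ : GPoint p q r u)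
      (_ : ∀ i, γ.ev ⊤ trivial (coordX p q i) = (gpoint f v).ev ⊤ trivial (coordX p q i))
      (_ : ∀ i, γ.ev ⊤ trivial (coordT p q i) = (gpoint f v).ev ⊤ trivial (coordT p q i))
      (W : Opens (Fin p → ℝ)) (hW : u ∈ W) (s : smoothSections p q W),
      (gpoint f v).ev W (hu ▸ hW) s = γ.ev W hW s := by
    rintro v _ rfl γ h h' W hW s
    exact (GPoint.ext_of_coord γ _ h h' W hW s).symm
  refine ObjectProperty.hom_ext _ (hom_ext_pull ?_ ?_)
  · ext v
    exact hb v
  · intro V W h h'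
    refine SuperAlg.hom_ext' fun s => evR_ext fun v hvW => ?_
    exact key v _ (hb v).symm (gpoint g v) (fun i => (h1 v i).symm) (fun i => (h2 v i).symm) V
      (h' hvW) s

/-- Every supermanifold is covered by open parts of the standard ones. -/
theorem exists_chart (S : SMfd) (x : S.obj) : ∃ (p q : ℕ) (O : Opens (std p q).obj)
    (f : restr (std p q) O ⟶ S), IsOpenImm f ∧ x ∈ Set.range (bmap f) := by
  obtain ⟨p, q, V, f, -, hf, hx⟩ := hasCharts_iff.1 S.property.2.2 x
  exact ⟨p, q, V, ObjectProperty.homMk f, ⟨hf⟩, hx⟩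

theorem std_hom_ext {S : SMfd} {p q : ℕ} {f g : S ⟶ std p q}
    (hx : ∀ i, pb f (coordX p q i) = pb g (coordX p q i))
    (ht : ∀ j, pb f (coordT p q j) = pb g (coordT p q j)) : f = g := by
  choose m r O e he hxe using exists_chart S
  refine hom_ext_of_cover (ι := ULift.{0} S.obj) (fun x => e x.down) (fun x => ⟨⟨x⟩, hxe x⟩)
    fun x => ?_
  refine std_hom_ext_of_open (fun i => ?_) fun i => ?_
  · rw [pb_comp, pb_comp, hx]
  · rw [pb_comp, pb_comp, ht]

end SMfd

/-! ### Directional derivatives of Grassmann-valued functions -/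

section PartialDerivative
open scoped Manifold ContDiff Topology
variable {n r : ℕ} {Q : Opens (Fin n → ℝ)}

open Classical in
/-- Extension by zero. -/
def extZero (f : Q → Grassmann r) (z : Fin n → ℝ) : Grassmann r := if h : z ∈ Q then f ⟨z, h⟩ else 0

theorem extZero_apply (f : Q → Grassmann r) (y : Q) : extZero f y.1 = f y := dif_pos y.2

theorem contDiffAt_extZero {f : Q → Grassmann r} (hf : IsSmooth f) (φ : Module.Dual ℝ (Grassmann r))
    (y : Q) : ContDiffAt ℝ ∞ (fun z => φ (extZero f z)) y.1 := by
  rw [← contMDiffAt_iff_contDiffAt]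
  refine (contMDiffAt_subtype_iff (x := y)).1 ?_
  have : (fun x : Q => φ (extZero f x.1)) = fun x => φ (f x) := funext fun x => by
    rw [extZero_apply]
  exact this ▸ hf φ y

/-- The derivative of a section in a constant direction, as a function. -/
def pdFun (v : Fin n → ℝ) (f : Q → Grassmann r) (y : Q) : Grassmann r :=
  ∑ i, fderiv ℝ (fun z => (Module.finBasis ℝ (Grassmann r)).coord i (extZero f z)) y.1 v •
    Module.finBasis ℝ (Grassmann r) i

theorem apply_pdFun {f : Q → Grassmann r} (hf : IsSmooth f) (v : Fin n → ℝ) (y : Q)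
    (φ : Module.Dual ℝ (Grassmann r)) :
    φ (pdFun v f y) = fderiv ℝ (fun z => φ (extZero f z)) y.1 v := by
  let b := Module.finBasis ℝ (Grassmann r)
  have h1 : (fun z => φ (extZero f z)) = fun z => ∑ i, b.coord i (extZero f z) * φ (b i) := by
    funext z
    conv_lhs => rw [← b.sum_repr (extZero f z), map_sum]
    simp [Module.Basis.coord_apply]
  have hd : ∀ i, DifferentiableAt ℝ (fun z => b.coord i (extZero f z)) y.1 := fun i =>
    (contDiffAt_extZero hf _ y).differentiableAt (by simp)
  rw [h1, fderiv_fun_sum fun i _ => (hd i).mul_const _, sum_apply, pdFun, map_sum]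
  refine Finset.sum_congr rfl fun i _ => ?_
  rw [fderiv_mul_const (hd i), map_smul, smul_apply, smul_eq_mul, smul_eq_mul,
    mul_comm]

theorem isSmooth_pdFun {f : Q → Grassmann r} (hf : IsSmooth f) (v : Fin n → ℝ) :
    IsSmooth (pdFun v f) := by
  intro φ y
  have h : (fun y => φ (pdFun v f y)) = fun y : Q => fderiv ℝ (fun z => φ (extZero f z)) y.1 v :=
    funext fun y => apply_pdFun hf v y φ
  rw [h]
  refine (contMDiffAt_subtype_iff (f := fun z => fderiv ℝ (fun z => φ (extZero f z)) z v)
    (x := y)).2 ?_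
  rw [contMDiffAt_iff_contDiffAt]
  exact ((contDiffAt_extZero hf φ y).fderiv_right (m := ∞) (by simp)).clm_apply contDiffAt_const

theorem ext_dual {x y : Grassmann r} (h : ∀ φ : Module.Dual ℝ (Grassmann r), φ x = φ y) : x = y :=
  (Module.finBasis ℝ (Grassmann r)).ext_elem fun i => h ((Module.finBasis ℝ (Grassmann r)).coord i)

/-- The derivative of a section in a constant direction. -/
def pd (v : Fin n → ℝ) : smoothSections n r Q →ₗ[ℝ] smoothSections n r Q where
  toFun f := ⟨pdFun v f.1, isSmooth_pdFun f.2 v⟩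
  map_add' f g := Subtype.ext (funext fun y => ext_dual fun φ => by
    have h : ∀ z, φ (extZero (f + g).1 z) = φ (extZero f.1 z) + φ (extZero g.1 z) := fun z => by
      unfold extZero; split_ifs
      · exact map_add φ _ _
      · simp
    change φ (pdFun v (f + g).1 y) = φ (pdFun v f.1 y + pdFun v g.1 y)
    rw [map_add, apply_pdFun (f + g).2, apply_pdFun f.2, apply_pdFun g.2]
    simp only [h]
    rw [fderiv_fun_add ((contDiffAt_extZero f.2 _ y).differentiableAt (by simp))
      ((contDiffAt_extZero g.2 _ y).differentiableAt (by simp))]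
    rfl)
  map_smul' c f := Subtype.ext (funext fun y => ext_dual fun φ => by
    have h : ∀ z, φ (extZero (c • f).1 z) = c * φ (extZero f.1 z) := fun z => by
      unfold extZero; split_ifs
      · exact map_smul φ _ _
      · simp
    change φ (pdFun v (c • f).1 y) = φ (c • pdFun v f.1 y)
    rw [map_smul, apply_pdFun (c • f).2, apply_pdFun f.2]
    simp only [h]
    rw [fderiv_const_mul ((contDiffAt_extZero f.2 _ y).differentiableAt (by simp))]
    rfl)

theorem apply_pd (v : Fin n → ℝ) (f : smoothSections n r Q) (y : Q)
    (φ : Module.Dual ℝ (Grassmann r)) :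
    φ ((pd v f).1 y) = fderiv ℝ (fun z => φ (extZero f.1 z)) y.1 v := apply_pdFun f.2 v y φ

theorem pd_mul (v : Fin n → ℝ) (f g : smoothSections n r Q) :
    pd v (f * g) = f * pd v g + pd v f * g := by
  let b := Module.finBasis ℝ (Grassmann r)
  have hm : ∀ (φ : Module.Dual ℝ (Grassmann r)) (x y : Grassmann r),
      φ (x * y) = ∑ i, ∑ j, b.coord i x * b.coord j y * φ (b i * b j) := by
    intro φ x y
    conv_lhs => rw [← b.sum_repr x, ← b.sum_repr y, Finset.sum_mul_sum]
    simp only [map_sum, smul_mul_smul_comm, map_smul, smul_eq_mul, Module.Basis.coord_apply]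
  refine Subtype.ext (funext fun y => ext_dual fun φ => ?_)
  have hd : ∀ (f : smoothSections n r Q) i, DifferentiableAt ℝ (fun z => b.coord i (extZero f.1 z)) y.1 :=
    fun f i => (contDiffAt_extZero f.2 _ y).differentiableAt (by simp)
  have h : ∀ z, φ (extZero (f * g).1 z) =
      ∑ i, ∑ j, b.coord i (extZero f.1 z) * b.coord j (extZero g.1 z) * φ (b i * b j) := fun z => by
    rw [← hm]
    unfold extZero; split_ifs
    · rfl
    · simp
  change _ = φ (f.1 y * (pd v g).1 y + (pd v f).1 y * g.1 y)
  rw [apply_pd, map_add, hm, hm, ← Finset.sum_add_distrib]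
  simp only [h]
  have hd2 : ∀ i j, DifferentiableAt ℝ (fun z => b.coord i (extZero f.1 z) *
      b.coord j (extZero g.1 z) * φ (b i * b j)) y.1 :=
    fun i j => ((hd f i).fun_mul (hd g j)).mul_const _
  rw [fderiv_fun_sum fun i _ => DifferentiableAt.fun_sum fun j _ => hd2 i j, sum_apply]
  refine Finset.sum_congr rfl fun i _ => ?_
  rw [fderiv_fun_sum fun j _ => hd2 i j, sum_apply,
    ← Finset.sum_add_distrib]
  refine Finset.sum_congr rfl fun j _ => ?_
  rw [fderiv_mul_const ((hd f i).fun_mul (hd g j)), smul_apply,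
    fderiv_fun_mul (hd f i) (hd g j), apply_pd, apply_pd]
  simp only [add_apply, smul_apply, smul_eq_mul,
    extZero_apply]
  ring

theorem pd_linear {r' : ℕ} (v : Fin n → ℝ) (f : smoothSections n r Q) (L : Grassmann r →ₗ[ℝ] Grassmann r')
    (y : Q) : L ((pd v f).1 y) = (pd v ⟨fun x => L (f.1 x), f.2.linear L⟩ : smoothSections n r' Q).1 y :=
  ext_dual fun φ => by
    rw [apply_pd]
    refine (apply_pd v f y (φ.comp L)).trans ?_
    congr 2
    funext z
    rw [LinearMap.comp_apply]
    unfold extZero; split_ifs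
    · rfl
    · simp

/-- `P` is the kernel of a linear projection, and differentiation commutes with linear maps of the
values. -/
theorem pd_mem (v : Fin n → ℝ) (f : smoothSections n r Q) (P : Submodule ℝ (Grassmann r))
    (hf : ∀ y, f.1 y ∈ P) (y : Q) : (pd v f).1 y ∈ P := by
  obtain ⟨P', hP⟩ := P.exists_isCompl
  have h0 : ∀ x, Submodule.projection P' P hP.symm x = 0 ↔ x ∈ P := fun x => by
    rw [← LinearMap.mem_ker, Submodule.ker_projection]
  rw [← h0, pd_linear]
  have : (⟨fun x => Submodule.projection P' P hP.symm (f.1 x), f.2.linear _⟩ : smoothSections n r Q) = 0 :=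
    Subtype.ext (funext fun x => (h0 _).2 (hf x))
  rw [this, map_zero]; rfl

theorem pd_sres {Q' : Opens (Fin n → ℝ)} (h : Q' ≤ Q) (v : Fin n → ℝ) (f : smoothSections n r Q) :
    pd v (sres h f) = sres h (pd v f) := by
  refine Subtype.ext (funext fun y => ext_dual fun φ => ?_)
  refine (apply_pd v _ y φ).trans (Eq.trans ?_ (apply_pd v f ⟨y.1, h y.2⟩ φ).symm)
  congr 1
  refine Filter.EventuallyEq.fderiv_eq ?_
  filter_upwards [Q'.2.mem_nhds y.2] with z hz
  exact congrArg φ ((extZero_apply (sres h f).1 ⟨z, hz⟩).trans (extZero_apply f.1 ⟨z, h hz⟩).symm)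

theorem pd_eq_zero (v : Fin n → ℝ) (f : smoothSections n r Q)
    (hf : ∀ (y z : Q) (t : ℝ), z.1 = y.1 + t • v → f.1 z = f.1 y) : pd v f = 0 := by
  refine Subtype.ext (funext fun y => ext_dual fun φ => ?_)
  rw [apply_pd]
  have hd := ((contDiffAt_extZero f.2 φ y).differentiableAt (by simp)).hasFDerivAt.hasLineDerivAt v
  have h0 : HasDerivAt (fun t : ℝ => φ (extZero f.1 (y.1 + t • v))) 0 0 := by
    refine (hasDerivAt_const (0 : ℝ) (φ (f.1 y))).congr_of_eventuallyEq ?_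
    have hc : Continuous fun t : ℝ => y.1 + t • v := by fun_prop
    have : ∀ᶠ t in 𝓝 (0 : ℝ), y.1 + t • v ∈ Q := hc.continuousAt.eventually
      (Q.2.mem_nhds (by simp))
    filter_upwards [this] with t ht
    rw [← hf y ⟨_, ht⟩ t rfl, ← extZero_apply f.1 ⟨_, ht⟩]
  exact (HasDerivAt.unique hd h0).trans (map_zero φ).symm

theorem pd_coord (i : Fin n) (v : Fin n → ℝ) :
    pd v (scal r Q (coord_smooth i)) = algebraMap ℝ _ (v i) := by
  refine Subtype.ext (funext fun y => ext_dual fun φ => ?_)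
  rw [apply_pd]
  have he : (fun z => φ (extZero (scal r Q (coord_smooth i)).1 z)) =ᶠ[𝓝 y.1]
      fun z => z i * φ 1 := by
    filter_upwards [Q.2.mem_nhds y.2] with z hz
    rw [extZero_apply (scal r Q (coord_smooth i)).1 ⟨z, hz⟩]
    change φ (algebraMap ℝ _ (z i)) = _
    rw [Algebra.algebraMap_eq_smul_one, map_smul, smul_eq_mul]
  rw [he.fderiv_eq, fderiv_mul_const (differentiableAt_apply i _), smul_apply]
  have : fderiv ℝ (fun z : Fin n → ℝ => z i) y.1 v = v i := by
    rw [(hasFDerivAt_apply i y.1).fderiv]; rfl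
  rw [this]
  change _ = φ (algebraMap ℝ (Grassmann r) (v i))
  rw [Algebra.algebraMap_eq_smul_one, map_smul, smul_eq_mul, smul_eq_mul, mul_comm]

end PartialDerivative

/-! ### Exponentials of nilpotent derivations -/

section Exponential
variable {B B' : Type*} [Ring B] [Algebra ℝ B] [Ring B'] [Algebra ℝ B']

/-- The exponential of a nilpotent linear map. -/
def expLin (D : B →ₗ[ℝ] B) : B →ₗ[ℝ] B :=
  letI : Module ℚ B := Module.compHom B (algebraMap ℚ ℝ)
  IsNilpotent.exp (A := Module.End ℝ B) D

theorem expLin_mul {D : B →ₗ[ℝ] B} (hd : ∀ x y, D (x * y) = x * D y + D x * y)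
    (hn : IsNilpotent (R := Module.End ℝ B) D) (x y : B) :
    expLin D (x * y) = expLin D x * expLin D y :=
  let _ : Module ℚ B := Module.compHom B (algebraMap ℚ ℝ)
  Module.End.exp_mul_of_derivation ℝ B D hd hn x y

theorem expLin_apply {D : B →ₗ[ℝ] B} (hn : IsNilpotent (R := Module.End ℝ B) D) (x : B)
    (h : D (D x) = 0) : expLin D x = x + D x := by
  let _ : Module ℚ B := Module.compHom B (algebraMap ℚ ℝ)
  have h2 : ((D : Module.End ℝ B) ^ 2) • x = 0 := by
    rw [pow_two]; exact h
  have := IsNilpotent.exp_smul_eq_sum (A := Module.End ℝ B) h2 hn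
  refine Eq.trans this ?_
  simp [Finset.sum_range_succ]

theorem expLin_eq_add {D : B →ₗ[ℝ] B} (hn : IsNilpotent (R := Module.End ℝ B) D) {x y : B}
    (h : D x = y) (h' : D y = 0) : expLin D x = x + y := by
  rw [expLin_apply hn x (by rw [h, h']), h]

theorem expLin_comm {D : B →ₗ[ℝ] B} {D' : B' →ₗ[ℝ] B'} (hn : IsNilpotent (R := Module.End ℝ B) D)
    (hn' : IsNilpotent (R := Module.End ℝ B') D') (g : B →ₗ[ℝ] B') (h : ∀ x, D' (g x) = g (D x))
    (x : B) : expLin D' (g x) = g (expLin D x) :=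
  let _ : Module ℚ B := Module.compHom B (algebraMap ℚ ℝ)
  let _ : Module ℚ B' := Module.compHom B' (algebraMap ℚ ℝ)
  LinearMap.congr_fun (Module.End.commute_exp_left_of_commute (R := ℝ) hn hn' (g := g)
    (LinearMap.ext h)) x

theorem expLin_mem {D : B →ₗ[ℝ] B} (P : Submodule ℝ B) (h : ∀ x ∈ P, D x ∈ P) (x : B) (hx : x ∈ P) :
    expLin D x ∈ P := by
  let _ : Module ℚ B := Module.compHom B (algebraMap ℚ ℝ)
  have hk : ∀ k : ℕ, ((D : Module.End ℝ B) ^ k) x ∈ P := fun k => by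
    induction k with
    | zero => exact hx
    | succ k ih => rw [pow_succ']; exact h _ ih
  unfold expLin IsNilpotent.exp
  rw [LinearMap.sum_apply]
  refine sum_mem fun k _ => ?_
  exact P.smul_mem (algebraMap ℚ ℝ (k.factorial : ℚ)⁻¹) (hk k)

/-- The exponential of a nilpotent derivation. -/
def expAlg (D : B →ₗ[ℝ] B) (hd : ∀ x y, D (x * y) = x * D y + D x * y)
    (hn : IsNilpotent (R := Module.End ℝ B) D) : B →ₐ[ℝ] B :=
  AlgHom.ofLinearMap (expLin D) (by
    have h1 : D 1 = 0 := by simpa using hd 1 1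
    rw [expLin_apply hn 1 (by rw [h1, map_zero]), h1, add_zero]) (expLin_mul hd hn)

end Exponential

theorem Grassmann.algHom_mem_part {n r : ℕ} (L : Grassmann n →ₐ[ℝ] Grassmann r)
    (hL : ∀ v, L (ExteriorAlgebra.ι ℝ v) ∈ part r 1) (i : ZMod 2) (a : Grassmann n)
    (ha : a ∈ part n i) : L a ∈ part r i := by
  have h1 : ∀ j : ℕ, (part r 1) ^ j ≤ part r (j : ZMod 2) := fun j => by
    have := CliffordAlgebra.evenOdd_mul_le (0 : QuadraticForm ℝ (Fin r → ℝ))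
    induction j with
    | zero => exact (CliffordAlgebra.one_le_evenOdd_zero _).trans (by simp)
    | succ j ih =>
      rw [pow_succ]
      refine (mul_le_mul' ih le_rfl).trans ((this _ _).trans ?_)
      rw [Nat.cast_succ]
  have h : (part n i).map L.toLinearMap ≤ part r i := by
    rw [part, CliffordAlgebra.evenOdd, Submodule.map_iSup]
    refine iSup_le fun ⟨j, hj⟩ => ?_
    rw [Submodule.map_pow]
    refine le_trans (pow_le_pow_left' ?_ _) ((h1 j).trans (by rw [hj]))
    rintro _ ⟨_, ⟨v, rfl⟩, rfl⟩
    exact hL v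
  exact h ⟨a, ha, rfl⟩

theorem Grassmann.odd_mul_self {r : ℕ} {a : Grassmann r} (ha : a ∈ part r 1) : a * a = 0 := by
  have := odd_anticomm ha ha
  rw [eq_neg_iff_add_eq_zero, ← two_smul ℝ] at this
  exact (smul_eq_zero.1 this).resolve_left two_ne_zero

/-! ### Construction of morphisms to ℝ^{p|q} with given coordinates -/

section Existence
open scoped Manifold ContDiff
variable {m r p q : ℕ}

/-- The first projection of a product of Euclidean spaces. -/
def prL (m p : ℕ) : (Fin (m + p) → ℝ) →L[ℝ] (Fin m → ℝ) :=
  ContinuousLinearMap.pi fun i => ContinuousLinearMap.proj (Fin.castAdd p i)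

/-- The second projection of a product of Euclidean spaces. -/
def prR (m p : ℕ) : (Fin (m + p) → ℝ) →L[ℝ] (Fin p → ℝ) :=
  ContinuousLinearMap.pi fun i => ContinuousLinearMap.proj (Fin.natAdd m i)

/-- The first inclusion into a sum of Euclidean spaces. -/
def inL (m p : ℕ) : (Fin m → ℝ) →ₗ[ℝ] (Fin (m + p) → ℝ) :=
  LinearMap.pi (Fin.addCases (fun j => LinearMap.proj j) (fun _ => 0))

/-- The second inclusion into a sum of Euclidean spaces. -/
def inR (m p : ℕ) : (Fin p → ℝ) →ₗ[ℝ] (Fin (m + p) → ℝ) :=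
  LinearMap.pi (Fin.addCases (fun _ => 0) (fun j => LinearMap.proj j))

theorem append_inL (x : Fin m → ℝ) : inL m p x = Fin.append x 0 := by
  funext i; refine Fin.addCases (fun j => ?_) (fun j => ?_) i <;> simp [inL]

theorem append_inR (x : Fin p → ℝ) : inR m p x = Fin.append 0 x := by
  funext i; refine Fin.addCases (fun j => ?_) (fun j => ?_) i <;> simp [inR]

theorem prR_append (x : Fin m → ℝ) (y : Fin p → ℝ) : prR m p (Fin.append x y) = y := by
  funext i; simp [prR]

theorem prL_append (x : Fin m → ℝ) (y : Fin p → ℝ) : prL m p (Fin.append x y) = x := by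
  funext i; simp [prL]

variable (F : Fin p → smoothSections m r ⊤) (ψ : Fin q → smoothSections m r ⊤)

/-- The map of bases given by even functions. -/
def baseMap (w : Fin m → ℝ) (i : Fin p) : ℝ := Grassmann.body r ((F i).1 ⟨w, trivial⟩)

theorem contDiff_comp_top {φ : Module.Dual ℝ (Grassmann r)} (f : smoothSections m r ⊤) :
    ContDiff ℝ ∞ (fun w : Fin m → ℝ => φ (f.1 ⟨w, trivial⟩)) := by
  rw [← contMDiff_iff_contDiff]
  intro w
  exact (contMDiffAt_subtype_iff (f := fun w => φ (f.1 ⟨w, trivial⟩))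
    (x := (⟨w, trivial⟩ : (⊤ : Opens (Fin m → ℝ))))).1 (f.2 φ _)

theorem baseMap_contDiff : ContDiff ℝ ∞ (baseMap F) :=
  contDiff_pi.2 fun i => contDiff_comp_top (φ := (Grassmann.body r).toLinearMap) (F i)

/-- The part of `ℝ^{m+p}` over an open subset of `ℝ^p`. -/
def cyl (m : ℕ) (V : Opens (Fin p → ℝ)) : Opens (Fin (m + p) → ℝ) :=
  ⟨prR m p ⁻¹' V, V.2.preimage (prR m p).continuous⟩

/-- Pullback of sections along the second projection. -/
def prSec (m r q : ℕ) (V : Opens (Fin p → ℝ)) :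
    stdSections p q V ⟶ stdSections (m + p) (r + q) (cyl m V) :=
  stdSections.pull (fun z => ⟨prR m p z.1, z.2⟩) (contMDiff_restrict (prR m p) V _ fun x => x.2)
    (ExteriorAlgebra.map (inR r q)) (map_mem_part _)

/-- The nilpotent part of the `i`-th function, pulled back along the first projection. -/
def nilPart (q : ℕ) (V : Opens (Fin p → ℝ)) (i : Fin p) :
    smoothSections (m + p) (r + q) (cyl m V) :=
  (stdSections.pull (U := (⊤ : Opens (Fin m → ℝ))) (V := cyl m V)
    (fun z => ⟨prL m p z.1, trivial⟩) (contMDiff_restrict (prL m p) ⊤ _ fun _ => trivial)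
    (ExteriorAlgebra.map (inL r q)) (map_mem_part _)).toAlgHom
    (F i - scal r ⊤ (contDiff_pi.1 (baseMap_contDiff F) i))

theorem nilPart_apply (V : Opens (Fin p → ℝ)) (i : Fin p) (z : cyl m V) :
    (nilPart F q V i).1 z = ExteriorAlgebra.map (inL r q)
      ((F i).1 ⟨prL m p z.1, trivial⟩ - algebraMap ℝ _ (baseMap F (prL m p z.1) i)) := rfl

theorem nilPart_mem_aug (V : Opens (Fin p → ℝ)) (i : Fin p) (z : cyl m V) :
    (nilPart F q V i).1 z ∈ Grassmann.aug (r + q) := by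
  have h : (Grassmann.body (r + q)).comp (ExteriorAlgebra.map (inL r q)) = Grassmann.body r :=
    ExteriorAlgebra.hom_ext (LinearMap.ext fun v => by simp)
  rw [nilPart_apply, Grassmann.mem_aug]
  refine (DFunLike.congr_fun h _).trans ?_
  rw [map_sub, Grassmann.body_algebraMap, sub_eq_zero]; rfl

variable {F} in
theorem nilPart_even (hF : ∀ i x, (F i).1 x ∈ Grassmann.part r 0) (V : Opens (Fin p → ℝ)) (i : Fin p)
    (z : cyl m V) : (nilPart F q V i).1 z ∈ Grassmann.part (r + q) 0 := by
  rw [nilPart_apply]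
  refine map_mem_part _ 0 _ (sub_mem (hF _ _) ?_)
  rw [Algebra.algebraMap_eq_smul_one]
  exact Submodule.smul_mem _ _ (SetLike.GradedOne.one_mem (A := Grassmann.part r))

/-- The derivation `∑ Nᵢ ∂ᵢ`. -/
def taylorD (q : ℕ) (V : Opens (Fin p → ℝ)) :
    smoothSections (m + p) (r + q) (cyl m V) →ₗ[ℝ] smoothSections (m + p) (r + q) (cyl m V) :=
  ∑ i, LinearMap.mulLeft ℝ (nilPart F q V i) ∘ₗ pd (Pi.single (Fin.natAdd m i) 1)

theorem taylorD_apply (V : Opens (Fin p → ℝ)) (s : smoothSections (m + p) (r + q) (cyl m V)) :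
    taylorD F q V s = ∑ i, nilPart F q V i * pd (Pi.single (Fin.natAdd m i) 1) s := by
  simp [taylorD, LinearMap.sum_apply]

theorem sections_sum_apply {n k : ℕ} {Q : Opens (Fin n → ℝ)} {ι : Type*} (t : Finset ι)
    (s : ι → smoothSections n k Q) (z : Q) : (∑ i ∈ t, s i).1 z = ∑ i ∈ t, (s i).1 z := by
  rw [AddSubmonoidClass.coe_finsetSum, Finset.sum_apply]

variable {F} in
-- The increments are even, hence central, and may be moved past `s`. This makes the exponential
-- multiplicative.
theorem taylorD_mul (hF : ∀ i x, (F i).1 x ∈ Grassmann.part r 0) (V : Opens (Fin p → ℝ))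
    (s t : smoothSections (m + p) (r + q) (cyl m V)) :
    taylorD F q V (s * t) = s * taylorD F q V t + taylorD F q V s * t := by
  simp only [taylorD_apply, Finset.mul_sum, Finset.sum_mul, ← Finset.sum_add_distrib]
  refine Finset.sum_congr rfl fun i _ => ?_
  have hc : s * nilPart F q V i = nilPart F q V i * s :=
    Subtype.ext (funext fun z => (Grassmann.even_comm (nilPart_even hF V i z)).symm)
  rw [pd_mul, mul_add, ← mul_assoc, ← mul_assoc, ← mul_assoc, hc]

/-- Each application multiplies by an increment in the augmentation ideal, and differentiation does
not leave the subspace reached before (`pd_mem`). -/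
theorem taylorD_pow (V : Opens (Fin p → ℝ)) (k : ℕ) (s : smoothSections (m + p) (r + q) (cyl m V)) (z) :
    (((taylorD F q V : Module.End ℝ _) ^ k) s).1 z ∈ Grassmann.aug (r + q) ^ k * ⊤ := by
  induction k generalizing z with
  | zero => simp
  | succ k ih =>
    have e : ((taylorD F q V : Module.End ℝ _) ^ (k + 1)) s =
        taylorD F q V (((taylorD F q V : Module.End ℝ _) ^ k) s) := by
      rw [pow_succ']; rfl
    rw [e, taylorD_apply, sections_sum_apply, pow_succ', mul_assoc]
    exact sum_mem fun i _ => Submodule.mul_mem_mul (nilPart_mem_aug F V i z) (pd_mem _ _ _ ih z)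

theorem taylorD_nilpotent (V : Opens (Fin p → ℝ)) :
    IsNilpotent (R := Module.End ℝ (smoothSections (m + p) (r + q) (cyl m V))) (taylorD F q V) := by
  refine ⟨r + q + 1, LinearMap.ext fun s => Subtype.ext (funext fun z => ?_)⟩
  have := taylorD_pow F V (r + q + 1) s z
  rwa [Grassmann.aug_pow, Submodule.bot_mul, Submodule.mem_bot] at this

variable {F} in
theorem taylorD_mem (hF : ∀ i x, (F i).1 x ∈ Grassmann.part r 0) (V : Opens (Fin p → ℝ)) (k : ZMod 2)
    (s : smoothSections (m + p) (r + q) (cyl m V)) (hs : ∀ z, s.1 z ∈ Grassmann.part (r + q) k) (z) :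
    (taylorD F q V s).1 z ∈ Grassmann.part (r + q) k := by
  rw [taylorD_apply, sections_sum_apply]
  refine sum_mem fun i _ => ?_
  have := SetLike.mul_mem_graded (nilPart_even hF V i z)
    (pd_mem (Pi.single (Fin.natAdd m i) 1) s _ hs z)
  rwa [zero_add] at this

variable (hF : ∀ i x, (F i).1 x ∈ Grassmann.part r 0) (hψ : ∀ j x, (ψ j).1 x ∈ Grassmann.part r 1)

/-- The Taylor expansion with nilpotent increments. -/
def taylor (hF : ∀ i x, (F i).1 x ∈ Grassmann.part r 0) (V : Opens (Fin p → ℝ)) :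
    stdSections (m + p) (r + q) (cyl m V) ⟶ stdSections (m + p) (r + q) (cyl m V) where
  toAlgHom := expAlg (taylorD F q V) (taylorD_mul hF V) (taylorD_nilpotent F V)
  map_mem k s hs := expLin_mem ((stdSections (m + p) (r + q) (cyl m V)).part k)
    (fun s hs z => taylorD_mem hF V k s hs z) s hs

/-- Substitution of odd functions for the last odd coordinates. -/
def oddSubst (w : Fin m → ℝ) : Grassmann (r + q) →ₐ[ℝ] Grassmann r :=
  ExteriorAlgebra.lift ℝ ⟨ExteriorAlgebra.ι ℝ ∘ₗ (prL r q).toLinearMap +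
    ∑ j, (LinearMap.proj (Fin.natAdd r j)).smulRight ((ψ j).1 ⟨w, trivial⟩), fun v =>
      Grassmann.odd_mul_self (by
        rw [LinearMap.add_apply, LinearMap.sum_apply]
        exact add_mem (Grassmann.ι_mem_part _)
          (sum_mem fun j _ => Submodule.smul_mem _ _ (hψ j _)))⟩

theorem oddSubst_ι (w : Fin m → ℝ) (v : Fin (r + q) → ℝ) :
    oddSubst ψ hψ w (ExteriorAlgebra.ι ℝ v) = ExteriorAlgebra.ι ℝ (prL r q v) +
      ∑ j, v (Fin.natAdd r j) • (ψ j).1 ⟨w, trivial⟩ := by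
  rw [oddSubst, ExteriorAlgebra.lift_ι_apply, LinearMap.add_apply, LinearMap.sum_apply]; rfl

theorem oddSubst_mem (w : Fin m → ℝ) (i : ZMod 2) (a : Grassmann (r + q))
    (ha : a ∈ Grassmann.part (r + q) i) : oddSubst ψ hψ w a ∈ Grassmann.part r i := by
  refine Grassmann.algHom_mem_part _ (fun v => ?_) i a ha
  rw [oddSubst_ι]
  exact add_mem (Grassmann.ι_mem_part _) (sum_mem fun j _ => Submodule.smul_mem _ _ (hψ j _))

theorem oddSubst_smooth (W : Opens (Fin m → ℝ)) (a : Grassmann (r + q)) :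
    IsSmooth (fun w : W => oddSubst ψ hψ w.1 a) := by
  induction a using ExteriorAlgebra.induction with
  | algebraMap c => simpa using IsSmooth.const (algebraMap ℝ (Grassmann r) c)
  | ι v =>
    simp only [oddSubst_ι]
    refine (IsSmooth.const _).add (f := fun _ => ExteriorAlgebra.ι ℝ (prL r q v))
      (g := fun w : W => ∑ j, v (Fin.natAdd r j) • (ψ j).1 ⟨w.1, trivial⟩) ?_
    have := (∑ j, v (Fin.natAdd r j) • sres (le_top (a := W)) (ψ j)).2
    have e : (∑ j, v (Fin.natAdd r j) • sres (le_top (a := W)) (ψ j)).1 =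
        fun w : W => ∑ j, v (Fin.natAdd r j) • (ψ j).1 ⟨w.1, trivial⟩ :=
      funext fun w => sections_sum_apply _ _ _
    rw [← e]; exact this
  | mul a b ha hb => simp only [map_mul]; exact ha.mul hb
  | add a b ha hb => simp only [map_add]; exact ha.add hb

theorem baseMap_graph_smooth (V : Opens (Fin p → ℝ)) (W : Opens (Fin m → ℝ))
    (h : ∀ w ∈ W, baseMap F w ∈ V) : ContMDiff 𝓘(ℝ, Fin m → ℝ) 𝓘(ℝ, Fin (m + p) → ℝ) ∞
      (fun w : W => (⟨Fin.append w.1 (baseMap F w.1), by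
        change prR m p _ ∈ V
        rw [prR_append]; exact h _ w.2⟩ : cyl m V)) := by
  refine (ContMDiff.subtypeVal_comp_iff _ _).1 ?_
  have : ContDiff ℝ ∞ fun w : Fin m → ℝ => Fin.append w (baseMap F w) := by
    refine contDiff_pi.2 (Fin.addCases (fun i => ?_) (fun i => ?_))
    · simpa using coord_smooth i
    · simpa using contDiff_pi.1 (baseMap_contDiff F) i
  exact this.contMDiff.comp contMDiff_subtype_val

theorem isSmooth_oddSubst (W : Opens (Fin m → ℝ)) {f : W → Grassmann (r + q)} (hf : IsSmooth f) :
    IsSmooth (fun w : W => oddSubst ψ hψ w.1 (f w)) := by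
  let b := Module.finBasis ℝ (Grassmann (r + q))
  have e : (fun w : W => oddSubst ψ hψ w.1 (f w)) = (∑ i,
      (⟨fun w => algebraMap ℝ (Grassmann r) (b.coord i (f w)), hf.linear
        ((Algebra.linearMap ℝ (Grassmann r)).comp (b.coord i))⟩ : smoothSections m r W) *
      ⟨_, oddSubst_smooth ψ hψ W (b i)⟩).1 := by
    funext w
    rw [sections_sum_apply]
    conv_lhs => rw [← b.sum_repr (f w), map_sum]
    refine Finset.sum_congr rfl fun i _ => ?_
    rw [map_smul, Algebra.smul_def]; rfl
  rw [e]
  exact Subtype.prop _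

/-- Evaluation along the graph of the base map, with substitution of the odd functions. -/
def graphEval (V : Opens (Fin p → ℝ)) (W : Opens (Fin m → ℝ)) (h : ∀ w ∈ W, baseMap F w ∈ V) :
    stdSections (m + p) (r + q) (cyl m V) ⟶ stdSections m r W where
  toAlgHom :=
    { toFun := fun f => ⟨fun w => oddSubst ψ hψ w.1 (f.1 ⟨Fin.append w.1 (baseMap F w.1), by
        change prR m p _ ∈ V
        rw [prR_append]; exact h _ w.2⟩),
        isSmooth_oddSubst ψ hψ W (f.2.comp _ (baseMap_graph_smooth F V W h))⟩
      map_one' := Subtype.ext (funext fun w => map_one (oddSubst ψ hψ w.1))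
      map_mul' := fun _ _ => Subtype.ext (funext fun w => map_mul (oddSubst ψ hψ w.1) _ _)
      map_zero' := Subtype.ext (funext fun w => map_zero (oddSubst ψ hψ w.1))
      map_add' := fun _ _ => Subtype.ext (funext fun w => map_add (oddSubst ψ hψ w.1) _ _)
      commutes' := fun c => Subtype.ext (funext fun w => (oddSubst ψ hψ w.1).commutes c) }
  map_mem i f hf w := oddSubst_mem ψ hψ w.1 i _ (hf _)

/-- Substitution of even and odd functions into sections. -/
def subst (V : Opens (Fin p → ℝ)) (W : Opens (Fin m → ℝ)) (h : ∀ w ∈ W, baseMap F w ∈ V) :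
    stdSections p q V ⟶ stdSections m r W :=
  -- A section f(y,η) is first regarded as a function on ℝ^{m+p|r+q}; the exponential of Σ N_i ∂_i
  -- turns it into f(y + N, η), with N the nilpotent part of `F`; finally y becomes the body of `F`
  -- and η becomes `ψ`.
  (prSec m r q V ≫ taylor (q := q) F hF V : _ ⟶ _) ≫ graphEval F ψ hψ V W h

theorem taylorD_sres {V V' : Opens (Fin p → ℝ)} (hQ : cyl m V' ≤ cyl m V) (x) :
    taylorD F q V' (sres hQ x) = sres hQ (taylorD F q V x) := by
  rw [taylorD_apply, taylorD_apply, map_sum]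
  refine Finset.sum_congr rfl fun i _ => ?_
  rw [map_mul, pd_sres]; rfl

theorem taylor_sres {V V' : Opens (Fin p → ℝ)} (hQ : cyl m V' ≤ cyl m V)
    (x : smoothSections (m + p) (r + q) (cyl m V)) :
    expLin (taylorD F q V') (sres hQ x) = sres hQ (expLin (taylorD F q V) x) := by
  have h1 := taylorD_nilpotent (q := q) F V
  have h2 := taylorD_nilpotent (q := q) F V'
  have h3 := taylorD_sres (q := q) F hQ
  generalize taylorD F q V' = D' at *
  generalize taylorD F q V = D at *
  exact expLin_comm h1 h2 (sres hQ).toLinearMap h3 x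

theorem subst_res {V V' : Opens (Fin p → ℝ)} {W W' : Opens (Fin m → ℝ)} (hV : V' ≤ V) (hW : W' ≤ W)
    (h : ∀ w ∈ W, baseMap F w ∈ V) (h' : ∀ w ∈ W', baseMap F w ∈ V') :
    (stdPresheaf p q).map (homOfLE hV).op ≫ subst F ψ hF hψ V' W' h' =
      subst F ψ hF hψ V W h ≫ (stdPresheaf m r).map (homOfLE hW).op := by
  refine SuperAlg.hom_ext fun s => ?_
  have hQ : cyl m V' ≤ cyl m V := fun z hz => hV hz
  have := taylor_sres F hQ ((prSec m r q V).toAlgHom s)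
  exact congrArg (graphEval F ψ hψ V' W' h').toAlgHom this

/-- The morphism `ℝ^{m|r} ⟶ ℝ^{p|q}` with given coordinates. -/
def mkStd : std m r ⟶ std p q :=
  ObjectProperty.homMk (InducedCategory.homMk
    { base := TopCat.ofHom ⟨baseMap F, (baseMap_contDiff F).continuous⟩
      c :=
        { app := fun V => subst F ψ hF hψ V.unop ((Opens.map (TopCat.ofHom
              ⟨baseMap F, (baseMap_contDiff F).continuous⟩)).obj V.unop) fun _ h => h
          naturality := fun _ _ i => subst_res F ψ hF hψ i.unop.le
            (fun _ hx => i.unop.le hx) _ _ } })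

end Existence

section Existence
open scoped Manifold ContDiff
variable {m r p q : ℕ}

/-- Multiplication by one bump function extends every section. The neighbourhood does not depend on
the section, so all coordinates of a morphism can be extended at once, each with its parity. -/
theorem exists_section_extension (W : Opens (Fin m → ℝ)) (u : Fin m → ℝ) (hu : u ∈ W) (r : ℕ) :
    ∃ (W' : Opens (Fin m → ℝ)) (hW : W' ≤ W), u ∈ W' ∧ ∀ f : smoothSections m r W,
      ∃ g : smoothSections m r ⊤, sres le_top g = sres hW f ∧
        ∀ k, (∀ y, f.1 y ∈ Grassmann.part r k) → ∀ y, g.1 y ∈ Grassmann.part r k := by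
  obtain ⟨ε, hε, hball⟩ := Metric.isOpen_iff.1 W.2 u hu
  let χ : ContDiffBump u := ⟨ε / 4, ε / 2, by positivity, by linarith⟩
  have hsub : Metric.closedBall u (ε / 2) ⊆ W :=
    (Metric.closedBall_subset_ball (by linarith)).trans hball
  have hin : Metric.ball u (ε / 4) ⊆ W := (Metric.ball_subset_ball (by linarith)).trans hball
  have h0 : ∀ z ∉ Metric.closedBall u (ε / 2), χ z = 0 := fun z hz => χ.zero_of_le_dist (by
    rw [Metric.mem_closedBall, not_le] at hz; exact hz.le)
  refine ⟨⟨Metric.ball u (ε / 4), Metric.isOpen_ball⟩, hin, Metric.mem_ball_self (by positivity),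
    fun f => ⟨⟨fun z => χ z.1 • extZero f.1 z.1, fun φ => ?_⟩, ?_, fun k hf y => ?_⟩⟩
  · have : ContDiff ℝ ∞ fun z => φ (χ z • extZero f.1 z) := contDiff_iff_contDiffAt.2 fun y => by
      simp only [map_smul, smul_eq_mul]
      by_cases hy : y ∈ Metric.closedBall u (ε / 2)
      · exact χ.contDiffAt.mul (contDiffAt_extZero f.2 φ ⟨y, hsub hy⟩)
      · refine (contDiffAt_const (c := (0 : ℝ))).congr_of_eventuallyEq ?_
        filter_upwards [Metric.isClosed_closedBall.isOpen_compl.mem_nhds hy] with z hz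
        rw [h0 z hz, zero_mul]
    exact this.contMDiff.comp contMDiff_subtype_val
  · refine Subtype.ext (funext fun y => ?_)
    change χ y.1 • extZero f.1 y.1 = f.1 ⟨y.1, hin y.2⟩
    rw [χ.one_of_mem_closedBall (Metric.ball_subset_closedBall y.2), one_smul]
    exact extZero_apply f.1 ⟨y.1, hin y.2⟩
  · refine Submodule.smul_mem _ _ ?_
    unfold extZero; split_ifs
    · exact hf _
    · exact zero_mem _

variable (F : Fin p → smoothSections m r ⊤) (ψ : Fin q → smoothSections m r ⊤)
  (hF : ∀ i x, (F i).1 x ∈ Grassmann.part r 0) (hψ : ∀ j x, (ψ j).1 x ∈ Grassmann.part r 1)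

theorem subst_eq (V : Opens (Fin p → ℝ)) (W : Opens (Fin m → ℝ)) (h : ∀ w ∈ W, baseMap F w ∈ V)
    (s : smoothSections p q V) (t : smoothSections (m + p) (r + q) (cyl m V))
    (ht : expLin (taylorD F q V) ((prSec m r q V).toAlgHom s) = t) :
    (subst F ψ hF hψ V W h).toAlgHom s = (graphEval F ψ hψ V W h).toAlgHom t := by
  rw [← ht]; rfl

theorem oddSubst_inL (w : Fin m → ℝ) (x : Grassmann r) :
    oddSubst ψ hψ w (ExteriorAlgebra.map (inL r q) x) = x := by
  have : (oddSubst ψ hψ w).comp (ExteriorAlgebra.map (inL r q)) = AlgHom.id ℝ _ := by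
    refine ExteriorAlgebra.hom_ext (LinearMap.ext fun v => ?_)
    change oddSubst ψ hψ w (ExteriorAlgebra.map (inL r q) (ExteriorAlgebra.ι ℝ v)) = _
    rw [ExteriorAlgebra.map_apply_ι, oddSubst_ι, append_inL, prL_append]
    simp
  exact DFunLike.congr_fun this x

/-- Constant sections are annihilated by the derivation, so the Taylor expansion fixes the odd
coordinate and only the substitution of `ψ` acts. -/
theorem subst_coordT (W : Opens (Fin m → ℝ)) (h : ∀ w ∈ W, baseMap F w ∈ (⊤ : Opens (Fin p → ℝ)))
    (j : Fin q) : (subst F ψ hF hψ ⊤ W h).toAlgHom (SMfd.coordT p q j) = sres le_top (ψ j) := by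
  have hs : (prSec m r q ⊤).toAlgHom (SMfd.coordT p q j) =
      cst (cyl m ⊤) (ExteriorAlgebra.ι ℝ (inR r q (Pi.single j 1))) := by
    refine Subtype.ext (funext fun z => ?_)
    exact ExteriorAlgebra.map_apply_ι _ _
  have hD : taylorD F q ⊤ (cst (cyl m ⊤) (ExteriorAlgebra.ι ℝ (inR r q (Pi.single j 1)))) = 0 := by
    rw [taylorD_apply]
    refine Finset.sum_eq_zero fun i _ => ?_
    rw [pd_eq_zero _ _ fun _ _ _ _ => rfl, mul_zero]
  refine (subst_eq F ψ hF hψ ⊤ W h _ (cst (cyl m ⊤) (ExteriorAlgebra.ι ℝ (inR r q (Pi.single j 1))))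
    ?_).trans ?_
  · refine (congrArg (expLin (taylorD F q ⊤)) hs).trans ?_
    exact (expLin_eq_add (taylorD_nilpotent (q := q) F ⊤) hD (map_zero _)).trans (add_zero _)
  refine Subtype.ext (funext fun w => ?_)
  change oddSubst ψ hψ w.1 (ExteriorAlgebra.ι ℝ (inR r q (Pi.single j 1))) = (ψ j).1 ⟨w.1, trivial⟩
  rw [oddSubst_ι, append_inR, prL_append]
  simp [Pi.single_apply]

/-- The derivation sends y_i to N_i, and N_i to zero as it does not depend on y. The expansion is
therefore y_i + N_i, which on the graph is body plus nilpotent part of `F i`. -/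
theorem subst_coordX (W : Opens (Fin m → ℝ)) (h : ∀ w ∈ W, baseMap F w ∈ (⊤ : Opens (Fin p → ℝ)))
    (i : Fin p) : (subst F ψ hF hψ ⊤ W h).toAlgHom (SMfd.coordX p q i) = sres le_top (F i) := by
  have hs : (prSec m r q ⊤).toAlgHom (SMfd.coordX p q i) =
      scal (r + q) (cyl m ⊤) (coord_smooth (Fin.natAdd m i)) := by
    refine Subtype.ext (funext fun z => ?_)
    exact (ExteriorAlgebra.map (inR r q)).commutes _
  have hD : taylorD F q ⊤ (scal (r + q) (cyl m ⊤) (coord_smooth (Fin.natAdd m i))) =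
      nilPart F q ⊤ i := by
    rw [taylorD_apply, Finset.sum_eq_single i]
    · rw [pd_coord, Pi.single_eq_same, map_one, mul_one]
    · intro j _ hj
      rw [pd_coord, Pi.single_eq_of_ne, map_zero, mul_zero]
      exact fun h => hj ((Fin.natAdd_injective p m h).symm)
    · simp
  have hD2 : taylorD F q ⊤ (nilPart F q ⊤ i) = 0 := by
    rw [taylorD_apply]
    refine Finset.sum_eq_zero fun k _ => ?_
    rw [pd_eq_zero _ _ fun y z t hz => ?_, mul_zero]
    have : prL m p z.1 = prL m p y.1 := by
      rw [hz, map_add, map_smul]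
      have : prL m p (Pi.single (Fin.natAdd m k) 1) = 0 := by
        funext l
        change (Pi.single (Fin.natAdd m k) (1 : ℝ) : Fin (m + p) → ℝ) (Fin.castAdd p l) = 0
        refine Pi.single_eq_of_ne (fun h => ?_) _
        have := congrArg Fin.val h
        simp at this
        omega
      rw [this, smul_zero, add_zero]
    rw [nilPart_apply, nilPart_apply]
    simp only [this]
  refine (subst_eq F ψ hF hψ ⊤ W h _ (scal (r + q) (cyl m ⊤) (coord_smooth (Fin.natAdd m i)) +
    nilPart F q ⊤ i) ?_).trans ?_
  · refine (congrArg (expLin (taylorD F q ⊤)) hs).trans ?_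
    exact expLin_eq_add (taylorD_nilpotent (q := q) F ⊤) hD hD2
  refine Subtype.ext (funext fun w => ?_)
  refine (map_add (oddSubst ψ hψ w.1) _ _).trans ?_
  rw [nilPart_apply, oddSubst_inL]
  change oddSubst ψ hψ w.1 (algebraMap ℝ _ (prR m p (Fin.append w.1 (baseMap F w.1)) i)) + _ = _
  rw [AlgHom.commutes, prR_append, prL_append]
  exact add_sub_cancel _ _

end Existence

namespace SMfd
variable {m r p q : ℕ}

theorem exists_Γ_extension (O : Opens (std m r).obj) (v : (restr (std m r) O).obj) :
    ∃ (W : Opens (std m r).obj) (hW : W ≤ O.isOpenEmbedding.functor.obj ⊤), v.1 ∈ W ∧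
      ∀ f : (std m r).obj.presheaf.obj (op (O.isOpenEmbedding.functor.obj ⊤)), ∃ g : Γ (std m r),
        res (std m r).obj (le_top (a := W)) g = res (std m r).obj hW f ∧
        ∀ k, f ∈ SuperAlg.part _ k → g ∈ (Γ (std m r)).part k :=
  exists_section_extension (O.isOpenEmbedding.functor.obj ⊤) v.1 ⟨v, trivial, rfl⟩ r

/-- In a chart the functions are extended to all of ℝ^{m|r} after shrinking; `mkStd` applied to the
extensions and restricted again has the required coordinates. -/
theorem exists_hom_std_local (S : SMfd) (F : Fin p → Γ S) (ψ : Fin q → Γ S)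
    (hF : ∀ i, F i ∈ (Γ S).part 0) (hψ : ∀ j, ψ j ∈ (Γ S).part 1) (x : S.obj) :
    ∃ (E : SMfd) (e : E ⟶ S) (f : E ⟶ std p q), IsOpenImm e ∧ x ∈ Set.range (bmap e) ∧
      (∀ i, pb f (coordX p q i) = pb e (F i)) ∧ ∀ j, pb f (coordT p q j) = pb e (ψ j) := by
  obtain ⟨m, r, O, c, hc, ⟨v, rfl⟩⟩ := exists_chart S x
  obtain ⟨W', hW, hv, hext⟩ := exists_Γ_extension O v
  choose G hG hGk using hext
  let F' : Fin p → smoothSections m r ⊤ := fun i => G (pb c (F i))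
  let ψ' : Fin q → smoothSections m r ⊤ := fun j => G (pb c (ψ j))
  have hF' : ∀ i x, (F' i).1 x ∈ Grassmann.part r 0 :=
    fun i => hGk _ 0 ((pb c).map_mem 0 _ (hF i))
  have hψ' : ∀ i x, (ψ' i).1 x ∈ Grassmann.part r 1 :=
    fun j => hGk _ 1 ((pb c).map_mem 1 _ (hψ j))
  let k := restrι (std m r) W'
  have hk : ∀ y, bmap k y ∈ Set.range (bmap (restrι (std m r) O)) := fun y => by
    rw [range_restrι]
    obtain ⟨z, -, hz⟩ := hW (bmap_restrι_mem _ _ y)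
    exact hz ▸ z.2
  let l := lift (restrι (std m r) O) k hk
  have hl : l ≫ restrι (std m r) O = k := lift_fac _ _ _
  have hkl : ∀ s : Γ (restr (std m r) O), pb k (G s) = pb l s := by
    intro s
    have h1 : (⊤ : Opens (restr (std m r) O).obj) ≤
        (Opens.map (restrι (std m r) O).hom.hom.base).obj (O.isOpenEmbedding.functor.obj ⊤) :=
      fun y _ => ⟨y, trivial, rfl⟩
    have h2 : s = pull (restrι (std m r) O).hom h1 s := rfl
    have h3 : (⊤ : Opens (restr (std m r) W').obj) ≤ (Opens.map k.hom.hom.base).obj W' :=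
      fun y _ => bmap_restrι_mem _ _ y
    have h4 : k.hom = l.hom ≫ (restrι (std m r) O).hom := congrArg (fun a => a.hom) hl.symm
    have h9 := pull_congr h4 (h3.trans (preimage_mono k.hom hW))
      (le_preimage_comp l.hom (restrι (std m r) O).hom h1 (top_le_preimage l))
    have h5 := pull_pull l.hom (restrι (std m r) O).hom h1 (top_le_preimage l)
    have h6 := res_pull k.hom hW h3
    have h7 := res_pull k.hom (le_top (a := W')) h3
    have h8 : res (std m r).obj (le_top (a := W')) (G s) =
      res (std m r).obj hW s := hG s
    calc pb k (G s)
        = pull k.hom h3 (res (std m r).obj (le_top (a := W')) (G s)) :=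
          (congrArg (fun φ => φ (G s)) h7).symm
      _ = pull k.hom h3 (res (std m r).obj hW s) := by rw [h8]
      _ = pull k.hom _ s := congrArg (fun φ => φ s) h6
      _ = pull (l.hom ≫ (restrι (std m r) O).hom) _ s :=
          congrArg (fun φ => φ s) h9
      _ = pull l.hom (top_le_preimage l) (pull (restrι (std m r) O).hom h1 s) :=
          (congrArg (fun φ => φ s) h5).symm
      _ = pb l s := rfl
  have hkimm : IsOpenImm (l ≫ restrι (std m r) O) := by
    rw [hl]; exact inferInstance
  have : IsOpenImm l := ⟨have : SheafedSpace.IsOpenImmersion (l.hom ≫ (restrι (std m r) O).hom) := hkimm.out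
    isOpenImmersion_of_comp l.hom (restrι (std m r) O).hom⟩
  refine ⟨_, l ≫ c, k ≫ mkStd F' ψ' hF' hψ', inferInstance, ⟨⟨v.1, hv⟩, ?_⟩, fun i => ?_, fun j => ?_⟩
  · refine congrArg (bmap c) ((IsOpenImm.isOpenEmbedding (restrι (std m r) O)).injective ?_)
    exact (bmap_lift _ _ _ _).trans rfl
  · rw [pb_comp, pb_comp, ← hkl]
    exact congrArg (pb k) (subst_coordX F' ψ' hF' hψ' ⊤ (fun _ _ => trivial) i)
  · rw [pb_comp, pb_comp, ← hkl]
    exact congrArg (pb k) (subst_coordT F' ψ' hF' hψ' ⊤ (fun _ _ => trivial) j)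

theorem Γ_ext {S : SMfd} {ι : Type} {E : ι → SMfd} (e : ∀ i, E i ⟶ S) [∀ i, IsOpenImm (e i)]
    (hcov : ∀ x, ∃ i, x ∈ Set.range (bmap (e i))) {s t : Γ S} (h : ∀ i, pb (e i) s = pb (e i) t) :
    s = t := by
  refine section_ext (W := ⊤) (Wi := fun i => opensRange (e i)) (fun i => le_top) (fun x _ => hcov x)
    fun i => ?_
  have h1 : (⊤ : Opens (E i).obj) ≤ (Opens.map (e i).hom.hom.base).obj (opensRange (e i)) :=
    fun y _ => ⟨y, rfl⟩
  have := isIso_pull (e i).hom h1 Set.image_univ.symm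
  have h2 := res_pull (e i).hom (le_top (a := opensRange (e i))) h1
  have h3 : ∀ s : Γ S, pull (e i).hom h1 (res S.obj le_top s) = pb (e i) s :=
    fun s => congrArg (fun φ => φ s) h2
  have hinj : Function.Injective (pull (e i).hom h1) :=
    Function.LeftInverse.injective (g := inv (pull (e i).hom h1)) fun x =>
      congrArg (fun φ => φ x) (IsIso.hom_inv_id (pull (e i).hom h1))
  exact hinj ((h3 s).trans ((h i).trans (h3 t).symm))

/-- Local solutions agree on overlaps because morphisms to ℝ^{p|q} are determined by their
coordinates, and hence they glue. -/
theorem exists_hom_std {S : SMfd} (F : Fin p → Γ S) (ψ : Fin q → Γ S)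
    (hF : ∀ i, F i ∈ (Γ S).part 0) (hψ : ∀ j, ψ j ∈ (Γ S).part 1) :
    ∃ f : S ⟶ std p q, (∀ i, pb f (coordX p q i) = F i) ∧ ∀ j, pb f (coordT p q j) = ψ j := by
  choose E e f he hx h1 h2 using exists_hom_std_local S F ψ hF hψ
  have hcov : ∀ x, ∃ i : ULift.{0} S.obj, x ∈ Set.range (bmap (e i.down)) := fun x => ⟨⟨x⟩, hx x⟩
  obtain ⟨g, hg⟩ := exists_glue (ι := ULift.{0} S.obj) (fun x => e x.down) hcov
    (fun x => f x.down) (fun i j R a b hab => std_hom_ext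
      (fun k => by rw [pb_comp, pb_comp, h1, h1, ← pb_comp, ← pb_comp, hab])
      (fun k => by rw [pb_comp, pb_comp, h2, h2, ← pb_comp, ← pb_comp, hab]))
  exact ⟨g, fun i => Γ_ext (fun x : ULift.{0} S.obj => e x.down) hcov fun x => by
      rw [← pb_comp, ← h1, ← hg x],
    fun i => Γ_ext (fun x : ULift.{0} S.obj => e x.down) hcov fun x => by
      rw [← pb_comp, ← h2, ← hg x]⟩

end SMfd

/-! ### Gluing a representing supermanifold from a local atlas -/

namespace SMfd
universe w

/-- A presheaf on supermanifolds whose elements have continuous underlying maps to a space `B`, such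
that the subpresheaves of elements with values in certain open sets `W i` covering `B` are
represented by supermanifolds. -/
structure LocalAtlas (J : SMfdᵒᵖ ⥤ Type w) (B : Type) [TopologicalSpace B] where
  β : ∀ {T : SMfd}, J.obj (op T) → T.obj → B
  continuous_β : ∀ {T : SMfd} (j : J.obj (op T)), Continuous (β j)
  β_map : ∀ {S T : SMfd} (u : S ⟶ T) (j : J.obj (op T)) (x : S.obj), β (J.map u.op j) x = β j (bmap u x)
  ι : Type
  W : ι → Opens B
  cover : ∀ b, ∃ i, b ∈ W i
  N : ι → SMfd
  n : ∀ i, J.obj (op (N i))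
  n_mem : ∀ i x, β (n i) x ∈ W i
  exists_hom : ∀ {T : SMfd} (i : ι) (j : J.obj (op T)), (∀ x, β j x ∈ W i) →
    ∃ u : T ⟶ N i, J.map u.op (n i) = j
  hom_ext : ∀ {T : SMfd} (i : ι) (u u' : T ⟶ N i), J.map u.op (n i) = J.map u'.op (n i) → u = u'

namespace LocalAtlas
variable {J : SMfdᵒᵖ ⥤ Type w} {B : Type} [TopologicalSpace B] (A : LocalAtlas J B)

theorem map_map {S T R : SMfd} (u : S ⟶ T) (v : T ⟶ R) (j : J.obj (op R)) :
    J.map u.op (J.map v.op j) = J.map (u ≫ v).op j := by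
  rw [op_comp, Functor.map_comp]; rfl

/-- The part of the `i`-th chart lying over `W j`. -/
def ov (i j : A.ι) : Opens (A.N i).obj :=
  ⟨A.β (A.n i) ⁻¹' A.W j, (A.W j).2.preimage (A.continuous_β _)⟩

/-- The overlaps. -/
def V (i j : A.ι) : SMfd := restr (A.N i) (A.ov i j)

/-- The inclusions of the overlaps. -/
def f (i j : A.ι) : A.V i j ⟶ A.N i := restrι _ _

instance (i j : A.ι) : IsOpenImm (A.f i j) := inferInstanceAs (IsOpenImm (restrι _ _))

theorem f_mem (i j : A.ι) (x) : A.β (A.n i) (bmap (A.f i j) x) ∈ A.W j := x.2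

/-- Over `W j` the universal element of the `i`-th chart is classified by a morphism to the `j`-th
chart; it lands in the overlap since the map to `B` is preserved. -/
theorem exists_t (i j : A.ι) : ∃ t : A.V i j ⟶ A.V j i,
    J.map (t ≫ A.f j i).op (A.n j) = J.map (A.f i j).op (A.n i) := by
  obtain ⟨u, hu⟩ := A.exists_hom j (J.map (A.f i j).op (A.n i)) fun x => by
    rw [A.β_map]; exact x.2
  refine ⟨lift (A.f j i) u fun y => ?_, by rw [lift_fac, hu]⟩
  have h1 : A.β (A.n j) (bmap u y) ∈ A.W i := by
    rw [← A.β_map, hu, A.β_map]; exact A.n_mem i _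
  exact ⟨⟨bmap u y, h1⟩, rfl⟩

/-- The transition maps. -/
def t (i j : A.ι) : A.V i j ⟶ A.V j i := (A.exists_t i j).choose

theorem t_spec (i j : A.ι) : J.map (A.t i j ≫ A.f j i).op (A.n j) = J.map (A.f i j).op (A.n i) :=
  (A.exists_t i j).choose_spec

/-- Morphisms to a chart lift to an overlap if their values lie in the other chart. -/
theorem exists_lift {T : SMfd} (i j : A.ι) (u : T ⟶ A.N i)
    (h : ∀ x, A.β (A.n i) (bmap u x) ∈ A.W j) : ∃ v : T ⟶ A.V i j, v ≫ A.f i j = u :=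
  ⟨lift (A.f i j) u fun y => ⟨⟨bmap u y, h y⟩, rfl⟩, lift_fac _ _ _⟩

instance (i j : A.ι) : SheafedSpace.IsOpenImmersion (A.f i j).hom := IsOpenImm.out

/-- The triple overlaps. -/
def P (i j k : A.ι) : SMfd := ⟨pullback (A.f i j).hom (A.f i k).hom,
  isSupermanifold_of_isOpenImmersion (pullback.fst (A.f i j).hom (A.f i k).hom) (A.V i j).property⟩

/-- The first projection of a triple overlap. -/
def Pfst (i j k : A.ι) : A.P i j k ⟶ A.V i j := ObjectProperty.homMk (pullback.fst _ _)

/-- The second projection of a triple overlap. -/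
def Psnd (i j k : A.ι) : A.P i j k ⟶ A.V i k := ObjectProperty.homMk (pullback.snd _ _)

theorem P_condition (i j k : A.ι) : A.Pfst i j k ≫ A.f i j = A.Psnd i j k ≫ A.f i k :=
  ObjectProperty.hom_ext _ pullback.condition

theorem exists_t' (i j k : A.ι) : ∃ t' : A.P i j k ⟶ A.P j k i,
    t' ≫ A.Psnd j k i = A.Pfst i j k ≫ A.t i j := by
  let u := A.Pfst i j k ≫ A.t i j ≫ A.f j i
  have hu : J.map u.op (A.n j) = J.map (A.Pfst i j k ≫ A.f i j).op (A.n i) := by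
    rw [← map_map, A.t_spec, map_map]
  obtain ⟨v, hv⟩ := A.exists_lift j k u fun x => by
    rw [← A.β_map, hu, P_condition, A.β_map]; exact A.f_mem i k _
  refine ⟨ObjectProperty.homMk (pullback.lift v.hom (A.Pfst i j k ≫ A.t i j).hom ?_), ?_⟩
  · exact congrArg (fun k => k.hom) (hv.trans (Category.assoc _ _ _).symm)
  · exact ObjectProperty.hom_ext _ (pullback.lift_snd _ _ _)

/-- The transition maps of triple overlaps. -/
def t' (i j k : A.ι) : A.P i j k ⟶ A.P j k i := (A.exists_t' i j k).choose

theorem t'_snd (i j k : A.ι) : A.t' i j k ≫ A.Psnd j k i = A.Pfst i j k ≫ A.t i j :=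
  (A.exists_t' i j k).choose_spec

theorem t'_spec (i j k : A.ι) : J.map (A.t' i j k ≫ A.Pfst j k i ≫ A.f j k).op (A.n j) =
    J.map (A.Pfst i j k ≫ A.f i j).op (A.n i) := by
  rw [P_condition, ← Category.assoc, t'_snd, Category.assoc, ← map_map, t_spec, map_map]

/-- Both morphisms to the `i`-th chart pull the universal element back to the same element of `J`,
so they coincide. -/
theorem cocycle (i j k : A.ι) : A.t' i j k ≫ A.t' j k i ≫ A.t' k i j = 𝟙 _ := by
  have h : A.t' i j k ≫ A.t' j k i ≫ A.t' k i j ≫ A.Pfst i j k ≫ A.f i j = A.Pfst i j k ≫ A.f i j := by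
    refine A.hom_ext i _ _ ?_
    rw [← map_map, ← map_map, t'_spec, map_map (A.t' j k i), t'_spec, map_map, t'_spec]
  have hm : Mono (A.Pfst i j k) :=
    have : IsOpenImm (A.Pfst i j k) := ⟨inferInstanceAs (SheafedSpace.IsOpenImmersion (pullback.fst _ _))⟩
    inferInstance
  rw [← cancel_mono (A.Pfst i j k), ← cancel_mono (A.f i j)]
  simpa using h

/-- The glueing data of the charts. -/
def glueData : SheafedSpace.GlueData SuperAlg where
  J := A.ι
  U i := (A.N i).obj
  V ij := (A.V ij.1 ij.2).obj
  f i j := (A.f i j).hom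
  f_mono i j := inferInstance
  f_hasPullback i j k := inferInstance
  f_id i := by
    obtain ⟨v, hv⟩ := A.exists_lift i i (𝟙 _) (fun x => A.n_mem i x)
    have : IsIso (A.f i i) := ⟨v, by rw [← cancel_mono (A.f i i), Category.assoc, hv]; simp, hv⟩
    exact inferInstanceAs (IsIso (isSupermanifold.ι.map (A.f i i)))
  t i j := (A.t i j).hom
  t_id i := by
    have : A.t i i = 𝟙 _ := by
      rw [← cancel_mono (A.f i i)]
      refine A.hom_ext i _ _ ?_
      rw [t_spec, Category.id_comp]
    rw [this]; rfl
  t' i j k := (A.t' i j k).hom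
  t_fac i j k := congrArg (fun k => k.hom) (A.t'_snd i j k)
  cocycle i j k := congrArg (fun k => k.hom) (A.cocycle i j k)
  f_open i j := inferInstance

/-- The glued space. -/
def glued : SuperSpace := A.glueData.toGlueData.glued

/-- The charts of the glued space. -/
def chart (i : A.ι) : (A.N i).obj ⟶ A.glued := A.glueData.toGlueData.ι i

instance (i : A.ι) : SheafedSpace.IsOpenImmersion (A.chart i) :=
  A.glueData.ιIsOpenImmersion i

theorem chart_surjective (x : A.glued) : ∃ (i : A.ι) (y : (A.N i).obj), (A.chart i).hom.base y = x :=
  A.glueData.ι_jointly_surjective x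

theorem t_chart (i j : A.ι) : (A.t i j).hom ≫ (A.f j i).hom ≫ A.chart j = (A.f i j).hom ≫ A.chart i :=
  A.glueData.toGlueData.glue_condition i j

theorem exists_overlap {S : SMfd} {i j : A.ι} (a : S ⟶ A.N i) (b : S ⟶ A.N j)
    (h : a.hom ≫ A.chart i = b.hom ≫ A.chart j) :
    ∃ c : S ⟶ A.V i j, c ≫ A.f i j = a ∧ c ≫ A.t i j ≫ A.f j i = b := by
  have hl := A.glueData.vPullbackConeIsLimit i j
  obtain ⟨c, h1, h2⟩ := PullbackCone.IsLimit.lift' hl a.hom b.hom h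
  exact ⟨ObjectProperty.homMk c, ObjectProperty.hom_ext _ h1, ObjectProperty.hom_ext _ h2⟩

end LocalAtlas
end SMfd

namespace SMfd
universe w
namespace LocalAtlas
variable {J : SMfdᵒᵖ ⥤ Type w} {B : Type} [TopologicalSpace B] (A : LocalAtlas J B)

theorem isOpenEmbedding_chart (i : A.ι) : Topology.IsOpenEmbedding (A.chart i).hom.base :=
  (A.glueData.ιIsOpenImmersion i).base_open

/-- The overlap is the fibre product of the two charts over the glued space. It is tested on the
open part of the first chart that lies in the image of the second. -/
theorem chart_rel {i j : A.ι} {x : (A.N i).obj} {y : (A.N j).obj}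
    (h : (A.chart i).hom.base x = (A.chart j).hom.base y) :
    ∃ z : (A.V i j).obj, bmap (A.f i j) z = x ∧ bmap (A.t i j ≫ A.f j i) z = y := by
  let O : Opens (A.N i).obj := ⟨(A.chart i).hom.base ⁻¹' Set.range (A.chart j).hom.base,
    (A.isOpenEmbedding_chart j).isOpen_range.preimage
      (A.chart i).hom.base.hom.continuous⟩
  have hr : Set.range ((restrι (A.N i) O).hom ≫ A.chart i).hom.base ⊆
      Set.range (A.chart j).hom.base := by
    rintro _ ⟨v, rfl⟩
    exact v.2
  let b : restr (A.N i) O ⟶ A.N j := ObjectProperty.homMk (InducedCategory.homMk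
    (PresheafedSpace.IsOpenImmersion.lift (A.chart j).hom ((restrι (A.N i) O).hom ≫ A.chart i).hom hr))
  have hb : b.hom ≫ A.chart j = (restrι (A.N i) O).hom ≫ A.chart i :=
    InducedCategory.hom_ext (PresheafedSpace.IsOpenImmersion.lift_fac _ _ hr)
  obtain ⟨c, hc1, hc2⟩ := A.exists_overlap (restrι (A.N i) O) b hb.symm
  let v : (restr (A.N i) O).obj := ⟨x, ⟨y, h.symm⟩⟩
  refine ⟨bmap c v, ?_, ?_⟩
  · rw [← bmap_comp, hc1]; rfl
  · rw [← bmap_comp, hc2]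
    refine (A.isOpenEmbedding_chart j).injective ?_
    exact (congrArg (fun k : (restr (A.N i) O).obj ⟶ A.glued => k.hom.base v) hb).trans h

theorem β_eq {i j : A.ι} {x : (A.N i).obj} {y : (A.N j).obj}
    (h : (A.chart i).hom.base x = (A.chart j).hom.base y) : A.β (A.n i) x = A.β (A.n j) y := by
  obtain ⟨z, rfl, rfl⟩ := A.chart_rel h
  rw [← A.β_map, ← A.β_map, t_spec]

/-- The map from the glued space to the base. -/
def toBase (x : A.glued) : B :=
  A.β (A.n (A.chart_surjective x).choose) (A.chart_surjective x).choose_spec.choose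

theorem toBase_chart (i : A.ι) (y : (A.N i).obj) :
    A.toBase ((A.chart i).hom.base y) = A.β (A.n i) y :=
  A.β_eq (A.chart_surjective _).choose_spec.choose_spec

theorem continuous_toBase : Continuous A.toBase := by
  refine ⟨fun O hO => ?_⟩
  have : A.toBase ⁻¹' O = ⋃ i, (A.chart i).hom.base '' (A.β (A.n i) ⁻¹' O) := by
    ext x
    simp only [Set.mem_iUnion]
    constructor
    · intro hx
      obtain ⟨i, y, rfl⟩ := A.chart_surjective x
      exact ⟨i, y, by rwa [Set.mem_preimage, toBase_chart] at hx, rfl⟩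
    · rintro ⟨i, y, hy, rfl⟩
      rw [Set.mem_preimage, toBase_chart]; exact hy
  rw [this]
  exact isOpen_iUnion fun i => (A.isOpenEmbedding_chart i).isOpenMap _
    (hO.preimage (A.continuous_β _))

/-- A point of another chart lying over `W i` belongs to an overlap. Consequently two points over
the same point of `B` have a common chart, which gives the Hausdorff property. -/
theorem range_chart (i : A.ι) : Set.range (A.chart i).hom.base = A.toBase ⁻¹' A.W i := by
  ext x
  constructor
  · rintro ⟨y, rfl⟩
    rw [Set.mem_preimage, toBase_chart]; exact A.n_mem i y
  · intro hx
    obtain ⟨j, y, rfl⟩ := A.chart_surjective x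
    rw [Set.mem_preimage, toBase_chart] at hx
    refine ⟨bmap (A.t j i ≫ A.f i j) ⟨y, hx⟩, ?_⟩
    exact congrArg (fun k : (A.V j i).obj ⟶ A.glued => k.hom.base ⟨y, hx⟩) (A.t_chart j i)

theorem glued_isSupermanifold [T2Space B] [SecondCountableTopology B] :
    isSupermanifold A.glued := by
  refine ⟨⟨fun x y hxy => ?_⟩, ?_, ?_⟩
  · by_cases h : A.toBase x = A.toBase y
    · obtain ⟨i, hi⟩ := A.cover (A.toBase x)
      obtain ⟨x', rfl⟩ := (A.range_chart i).symm.subset hi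
      obtain ⟨y', rfl⟩ := (A.range_chart i).symm.subset (show A.toBase y ∈ A.W i from h ▸ hi)
      have := (A.N i).property.1
      obtain ⟨u, v, hu, hv, hxu, hyv, huv⟩ := t2_separation (fun h => hxy (congrArg _ h) : x' ≠ y')
      exact ⟨_, _, (A.isOpenEmbedding_chart i).isOpenMap _ hu,
        (A.isOpenEmbedding_chart i).isOpenMap _ hv, ⟨x', hxu, rfl⟩, ⟨y', hyv, rfl⟩,
        (Set.disjoint_image_iff (A.isOpenEmbedding_chart i).injective).2 huv⟩
    · obtain ⟨u, v, hu, hv, hxu, hyv, huv⟩ := t2_separation h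
      exact ⟨_, _, hu.preimage A.continuous_toBase, hv.preimage A.continuous_toBase, hxu, hyv,
        huv.preimage _⟩
  · obtain ⟨s, hs, hcov⟩ := TopologicalSpace.isOpen_iUnion_countable
      (fun i => (A.W i : Set B)) fun i => (A.W i).2
    have := hs.to_subtype
    have h2 : ∀ i : s, SecondCountableTopology (Set.range (A.chart i).hom.base) := fun i => by
      have := (A.N i).property.2.1
      exact (A.isOpenEmbedding_chart i).isEmbedding.toHomeomorph.symm.isEmbedding.secondCountableTopology
    refine TopologicalSpace.secondCountableTopology_of_countable_cover
      (U := fun i : s => Set.range (A.chart i).hom.base)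
      (fun i => (A.isOpenEmbedding_chart i).isOpen_range) (Set.eq_univ_of_forall fun x => ?_)
    obtain ⟨i, hi⟩ := A.cover (A.toBase x)
    have : A.toBase x ∈ ⋃ i ∈ s, (A.W i : Set B) := hcov ▸ Set.mem_iUnion.2 ⟨i, hi⟩
    simp only [Set.mem_iUnion] at this ⊢
    obtain ⟨j, hj, hx⟩ := this
    exact ⟨⟨j, hj⟩, (A.range_chart j).symm.subset hx⟩
  · rw [hasCharts_iff]
    intro x
    obtain ⟨i, y, rfl⟩ := A.chart_surjective x
    obtain ⟨p, q, V, f, -, hf, v, rfl⟩ := hasCharts_iff.1 (A.N i).property.2.2 y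
    exact ⟨p, q, V, f ≫ A.chart i, trivial, inferInstance, v, rfl⟩

theorem glued_hasCharts {S : ℕ → ℕ → Prop} (h : ∀ i, HasCharts S (A.N i).obj) :
    HasCharts S A.glued := by
  rw [hasCharts_iff]
  intro x
  obtain ⟨i, y, rfl⟩ := A.chart_surjective x
  obtain ⟨p, q, V, f, hS, hf, v, rfl⟩ := hasCharts_iff.1 (h i) y
  exact ⟨p, q, V, f ≫ A.chart i, hS, inferInstance, v, rfl⟩

/-- The glued supermanifold. -/
def space [T2Space B] [SecondCountableTopology B] : SMfd := ⟨A.glued, A.glued_isSupermanifold⟩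

variable [T2Space B] [SecondCountableTopology B]

/-- The charts of the glued supermanifold. -/
def ch (i : A.ι) : A.N i ⟶ A.space := ObjectProperty.homMk (A.chart i)

instance (i : A.ι) : IsOpenImm (A.ch i) := ⟨inferInstanceAs (SheafedSpace.IsOpenImmersion (A.chart i))⟩

theorem map_eq_of_ch {S : SMfd} {i j : A.ι} (a : S ⟶ A.N i) (b : S ⟶ A.N j) (h : a ≫ A.ch i = b ≫ A.ch j) :
    J.map a.op (A.n i) = J.map b.op (A.n j) := by
  obtain ⟨c, rfl, rfl⟩ := A.exists_overlap a b (congrArg (fun k => k.hom) h)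
  rw [← map_map, ← map_map, t_spec]

theorem ch_eq_of_map {S : SMfd} {i j : A.ι} (a : S ⟶ A.N i) (b : S ⟶ A.N j)
    (h : J.map a.op (A.n i) = J.map b.op (A.n j)) : a ≫ A.ch i = b ≫ A.ch j := by
  obtain ⟨v, rfl⟩ := A.exists_lift i j a fun x => by
    rw [← A.β_map, h, A.β_map]; exact A.n_mem j _
  have : v ≫ A.t i j ≫ A.f j i = b := A.hom_ext j _ _ (by rw [← h, ← map_map, t_spec, map_map])
  rw [← this]
  refine ObjectProperty.hom_ext _ ?_
  have := A.t_chart i j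
  exact (congrArg (fun k => v.hom ≫ k) this).symm

theorem exists_generic (hJ : IsLocal J) : ∃ m : J.obj (op A.space), ∀ i, J.map (A.ch i).op m = A.n i := by
  obtain ⟨m, hm, -⟩ := hJ A.space A.ι A.N A.ch inferInstance (fun x => A.chart_surjective x) A.n
    fun i j S a b h => A.map_eq_of_ch a b h
  exact ⟨m, hm⟩

/-- The presheaf is represented by the glued supermanifold. -/
theorem representable (hJ : IsLocal J) : Nonempty (J.RepresentableBy A.space) := by
  obtain ⟨m, hm⟩ := A.exists_generic hJ
  have hβ : ∀ x, A.β m x = A.toBase x := fun x => by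
    obtain ⟨i, y, rfl⟩ := A.chart_surjective x
    rw [toBase_chart, ← hm, A.β_map]; rfl
  let T' : ∀ {T : SMfd} (j : J.obj (op T)) (i : A.ι), SMfd := fun {T} j i =>
    restr T ⟨A.β j ⁻¹' A.W i, (A.W i).2.preimage (A.continuous_β _)⟩
  let e : ∀ {T : SMfd} (j : J.obj (op T)) (i : A.ι), T' j i ⟶ T := fun j i => restrι _ _
  have hcov : ∀ {T : SMfd} (j : J.obj (op T)) x, ∃ i, x ∈ Set.range (bmap (e j i)) := fun j x => by
    obtain ⟨i, hi⟩ := A.cover (A.β j x)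
    exact ⟨i, ⟨x, hi⟩, rfl⟩
  have hei : ∀ {T : SMfd} (j : J.obj (op T)) i, IsOpenImm (e j i) := fun j i =>
    inferInstanceAs (IsOpenImm (restrι _ _))
  have hbij : ∀ {T : SMfd}, Function.Bijective fun u : T ⟶ A.space => J.map u.op m := by
    intro T
    refine ⟨fun u u' huu => ?_, fun j => ?_⟩
    · have huu : J.map u.op m = J.map u'.op m := huu
      refine hom_ext_of_cover (e (J.map u.op m)) (hcov _) fun i => ?_
      -- The map to `B` depends only on the classified element, so every morphism classifying it
      -- sends the `i`-th piece into the `i`-th chart.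
      have key : ∀ u'' : T ⟶ A.space, J.map u''.op m = J.map u.op m →
          ∃ v : T' (J.map u.op m) i ⟶ A.N i, v ≫ A.ch i = e _ i ≫ u'' := fun u'' h => by
        refine ⟨lift (A.ch i) (e _ i ≫ u'') fun y => ?_, lift_fac _ _ _⟩
        refine (A.range_chart i).symm.subset ?_
        change A.toBase _ ∈ A.W i
        rw [← hβ, bmap_comp, ← A.β_map, h]
        exact y.2
      obtain ⟨v, hv⟩ := key u rfl
      obtain ⟨v', hv'⟩ := key u' huu.symm
      rw [← hv, ← hv']
      refine A.ch_eq_of_map v v' ?_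
      rw [← hm, map_map, map_map, hv, hv', ← map_map, ← map_map, huu]
    · have hex : ∀ i, ∃ u : T' j i ⟶ A.N i, J.map u.op (A.n i) = J.map (e j i).op j := fun i =>
        A.exists_hom i _ fun x => by rw [A.β_map]; exact x.2
      choose u hu using hex
      obtain ⟨g, hg⟩ := exists_glue (e j) (hcov j) (fun i => u i ≫ A.ch i) fun i k S a b hab => by
        rw [← Category.assoc, ← Category.assoc]
        refine A.ch_eq_of_map _ _ ?_
        rw [← map_map, ← map_map, hu, hu, map_map, map_map, hab]
      refine ⟨g, ?_⟩
      obtain ⟨j', -, huniq⟩ := hJ T A.ι (T' j) (e j) (hei j) (hcov j)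
        (fun i => J.map (e j i).op j) fun i k S a b hab => by rw [map_map, map_map, hab]
      refine (huniq _ fun i => ?_).trans (huniq _ fun i => rfl).symm
      change J.map (e j i).op (J.map g.op m) = _
      rw [map_map, hg, ← map_map, hm, hu]
  exact ⟨{ homEquiv := fun {T} => Equiv.ofBijective _ hbij
           homEquiv_comp := fun f g => (map_map f g m).symm }⟩

end LocalAtlas
end SMfd

/-! ### Products of standard supermanifolds and presheaves with fibre coordinates -/

namespace SMfd
universe w

theorem pb_mem {S T : SMfd} (f : S ⟶ T) {i : ZMod 2} {s : Γ T} (hs : s ∈ (Γ T).part i) :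
    pb f s ∈ (Γ S).part i := (pb f).map_mem i s hs

theorem exists_chart_of {S : ℕ → ℕ → Prop} {N : SMfd} (hN : HasCharts S N.obj) (x : N.obj) :
    ∃ (p q : ℕ) (O : Opens (std p q).obj) (f : restr (std p q) O ⟶ N), S p q ∧ IsOpenImm f ∧
      x ∈ Set.range (bmap f) := by
  obtain ⟨p, q, V, f, hS, hf, hx⟩ := hasCharts_iff.1 hN x
  exact ⟨p, q, V, ObjectProperty.homMk f, hS, ⟨hf⟩, hx⟩

section Product
variable (a b s t : ℕ)

/-- The first projection of the product of two standard supermanifolds. -/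
def pr1 : std (a + s) (b + t) ⟶ std a b := ObjectProperty.homMk (stdProj a b s t)

/-- The second projection of the product of two standard supermanifolds. -/
def pr2 : std (a + s) (b + t) ⟶ std s t := ObjectProperty.homMk (stdMap (prR a s) (inR b t))

theorem pb_pr1_coordX (i : Fin a) : pb (pr1 a b s t) (coordX a b i) =
    coordX (a + s) (b + t) (Fin.castAdd s i) :=
  Subtype.ext (funext fun z => (ExteriorAlgebra.map (inL b t)).commutes (z.1 (Fin.castAdd s i)))

theorem pb_pr2_coordX (i : Fin s) : pb (pr2 a b s t) (coordX s t i) =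
    coordX (a + s) (b + t) (Fin.natAdd a i) :=
  Subtype.ext (funext fun z => (ExteriorAlgebra.map (inR b t)).commutes (z.1 (Fin.natAdd a i)))

theorem pb_pr1_coordT (i : Fin b) : pb (pr1 a b s t) (coordT a b i) =
    coordT (a + s) (b + t) (Fin.castAdd t i) := by
  refine Subtype.ext (funext fun z => (ExteriorAlgebra.map_apply_ι (inL b t) _).trans ?_)
  refine congrArg (ExteriorAlgebra.ι ℝ) (funext (Fin.addCases (fun j => ?_) fun j => ?_))
  · simp [append_inL, Pi.single_apply]
  · have h : Fin.natAdd b j ≠ Fin.castAdd t i := fun h => by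
      have := congrArg Fin.val h
      simp at this; omega
    simp [append_inL, h]

theorem pb_pr2_coordT (i : Fin t) : pb (pr2 a b s t) (coordT s t i) =
    coordT (a + s) (b + t) (Fin.natAdd b i) := by
  refine Subtype.ext (funext fun z => (ExteriorAlgebra.map_apply_ι (inR b t) _).trans ?_)
  refine congrArg (ExteriorAlgebra.ι ℝ) (funext (Fin.addCases (fun j => ?_) fun j => ?_))
  · have h : Fin.castAdd t j ≠ Fin.natAdd b i := fun h => by
      have := congrArg Fin.val h
      simp at this; omega
    simp [append_inR, h]
  · simp [append_inR, Pi.single_apply]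

variable {a b s t} {T : SMfd}

theorem pair_ext {h h' : T ⟶ std (a + s) (b + t)} (h1 : h ≫ pr1 a b s t = h' ≫ pr1 a b s t)
    (h2 : h ≫ pr2 a b s t = h' ≫ pr2 a b s t) : h = h' := by
  refine std_hom_ext (Fin.addCases (fun i => ?_) fun i => ?_) (Fin.addCases (fun i => ?_) fun i => ?_)
  · rw [← pb_pr1_coordX, ← pb_comp, ← pb_comp, h1]
  · rw [← pb_pr2_coordX, ← pb_comp, ← pb_comp, h2]
  · rw [← pb_pr1_coordT, ← pb_comp, ← pb_comp, h1]
  · rw [← pb_pr2_coordT, ← pb_comp, ← pb_comp, h2]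

theorem exists_pair (f : T ⟶ std a b) (g : T ⟶ std s t) :
    ∃ h : T ⟶ std (a + s) (b + t), h ≫ pr1 a b s t = f ∧ h ≫ pr2 a b s t = g := by
  obtain ⟨h, hx, ht⟩ := exists_hom_std
    (Fin.addCases (fun i => pb f (coordX a b i)) (fun i => pb g (coordX s t i)))
    (Fin.addCases (fun i => pb f (coordT a b i)) (fun i => pb g (coordT s t i)))
    (Fin.addCases (fun i => by simpa using pb_mem f (coordX_mem _ _ _))
      (fun i => by simpa using pb_mem g (coordX_mem _ _ _)))
    (Fin.addCases (fun i => by simpa using pb_mem f (coordT_mem _ _ _))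
      (fun i => by simpa using pb_mem g (coordT_mem _ _ _)))
  refine ⟨h, std_hom_ext (fun i => ?_) (fun i => ?_), std_hom_ext (fun i => ?_) (fun i => ?_)⟩
  · rw [pb_comp, pb_pr1_coordX, hx, Fin.addCases_left]
  · rw [pb_comp, pb_pr1_coordT, ht, Fin.addCases_left]
  · rw [pb_comp, pb_pr2_coordX, hx, Fin.addCases_right]
  · rw [pb_comp, pb_pr2_coordT, ht, Fin.addCases_right]

theorem bmap_pair_inj {z z' : (std (a + s) (b + t)).obj}
    (h1 : bmap (pr1 a b s t) z = bmap (pr1 a b s t) z')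
    (h2 : bmap (pr2 a b s t) z = bmap (pr2 a b s t) z') : z = z' :=
  funext (Fin.addCases (fun i => congrFun h1 i) fun i => congrFun h2 i)

end Product

/-- A presheaf with a map to a supermanifold `N` and underlying maps to a space `B` over `N`. -/
structure Over (J : SMfdᵒᵖ ⥤ Type w) (N : SMfd) (B : Type) [TopologicalSpace B] where
  π : ∀ {T : SMfd}, J.obj (op T) → (T ⟶ N)
  π_map : ∀ {S T : SMfd} (u : S ⟶ T) (j : J.obj (op T)), π (J.map u.op j) = u ≫ π j
  β : ∀ {T : SMfd}, J.obj (op T) → T.obj → B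
  continuous_β : ∀ {T : SMfd} (j : J.obj (op T)), Continuous (β j)
  β_map : ∀ {S T : SMfd} (u : S ⟶ T) (j : J.obj (op T)) (x : S.obj), β (J.map u.op j) x = β j (bmap u x)
  ρ : B → N.obj
  continuous_ρ : Continuous ρ
  ρ_β : ∀ {T : SMfd} (j : J.obj (op T)) (x : T.obj), ρ (β j x) = bmap (π j) x

/-- Fibre coordinates near a point of the base. -/
structure Over.Coord {J : SMfdᵒᵖ ⥤ Type w} {N : SMfd} {B : Type} [TopologicalSpace B] (Q : Over J N B)
    (b : B) (S : ℕ → ℕ → Prop) where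
  W : Opens B
  mem : b ∈ W
  s : ℕ
  t : ℕ
  dim : S s t
  c : ∀ {T : SMfd} (j : J.obj (op T)), (∀ x, Q.β j x ∈ W) → (T ⟶ std s t)
  c_map : ∀ {S T : SMfd} (u : S ⟶ T) (j : J.obj (op T)) (h : ∀ x, Q.β j x ∈ W)
    (h' : ∀ x, Q.β (J.map u.op j) x ∈ W), c (J.map u.op j) h' = u ≫ c j h
  inj : ∀ {T : SMfd} (j j' : J.obj (op T)) (h : ∀ x, Q.β j x ∈ W) (h' : ∀ x, Q.β j' x ∈ W),
    Q.π j = Q.π j' → c j h = c j' h' → j = j'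
  -- An openness condition: if the underlying values of `n` and `γ` at the single point `τ` are
  -- attained by some element, then near `τ` they are the data of an element.
  lift : ∀ {T₀ T : SMfd} (j : J.obj (op T₀)) (h : ∀ x, Q.β j x ∈ W) (τ₀ : T₀.obj) (n : T ⟶ N)
    (γ : T ⟶ std s t) (τ : T.obj), bmap n τ = bmap (Q.π j) τ₀ → bmap γ τ = bmap (c j h) τ₀ →
    ∃ (E : SMfd) (e : E ⟶ T) (_ : IsOpenImm e) (j' : J.obj (op E)) (h' : ∀ x, Q.β j' x ∈ W),
      τ ∈ Set.range (bmap e) ∧ Q.π j' = e ≫ n ∧ c j' h' = e ≫ γ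

namespace Over
variable {J : SMfdᵒᵖ ⥤ Type w} {N : SMfd} {B : Type} [TopologicalSpace B] (Q : Over J N B)
  {S : ℕ → ℕ → Prop}

/-- The representing object is the open part of (chart of `N`) × ℝ^{s|t} over which elements with
the tautological coordinates exist locally. These are unique, so they glue to a universal element
`n`. -/
theorem exists_local (hJ : IsLocal J) (hS : ∀ a b s t, S a b → S s t → S (a + s) (b + t))
    (hN : HasCharts S N.obj) (b : B) (C : Q.Coord b S) :
    ∃ (W : Opens B) (M : SMfd) (n : J.obj (op M)), b ∈ W ∧ HasCharts S M.obj ∧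
      (∀ x, Q.β n x ∈ W) ∧ (∀ (T : SMfd) (j : J.obj (op T)), (∀ x, Q.β j x ∈ W) →
        ∃ u : T ⟶ M, J.map u.op n = j) ∧
      ∀ (T : SMfd) (u u' : T ⟶ M), J.map u.op n = J.map u'.op n → u = u' := by
  obtain ⟨a, d, O, φ, hS1, hφ, hb⟩ := exists_chart_of hN (Q.ρ b)
  let P := std (a + C.s) (d + C.t)
  let Z : Opens P.obj := preim (pr1 a d C.s C.t) O
  let ζ : restr P Z ⟶ P := restrι P Z
  let l : restr P Z ⟶ restr (std a d) O := SMfd.lift (restrι (std a d) O) (ζ ≫ pr1 a d C.s C.t)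
    fun z => by rw [range_restrι]; exact z.2
  have hl : l ≫ restrι (std a d) O = ζ ≫ pr1 a d C.s C.t := lift_fac _ _ _
  let good : Set (restr P Z).obj := {z | ∃ (E : SMfd) (e : E ⟶ restr P Z) (_ : IsOpenImm e)
    (j : J.obj (op E)) (h : ∀ x, Q.β j x ∈ C.W), z ∈ Set.range (bmap e) ∧ Q.π j = e ≫ l ≫ φ ∧
      C.c j h = e ≫ ζ ≫ pr2 a d C.s C.t}
  have hgood : IsOpen good := by
    refine isOpen_iff_forall_mem_open.2 fun z hz => ?_
    obtain ⟨E, e, he, j, h, hze, h1, h2⟩ := hz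
    exact ⟨_, fun z' hz' => ⟨E, e, he, j, h, hz', h1, h2⟩,
      (IsOpenImm.isOpenEmbedding e).isOpen_range, hze⟩
  let Ω : Opens (restr P Z).obj := ⟨good, hgood⟩
  let M := restr (restr P Z) Ω
  let ω : M ⟶ restr P Z := restrι _ _
  have hex : ∀ z : M.obj, ∃ (E : SMfd) (e : E ⟶ M) (_ : IsOpenImm e) (j : J.obj (op E))
      (h : ∀ x, Q.β j x ∈ C.W), z ∈ Set.range (bmap e) ∧ Q.π j = e ≫ ω ≫ l ≫ φ ∧
      C.c j h = e ≫ ω ≫ ζ ≫ pr2 a d C.s C.t := by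
    intro z
    obtain ⟨E, e, he, j, h, ⟨y, hy⟩, h1, h2⟩ := z.2
    have hr : ∀ y, bmap e y ∈ Set.range (bmap ω) := fun y =>
      ⟨⟨bmap e y, E, e, he, j, h, ⟨y, rfl⟩, h1, h2⟩, rfl⟩
    have hf : SMfd.lift ω e hr ≫ ω = e := lift_fac _ _ _
    have him : SheafedSpace.IsOpenImmersion ((SMfd.lift ω e hr).hom ≫ ω.hom) := by
      have : (SMfd.lift ω e hr).hom ≫ ω.hom = e.hom := congrArg (fun k => k.hom) hf
      rw [this]; infer_instance
    refine ⟨E, SMfd.lift ω e hr, ⟨isOpenImmersion_of_comp _ ω.hom⟩, j, h, ⟨y, ?_⟩, ?_, ?_⟩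
    · exact (IsOpenImm.isOpenEmbedding ω).injective ((bmap_lift _ _ _ _).trans hy)
    · rw [← Category.assoc, hf, h1]
    · rw [← Category.assoc, hf, h2]
  choose E e he j hj hze hπ hc using hex
  have hcov : ∀ z, ∃ i : ULift.{0} M.obj, z ∈ Set.range (bmap (e i.down)) := fun z => ⟨⟨z⟩, hze z⟩
  obtain ⟨n, hn, -⟩ := hJ M (ULift.{0} M.obj) (fun z => E z.down) (fun z => e z.down)
    (fun z => he z.down) hcov (fun z => j z.down) fun z z' R u v huv => by
      refine C.inj _ _ (fun x => by rw [Q.β_map]; exact hj _ _)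
        (fun x => by rw [Q.β_map]; exact hj _ _) ?_ ?_
      · rw [Q.π_map, Q.π_map, hπ, hπ, ← Category.assoc, huv, Category.assoc]
      · rw [C.c_map u _ (hj _), C.c_map v _ (hj _), hc, hc, ← Category.assoc, huv, Category.assoc]
  have hnW : ∀ x, Q.β n x ∈ C.W := fun x => by
    obtain ⟨i, y, rfl⟩ := hcov x
    rw [← Q.β_map, hn]; exact hj _ _
  have hnπ : Q.π n = ω ≫ l ≫ φ := hom_ext_of_cover (fun z : ULift.{0} M.obj => e z.down) hcov
    fun i => by rw [← Q.π_map, hn, hπ]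
  have hnc : C.c n hnW = ω ≫ ζ ≫ pr2 a d C.s C.t :=
    hom_ext_of_cover (fun z : ULift.{0} M.obj => e z.down) hcov fun i => by
      rw [← C.c_map _ _ hnW (fun x => by rw [Q.β_map]; exact hnW _), ← hc]
      congr 1
      exact hn i
  refine ⟨C.W ⊓ ⟨Q.ρ ⁻¹' Set.range (bmap φ), (IsOpenImm.isOpenEmbedding φ).isOpen_range.preimage
    Q.continuous_ρ⟩, M, n, ⟨C.mem, hb⟩, ?_, fun x => ⟨hnW x, ?_⟩, fun T k hk => ?_, fun T u u' huu => ?_⟩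
  · have hP : HasCharts S P.obj := fun _ =>
      ⟨_, _, ⊤, ⊤, hS _ _ _ _ hS1 C.dim, trivial, ⟨Iso.refl _⟩⟩
    have h1 : HasCharts S (restr P Z).obj := hP.of_isOpenImmersion (restrι P Z).hom
    exact h1.of_isOpenImmersion (restrι (restr P Z) Ω).hom
  · change Q.ρ _ ∈ Set.range (bmap φ)
    rw [Q.ρ_β, hnπ]
    exact ⟨_, rfl⟩
  · have hkφ : ∀ x, bmap (Q.π k) x ∈ Set.range (bmap φ) := fun x => by
      rw [← Q.ρ_β]; exact (hk x).2
    have hkW : ∀ x, Q.β k x ∈ C.W := fun x => (hk x).1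
    let v := SMfd.lift φ (Q.π k) hkφ
    have hv : v ≫ φ = Q.π k := lift_fac _ _ _
    obtain ⟨h, h1, h2⟩ := exists_pair (v ≫ restrι (std a d) O) (C.c k hkW)
    let h' : T ⟶ restr P Z := SMfd.lift ζ h fun y => by
      refine (range_restrι P Z).symm.subset ?_
      change bmap (pr1 a d C.s C.t) (bmap h y) ∈ O
      rw [← bmap_comp, h1]
      exact bmap_restrι_mem _ _ _
    have hh' : h' ≫ ζ = h := lift_fac _ _ _
    have hl' : h' ≫ l = v := by
      rw [← cancel_mono (restrι (std a d) O), Category.assoc, hl, ← Category.assoc, hh', h1]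
    -- The element `k` itself shows, by `C.lift`, that its coordinates take values in the set
    -- `good`.
    let h'' : T ⟶ M := SMfd.lift ω h' fun y => by
      refine (range_restrι _ Ω).symm.subset ?_
      refine C.lift k hkW y (l ≫ φ) (ζ ≫ pr2 a d C.s C.t) (bmap h' y) ?_ ?_
      · rw [← bmap_comp, ← Category.assoc, hl', hv]
      · rw [← bmap_comp, ← Category.assoc, hh', h2]
    have hh'' : h'' ≫ ω = h' := lift_fac _ _ _
    refine ⟨h'', C.inj _ _ (fun x => by rw [Q.β_map]; exact hnW _) hkW ?_ ?_⟩
    · rw [Q.π_map, hnπ, ← Category.assoc, hh'', ← Category.assoc, hl', hv]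
    · rw [C.c_map _ _ hnW, hnc, ← Category.assoc, hh'', ← Category.assoc, hh', h2]
  · rw [← cancel_mono ω, ← cancel_mono ζ]
    refine pair_ext ?_ ?_
    · have h1 : u ≫ ω ≫ l ≫ φ = u' ≫ ω ≫ l ≫ φ := by
        rw [← hnπ, ← Q.π_map, ← Q.π_map, huu]
      have h2 : u ≫ ω ≫ l = u' ≫ ω ≫ l := by
        rw [← cancel_mono φ]; simpa using h1
      simp only [Category.assoc, ← hl]
      rw [← Category.assoc ω, ← Category.assoc u, h2]; simp
    · have h1 : u ≫ ω ≫ ζ ≫ pr2 a d C.s C.t = u' ≫ ω ≫ ζ ≫ pr2 a d C.s C.t := by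
        rw [← hnc, ← C.c_map u n hnW fun x => by rw [Q.β_map]; exact hnW _,
          ← C.c_map u' n hnW fun x => by rw [Q.β_map]; exact hnW _]
        congr 1
      simpa using h1

theorem representable [T2Space B] [SecondCountableTopology B] (hJ : IsLocal J)
    (hS : ∀ a b s t, S a b → S s t → S (a + s) (b + t)) (hN : HasCharts S N.obj)
    (C : ∀ b, Nonempty (Q.Coord b S)) :
    ∃ M : SMfd, HasCharts S M.obj ∧ Nonempty (J.RepresentableBy M) := by
  choose W M n hb hM hn h1 h2 using fun b => Q.exists_local hJ hS hN b (C b).some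
  let A : LocalAtlas J B :=
    { β := Q.β, continuous_β := Q.continuous_β, β_map := Q.β_map, ι := B, W := W,
      cover := fun b => ⟨b, hb b⟩, N := M, n := n, n_mem := hn,
      exists_hom := fun i j h => h1 i _ j h, hom_ext := fun i u u' h => h2 i _ u u' h }
  exact ⟨A.space, A.glued_hasCharts hM, A.representable hJ⟩

end Over
end SMfd

/-! ### Functions on a product with the odd line -/

namespace Grassmann
variable {q : ℕ}

/-- The last odd generator. -/
def lastGen (q : ℕ) : Grassmann (q + 1) := ExteriorAlgebra.ι ℝ (inR q 1 1)

/-- The inclusion omitting the last odd generator. -/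
def incl (q : ℕ) : Grassmann q →ₐ[ℝ] Grassmann (q + 1) := ExteriorAlgebra.map (inL q 1)

/-- Setting the last odd generator to zero. -/
def constPart (q : ℕ) : Grassmann (q + 1) →ₐ[ℝ] Grassmann q :=
  ExteriorAlgebra.map (prL q 1).toLinearMap

theorem constPart_incl (a : Grassmann q) : constPart q (incl q a) = a := by
  have : (constPart q).comp (incl q) = AlgHom.id ℝ _ :=
    ExteriorAlgebra.hom_ext (LinearMap.ext fun v => by
      simp [constPart, incl, append_inL, prL_append])
  exact DFunLike.congr_fun this a

theorem constPart_lastGen : constPart q (lastGen q) = 0 := by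
  simp [constPart, lastGen, append_inR, prL_append]

theorem lastGen_mem : lastGen q ∈ part (q + 1) 1 := ι_mem_part _

/-- The coefficient of the last odd generator. -/
def linPart (q : ℕ) : Grassmann (q + 1) →ₗ[ℝ] Grassmann q :=
  (constPart q).toLinearMap ∘ₗ (CliffordAlgebra.contractRight (Q := (0 : QuadraticForm ℝ (Fin (q + 1) → ℝ)))).flip
    (LinearMap.proj (Fin.natAdd q 0))

theorem contractRight_incl (a : Grassmann q) : CliffordAlgebra.contractRight
    (Q := (0 : QuadraticForm ℝ (Fin (q + 1) → ℝ))) (incl q a) (LinearMap.proj (Fin.natAdd q 0)) = 0 := by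
  induction a using CliffordAlgebra.right_induction with
  | algebraMap c =>
    rw [AlgHom.commutes]
    exact CliffordAlgebra.contractRight_algebraMap (Q := (0 : QuadraticForm ℝ (Fin (q + 1) → ℝ))) _ c
  | add x y hx hy => rw [map_add, map_add, LinearMap.add_apply, hx, hy, add_zero]
  | mul_ι v x hx =>
    have h : incl q (CliffordAlgebra.ι 0 v) = CliffordAlgebra.ι 0 (inL q 1 v) :=
      ExteriorAlgebra.map_apply_ι _ _
    rw [map_mul, h, CliffordAlgebra.contractRight_mul_ι, hx, zero_mul, sub_zero, append_inL]
    simp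

theorem linPart_incl_mul (b : Grassmann q) : linPart q (incl q b * lastGen q) = b := by
  change constPart q (CliffordAlgebra.contractRight (Q := (0 : QuadraticForm ℝ (Fin (q + 1) → ℝ)))
    (incl q b * CliffordAlgebra.ι 0 (inR q 1 1)) (LinearMap.proj (Fin.natAdd q 0))) = b
  rw [CliffordAlgebra.contractRight_mul_ι, contractRight_incl, zero_mul, sub_zero, map_smul,
    constPart_incl, append_inR]
  simp

theorem linPart_incl (b : Grassmann q) : linPart q (incl q b) = 0 := by
  change constPart q (CliffordAlgebra.contractRight (Q := (0 : QuadraticForm ℝ (Fin (q + 1) → ℝ)))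
    (incl q b) (LinearMap.proj (Fin.natAdd q 0))) = 0
  rw [contractRight_incl, map_zero]

theorem exists_lin (x : Grassmann (q + 1)) : ∃ a b, x = incl q a + incl q b * lastGen q := by
  induction x using ExteriorAlgebra.induction with
  | algebraMap c => exact ⟨algebraMap ℝ _ c, 0, by simp⟩
  | ι v =>
    refine ⟨ExteriorAlgebra.ι ℝ (prL q 1 v), algebraMap ℝ _ (v (Fin.natAdd q 0)), ?_⟩
    rw [incl, ExteriorAlgebra.map_apply_ι, AlgHom.commutes, ← Algebra.smul_def, lastGen, ← map_smul,
      ← map_add, append_inL, append_inR]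
    refine congrArg _ (funext (Fin.addCases (fun i => ?_) fun i => ?_))
    · simp [prL]
    · rw [Subsingleton.elim i 0]; simp
  | mul x y hx hy =>
    obtain ⟨a, b, rfl⟩ := hx
    obtain ⟨a', b', rfl⟩ := hy
    obtain ⟨u, hu, v, hv, rfl⟩ := exists_parts a'
    obtain ⟨w, hw, z, hz, rfl⟩ := exists_parts b'
    have h1 := even_comm (b := lastGen q) (map_mem_part (inL q 1) 0 u hu)
    have h2 := odd_anticomm (lastGen_mem (q := q)) (map_mem_part (inL q 1) 1 v hv)
    have h3 := even_comm (b := lastGen q) (map_mem_part (inL q 1) 0 w hw)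
    have h4 := odd_anticomm (lastGen_mem (q := q)) (map_mem_part (inL q 1) 1 z hz)
    have h5 := odd_mul_self (lastGen_mem (q := q))
    change incl q u * _ = _ * incl q u at h1
    change _ * incl q v = -(incl q v * _) at h2
    change incl q w * _ = _ * incl q w at h3
    change _ * incl q z = -(incl q z * _) at h4
    -- With the second factor split as u + v, even plus odd, moving the last generator θ past it
    -- gives θ(u + v) = (u - v)θ; the product of the two θ-terms vanishes as θ² = 0.
    refine ⟨a * (u + v), a * (w + z) + b * (u - v), ?_⟩
    simp only [map_add, map_mul, map_sub, mul_add, add_mul, mul_sub, sub_mul, mul_assoc]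
    simp only [h2, ← h1]
    rw [← mul_assoc (lastGen q) (incl q w), ← h3, ← mul_assoc (lastGen q) (incl q z), h4]
    simp only [mul_assoc, h5, mul_zero, mul_neg, neg_mul, neg_zero, add_zero]
    abel
  | add x y hx hy =>
    obtain ⟨a, b, rfl⟩ := hx
    obtain ⟨a', b', rfl⟩ := hy
    exact ⟨a + a', b + b', by simp only [map_add, add_mul]; abel⟩

theorem eq_lin (x : Grassmann (q + 1)) :
    x = incl q (constPart q x) + incl q (linPart q x) * lastGen q := by
  obtain ⟨a, b, rfl⟩ := exists_lin x
  rw [map_add, map_mul, constPart_lastGen, mul_zero, add_zero, constPart_incl, map_add,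
    linPart_incl_mul, linPart_incl, zero_add]

end Grassmann

namespace SMfd
variable {p q : ℕ}

/-- The odd function given by a morphism to the odd line. -/
def θ {S : SMfd} (d : S ⟶ oddLine) : Γ S := pb d (coordT 0 1 0)

theorem θ_mem {S : SMfd} (d : S ⟶ oddLine) : θ d ∈ (Γ S).part 1 := pb_mem d (coordT_mem 0 1 0)

theorem pb_θ {S T : SMfd} (u : S ⟶ T) (d : T ⟶ oddLine) : pb u (θ d) = θ (u ≫ d) := (pb_comp _ _ _).symm

theorem θ_inj {S : SMfd} {d d' : S ⟶ oddLine} (h : θ d = θ d') : d = d' :=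
  std_hom_ext (fun i => i.elim0) fun i => by rw [Subsingleton.elim i 0]; exact h

theorem exists_θ {S : SMfd} {s : Γ S} (hs : s ∈ (Γ S).part 1) : ∃ d : S ⟶ oddLine, θ d = s := by
  obtain ⟨d, -, hd⟩ := exists_hom_std (p := 0) (q := 1) (fun i => i.elim0) (fun _ => s)
    (fun i => i.elim0) fun _ => hs
  exact ⟨d, hd 0⟩

/-- The product of an open part of `ℝ^{p|q}` with the odd line. -/
def prodD (O : Opens (std p q).obj) : SMfd := restr (std (p + 0) (q + 1)) (preim (pr1 p q 0 1) O)

/-- The inclusion of the product into `ℝ^{p|q+1}`. -/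
def prodD.ι (O : Opens (std p q).obj) : prodD O ⟶ std (p + 0) (q + 1) := restrι _ _

instance (O : Opens (std p q).obj) : IsOpenImm (prodD.ι O) := inferInstanceAs (IsOpenImm (restrι _ _))

theorem prodD.range_ι (O : Opens (std p q).obj) :
    Set.range (bmap (prodD.ι O)) = preim (pr1 p q 0 1) O := range_restrι _ _

/-- The first projection. -/
def prodD.fst (O : Opens (std p q).obj) : prodD O ⟶ restr (std p q) O :=
  lift (restrι (std p q) O) (prodD.ι O ≫ pr1 p q 0 1) fun z => by rw [range_restrι]; exact z.2

/-- The second projection. -/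
def prodD.snd (O : Opens (std p q).obj) : prodD O ⟶ oddLine := prodD.ι O ≫ pr2 p q 0 1

theorem prodD.fst_ι (O : Opens (std p q).obj) : prodD.fst O ≫ restrι (std p q) O =
    prodD.ι O ≫ pr1 p q 0 1 := lift_fac _ _ _

theorem prodD.exists_lift {O : Opens (std p q).obj} {S : SMfd} (u : S ⟶ restr (std p q) O)
    (d : S ⟶ oddLine) : ∃ v : S ⟶ prodD O, v ≫ prodD.fst O = u ∧ v ≫ prodD.snd O = d := by
  obtain ⟨h, h1, h2⟩ := exists_pair (u ≫ restrι _ _) d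
  have hr : ∀ y, bmap h y ∈ Set.range (bmap (prodD.ι O)) := by
    intro y
    rw [prodD.range_ι]
    change bmap (pr1 p q 0 1) (bmap h y) ∈ O
    rw [← bmap_comp, h1]
    exact bmap_restrι_mem _ _ _
  have hv : SMfd.lift (prodD.ι O) h hr ≫ prodD.ι O = h := lift_fac _ _ _
  refine ⟨SMfd.lift (prodD.ι O) h hr, ?_, ?_⟩
  · rw [← cancel_mono (restrι (std p q) O), Category.assoc, prodD.fst_ι, ← Category.assoc, hv, h1]
  · rw [prodD.snd, ← Category.assoc, hv, h2]

/-- Evaluation of functions on the product with the odd line. -/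
def prodD.ev (O : Opens (std p q).obj) (y : (prodD O).obj) : Γ (prodD O) →ₐ[ℝ] Grassmann (q + 1) :=
  evR (O := preim (pr1 p q 0 1) O) ⊤ y trivial

theorem prodD.ev_ext {O : Opens (std p q).obj} {s t : Γ (prodD O)}
    (h : ∀ y, prodD.ev O y s = prodD.ev O y t) : s = t :=
  evR_ext (O := preim (pr1 p q 0 1) O) fun v _ => h v

theorem evR_pb_fst (O : Opens (std p q).obj) (a : Γ (restr (std p q) O)) (y : (prodD O).obj) :
    prodD.ev O y (pb (prodD.fst O) a) =
      Grassmann.incl q (evR (O := O) ⊤ ⟨prL p 0 y.1, y.2⟩ trivial a) := by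
  have h1 : (⊤ : Opens (restr (std p q) O).obj) ≤
      (Opens.map (restrι (std p q) O).hom.hom.base).obj (O.isOpenEmbedding.functor.obj ⊤) :=
    fun y _ => ⟨y, trivial, rfl⟩
  have h5 := pull_pull (prodD.fst O).hom (restrι (std p q) O).hom h1 (top_le_preimage (prodD.fst O))
  have h4 : (prodD.fst O).hom ≫ (restrι (std p q) O).hom = (prodD.ι O).hom ≫ (pr1 p q 0 1).hom :=
    congrArg (fun k => k.hom) (prodD.fst_ι O)
  have h6 : (⊤ : Opens (prodD O).obj) ≤
      (Opens.map ((prodD.ι O).hom ≫ (pr1 p q 0 1).hom).hom.base).obj (O.isOpenEmbedding.functor.obj ⊤) :=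
    fun y _ => ⟨⟨prL p 0 y.1, y.2⟩, trivial, rfl⟩
  have h9 := pull_congr h4 (le_preimage_comp (prodD.fst O).hom (restrι (std p q) O).hom h1
    (top_le_preimage (prodD.fst O))) h6
  have h10 : pb (prodD.fst O) a = pull ((prodD.ι O).hom ≫ (pr1 p q 0 1).hom) h6 a :=
    (congrArg (fun φ => φ a) h5).trans (congrArg (fun φ => φ a) h9)
  rw [h10]; rfl

theorem evR_snd (O : Opens (std p q).obj) (y : (prodD O).obj) :
    prodD.ev O y (θ (prodD.snd O)) = Grassmann.lastGen q := by
  have h : θ (prodD.snd O) = pb (prodD.ι O) (pb (pr2 p q 0 1) (coordT 0 1 0)) := pb_comp _ _ _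
  rw [h]
  refine (ExteriorAlgebra.map_apply_ι (inR q 1) _).trans ?_
  refine congrArg (fun v => ExteriorAlgebra.ι ℝ (inR q 1 v)) (funext fun i => ?_)
  rw [Subsingleton.elim i 0, Pi.single_eq_same]; rfl

theorem prodD.eq_zero {O : Opens (std p q).obj} {b : Γ (restr (std p q) O)}
    (h : pb (prodD.fst O) b * θ (prodD.snd O) = 0) : b = 0 := by
  refine evR_ext fun v hv => ?_
  let y : (prodD O).obj := ⟨v.1, v.2⟩
  have h1 := congrArg (prodD.ev O y) h
  rw [map_mul, evR_pb_fst, evR_snd, map_zero] at h1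
  have h2 := congrArg (Grassmann.linPart q) h1
  rw [Grassmann.linPart_incl_mul, map_zero] at h2
  rw [map_zero]
  exact h2

/-- A linear map applied to the values of a section of the product with the odd line. -/
def prodD.push (O : Opens (std p q).obj) (L : Grassmann (q + 1) →ₗ[ℝ] Grassmann q)
    (s : smoothSections (p + 0) (q + 1)
      ((preim (pr1 p q 0 1) O).isOpenEmbedding.functor.obj ⊤ : Opens (Fin (p + 0) → ℝ))) :
    smoothSections p q (O.isOpenEmbedding.functor.obj ⊤ : Opens (Fin p → ℝ)) :=
  ⟨fun y => L (s.1 ⟨y.1, by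
      obtain ⟨v, -, hv⟩ := y.2
      exact ⟨⟨v.1, v.2⟩, trivial, hv⟩⟩), by
    refine IsSmooth.linear ?_ L
    exact s.2.comp _ (contMDiff_restrict (ContinuousLinearMap.id ℝ (Fin p → ℝ)) _ _ _)⟩

theorem prodD.exists_lin {O : Opens (std p q).obj} (s : Γ (prodD O)) :
    ∃ a b, s = pb (prodD.fst O) a + pb (prodD.fst O) b * θ (prodD.snd O) := by
  refine ⟨prodD.push O (Grassmann.constPart q).toLinearMap s, prodD.push O (Grassmann.linPart q) s,
    prodD.ev_ext fun y => ?_⟩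
  rw [map_add, map_mul]
  refine Eq.trans ?_ (congrArg₂ (· + ·) (evR_pb_fst O _ y).symm
    (congrArg₂ (· * ·) (evR_pb_fst O _ y).symm (evR_snd O y).symm))
  exact Grassmann.eq_lin _

end SMfd

/-! ### Natural families of functions of odd parameters -/

namespace SMfd

theorem pb_add {S T : SMfd} (f : S ⟶ T) (s t : Γ T) : pb f (s + t) = pb f s + pb f t := map_add _ _ _
theorem pb_sub {S T : SMfd} (f : S ⟶ T) (s t : Γ T) : pb f (s - t) = pb f s - pb f t := map_sub _ _ _
theorem pb_mul {S T : SMfd} (f : S ⟶ T) (s t : Γ T) : pb f (s * t) = pb f s * pb f t := map_mul _ _ _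
theorem pb_zero {S T : SMfd} (f : S ⟶ T) : pb f (0 : Γ T) = 0 := map_zero _
theorem pb_one {S T : SMfd} (f : S ⟶ T) : pb f (1 : Γ T) = 1 := map_one _

/-- A cover by open parts of standard supermanifolds. -/
theorem exists_std_cover (T : SMfd) : ∃ (p q : T.obj → ℕ) (O : ∀ x, Opens (std (p x) (q x)).obj)
    (e : ∀ x, restr (std (p x) (q x)) (O x) ⟶ T), (∀ x, IsOpenImm (e x)) ∧
      ∀ x, ∃ i, x ∈ Set.range (bmap (e i)) := by
  choose p q O e he hx using exists_chart T
  exact ⟨p, q, O, e, he, fun x => ⟨x, hx x⟩⟩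

/-- The test object is the product of a chart with the odd line, where the odd coordinate is
independent of everything coming from `T`. -/
theorem eq_zero_of_mul_θ {T : SMfd} {b : Γ T}
    (h : ∀ (S : SMfd) (d : S ⟶ oddLine) (x : S ⟶ T), pb x b * θ d = 0) : b = 0 := by
  obtain ⟨p, q, O, e, he, hcov⟩ := exists_std_cover T
  refine Γ_ext (ι := T.obj) e hcov fun i => ?_
  rw [pb_zero]
  refine prodD.eq_zero ?_
  rw [← pb_comp]
  exact h _ _ _

/-- The zero parameter isolates the constant terms; a generic parameter then compares the linear
ones. -/
theorem linear_unique {T : SMfd} {a a' b b' : Γ T} (h : ∀ (S : SMfd) (d : S ⟶ oddLine) (x : S ⟶ T),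
    pb x a + pb x b * θ d = pb x a' + pb x b' * θ d) : a = a' ∧ b = b' := by
  have ha : a = a' := by
    obtain ⟨d, hd⟩ := exists_θ (S := T) (Submodule.zero_mem ((Γ T).part 1))
    simpa [hd] using h T d (𝟙 _)
  subst ha
  refine ⟨rfl, sub_eq_zero.1 (eq_zero_of_mul_θ fun S d x => ?_)⟩
  rw [pb_sub, sub_mul, sub_eq_zero]
  exact add_left_cancel (h S d x)

/-- Functions are morphisms to `ℝ^{1|1}`. -/
theorem exists_hom_of_Γ {S : SMfd} (s : Γ S) : ∃ g : S ⟶ std 1 1,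
    pb g (coordX 1 1 0 + coordT 1 1 0) = s := by
  obtain ⟨a, ha, b, hb, rfl⟩ := (Γ S).exists_parts s
  obtain ⟨g, hx, ht⟩ := exists_hom_std (p := 1) (q := 1) (fun _ => a) (fun _ => b) (fun _ => ha)
    fun _ => hb
  exact ⟨g, by rw [pb_add, hx, ht]⟩

theorem parts_unique (A : SuperAlg) {a a' b b' : A} (ha : a ∈ A.part 0) (ha' : a' ∈ A.part 0)
    (hb : b ∈ A.part 1) (hb' : b' ∈ A.part 1) (h : a + b = a' + b') : a = a' ∧ b = b' := by
  have h1 : a - a' = b' - b := by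
    rw [sub_eq_iff_eq_add, sub_add_eq_add_sub, eq_sub_iff_add_eq, h, add_comm]
  have h2 : a - a' = 0 := Submodule.disjoint_def.1 A.isCompl.disjoint _ (sub_mem ha ha')
    (h1 ▸ sub_mem hb' hb)
  exact ⟨sub_eq_zero.1 h2, (sub_eq_zero.1 (h1 ▸ h2)).symm⟩

theorem hom_eq_of_Γ {S : SMfd} {g g' : S ⟶ std 1 1}
    (h : pb g (coordX 1 1 0 + coordT 1 1 0) = pb g' (coordX 1 1 0 + coordT 1 1 0)) : g = g' := by
  rw [pb_add, pb_add] at h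
  obtain ⟨h1, h2⟩ := parts_unique _ (pb_mem _ (coordX_mem _ _ _)) (pb_mem _ (coordX_mem _ _ _))
    (pb_mem _ (coordT_mem _ _ _)) (pb_mem _ (coordT_mem _ _ _)) h
  exact std_hom_ext (fun i => by rw [Subsingleton.elim i 0, h1])
    fun i => by rw [Subsingleton.elim i 0, h2]

theorem Γ_glue {T : SMfd} {ι : Type} {E : ι → SMfd} (e : ∀ i, E i ⟶ T) [∀ i, IsOpenImm (e i)]
    (hcov : ∀ x, ∃ i, x ∈ Set.range (bmap (e i))) (s : ∀ i, Γ (E i))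
    (h : ∀ (i j : ι) (S : SMfd) (a : S ⟶ E i) (b : S ⟶ E j), a ≫ e i = b ≫ e j →
      pb a (s i) = pb b (s j)) : ∃ t : Γ T, ∀ i, pb (e i) t = s i := by
  choose g hg using fun i => exists_hom_of_Γ (s i)
  obtain ⟨k, hk⟩ := exists_glue e hcov g fun i j S a b hab => hom_eq_of_Γ (by
    rw [pb_comp, pb_comp, hg, hg, h i j S a b hab])
  exact ⟨pb k (coordX 1 1 0 + coordT 1 1 0), fun i => by rw [← pb_comp, hk, hg]⟩

/-- By naturality, over a chart the family is determined by its value on the two projections of the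
product of the chart with the odd line, and a function there has the form a + bθ. Uniqueness of the
coefficients lets them glue. -/
theorem exists_linear {T : SMfd} (c : ∀ {S : SMfd}, (S ⟶ oddLine) → (S ⟶ T) → Γ S)
    (hc : ∀ {S S' : SMfd} (u : S' ⟶ S) (d : S ⟶ oddLine) (x : S ⟶ T),
      c (u ≫ d) (u ≫ x) = pb u (c d x)) :
    ∃ a b : Γ T, ∀ {S : SMfd} (d : S ⟶ oddLine) (x : S ⟶ T), c d x = pb x a + pb x b * θ d := by
  obtain ⟨p, q, O, e, he, hcov⟩ := exists_std_cover T
  choose a b hab using fun i => prodD.exists_lin (c (prodD.snd (O i)) (prodD.fst (O i) ≫ e i))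
  have key : ∀ i {S : SMfd} (u : S ⟶ restr (std (p i) (q i)) (O i)) (d : S ⟶ oddLine),
      c d (u ≫ e i) = pb u (a i) + pb u (b i) * θ d := fun i S u d => by
    obtain ⟨v, rfl, rfl⟩ := prodD.exists_lift u d
    rw [Category.assoc, hc, hab, pb_add, pb_mul, pb_comp, pb_comp, pb_θ]
  have hcompat : ∀ (i j : T.obj) (S : SMfd) (u : S ⟶ restr (std (p i) (q i)) (O i))
      (v : S ⟶ restr (std (p j) (q j)) (O j)), u ≫ e i = v ≫ e j →
      pb u (a i) = pb v (a j) ∧ pb u (b i) = pb v (b j) := fun i j S u v huv => by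
    refine linear_unique fun R d x => ?_
    rw [← pb_comp, ← pb_comp, ← pb_comp, ← pb_comp, ← key, ← key, Category.assoc, huv, Category.assoc]
  obtain ⟨A, hA⟩ := Γ_glue (ι := T.obj) e hcov a fun i j S u v h => (hcompat i j S u v h).1
  obtain ⟨B, hB⟩ := Γ_glue (ι := T.obj) e hcov b fun i j S u v h => (hcompat i j S u v h).2
  refine ⟨A, B, fun {S} d x => ?_⟩
  have hcov' : ∀ y, ∃ i : T.obj, y ∈ Set.range (bmap (restrι S (preim x (opensRange (e i))))) :=
    fun y => by
      obtain ⟨i, hi⟩ := hcov (bmap x y)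
      exact ⟨i, ⟨y, hi⟩, rfl⟩
  refine Γ_ext (ι := T.obj) (fun i => restrι S (preim x (opensRange (e i)))) hcov' fun i => ?_
  let r := restrι S (preim x (opensRange (e i)))
  have hr : ∀ y, bmap (r ≫ x) y ∈ Set.range (bmap (e i)) := fun y => y.2
  obtain ⟨l, hl⟩ : ∃ l, l ≫ e i = r ≫ x := ⟨lift (e i) (r ≫ x) hr, lift_fac _ _ _⟩
  change pb r (c d x) = pb r (pb x A + pb x B * θ d)
  rw [← hc, ← hl, key, pb_add, pb_mul, ← pb_comp, ← pb_comp, ← hl, pb_comp, pb_comp, hA, hB, pb_θ]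

/-- Natural families of functions depending on `k` odd parameters and a morphism to `T`. -/
def NatFam (k : ℕ) (T : SMfd) (c : ∀ {S : SMfd}, (Fin k → (S ⟶ oddLine)) → (S ⟶ T) → Γ S) : Prop :=
  ∀ {S S' : SMfd} (u : S' ⟶ S) (d : Fin k → (S ⟶ oddLine)) (x : S ⟶ T),
    c (fun i => u ≫ d i) (u ≫ x) = pb u (c d x)

theorem comp_snoc {k : ℕ} {S S' : SMfd} (u : S' ⟶ S) (d : Fin k → (S ⟶ oddLine)) (e : S ⟶ oddLine) :
    (fun i => u ≫ (Fin.snoc d e : Fin (k + 1) → (S ⟶ oddLine)) i) =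
      (Fin.snoc (fun i => u ≫ d i) (u ≫ e) : Fin (k + 1) → (S' ⟶ oddLine)) := by
  funext i
  refine Fin.lastCases ?_ (fun i => ?_) i <;> simp

/-- `exists_linear` is applied in the last parameter with the others fixed; naturality of the
coefficients in the remaining parameters comes from their uniqueness. -/
theorem exists_linear_last {k : ℕ} {T : SMfd}
    (c : ∀ {S : SMfd}, (Fin (k + 1) → (S ⟶ oddLine)) → (S ⟶ T) → Γ S) (hc : NatFam (k + 1) T c) :
    ∃ a b : ∀ {S : SMfd}, (Fin k → (S ⟶ oddLine)) → (S ⟶ T) → Γ S, NatFam k T a ∧ NatFam k T b ∧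
      ∀ {S : SMfd} (d : Fin k → (S ⟶ oddLine)) (e : S ⟶ oddLine) (x : S ⟶ T),
        c (Fin.snoc d e : Fin (k + 1) → (S ⟶ oddLine)) x = a d x + b d x * θ e := by
  have h : ∀ {S : SMfd} (d : Fin k → (S ⟶ oddLine)) (x : S ⟶ T), ∃ a b : Γ S,
      ∀ {S' : SMfd} (e : S' ⟶ oddLine) (u : S' ⟶ S),
        c (Fin.snoc (fun i => u ≫ d i) e : Fin (k + 1) → (S' ⟶ oddLine)) (u ≫ x) =
          pb u a + pb u b * θ e := fun {S} d x =>
    exists_linear (fun {S'} e u => c (Fin.snoc (fun i => u ≫ d i) e : Fin (k + 1) → (S' ⟶ oddLine)) (u ≫ x))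
      fun {S' S''} v e u => by
        rw [← hc, comp_snoc]
        simp only [Category.assoc]
  choose a b hab using @h
  have hn : ∀ {S S' : SMfd} (u : S' ⟶ S) (d : Fin k → (S ⟶ oddLine)) (x : S ⟶ T),
      a (fun i => u ≫ d i) (u ≫ x) = pb u (a d x) ∧ b (fun i => u ≫ d i) (u ≫ x) = pb u (b d x) :=
    fun {S S'} u d x => linear_unique fun R e v => by
      rw [← hab, ← pb_comp, ← pb_comp, ← hab]
      simp only [Category.assoc]
  refine ⟨a, b, fun u d x => (hn u d x).1, fun u d x => (hn u d x).2, fun d e x => ?_⟩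
  have := hab d x e (𝟙 _)
  simpa using this

/-- The product of the odd parameters. -/
def thetas {k : ℕ} {S : SMfd} (d : Fin k → (S ⟶ oddLine)) : Γ S :=
  (List.ofFn fun i => θ (d i)).prod

theorem thetas_zero {S : SMfd} (d : Fin 0 → (S ⟶ oddLine)) : thetas d = 1 := by
  rw [thetas, List.ofFn_zero, List.prod_nil]

theorem thetas_succ {k : ℕ} {S : SMfd} (d : Fin (k + 1) → (S ⟶ oddLine)) :
    thetas d = thetas (Fin.init d) * θ (d (Fin.last _)) := by
  rw [thetas, List.ofFn_succ', List.concat_eq_append, List.prod_append, List.prod_singleton]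
  rfl

theorem thetas_snoc {k : ℕ} {S : SMfd} (d : Fin k → (S ⟶ oddLine)) (e : S ⟶ oddLine) :
    thetas (Fin.snoc d e : Fin (k + 1) → (S ⟶ oddLine)) = thetas d * θ e := by
  rw [thetas_succ, Fin.init_snoc, Fin.snoc_last]

theorem pb_thetas {k : ℕ} {S S' : SMfd} (u : S' ⟶ S) (d : Fin k → (S ⟶ oddLine)) :
    pb u (thetas d) = thetas (fun i => u ≫ d i) := by
  induction k with
  | zero => rw [thetas_zero, thetas_zero, pb_one]
  | succ k ih => rw [thetas_succ, thetas_succ, pb_mul, pb_θ, ih]; rfl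

theorem thetas_mem {k : ℕ} {S : SMfd} (d : Fin k → (S ⟶ oddLine)) : thetas d ∈ (Γ S).part k := by
  induction k with
  | zero => rw [thetas_zero]; exact (Nat.cast_zero (R := ZMod 2)).symm ▸ (SetLike.GradedOne.one_mem : (1 : Γ S) ∈ (Γ S).part 0)
  | succ k ih => rw [thetas_succ]; exact (Γ S).mul_mem_part (by push_cast; rfl) (ih _) (θ_mem _)

theorem eq_zero_of_mul_thetas {k : ℕ} {T : SMfd} {v : Γ T}
    (h : ∀ (S : SMfd) (d : Fin k → (S ⟶ oddLine)) (x : S ⟶ T), pb x v * thetas d = 0) : v = 0 := by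
  induction k with
  | zero => simpa [thetas_zero] using h T (fun i => i.elim0) (𝟙 _)
  | succ k ih =>
    refine ih fun S d x => eq_zero_of_mul_θ fun R e u => ?_
    have := h R (Fin.snoc (fun i => u ≫ d i) e) (u ≫ x)
    rwa [thetas_snoc, ← mul_assoc, pb_comp, ← pb_thetas, ← pb_mul] at this

theorem θ_mul_self {S : SMfd} (d : S ⟶ oddLine) : θ d * θ d = 0 := by
  have h := (Γ S).supercomm 1 1 _ _ (θ_mem d) (θ_mem d)
  have e : ((-1 : ℤˣ) ^ ((1 : ZMod 2) * 1)) = -1 := by rw [mul_one]; exact uzpow_one _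
  rw [e, Units.neg_smul, one_smul, eq_neg_iff_add_eq_zero, ← two_smul ℝ] at h
  exact (smul_eq_zero.1 h).resolve_left two_ne_zero

theorem linear_eq_zero {S : SMfd} {a b : Γ S} (h : ∀ {S' : SMfd} (u : S' ⟶ S) (e : S' ⟶ oddLine),
    pb u a + pb u b * θ e = 0) : a = 0 ∧ b = 0 :=
  linear_unique fun S' e u => by rw [h, pb_zero, zero_mul, zero_add]

/-- A family vanishing on degenerate parameters is a multiple of the product of the parameters. -/
theorem exists_top {k : ℕ} {T : SMfd}
    (c : ∀ {S : SMfd}, (Fin k → (S ⟶ oddLine)) → (S ⟶ T) → Γ S) (hc : NatFam k T c)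
    (h0 : ∀ {S : SMfd} (d : Fin k → (S ⟶ oddLine)) (x : S ⟶ T) (i : Fin k), i.1 = 0 → θ (d i) = 0 →
      c d x = 0)
    (h1 : ∀ {S : SMfd} (d : Fin k → (S ⟶ oddLine)) (x : S ⟶ T) (i j : Fin k), j.1 = i.1 + 1 → d i = d j →
      c d x = 0) :
    ∃ v : Γ T, ∀ {S : SMfd} (d : Fin k → (S ⟶ oddLine)) (x : S ⟶ T), c d x = pb x v * thetas d := by
  induction k with
  | zero =>
    refine ⟨c (fun i => i.elim0) (𝟙 _), fun d x => ?_⟩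
    rw [← hc, Category.comp_id, thetas_zero, mul_one]
    congr 1
    exact Subsingleton.elim _ _
  | succ k ih =>
    obtain ⟨a, b, ha, hb, hab⟩ := exists_linear_last c hc
    have hz : ∀ {S : SMfd} (d : Fin k → (S ⟶ oddLine)) (x : S ⟶ T),
        (∀ {S' : SMfd} (u : S' ⟶ S) (e : S' ⟶ oddLine),
          c (Fin.snoc (fun i => u ≫ d i) e : Fin (k + 1) → (S' ⟶ oddLine)) (u ≫ x) = 0) →
        a d x = 0 ∧ b d x = 0 := fun d x h => linear_eq_zero fun u e => by
      rw [← ha, ← hb, ← hab, h]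
    have hz0 : ∀ {S : SMfd} (d : Fin k → (S ⟶ oddLine)) (x : S ⟶ T) (i : Fin k), i.1 = 0 →
        θ (d i) = 0 → a d x = 0 ∧ b d x = 0 := fun d x i hi hd => hz d x fun u e =>
      h0 _ _ i.castSucc hi (by simp [← pb_θ, hd])
    have hz1 : ∀ {S : SMfd} (d : Fin k → (S ⟶ oddLine)) (x : S ⟶ T) (i j : Fin k), j.1 = i.1 + 1 →
        d i = d j → a d x = 0 ∧ b d x = 0 := fun d x i j hi hd => hz d x fun u e =>
      h1 _ _ i.castSucc j.castSucc hi (by simp [hd])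
    obtain ⟨v, hv⟩ := ih b hb (fun d x i hi hd => (hz0 d x i hi hd).2)
      fun d x i j hi hd => (hz1 d x i j hi hd).2
    obtain ⟨w, hw⟩ := ih a ha (fun d x i hi hd => (hz0 d x i hi hd).1)
      fun d x i j hi hd => (hz1 d x i j hi hd).1
    -- Let the last parameter equal the one before it, or zero if there is none. Then the family
    -- vanishes by assumption, and the linear term vanishes since it contains the square of an odd
    -- function or the factor zero.
    have ha0 : ∀ {S : SMfd} (d : Fin k → (S ⟶ oddLine)) (x : S ⟶ T), a d x = 0 := by
      intro S d x
      rcases k with _ | k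
      · obtain ⟨e, he⟩ := exists_θ (S := S) (Submodule.zero_mem ((Γ S).part 1))
        have := hab d e x
        rw [h0 _ x (Fin.last 0) rfl ((congrArg θ (Fin.snoc_last (α := fun _ => S ⟶ oddLine) e d)).trans he), he, mul_zero, add_zero] at this
        exact this.symm
      · have := hab d (d (Fin.last k)) x
        rw [h1 _ x (Fin.last k).castSucc (Fin.last (k + 1)) rfl (by simp), hv, thetas_succ, mul_assoc,
          mul_assoc, θ_mul_self, mul_zero, mul_zero, add_zero] at this
        exact this.symm
    refine ⟨v, fun d x => ?_⟩
    rw [← Fin.snoc_init_self d, hab, ha0, zero_add, hv, thetas_snoc, mul_assoc]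

/-- The coefficient of a homogeneous family is homogeneous. -/
theorem top_mem {k : ℕ} {T : SMfd} {v : Γ T} {i : ZMod 2}
    (h : ∀ (S : SMfd) (d : Fin k → (S ⟶ oddLine)) (x : S ⟶ T), pb x v * thetas d ∈ (Γ S).part i) :
    v ∈ (Γ T).part (i + k) := by
  obtain ⟨a, ha, b, hb, rfl⟩ := (Γ T).exists_parts v
  have hcase : ∀ j : ZMod 2, j = 0 ∨ j = 1 := by decide
  have hka : ∀ (S : SMfd) (d : Fin k → (S ⟶ oddLine)) (x : S ⟶ T),
      pb x a * thetas d ∈ (Γ S).part k := fun S d x =>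
    (Γ S).mul_mem_part (zero_add _) (pb_mem x ha) (thetas_mem d)
  have hkb : ∀ (S : SMfd) (d : Fin k → (S ⟶ oddLine)) (x : S ⟶ T),
      pb x b * thetas d ∈ (Γ S).part (1 + k) := fun S d x =>
    (Γ S).mul_mem_part rfl (pb_mem x hb) (thetas_mem d)
  have hd : ∀ {S : SMfd} {j : ZMod 2} {s : Γ S}, s ∈ (Γ S).part j → s ∈ (Γ S).part (j + 1) → s = 0 := by
    intro S j s h1 h2
    rcases hcase j with rfl | rfl
    · exact Submodule.disjoint_def.1 (Γ S).isCompl.disjoint _ h1 h2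
    · exact Submodule.disjoint_def.1 (Γ S).isCompl.disjoint _ h2 h1
  have htwo : ∀ j : ZMod 2, j + j = 0 := by decide
  have hone : (1 : ZMod 2) + 1 = 0 := by decide
  rcases hcase (i + k) with hik | hik
  · have hi : i = k := by linear_combination hik - htwo k
    have : b = 0 := eq_zero_of_mul_thetas (k := k) fun S d x => hd (j := k) (by
      have := sub_mem (h S d x) (hi ▸ hka S d x)
      rw [← sub_mul, pb_add, add_sub_cancel_left] at this
      exact hi ▸ this) (by rw [add_comm]; exact hkb S d x)
    rw [this, add_zero, hik]; exact ha
  · have hi : i = 1 + k := by linear_combination hik - htwo k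
    have : a = 0 := eq_zero_of_mul_thetas (k := k) fun S d x => hd (j := k) (hka S d x) (by
      have := sub_mem (h S d x) (hi ▸ hkb S d x)
      rw [← sub_mul, pb_add, add_sub_cancel_right] at this
      rw [add_comm]; exact hi ▸ this)
    rw [this, zero_add, hik]; exact hb

end SMfd

theorem Grassmann.eq_algebraMap (x : Grassmann 0) : x = algebraMap ℝ _ (Grassmann.body 0 x) := by
  have h := Grassmann.pow_eq_zero (r := 0) (x := x - algebraMap ℝ _ (Grassmann.body 0 x))
    (by rw [map_sub, Grassmann.body_algebraMap, sub_self])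
  rw [zero_add, pow_one] at h
  exact sub_eq_zero.1 h

theorem Grassmann.odd_eq_zero {x : Grassmann 0} (hx : x ∈ Grassmann.part 0 1) : x = 0 := by
  refine Submodule.disjoint_def.1
    (CliffordAlgebra.evenOdd_isCompl (0 : QuadraticForm ℝ (Fin 0 → ℝ))).disjoint _ ?_ hx
  rw [Grassmann.eq_algebraMap x, Algebra.algebraMap_eq_smul_one]
  exact Submodule.smul_mem _ _ (SetLike.GradedOne.one_mem (A := Grassmann.part 0))

namespace SMfd

/-! ### Points -/

/-- The one-point supermanifold. -/
def pt : SMfd := restr (std 0 0) ⊤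

/-- The point of `pt`. -/
def pt.default : pt.obj := ⟨fun i => i.elim0, trivial⟩

theorem pt.eq_default (z : pt.obj) : z = pt.default := Subtype.ext (funext fun i => i.elim0)

/-- The inclusion of a point of `ℝ^{p|q}`. -/
def stdPoint {p : ℕ} (q : ℕ) (v : Fin p → ℝ) : std 0 0 ⟶ std p q :=
  ObjectProperty.homMk (InducedCategory.homMk
    { base := TopCat.ofHom ⟨fun _ => v, continuous_const⟩
      c :=
        { app := fun U => stdSections.pull
            (V := (Opens.map (TopCat.ofHom (⟨fun _ => v, continuous_const⟩ :
              C((Fin 0 → ℝ), (Fin p → ℝ))))).obj U.unop)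
            (fun x => ⟨v, x.2⟩) ((ContMDiff.subtypeVal_comp_iff _ _).1 contMDiff_const)
            (ExteriorAlgebra.map 0) (map_mem_part 0)
          naturality := fun _ _ _ => rfl } })

theorem exists_point (T : SMfd) (x : T.obj) : ∃ u : pt ⟶ T, ∀ z, bmap u z = x := by
  obtain ⟨p, q, O, e, he, y, rfl⟩ := exists_chart T x
  have h : ∀ z, bmap (restrι (std 0 0) ⊤ ≫ stdPoint q y.1) z ∈ Set.range (bmap (restrι (std p q) O)) :=
    fun z => ⟨y, (bmap_comp (restrι (std 0 0) ⊤) (stdPoint q y.1) z).symm⟩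
  refine ⟨lift (restrι (std p q) O) (restrι (std 0 0) ⊤ ≫ stdPoint q y.1) h ≫ e, fun z => ?_⟩
  rw [bmap_comp]
  congr 1
  exact (IsOpenImm.isOpenEmbedding (restrι (std p q) O)).injective (bmap_lift _ _ h _)

theorem restr_odd_eq_zero {p : ℕ} {O : Opens (std p 0).obj} {s : Γ (restr (std p 0) O)}
    (hs : s ∈ (Γ (restr (std p 0) O)).part 1) : s = 0 := by
  refine Subtype.ext (funext fun y => ?_)
  exact Grassmann.odd_eq_zero (hs y)

/-- On the one-point supermanifold odd functions vanish and even ones are real numbers; in a chart,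
the values of the even coordinates are those of the underlying point. -/
theorem pt_hom_ext {T : SMfd} {u u' : pt ⟶ T} (h : bmap u pt.default = bmap u' pt.default) : u = u' := by
  obtain ⟨p, q, O, e, he, hy⟩ := exists_chart T (bmap u pt.default)
  have h1 : ∀ z, bmap u z ∈ Set.range (bmap e) := fun z => by rw [pt.eq_default z]; exact hy
  have h2 : ∀ z, bmap u' z ∈ Set.range (bmap e) := fun z => by rw [pt.eq_default z, ← h]; exact hy
  have h3 : lift e u h1 = lift e u' h2 := by
    rw [← cancel_mono (restrι (std p q) O)]
    set a := lift e u h1 ≫ restrι (std p q) O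
    set b := lift e u' h2 ≫ restrι (std p q) O
    have hab : bmap a pt.default = bmap b pt.default := by
      rw [bmap_comp, bmap_comp]
      congr 1
      refine (IsOpenImm.isOpenEmbedding e).injective ?_
      rw [bmap_lift, bmap_lift, h]
    refine std_hom_ext (fun i => ?_) fun j => ?_
    · refine evR_ext fun v _ => ?_
      rw [pt.eq_default v]
      have ha := (gpoint a pt.default).body_coord i
      have hb := (gpoint b pt.default).body_coord i
      refine (Grassmann.eq_algebraMap _).trans (Eq.trans (congrArg _ ?_) (Grassmann.eq_algebraMap _).symm)
      exact ha.trans ((congrFun hab i).trans hb.symm)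
    · exact (restr_odd_eq_zero (pb_mem a (coordT_mem _ _ _))).trans
        (restr_odd_eq_zero (pb_mem b (coordT_mem _ _ _))).symm
  rw [← lift_fac e u h1, h3, lift_fac]

/-! ### Manifolds -/

/-- The purely even dimensions. -/
abbrev Even : ℕ → ℕ → Prop := fun _ q => q = 0

theorem Even.add (a b s t : ℕ) (h : Even a b) (h' : Even s t) : Even (a + s) (b + t) := by
  subst h h'; rfl

theorem odd_eq_zero {M : SMfd} (hM : HasCharts Even M.obj) {s : Γ M} (hs : s ∈ (Γ M).part 1) :
    s = 0 := by
  choose p q O e hq he hx using exists_chart_of hM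
  refine Γ_ext (ι := M.obj) e (fun x => ⟨x, hx x⟩) fun x => ?_
  rw [pb_zero]
  have hs' := pb_mem (e x) hs
  generalize pb (e x) s = t at hs' ⊢
  have := hq x
  revert t
  generalize O x = O
  generalize q x = r at O this
  subst this
  intro t ht
  exact restr_odd_eq_zero ht

/-- An odd coordinate would be a nonzero odd function on an open part of a purely even
supermanifold. -/
theorem odd_dim_eq_zero {m r : ℕ} {O : Opens (std m r).obj} {M : SMfd}
    (hM : HasCharts Even M.obj) (e : restr (std m r) O ⟶ M) [IsOpenImm e]
    (y : (restr (std m r) O).obj) : r = 0 := by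
  by_contra hr
  have h1 : HasCharts Even (restr (std m r) O).obj := hM.of_isOpenImmersion e.hom
  let j : Fin r := ⟨0, Nat.pos_of_ne_zero hr⟩
  have h2 := odd_eq_zero h1 (pb_mem (restrι (std m r) O) (coordT_mem m r j))
  have h3 := congrArg (evR (O := O) ⊤ y trivial) h2
  rw [map_zero] at h3
  have h4 : ExteriorAlgebra.ι ℝ (Pi.single j 1 : Fin r → ℝ) = 0 := h3
  rw [ExteriorAlgebra.ι_eq_zero_iff] at h4
  simpa using congrFun h4 j

theorem parity_comp {S T : SMfd} (f : S ⟶ T) : S.parity ≫ f = f ≫ T.parity := by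
  refine ObjectProperty.hom_ext _ (hom_ext_pull ?_ ?_)
  · rfl
  · intro V W h h'
    have h1 := pull_pull S.parity.hom f.hom (W := W) (V := W) (U := V) h' le_rfl
    have h2 := pull_pull f.hom T.parity.hom (W := W) (V := V) (U := V) le_rfl h
    refine h1.symm.trans (Eq.trans ?_ h2)
    have h3 : pull S.parity.hom (W := W) (V := W) le_rfl = (S.obj.presheaf.obj (op W)).parity :=
      (congrArg _ (res_self _)).trans (Category.comp_id _)
    have h4 : pull T.parity.hom (W := V) (V := V) le_rfl = (T.obj.presheaf.obj (op V)).parity :=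
      (congrArg _ (res_self _)).trans (Category.comp_id _)
    rw [h3, h4]
    exact SuperAlg.parity_naturality _

theorem pb_parity {S : SMfd} (s : Γ S) : pb S.parity s = (Γ S).parityLin s := by
  have h : pb S.parity = (Γ S).parity := (congrArg _ (res_self _)).trans (Category.comp_id _)
  rw [h]; rfl

theorem parity_eq_id {M : SMfd} (hM : HasCharts Even M.obj) : M.parity = 𝟙 M := by
  choose p q O e hq he hx using exists_chart_of hM
  refine hom_ext_of_cover (ι := ULift.{0} M.obj) (fun x => e x.down) (fun x => ⟨⟨x⟩, hx x⟩)
    fun x => ?_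
  rw [← parity_comp, Category.comp_id]
  have h1 : HasCharts Even (restr (std _ _) (O x.down)).obj := hM.of_isOpenImmersion (e x.down).hom
  have : (restr (std _ _) (O x.down)).parity = 𝟙 _ := by
    rw [← cancel_mono (restrι (std _ _) (O x.down)), Category.id_comp]
    refine std_hom_ext (fun i => ?_) fun i => ?_
    · rw [pb_comp, pb_parity, SuperAlg.parityLin_even _ (pb_mem _ (coordX_mem _ _ _))]
    · rw [pb_comp, odd_eq_zero h1 (pb_mem _ (coordT_mem _ _ _)), pb_zero]
  rw [this, Category.id_comp]

end SMfd

/-! ### Submersions on the level of T-points, and fibre products -/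

namespace SMfd

/-- Fibre coordinates of `f` near `x`: on an open neighbourhood `E` of `x`, morphisms `u` to `E` are
locally the same as pairs of a morphism to `H` and a morphism to `ℝ^{s|t}`. -/
structure SubChart (S : ℕ → ℕ → Prop) {X H : SMfd} (f : X ⟶ H) (x : X.obj) where
  E : SMfd
  e : E ⟶ X
  isOpenImm : IsOpenImm e
  mem : x ∈ Set.range (bmap e)
  s : ℕ
  t : ℕ
  dim : S s t
  c : E ⟶ std s t
  inj : ∀ {T : SMfd} (u u' : T ⟶ E), u ≫ e ≫ f = u' ≫ e ≫ f → u ≫ c = u' ≫ c → u = u'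
  exists_lift : ∀ (y : E.obj) {T : SMfd} (a : T ⟶ H) (γ : T ⟶ std s t) (τ : T.obj),
    bmap a τ = bmap (e ≫ f) y → bmap γ τ = bmap c y →
    ∃ (E' : SMfd) (i : E' ⟶ T) (_ : IsOpenImm i) (τ' : E'.obj) (u : E' ⟶ E), bmap i τ' = τ ∧
      u ≫ e ≫ f = i ≫ a ∧ u ≫ c = i ≫ γ

attribute [instance] SubChart.isOpenImm

/-- `f` has fibre coordinates near all points. -/
def IsSub (S : ℕ → ℕ → Prop) {X H : SMfd} (f : X ⟶ H) : Prop := ∀ x, Nonempty (SubChart S f x)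

variable {S : ℕ → ℕ → Prop} {X Y H : SMfd}

namespace SubChart
variable {f : X ⟶ H} {x : X.obj}

theorem point_inj (K : SubChart S f x) {y y' : K.E.obj} (h : bmap (K.e ≫ f) y = bmap (K.e ≫ f) y')
    (h' : bmap K.c y = bmap K.c y') : y = y' := by
  obtain ⟨u, hu⟩ := exists_point K.E y
  obtain ⟨u', hu'⟩ := exists_point K.E y'
  have : u = u' := K.inj u u' (pt_hom_ext (by rw [bmap_comp u, bmap_comp u', hu, hu', h]))
    (pt_hom_ext (by rw [bmap_comp u, bmap_comp u', hu, hu', h']))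
  rw [← hu pt.default, this, hu']

/-- Points of the chart are determined by their image in `H` and their coordinates, so a lift
automatically passes through `y`. This is what allows lifts through successive submersions to be
chained. -/
theorem exists_lift_at (K : SubChart S f x) (y : K.E.obj) {T : SMfd} (a : T ⟶ H) (γ : T ⟶ std K.s K.t)
    (τ : T.obj) (ha : bmap a τ = bmap (K.e ≫ f) y) (hγ : bmap γ τ = bmap K.c y) :
    ∃ (E' : SMfd) (i : E' ⟶ T) (_ : IsOpenImm i) (τ' : E'.obj) (u : E' ⟶ K.E), bmap i τ' = τ ∧
      u ≫ K.e ≫ f = i ≫ a ∧ u ≫ K.c = i ≫ γ ∧ bmap u τ' = y := by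
  obtain ⟨E', i, hi, τ', u, rfl, h1, h2⟩ := K.exists_lift y a γ τ ha hγ
  refine ⟨E', i, hi, τ', u, rfl, h1, h2, K.point_inj ?_ ?_⟩
  · rw [← bmap_comp, h1, bmap_comp, ha]
  · rw [← bmap_comp, h2, bmap_comp, hγ]

end SubChart

theorem IsSub.of_isIso (hS : S 0 0) (f : X ⟶ H) [IsIso f] : IsSub S f := fun x => by
  have hc : ∀ {T : SMfd} (a b : T ⟶ std 0 0), a = b := fun a b =>
    std_hom_ext (fun i => i.elim0) fun i => i.elim0
  obtain ⟨g, -, -⟩ := exists_hom_std (S := X) (p := 0) (q := 0) (fun i => i.elim0) (fun i => i.elim0)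
    (fun i => i.elim0) fun i => i.elim0
  exact ⟨{ E := X, e := 𝟙 X, isOpenImm := inferInstance, mem := ⟨x, rfl⟩, s := 0, t := 0, dim := hS,
           c := g
           inj := fun u u' h _ => by rw [← cancel_mono f]; simpa using h
           exists_lift := fun y T a γ τ ha _ => ⟨T, 𝟙 T, inferInstance, τ, a ≫ inv f, rfl, by simp,
             hc _ _⟩ }⟩

/-- The fibre coordinates of the composite are those of `f` together with those of `g` pulled back
along `f`. A lift is found first in `Y` and then, after shrinking, in `X`. -/
theorem IsSub.comp (hS : ∀ a b s t, S a b → S s t → S (a + s) (b + t)) {f : X ⟶ Y} {g : Y ⟶ H}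
    (hf : IsSub S f) (hg : IsSub S g) : IsSub S (f ≫ g) := fun x => by
  obtain ⟨F⟩ := hf x
  obtain ⟨G⟩ := hg (bmap f x)
  let O := preim (F.e ≫ f) (opensRange G.e)
  let r := restrι F.E O
  obtain ⟨l, hl⟩ : ∃ l : restr F.E O ⟶ G.E, l ≫ G.e = r ≫ F.e ≫ f :=
    ⟨lift G.e (r ≫ F.e ≫ f) fun y => y.2, lift_fac _ _ _⟩
  obtain ⟨c, hc1, hc2⟩ := exists_pair (r ≫ F.c) (l ≫ G.c)
  refine ⟨{ E := restr F.E O, e := r ≫ F.e, isOpenImm := inferInstance, mem := ?_,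
            s := F.s + G.s, t := F.t + G.t, dim := hS _ _ _ _ F.dim G.dim, c := c,
            inj := ?_, exists_lift := ?_ }⟩
  · obtain ⟨y, hy⟩ := F.mem
    have : y ∈ Set.range (bmap r) := by
      rw [range_restrι]
      change bmap (F.e ≫ f) y ∈ Set.range (bmap G.e)
      rw [bmap_comp, hy]; exact G.mem
    obtain ⟨z, rfl⟩ := this
    exact ⟨z, by rw [bmap_comp, hy]⟩
  · intro T u u' h h'
    have h1 : u ≫ r ≫ F.c = u' ≫ r ≫ F.c := by
      rw [← hc1, ← Category.assoc, h', Category.assoc]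
    have h2 : u ≫ l ≫ G.c = u' ≫ l ≫ G.c := by
      rw [← hc2, ← Category.assoc, h', Category.assoc]
    have h3 : u ≫ l = u' ≫ l := G.inj _ _ (by
      simp only [Category.assoc, reassoc_of% hl] at h ⊢; exact h) (by simpa using h2)
    rw [← cancel_mono r]
    refine F.inj _ _ ?_ (by simpa using h1)
    rw [Category.assoc, Category.assoc, ← hl, ← Category.assoc, h3, Category.assoc]
  · intro y T a γ τ ha hγ
    obtain ⟨E₁, i₁, hi₁, τ₁, u₁, rfl, h1, h2, h3⟩ := G.exists_lift_at (bmap l y) a (γ ≫ pr2 _ _ _ _) τ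
      (by rw [ha, ← bmap_comp]; simp only [Category.assoc, reassoc_of% hl])
      (by rw [bmap_comp, hγ, ← bmap_comp, ← bmap_comp, hc2])
    obtain ⟨E₂, i₂, hi₂, τ₂, u₂, rfl, k1, k2, k3⟩ := F.exists_lift_at (bmap r y) (u₁ ≫ G.e)
      (i₁ ≫ γ ≫ pr1 _ _ _ _) τ₁
      (by rw [bmap_comp, h3, ← bmap_comp, ← bmap_comp, hl])
      (by rw [← bmap_comp, bmap_comp, bmap_comp, hγ, ← bmap_comp, hc1])
    have hr : ∀ z, bmap u₂ z ∈ Set.range (bmap r) := fun z => by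
      rw [range_restrι]
      change bmap (F.e ≫ f) (bmap u₂ z) ∈ Set.range (bmap G.e)
      rw [← bmap_comp, k1, ← Category.assoc, bmap_comp]
      exact ⟨_, rfl⟩
    obtain ⟨v, hv⟩ : ∃ v, v ≫ r = u₂ := ⟨lift r u₂ hr, lift_fac _ _ _⟩
    have hvl : v ≫ l = i₂ ≫ u₁ := by
      rw [← cancel_mono G.e, Category.assoc, hl, reassoc_of% hv, k1, Category.assoc]
    refine ⟨E₂, i₂ ≫ i₁, inferInstance, τ₂, v, bmap_comp _ _ _, ?_, pair_ext ?_ ?_⟩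
    · simp only [Category.assoc]
      rw [← Category.assoc F.e, ← Category.assoc r, ← hl, Category.assoc, reassoc_of% hvl, h1]
    · rw [Category.assoc, hc1, reassoc_of% hv, k2]; simp
    · rw [Category.assoc, hc2, reassoc_of% hvl, h2]; simp

/-- The presheaf represented by a fibre product. -/
def fibreProduct (f : X ⟶ H) (g : Y ⟶ H) : SMfdᵒᵖ ⥤ Type where
  obj T := {p : (T.unop ⟶ X) × (T.unop ⟶ Y) // p.1 ≫ f = p.2 ≫ g}
  map u := ↾fun p => ⟨(u.unop ≫ p.1.1, u.unop ≫ p.1.2), by simp [p.2]⟩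

theorem fibreProduct_isLocal (f : X ⟶ H) (g : Y ⟶ H) : IsLocal (fibreProduct f g) := by
  intro T ι T' e he hcov s hs
  obtain ⟨a, ha⟩ := exists_glue e hcov (fun i => (s i).1.1) fun i j R u v h =>
    congrArg (fun p => p.1.1) (hs i j R u v h)
  obtain ⟨b, hb⟩ := exists_glue e hcov (fun i => (s i).1.2) fun i j R u v h =>
    congrArg (fun p => p.1.2) (hs i j R u v h)
  refine ⟨⟨(a, b), hom_ext_of_cover e hcov fun i => ?_⟩, fun i => Subtype.ext (Prod.ext (ha i) (hb i)),
    fun p hp => Subtype.ext (Prod.ext (hom_ext_of_cover e hcov fun i => ?_)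
      (hom_ext_of_cover e hcov fun i => ?_))⟩
  · rw [← Category.assoc, ← Category.assoc, ha, hb, (s i).2]
  · exact (congrArg (fun p => p.1.1) (hp i)).trans (ha i).symm
  · exact (congrArg (fun p => p.1.2) (hp i)).trans (hb i).symm

/-- Fibre products along maps with fibre coordinates. -/
theorem exists_fibreProduct (hS : ∀ a b s t, S a b → S s t → S (a + s) (b + t)) (f : X ⟶ H) (g : Y ⟶ H)
    (hg : IsSub S g) (hX : HasCharts S X.obj) :
    ∃ (P : SMfd) (p : P ⟶ X) (q : P ⟶ Y), HasCharts S P.obj ∧ p ≫ f = q ≫ g ∧ IsSub S p ∧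
      (∀ (T : SMfd) (a : T ⟶ X) (b : T ⟶ Y), a ≫ f = b ≫ g → ∃ u : T ⟶ P, u ≫ p = a ∧ u ≫ q = b) ∧
      ∀ (T : SMfd) (u u' : T ⟶ P), u ≫ p = u' ≫ p → u ≫ q = u' ≫ q → u = u' := by
  have : T2Space X.obj := X.property.1
  have : SecondCountableTopology X.obj := X.property.2.1
  have : T2Space Y.obj := Y.property.1
  have : SecondCountableTopology Y.obj := Y.property.2.1
  -- The fibre product is constructed over `X`, with the fibre coordinates of `g` at the second
  -- component as its fibre coordinates; the points control where a chart of `g` may be used.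
  let B := {z : X.obj × Y.obj // bmap f z.1 = bmap g z.2}
  let Q : Over (fibreProduct f g) X B :=
    { π := fun j => j.1.1
      π_map := fun _ _ => rfl
      β := fun j z => ⟨(bmap j.1.1 z, bmap j.1.2 z), by rw [← bmap_comp, ← bmap_comp, j.2]⟩
      continuous_β := fun j => ((continuous_bmap j.1.1).prodMk (continuous_bmap j.1.2)).subtype_mk
        fun z => (by rw [← bmap_comp, ← bmap_comp, j.2] : bmap f (bmap j.1.1 z) = bmap g (bmap j.1.2 z))
      β_map := fun u j z => Subtype.ext (Prod.ext (bmap_comp _ _ _) (bmap_comp _ _ _))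
      ρ := fun b => b.1.1
      continuous_ρ := continuous_fst.comp continuous_subtype_val
      ρ_β := fun _ _ => rfl }
  have : T2Space B := inferInstanceAs (T2Space {z : X.obj × Y.obj // bmap f z.1 = bmap g z.2})
  have : SecondCountableTopology B :=
    TopologicalSpace.Subtype.secondCountableTopology _
  have hc : ∀ b, Nonempty (Q.Coord b S) := fun b => by
    obtain ⟨K⟩ := hg b.1.2
    have hmem : ∀ {T : SMfd} (j : (fibreProduct f g).obj (op T)),
        (∀ z, Q.β j z ∈ (⟨_, (IsOpenImm.isOpenEmbedding K.e).isOpen_range.preimage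
          (continuous_snd.comp continuous_subtype_val)⟩ : Opens B)) →
        ∀ z, bmap j.1.2 z ∈ Set.range (bmap K.e) := fun j h => h
    refine ⟨{ W := ⟨_, (IsOpenImm.isOpenEmbedding K.e).isOpen_range.preimage
                (continuous_snd.comp continuous_subtype_val)⟩
              mem := K.mem, s := K.s, t := K.t, dim := K.dim
              c := fun j h => lift K.e j.1.2 (hmem j h) ≫ K.c
              c_map := fun u j h h' => ?_
              inj := fun j j' h h' h1 h2 => ?_
              lift := fun {T₀ T} j h τ₀ n γ τ h1 h2 => ?_ }⟩
    · rw [← Category.assoc]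
      congr 1
      rw [← cancel_mono K.e, lift_fac, Category.assoc, lift_fac]
      rfl
    · have h3 := j.2
      have h3' := j'.2
      have h1' : j.1.1 = j'.1.1 := h1
      have : lift K.e j.1.2 (hmem j h) = lift K.e j'.1.2 (hmem j' h') := K.inj _ _ (by
        rw [← Category.assoc, lift_fac, ← Category.assoc, lift_fac, ← h3, ← h3', h1']) h2
      refine Subtype.ext (Prod.ext h1 ?_)
      rw [← lift_fac K.e j.1.2 (hmem j h), this, lift_fac]
    · have h3 := j.2
      obtain ⟨E', i, hi, τ', u, rfl, k1, k2⟩ := K.exists_lift (bmap (lift K.e j.1.2 (hmem j h)) τ₀)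
        (n ≫ f) γ τ (by
          have h1' : bmap n τ = bmap j.1.1 τ₀ := h1
          rw [bmap_comp, h1', ← bmap_comp, ← bmap_comp, h3, ← Category.assoc, lift_fac])
        (by rw [h2, bmap_comp])
      have hj' : (i ≫ n) ≫ f = (u ≫ K.e) ≫ g := by rw [Category.assoc, Category.assoc, k1]
      refine ⟨E', i, hi, ⟨(i ≫ n, u ≫ K.e), hj'⟩, fun z => ⟨bmap u z, (bmap_comp _ _ _).symm⟩,
        ⟨τ', rfl⟩, rfl, ?_⟩
      rw [← k2]
      congr 1
      rw [← cancel_mono K.e, lift_fac]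
  obtain ⟨P, hP, ⟨r⟩⟩ := Q.representable (fibreProduct_isLocal f g) hS hX hc
  let w := r.homEquiv (𝟙 P)
  have hw : ∀ {T : SMfd} (u : T ⟶ P), r.homEquiv u = (fibreProduct f g).map u.op w := fun u => by
    rw [← r.homEquiv_comp, Category.comp_id]
  have hlift : ∀ (T : SMfd) (a : T ⟶ X) (b : T ⟶ Y), a ≫ f = b ≫ g →
      ∃ u : T ⟶ P, u ≫ w.1.1 = a ∧ u ≫ w.1.2 = b := fun T a b h => by
    refine ⟨r.homEquiv.symm ⟨(a, b), h⟩, ?_⟩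
    have := (hw _).symm.trans
      (r.homEquiv.apply_symm_apply (⟨(a, b), h⟩ : (fibreProduct f g).obj (op T)))
    exact ⟨congrArg (fun p => p.1.1) this, congrArg (fun p => p.1.2) this⟩
  have hext : ∀ (T : SMfd) (u u' : T ⟶ P), u ≫ w.1.1 = u' ≫ w.1.1 → u ≫ w.1.2 = u' ≫ w.1.2 →
      u = u' := fun T u u' h h' => r.homEquiv.injective (by
    rw [hw, hw]; exact Subtype.ext (Prod.ext h h'))
  refine ⟨P, w.1.1, w.1.2, hP, w.2, fun y => ?_, hlift, hext⟩
  obtain ⟨K⟩ := hg (bmap w.1.2 y)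
  let O := preim w.1.2 (opensRange K.e)
  let ρ := restrι P O
  obtain ⟨l, hl⟩ : ∃ l : restr P O ⟶ K.E, l ≫ K.e = ρ ≫ w.1.2 :=
    ⟨lift K.e (ρ ≫ w.1.2) fun y => y.2, lift_fac _ _ _⟩
  refine ⟨{ E := restr P O, e := ρ, isOpenImm := inferInstance
            mem := (range_restrι P O).symm.subset K.mem
            s := K.s, t := K.t, dim := K.dim, c := l ≫ K.c
            inj := fun u u' h h' => ?_
            exists_lift := fun y T a γ τ h h' => ?_ }⟩
  · have h1 : u ≫ l = u' ≫ l := K.inj _ _ (by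
      simp only [Category.assoc, reassoc_of% hl]
      rw [← w.2, ← Category.assoc ρ, ← Category.assoc, h]; simp) (by simpa using h')
    rw [← cancel_mono ρ]
    refine hext _ _ _ (by simpa using h) ?_
    rw [Category.assoc, Category.assoc, ← hl, reassoc_of% h1]
  · obtain ⟨E', i, hi, τ', u, rfl, k1, k2⟩ := K.exists_lift (bmap l y) (a ≫ f) γ τ
      (by rw [bmap_comp, h, ← bmap_comp, ← bmap_comp, reassoc_of% hl, Category.assoc, w.2])
      (by rw [h', bmap_comp])
    obtain ⟨v, hv1, hv2⟩ := hlift E' (i ≫ a) (u ≫ K.e) (by simp [k1])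
    have hr : ∀ z, bmap v z ∈ Set.range (bmap ρ) := fun z => (range_restrι P O).symm.subset (by
      change bmap w.1.2 (bmap v z) ∈ Set.range (bmap K.e)
      rw [← bmap_comp, hv2, bmap_comp]; exact ⟨_, rfl⟩)
    refine ⟨E', i, hi, τ', lift ρ v hr, rfl, ?_, ?_⟩
    · rw [← Category.assoc, lift_fac, hv1]
    · rw [← Category.assoc, ← k2]
      congr 1
      rw [← cancel_mono K.e, Category.assoc, hl, ← Category.assoc, lift_fac, hv2]

end SMfd

namespace SMfd

/-- In product charts the second projection supplies the fibre coordinates; lifts are pairs,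
restricted to the open set where they stay inside the chart. -/
theorem IsSub.of_isSubmersion {X H : SMfd} (hX : HasCharts Even X.obj) (f : X ⟶ H)
    (hf : IsSubmersion f.hom) : IsSub Even f := fun x => by
  obtain ⟨p, q, s, t, U, V, U', V', φ, ψ, g, hx, hg, hgφ⟩ := hf x
  change Opens (std (p + s) (q + t)).obj at U'
  change Opens (std p q).obj at V'
  let Φ : restr X U ⟶ restr (std (p + s) (q + t)) U' := ObjectProperty.homMk φ.hom
  let Φ' : restr (std (p + s) (q + t)) U' ⟶ restr X U := ObjectProperty.homMk φ.inv
  let Ψ : restr H V ⟶ restr (std p q) V' := ObjectProperty.homMk ψ.hom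
  let Ψ' : restr (std p q) V' ⟶ restr H V := ObjectProperty.homMk ψ.inv
  let G : restr X U ⟶ restr H V := ObjectProperty.homMk g
  have hΦ : Φ ≫ Φ' = 𝟙 _ := ObjectProperty.hom_ext _ φ.hom_inv_id
  have hΦ' : Φ' ≫ Φ = 𝟙 _ := ObjectProperty.hom_ext _ φ.inv_hom_id
  have hΨ : Ψ ≫ Ψ' = 𝟙 _ := ObjectProperty.hom_ext _ ψ.hom_inv_id
  have : IsIso Φ' := ⟨Φ, hΦ', hΦ⟩
  have : Mono Ψ := mono_of_mono_fac hΨ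
  have hG : G ≫ restrι H V = restrι X U ≫ f := ObjectProperty.hom_ext _ hg
  have hGΦ : G ≫ Ψ ≫ restrι (std p q) V' = Φ ≫ restrι (std (p + s) (q + t)) U' ≫ pr1 p q s t :=
    ObjectProperty.hom_ext _ hgφ
  let ρ := restrι X U
  let ρ' := restrι (std (p + s) (q + t)) U'
  let y₀ : (restr X U).obj := ⟨x, hx⟩
  -- `q + t` is the odd dimension of a chart of `X`, which is purely even.
  have ht : t = 0 := by
    have := odd_dim_eq_zero hX (Φ' ≫ ρ) (bmap Φ y₀)
    omega
  refine ⟨{ E := restr X U, e := ρ, isOpenImm := inferInstance, mem := ⟨y₀, rfl⟩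
            s := s, t := t, dim := ht, c := Φ ≫ ρ' ≫ pr2 p q s t
            inj := fun u u' h h' => ?_
            exists_lift := fun y T a γ τ h h' => ?_ }⟩
  · have h1 : u ≫ G = u' ≫ G := by
      rw [← cancel_mono (restrι H V), Category.assoc, Category.assoc, hG, h]
    have h2 : u ≫ Φ ≫ ρ' = u' ≫ Φ ≫ ρ' := pair_ext (by
      simp only [Category.assoc]
      rw [← hGΦ, ← Category.assoc, h1, Category.assoc]) (by simpa using h')
    have h3 : u ≫ Φ = u' ≫ Φ := by
      rw [← cancel_mono ρ']; simpa using h2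
    have h4 := congrArg (fun k => k ≫ Φ') h3
    simpa [hΦ] using h4
  · let A := restr T (preim a V)
    let i := restrι T (preim a V)
    have hτ : bmap a τ ∈ Set.range (bmap (restrι H V)) := by
      rw [h, ← hG, bmap_comp]; exact ⟨_, rfl⟩
    obtain ⟨τ₁, hτ₁⟩ : ∃ τ₁, bmap i τ₁ = τ := ⟨⟨τ, by rw [range_restrι] at hτ; exact hτ⟩, rfl⟩
    obtain ⟨a', ha'⟩ : ∃ a' : A ⟶ restr H V, a' ≫ restrι H V = i ≫ a :=
      ⟨lift (restrι H V) (i ≫ a) fun z => by rw [range_restrι]; exact z.2, lift_fac _ _ _⟩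
    obtain ⟨k, hk1, hk2⟩ := exists_pair (a' ≫ Ψ ≫ restrι (std p q) V') (i ≫ γ)
    have hkτ : bmap k τ₁ = bmap (Φ ≫ ρ') y := bmap_pair_inj (by
      rw [← bmap_comp, hk1, ← bmap_comp, Category.assoc, ← hGΦ, bmap_comp, bmap_comp G]
      congr 1
      refine (IsOpenImm.isOpenEmbedding (restrι H V)).injective ?_
      rw [← bmap_comp, ha', ← bmap_comp, hG, ← h, bmap_comp, hτ₁]) (by
      rw [← bmap_comp, hk2, bmap_comp, hτ₁, h', ← bmap_comp, Category.assoc])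
    let j := restrι A (preim k U')
    have hτ₁U : bmap k τ₁ ∈ U' := by
      rw [hkτ, bmap_comp]; exact bmap_restrι_mem _ _ _
    obtain ⟨k', hk'⟩ : ∃ k' : restr A (preim k U') ⟶ restr (std (p + s) (q + t)) U', k' ≫ ρ' = j ≫ k :=
      ⟨lift ρ' (j ≫ k) fun z => by rw [range_restrι]; exact z.2, lift_fac _ _ _⟩
    refine ⟨_, j ≫ i, inferInstance, ⟨τ₁, hτ₁U⟩, k' ≫ Φ', (bmap_comp _ _ _).trans hτ₁, ?_, ?_⟩
    · have h1 : (k' ≫ Φ') ≫ G = j ≫ a' := by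
        rw [← cancel_mono Ψ, ← cancel_mono (restrι (std p q) V')]
        simp only [Category.assoc]
        rw [hGΦ, ← Category.assoc Φ', hΦ', Category.id_comp, ← Category.assoc, hk', Category.assoc, hk1]
      rw [← hG, ← Category.assoc, h1, Category.assoc, ha', Category.assoc]
    · rw [Category.assoc, ← Category.assoc Φ', hΦ', Category.id_comp, ← Category.assoc, hk',
        Category.assoc, hk2, Category.assoc]

end SMfd

/-! ### Partial horns -/

namespace SMfd
variable (X : SimplicialObject SMfd)

/-- `r` simplices which fit together as the faces `1, …, r` of a simplex of dimension `m + 1`. -/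
def Compat {r : ℕ} {T : SMfd} (m : ℕ) : (Fin r → (T ⟶ X _⦋m⦌)) → Prop :=
  Nat.casesOn (motive := fun m => (Fin r → (T ⟶ X _⦋m⦌)) → Prop) m (fun _ => True) fun m x =>
    ∀ (i j : Fin r) (_ : i.1 < j.1) (h : j.1 < m + 2),
      x j ≫ X.δ (⟨i.1 + 1, by omega⟩ : Fin (m + 2)) = x i ≫ X.δ (⟨j.1, h⟩ : Fin (m + 2))

variable {X}

theorem compat_faces {m r : ℕ} (hr : r ≤ m + 1) {T : SMfd} (y : T ⟶ X _⦋m + 1⦌) :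
    Compat X m fun i : Fin r => y ≫ X.δ (⟨i.1 + 1, by omega⟩ : Fin (m + 2)) := by
  cases m with
  | zero => trivial
  | succ m =>
    intro i j hij h
    have := X.δ_comp_δ (i := (⟨i.1 + 1, by omega⟩ : Fin (m + 2))) (j := (⟨j.1, h⟩ : Fin (m + 2))) hij
    rw [Category.assoc, Category.assoc]
    exact congrArg (y ≫ ·) this

/-- The face opposite to `r + 1` of compatible simplices. -/
theorem Compat.face {m r : ℕ} (hr : r ≤ m + 1) {T : SMfd} {x : Fin r → (T ⟶ X _⦋m + 1⦌)}
    (hx : Compat X (m + 1) x) :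
    Compat X m fun i => x i ≫ X.δ (⟨r, by omega⟩ : Fin (m + 2)) := by
  cases m with
  | zero => trivial
  | succ m =>
    intro i j hij h
    have h1 := X.δ_comp_δ (i := (⟨i.1 + 1, by omega⟩ : Fin (m + 2)))
      (j := (⟨r - 1, by omega⟩ : Fin (m + 2))) (show i.1 + 1 ≤ r - 1 by omega)
    have h2 := X.δ_comp_δ (i := (⟨j.1, h⟩ : Fin (m + 2)))
      (j := (⟨r - 1, by omega⟩ : Fin (m + 2))) (show j.1 ≤ r - 1 by omega)
    have e : (⟨r - 1, by omega⟩ : Fin (m + 2)).succ = (⟨r, by omega⟩ : Fin (m + 3)) :=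
      Fin.ext (by simp; omega)
    rw [e] at h1 h2
    have h3 := hx i j hij (by omega)
    rw [Category.assoc, Category.assoc, h1, h2, ← Category.assoc, ← Category.assoc]
    exact congrArg (· ≫ _) h3

variable (X) in
/-- `N`, with the universal simplices `p`, represents partial horns. -/
structure IsHornObj (m : ℕ) {r : ℕ} (N : SMfd) (p : Fin r → (N ⟶ X _⦋m⦌)) : Prop where
  charts : HasCharts Even N.obj
  compat : Compat X m p
  exists_hom : ∀ {T : SMfd} (x : Fin r → (T ⟶ X _⦋m⦌)), Compat X m x → ∃ u, ∀ i, u ≫ p i = x i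
  hom_ext : ∀ {T : SMfd} (u u' : T ⟶ N), (∀ i, u ≫ p i = u' ≫ p i) → u = u'

theorem isHornObj_one (hX : ∀ k, HasCharts Even (X _⦋k⦌).obj) (m : ℕ) :
    IsHornObj X m (X _⦋m⦌) fun _ : Fin 1 => 𝟙 _ where
  charts := hX m
  compat := by
    cases m with
    | zero => trivial
    | succ m => exact fun i j hij => by omega
  exists_hom := fun x _ => ⟨x 0, fun i => by rw [Category.comp_id, Subsingleton.elim i 0]⟩
  hom_ext := fun u u' h => by simpa using h 0

variable (X) in
/-- The partial horns are represented by manifolds, and restricting simplices to them is a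
submersion. -/
def HornSub (m : ℕ) : Prop := ∀ r, 1 ≤ r → ∀ (hr : r ≤ m + 1), ∃ (N : SMfd) (p : Fin r → (N ⟶ X _⦋m⦌)),
  IsHornObj X m N p ∧ ∃ f : X _⦋m + 1⦌ ⟶ N,
    (∀ i, f ≫ p i = X.δ (⟨i.1 + 1, by omega⟩ : Fin (m + 2))) ∧ IsSub Even f

/-- An additional simplex must have its own faces 1,…,r equal to the r-th faces of the simplices
present. These form a partial horn one dimension lower, so the new object is a fibre product over
the lower horn object and its projection is the base change of a submersion. -/
theorem IsHornObj.exists_succ {m r : ℕ} (hm : HornSub X m) (hr1 : 1 ≤ r) (hr : r ≤ m + 1) {N : SMfd}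
    {p : Fin r → (N ⟶ X _⦋m + 1⦌)} (hp : IsHornObj X (m + 1) N p) :
    ∃ (N' : SMfd) (p' : Fin (r + 1) → (N' ⟶ X _⦋m + 1⦌)) (π : N' ⟶ N), IsHornObj X (m + 1) N' p' ∧
      IsSub Even π ∧ ∀ i : Fin r, π ≫ p i = p' i.castSucc := by
  obtain ⟨M, q, hq, g, hgq, hg⟩ := hm r hr1 hr
  obtain ⟨f, hf⟩ := hq.exists_hom _ (hp.compat.face hr)
  obtain ⟨P, p₁, p₂, hP, hpp, hsub, hlift, hext⟩ := exists_fibreProduct Even.add f g hg hp.charts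
  refine ⟨P, Fin.snoc (α := fun _ => P ⟶ X _⦋m + 1⦌) (fun i => p₁ ≫ p i) p₂, p₁, ⟨hP, ?_, ?_, ?_⟩, hsub,
    fun i => by rw [Fin.snoc_castSucc]⟩
  · intro i j hij h
    induction i using Fin.lastCases with
    | last => simp at hij; omega
    | cast i =>
    induction j using Fin.lastCases with
    | last =>
      simp only [Fin.snoc_castSucc, Fin.snoc_last, Category.assoc]
      have h1 := congrArg (· ≫ q i) hpp
      simp only [Category.assoc, hf, hgq] at h1
      exact h1.symm
    | cast j =>
      simp only [Fin.snoc_castSucc, Category.assoc]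
      exact congrArg (p₁ ≫ ·) (hp.compat i j hij h)
  · intro T x hx
    have hx' : Compat X (m + 1) fun i : Fin r => x i.castSucc := fun i j hij h =>
      hx i.castSucc j.castSucc hij h
    obtain ⟨a, ha⟩ := hp.exists_hom _ hx'
    obtain ⟨u, hu1, hu2⟩ := hlift T a (x (Fin.last r)) (hq.hom_ext _ _ fun i => by
      simp only [Category.assoc, hf, hgq]
      rw [← Category.assoc, ha]
      exact (hx i.castSucc (Fin.last r) i.2 (by simp; omega)).symm)
    refine ⟨u, fun i => ?_⟩
    induction i using Fin.lastCases with
    | last => rw [Fin.snoc_last, hu2]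
    | cast i => rw [Fin.snoc_castSucc, ← Category.assoc, hu1, ha]
  · intro T u u' h
    refine hext _ _ _ (hp.hom_ext _ _ fun i => ?_) ?_
    · simpa using h i.castSucc
    · simpa using h (Fin.last r)

/-- Induction on the number `d` of faces still missing from the full horn: restricting to `r` faces
is restricting to `r + 1` faces followed by the projection that forgets one, and submersions
compose. -/
theorem IsHornObj.isSub {m : ℕ} (htop : ∀ {N : SMfd} {p : Fin (m + 1) → (N ⟶ X _⦋m⦌)}
      (_ : IsHornObj X m N p) (f : X _⦋m + 1⦌ ⟶ N), (∀ i, f ≫ p i = X.δ i.succ) → IsSub Even f)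
    (hm : ∀ k, m = k + 1 → HornSub X k) (d : ℕ) {r : ℕ} (hr1 : 1 ≤ r) (hr : r + d = m + 1) {N : SMfd}
    {p : Fin r → (N ⟶ X _⦋m⦌)} (hp : IsHornObj X m N p) (f : X _⦋m + 1⦌ ⟶ N)
    (hf : ∀ i, f ≫ p i = X.δ (⟨i.1 + 1, by omega⟩ : Fin (m + 2))) : IsSub Even f := by
  induction d generalizing r N with
  | zero =>
    obtain rfl : r = m + 1 := hr
    exact htop hp f hf
  | succ d ih =>
    obtain ⟨k, rfl⟩ : ∃ k, m = k + 1 := ⟨m - 1, by omega⟩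
    obtain ⟨N', p', π, hp', hπ, hpp⟩ := hp.exists_succ (hm k rfl) hr1 (by omega)
    obtain ⟨f', hf'⟩ := hp'.exists_hom _
      (compat_faces (X := X) (m := k + 1) (r := r + 1) (by omega) (𝟙 _))
    simp only [Category.id_comp] at hf'
    have h1 := ih (r := r + 1) (by omega) (by omega) hp' f' hf'
    have h2 : f = f' ≫ π := hp.hom_ext _ _ fun i => by
      rw [hf, Category.assoc, hpp, hf']; rfl
    rw [h2]
    exact h1.comp Even.add hπ

theorem exists_isHornObj (hX : ∀ k, HasCharts Even (X _⦋k⦌).obj) {m : ℕ}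
    (hm : ∀ k, m = k + 1 → HornSub X k) {r : ℕ} (hr1 : 1 ≤ r) (hr : r ≤ m + 1) :
    ∃ (N : SMfd) (p : Fin r → (N ⟶ X _⦋m⦌)), IsHornObj X m N p := by
  induction r, hr1 using Nat.le_induction with
  | base => exact ⟨_, _, isHornObj_one hX m⟩
  | succ r h1 ih =>
    obtain ⟨k, rfl⟩ : ∃ k, m = k + 1 := ⟨m - 1, by omega⟩
    obtain ⟨N, p, hp⟩ := ih (by omega)
    obtain ⟨N', p', -, hp', -⟩ := hp.exists_succ (hm k rfl) h1 (by omega)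
    exact ⟨N', p', hp'⟩

/-- If restricting simplices to horns is a submersion, then so is restricting them to partial
horns. -/
theorem hornSub (hX : ∀ k, HasCharts Even (X _⦋k⦌).obj)
    (htop : ∀ (m : ℕ) {N : SMfd} {p : Fin (m + 1) → (N ⟶ X _⦋m⦌)} (_ : IsHornObj X m N p)
      (f : X _⦋m + 1⦌ ⟶ N), (∀ i, f ≫ p i = X.δ i.succ) → IsSub Even f) (m : ℕ) : HornSub X m := by
  induction m using Nat.strong_induction_on with
  | _ m ih =>
    intro r hr1 hr
    have hm : ∀ k, m = k + 1 → HornSub X k := fun k hk => ih k (by omega)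
    obtain ⟨N, p, hp⟩ := exists_isHornObj hX hm hr1 hr
    obtain ⟨f, hf⟩ := hp.exists_hom _ (compat_faces (X := X) (m := m) hr (𝟙 _))
    simp only [Category.id_comp] at hf
    exact ⟨N, p, hp, f, hf, hp.isSub (htop m) hm (m + 1 - r) hr1 (by omega) f hf⟩

end SMfd

/-! ### Horns of a Lie groupoid with missing face 0 -/

section Horn
universe v u
variable {C : Type u} [Category.{v} C] {X : SimplicialObject C} {m : ℕ} {Z Z' : C}

/-- The faces of a horn. -/
def hornFace (a : (HomSSet (Λ[m + 1, 0] : SSet.{v}) X).obj (op Z)) (i : Fin (m + 1)) : Z ⟶ X _⦋m⦌ :=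
  SSet.yonedaEquiv (SSet.horn.ι 0 i.succ (Fin.succ_ne_zero i) ≫ a)

theorem hornFace_map (u : Z' ⟶ Z) (a : (HomSSet (Λ[m + 1, 0] : SSet.{v}) X).obj (op Z))
    (i : Fin (m + 1)) : hornFace ((HomSSet (Λ[m + 1, 0] : SSet.{v}) X).map u.op a) i =
      u ≫ hornFace a i := rfl

theorem hornFace_ext {a b : (HomSSet (Λ[m + 1, 0] : SSet.{v}) X).obj (op Z)}
    (h : ∀ i, hornFace a i = hornFace b i) : a = b := by
  refine SSet.horn.hom_ext' fun j hj => ?_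
  obtain ⟨i, rfl⟩ := Fin.eq_succ_of_ne_zero hj
  exact SSet.yonedaEquiv.injective (h i)

theorem hornFace_universalHorn (i : Fin (m + 1)) :
    hornFace (universalHorn X (m + 1) 0) i = X.δ i.succ := by
  unfold hornFace universalHorn
  rw [← Category.assoc, SSet.horn.ι_ι, SSet.yonedaEquiv_comp]
  exact (Category.id_comp _ : 𝟙 _ ≫ X.map (SimplexCategory.δ i.succ).op = _)

theorem yonedaEquiv_symm_δ (x : Z ⟶ X _⦋m + 1⦌) (i : Fin (m + 2)) :
    SSet.stdSimplex.δ i ≫ (SSet.yonedaEquiv (X := points X Z) (n := ⦋m + 1⦌)).symm x =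
      (SSet.yonedaEquiv (X := points X Z) (n := ⦋m⦌)).symm (x ≫ X.δ i) :=
  SSet.yonedaEquiv_symm_naturality_left (X := points X Z) (SimplexCategory.δ i) x

theorem horn_ι_comp (a : (HomSSet (Λ[m + 1, 0] : SSet.{v}) X).obj (op Z)) (i : Fin (m + 1)) :
    SSet.horn.ι 0 i.succ (Fin.succ_ne_zero i) ≫ a =
      (SSet.yonedaEquiv (X := points X Z) (n := ⦋m⦌)).symm (hornFace a i) :=
  (Equiv.symm_apply_apply _ _).symm

end Horn

/-- The simplicial supermanifold underlying a simplicial manifold. -/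
abbrev toSMfd (X : SimplicialObject Mfd) : SimplicialObject SMfd := X ⋙ Mfd.toSMfd


namespace SMfd
variable {X : SimplicialObject Mfd}

theorem compat_hornFace {m : ℕ} {Z : Mfd} (a : (HomSSet Λ[m + 1, 0] X).obj (op Z)) :
    Compat (toSMfd X) m fun i => Mfd.toSMfd.map (hornFace a i) := by
  cases m with
  | zero => trivial
  | succ m =>
    intro i j hij h
    have h1 := SSet.horn.IsCompatible.of_hom a i.succ j.succ (Fin.succ_ne_zero i) (Fin.succ_ne_zero j)
      (Fin.succ_lt_succ_iff.2 hij)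
    have h3 : hornFace a i ≫ X.δ (⟨j.1, h⟩ : Fin (m + 2)) =
        hornFace a j ≫ X.δ (⟨i.1 + 1, by omega⟩ : Fin (m + 2)) := by
      refine (SSet.yonedaEquiv (X := points X Z) (n := ⦋m⦌)).symm.injective ?_
      rw [← yonedaEquiv_symm_δ, ← yonedaEquiv_symm_δ, ← horn_ι_comp, ← horn_ι_comp]
      exact h1
    exact (congrArg Mfd.toSMfd.map h3).symm

theorem exists_horn {m : ℕ} {Z : Mfd} (x : Fin (m + 1) → (Z ⟶ X _⦋m⦌))
    (hx : Compat (toSMfd X) m fun i => Mfd.toSMfd.map (x i)) :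
    ∃ a : (HomSSet Λ[m + 1, 0] X).obj (op Z), ∀ i, hornFace a i = x i := by
  have hc : SSet.horn.IsCompatible (i := (0 : Fin (m + 2))) (X := points X Z)
      fun j hj => (SSet.yonedaEquiv (X := points X Z) (n := ⦋m⦌)).symm (x (j.pred hj)) := by
    cases m with
    | zero => trivial
    | succ m =>
      intro j k hj hk hjk
      obtain ⟨j, rfl⟩ := Fin.eq_succ_of_ne_zero hj
      obtain ⟨k, rfl⟩ := Fin.eq_succ_of_ne_zero hk
      have hjk' : j.1 < k.1 := Fin.succ_lt_succ_iff.1 hjk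
      have h1 := Mfd.toSMfd.map_injective (hx j k hjk' k.2)
      refine (yonedaEquiv_symm_δ _ _).trans (Eq.trans ?_ (yonedaEquiv_symm_δ _ _).symm)
      exact congrArg _ h1.symm
  refine ⟨hc.desc, fun i => ?_⟩
  have := hc.ι_desc i.succ (Fin.succ_ne_zero i)
  exact (congrArg SSet.yonedaEquiv this).trans (Equiv.apply_symm_apply _ _)

/-- The hypothesis represents horns only on manifolds, whereas `N` represents them on all
supermanifolds. Since `N` is purely even, each of the two objects classifies the universal horn of
the other; so they are isomorphic, and `f` is the given submersion followed by an isomorphism. -/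
theorem isSub_horn {n : ℕ} (hX : IsLieGroupoid n X) (m : ℕ) {N : SMfd}
    {p : Fin (m + 1) → (N ⟶ (toSMfd X) _⦋m⦌)} (hp : IsHornObj (toSMfd X) m N p)
    (f : (toSMfd X) _⦋m + 1⦌ ⟶ N) (hf : ∀ i, f ≫ p i = (toSMfd X).δ i.succ) :
    IsSub Even f ∧ (n < m + 1 → IsIso f) := by
  obtain ⟨H, r, ⟨hsub, -⟩, hiso⟩ := hX (m + 1) 0 (by omega)
  let N' : Mfd := ⟨N.obj, N.property.1, N.property.2.1, hp.charts⟩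
  let p' : ∀ i, N' ⟶ X _⦋m⦌ := fun i => ObjectProperty.homMk (p i).hom
  let f' : X _⦋m + 1⦌ ⟶ N' := ObjectProperty.homMk f.hom
  let u := r.homEquiv.symm (universalHorn X (m + 1) 0)
  obtain ⟨a, ha⟩ := exists_horn p' hp.compat
  let v : N' ⟶ H := r.homEquiv.symm a
  obtain ⟨w, hw⟩ := hp.exists_hom (T := Mfd.toSMfd.obj H) _ (compat_hornFace (r.homEquiv (𝟙 H)))
  have hface : ∀ {Z : Mfd} (k : Z ⟶ H) (i), k ≫ hornFace (r.homEquiv (𝟙 H)) i =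
      hornFace (r.homEquiv k) i := fun k i => by
    rw [← hornFace_map, ← r.homEquiv_comp, Category.comp_id]
  have hvw : Mfd.toSMfd.map v ≫ w = 𝟙 N := hp.hom_ext _ _ fun i => by
    rw [Category.assoc, hw]
    refine Eq.trans ?_ (Category.id_comp _).symm
    have h1 : v ≫ hornFace (r.homEquiv (𝟙 H)) i = p' i := by
      rw [hface, Equiv.apply_symm_apply, ha]
    exact congrArg Mfd.toSMfd.map h1
  let w' : H ⟶ N' := ObjectProperty.homMk w.hom
  have hwv : w ≫ Mfd.toSMfd.map v = 𝟙 _ := by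
    have : w' ≫ v = 𝟙 H := r.homEquiv.injective (hornFace_ext fun i => by
      rw [r.homEquiv_comp, hornFace_map, Equiv.apply_symm_apply, ha]
      exact Mfd.toSMfd.map_injective (hw i))
    exact congrArg Mfd.toSMfd.map this
  have hfv : f' ≫ v = u := r.homEquiv.injective (hornFace_ext fun i => by
    rw [r.homEquiv_comp, hornFace_map, Equiv.apply_symm_apply, ha, Equiv.apply_symm_apply,
      hornFace_universalHorn]
    exact Mfd.toSMfd.map_injective (hf i))
  have hfu : f = Mfd.toSMfd.map u ≫ w := by
    have := congrArg (fun k => Mfd.toSMfd.map k ≫ w) hfv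
    rw [← this]
    change f = (Mfd.toSMfd.map (f' ≫ v)) ≫ w
    rw [Functor.map_comp, Category.assoc, hvw]
    exact (Category.comp_id f).symm
  have : IsIso w := ⟨Mfd.toSMfd.map v, hwv, hvw⟩
  refine ⟨?_, fun h => ?_⟩
  · rw [hfu]
    exact (IsSub.of_isSubmersion (X _⦋m + 1⦌).property.2.2 _ hsub).comp Even.add (IsSub.of_isIso (S := Even) rfl w)
  · have := hiso h
    rw [hfu]
    infer_instance

/-- The underlying simplicial supermanifold of a Lie `n`-groupoid has submersive partial horns. -/
theorem hornSub_of_isLieGroupoid {n : ℕ} (hX : IsLieGroupoid n X) (m : ℕ) :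
    HornSub (toSMfd X) m :=
  hornSub (fun k => (X.obj (op (SimplexCategory.mk k))).property.2.2)
    (fun m _ _ hp f hf => (isSub_horn hX m hp f hf).1) m

end SMfd

/-! ### Families of simplices with odd parameters and first vertex zero -/

namespace SMfd

/-- The zero morphism to the odd line. -/
def zeroD (S : SMfd) : S ⟶ oddLine := (exists_θ (Submodule.zero_mem ((Γ S).part 1))).choose

theorem θ_zeroD (S : SMfd) : θ (zeroD S) = 0 := (exists_θ (Submodule.zero_mem ((Γ S).part 1))).choose_spec

theorem comp_zeroD {S T : SMfd} (u : S ⟶ T) : u ≫ zeroD T = zeroD S :=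
  θ_inj (by rw [← pb_θ, θ_zeroD, θ_zeroD, pb_zero])

/-- Vertices of a simplex of odd parameters whose first vertex is zero. -/
def Tup (m : ℕ) (S : SMfd) : Type := {d : Fin (m + 1) → (S ⟶ oddLine) // d 0 = zeroD S}

namespace Tup
variable {m : ℕ} {S S' S'' : SMfd}

theorem ext' {d d' : Tup m S} (h : ∀ i, d.1 i = d'.1 i) : d = d' := Subtype.ext (funext h)

/-- Pullback of parameters. -/
def comp (u : S' ⟶ S) (d : Tup m S) : Tup m S' := ⟨fun i => u ≫ d.1 i, (congrArg (u ≫ ·) d.2).trans (comp_zeroD u)⟩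

theorem comp_comp (u : S' ⟶ S) (v : S'' ⟶ S') (d : Tup m S) : (d.comp u).comp v = d.comp (v ≫ u) :=
  ext' fun _ => (Category.assoc _ _ _).symm

theorem comp_id (d : Tup m S) : d.comp (𝟙 S) = d := ext' fun _ => Category.id_comp _

/-- Omission of a vertex other than the first one. -/
def face (i : Fin (m + 1)) (d : Tup (m + 1) S) : Tup m S :=
  ⟨fun j => d.1 (i.succ.succAbove j), by simpa using d.2⟩

/-- Repetition of a vertex. -/
def degen (r : Fin (m + 1)) (d : Tup m S) : Tup (m + 1) S :=
  ⟨fun j => d.1 (r.predAbove j), by simpa using d.2⟩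

/-- The zero parameters. -/
def zero (m : ℕ) (S : SMfd) : Tup m S := ⟨fun _ => zeroD S, rfl⟩

theorem comp_zero (u : S' ⟶ S) : (zero m S).comp u = zero m S' := ext' fun _ => comp_zeroD u

theorem face_face {i j : Fin (m + 1)} (h : i ≤ j) (d : Tup (m + 2) S) :
    face i (face j.succ d) = face j (face i.castSucc d) := ext' fun x => by
  have := congrArg (fun f => f.toOrderHom x)
    (SimplexCategory.δ_comp_δ (i := i.succ) (j := j.succ) (Fin.succ_le_succ_iff.2 h))
  exact congrArg d.1 this

theorem degen_degen {i j : Fin (m + 1)} (h : i ≤ j) (d : Tup m S) :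
    degen j.succ (degen i d) = degen i.castSucc (degen j d) := ext' fun x => by
  have := congrArg (fun f => f.toOrderHom x) (SimplexCategory.σ_comp_σ h)
  exact congrArg d.1 this.symm

theorem face_degen_self (r : Fin (m + 1)) (d : Tup m S) : face r (degen r d) = d := ext' fun x => by
  have := congrArg (fun f => f.toOrderHom x) (SimplexCategory.δ_comp_σ_succ (i := r))
  exact congrArg d.1 this

theorem face_degen_pred (i r : Fin (m + 1)) (h : i.1 + 1 = r.1) (d : Tup m S) :
    face i (degen r d) = d := ext' fun x => by
  have := congrArg (fun f => f.toOrderHom x) (SimplexCategory.δ_comp_σ_self (i := r))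
  have e : i.succ = r.castSucc := Fin.ext h
  refine (congrArg (fun i' => d.1 (r.predAbove (i'.succAbove x))) e).trans ?_
  exact congrArg d.1 this

theorem face_degen_of_lt (i r : Fin (m + 1)) (h : i < r) (d : Tup (m + 1) S) :
    face i.castSucc (degen r.succ d) = degen r (face i d) := ext' fun x => by
  have := congrArg (fun f => f.toOrderHom x)
    (SimplexCategory.δ_comp_σ_of_le (i := i.succ) (j := r) h)
  exact congrArg d.1 this

theorem face_degen_of_gt (i r : Fin (m + 1)) (h : r ≤ i) (d : Tup (m + 1) S) :
    face i.succ (degen r.castSucc d) = degen r (face i d) := ext' fun x => by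
  have := congrArg (fun f => f.toOrderHom x)
    (SimplexCategory.δ_comp_σ_of_gt (i := i.succ) (j := r) (Nat.lt_succ_of_le h))
  exact congrArg d.1 this

theorem degen_apply_eq (r : Fin (m + 1)) (d : Tup m S) :
    (degen r d).1 r.castSucc = (degen r d).1 r.succ := by
  change d.1 (r.predAbove r.castSucc) = d.1 (r.predAbove r.succ)
  rw [Fin.predAbove_castSucc_self, Fin.predAbove_succ_self]

theorem degen_apply_of_le (r : Fin (m + 1)) (d : Tup m S) (j : Fin (m + 1)) (h : j ≤ r) :
    (degen r d).1 j.castSucc = d.1 j := by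
  change d.1 (r.predAbove j.castSucc) = d.1 j
  rw [Fin.predAbove_castSucc_of_le _ _ h]

theorem face_apply_of_le (r : Fin (m + 1)) (d : Tup (m + 1) S) (j : Fin (m + 1)) (h : j ≤ r) :
    (face r d).1 j = d.1 j.castSucc := by
  change d.1 (r.succ.succAbove j) = _
  rw [Fin.succAbove_of_castSucc_lt _ _ (Nat.lt_succ_of_le h)]

theorem eq_degen {r : Fin (m + 1)} {d : Tup (m + 1) S} (h : d.1 r.castSucc = d.1 r.succ) :
    d = degen r (face r d) := ext' fun j => by
  change d.1 j = d.1 (r.succ.succAbove (r.predAbove j))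
  by_cases hj : j = r.succ
  · subst hj
    rw [Fin.predAbove_succ_self, Fin.succAbove_succ_self, h]
  · refine congrArg d.1 ?_
    rcases lt_or_ge r.castSucc j with hlt | hge
    · rw [Fin.predAbove_of_castSucc_lt _ _ hlt]
      refine Fin.ext ?_
      have h1 : r.1 < j.1 := hlt
      have h2 : j.1 ≠ r.1 + 1 := fun h => hj (Fin.ext h)
      rw [Fin.succAbove_of_le_castSucc _ _ (show r.1 + 1 ≤ j.1 - 1 by omega)]
      simp
    · rw [Fin.predAbove_of_le_castSucc _ _ hge, Fin.succAbove_of_castSucc_lt _ _ (by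
        rw [Fin.castSucc_castPred]; exact Nat.lt_succ_of_le hge), Fin.castSucc_castPred]

end Tup

/-- Natural families of morphisms to `Y` depending on odd parameters and a morphism to `T`. -/
@[ext]
structure Fam (Y : SMfd) (m : ℕ) (T : SMfd) where
  toFun : ∀ {S : SMfd}, Tup m S → (S ⟶ T) → (S ⟶ Y)
  nat : ∀ {S S' : SMfd} (u : S' ⟶ S) (d : Tup m S) (x : S ⟶ T),
    toFun (d.comp u) (u ≫ x) = u ≫ toFun d x

namespace Fam
variable {Y : SMfd} {m : ℕ} {T T' T'' : SMfd}

theorem ext' {F G : Fam Y m T} (h : ∀ (S : SMfd) (d : Tup m S) (x : S ⟶ T), F.toFun d x = G.toFun d x) :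
    F = G := Fam.ext (by funext S d x; exact h S d x)

/-- Pullback of families. -/
def pull (n : T' ⟶ T) (F : Fam Y m T) : Fam Y m T' where
  toFun d x := F.toFun d (x ≫ n)
  nat u d x := by rw [Category.assoc, F.nat]

theorem pull_id (F : Fam Y m T) : F.pull (𝟙 T) = F := ext' fun S d x => by
  change F.toFun d (x ≫ 𝟙 T) = _
  rw [Category.comp_id]

theorem pull_pull (n : T' ⟶ T) (n' : T'' ⟶ T') (F : Fam Y m T) :
    (F.pull n).pull n' = F.pull (n' ≫ n) := ext' fun S d x => by
  change F.toFun d ((x ≫ n') ≫ n) = F.toFun d (x ≫ n' ≫ n)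
  rw [Category.assoc]

/-- The odd line has only one point, so after restriction to a point of `S` all parameters coincide.
Questions about open sets can therefore be settled at zero parameters. -/
theorem bmap_eq (F : Fam Y m T) {S : SMfd} (d d' : Tup m S) (x : S ⟶ T) (z : S.obj) :
    bmap (F.toFun d x) z = bmap (F.toFun d' x) z := by
  obtain ⟨u, hu⟩ := exists_point S z
  have h : d.comp u = d'.comp u := Tup.ext' fun i => pt_hom_ext (funext fun i => i.elim0)
  have h1 : u ≫ F.toFun d x = u ≫ F.toFun d' x := by rw [← F.nat, ← F.nat, h]
  rw [← hu pt.default, ← bmap_comp, h1, bmap_comp]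

theorem ext_of_cover {ι : Type} {E : ι → SMfd} (e : ∀ i, E i ⟶ T) [∀ i, IsOpenImm (e i)]
    (hcov : ∀ x, ∃ i, x ∈ Set.range (bmap (e i))) {F G : Fam Y m T}
    (h : ∀ i, F.pull (e i) = G.pull (e i)) : F = G := ext' fun S d x => by
  refine hom_ext_of_cover (fun i => restrι S (preim x (opensRange (e i))))
    (fun y => (hcov (bmap x y)).imp fun i hi => ⟨⟨y, hi⟩, rfl⟩) fun i => ?_
  rw [← F.nat, ← G.nat, ← lift_fac (e i) (restrι S (preim x (opensRange (e i))) ≫ x) fun y => y.2]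
  exact congrArg (fun K : Fam Y m (E i) => K.toFun _ _) (h i)

theorem exists_glue {ι : Type} {E : ι → SMfd} (e : ∀ i, E i ⟶ T) [∀ i, IsOpenImm (e i)]
    (hcov : ∀ x, ∃ i, x ∈ Set.range (bmap (e i))) (s : ∀ i, Fam Y m (E i))
    (hs : ∀ (i j : ι) (S : SMfd) (a : S ⟶ E i) (b : S ⟶ E j), a ≫ e i = b ≫ e j →
      (s i).pull a = (s j).pull b) : ∃ F : Fam Y m T, ∀ i, F.pull (e i) = s i := by
  have hs' : ∀ {i j : ι} {S : SMfd} (d : Tup m S) (a : S ⟶ E i) (b : S ⟶ E j), a ≫ e i = b ≫ e j →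
      (s i).toFun d a = (s j).toFun d b := fun {i j S} d a b h => by
    have := congrArg (fun K : Fam Y m S => K.toFun d (𝟙 S)) (hs i j S a b h)
    have h1 : (s i).toFun d (𝟙 S ≫ a) = (s j).toFun d (𝟙 S ≫ b) := this
    rwa [Category.id_comp, Category.id_comp] at h1
  -- A morphism to `T` need not factor through the cover; the value on it is glued from the parts of
  -- `S` lying over the `E i`.
  have hex : ∀ {S : SMfd} (d : Tup m S) (x : S ⟶ T), ∃ g : S ⟶ Y, ∀ {R : SMfd} (u : R ⟶ S) (i : ι)
      (a : R ⟶ E i), a ≫ e i = u ≫ x → u ≫ g = (s i).toFun (d.comp u) a := fun {S} d x => by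
    let ρ : ∀ i, restr S (preim x (opensRange (e i))) ⟶ S := fun i =>
      restrι S (preim x (opensRange (e i)))
    have hρ : ∀ i, ∃ l, l ≫ e i = ρ i ≫ x := fun i =>
      ⟨lift (e i) (ρ i ≫ x) fun y => y.2, lift_fac _ _ _⟩
    choose l hl using hρ
    have hcov' : ∀ y, ∃ i, y ∈ Set.range (bmap (ρ i)) := fun y =>
      (hcov (bmap x y)).imp fun i hi => ⟨⟨y, hi⟩, rfl⟩
    obtain ⟨g, hg⟩ := SMfd.exists_glue (Y := Y) ρ hcov' (fun i => (s i).toFun (d.comp (ρ i)) (l i))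
      fun i j R a b hab => by
        rw [← (s i).nat, ← (s j).nat, Tup.comp_comp, Tup.comp_comp, hab]
        exact hs' _ _ _ (by rw [Category.assoc, Category.assoc, hl, hl, ← Category.assoc, hab,
          Category.assoc])
    refine ⟨g, fun {R} u i a ha => ?_⟩
    have hr : ∀ z, bmap u z ∈ Set.range (bmap (ρ i)) := fun z => by
      refine (range_restrι S _).symm.subset ?_
      change bmap x (bmap u z) ∈ Set.range (bmap (e i))
      rw [← bmap_comp, ← ha, bmap_comp]; exact ⟨_, rfl⟩
    obtain ⟨v, rfl⟩ : ∃ v, v ≫ ρ i = u := ⟨lift (ρ i) u hr, lift_fac _ _ _⟩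
    have hva : v ≫ l i = a := by
      rw [← cancel_mono (e i), Category.assoc, hl, ha, Category.assoc]
    rw [Category.assoc, hg, ← (s i).nat, Tup.comp_comp, hva]
  choose F hF using @hex
  refine ⟨⟨F, fun {S S'} u d x => ?_⟩, fun i => ext' fun S d x => ?_⟩
  · let ρ : ∀ i, restr S' (preim (u ≫ x) (opensRange (e i))) ⟶ S' := fun i =>
      restrι S' (preim (u ≫ x) (opensRange (e i)))
    refine hom_ext_of_cover ρ (fun y => (hcov (bmap (u ≫ x) y)).imp fun i hi => ⟨⟨y, hi⟩, rfl⟩)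
      fun i => ?_
    obtain ⟨l, hl⟩ : ∃ l, l ≫ e i = ρ i ≫ u ≫ x :=
      ⟨lift (e i) (ρ i ≫ u ≫ x) fun y => y.2, lift_fac _ _ _⟩
    rw [hF (d.comp u) (u ≫ x) (ρ i) i l hl, Tup.comp_comp, ← Category.assoc,
      hF d x (ρ i ≫ u) i l (by rw [hl, Category.assoc])]
  · have := hF d (x ≫ e i) (𝟙 S) i x (Category.id_comp _).symm
    rw [Category.id_comp, Tup.comp_id] at this
    exact this

end Fam
end SMfd

/-! ### Degenerate parameters and the extension problem -/

namespace SMfd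

theorem thetas_eq_zero {k : ℕ} {S : SMfd} {d : Fin k → (S ⟶ oddLine)} {i : Fin k} (h : θ (d i) = 0) :
    thetas d = 0 :=
  List.prod_eq_zero (List.mem_ofFn.2 ⟨i, h⟩)

theorem thetas_eq_zero_of_eq {k : ℕ} {S : SMfd} {d : Fin k → (S ⟶ oddLine)} {i j : Fin k}
    (hij : j.1 = i.1 + 1) (h : d i = d j) : thetas d = 0 := by
  induction k with
  | zero => exact i.elim0
  | succ k ih =>
    rw [thetas_succ]
    induction j using Fin.lastCases with
    | last =>
      obtain _ | k := k
      · simp at hij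
      · obtain rfl : i = (Fin.last k).castSucc := Fin.ext (by simp at hij ⊢; omega)
        rw [thetas_succ, ← h]
        change thetas _ * θ (d (Fin.last k).castSucc) * θ (d (Fin.last k).castSucc) = 0
        rw [mul_assoc, θ_mul_self, mul_zero]
    | cast j =>
      have hi : i.1 < k := by have := j.2; simp at hij; omega
      rw [ih (d := Fin.init d) (i := ⟨i.1, hi⟩) (j := j) hij h, zero_mul]

namespace Tup
variable {m : ℕ} {S S' : SMfd}

/-- The parameters of all vertices but the first one. -/
def params (d : Tup m S) (i : Fin m) : S ⟶ oddLine := d.1 i.succ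

/-- The tuple with given parameters. -/
def ofParams (d : Fin m → (S ⟶ oddLine)) : Tup m S :=
  ⟨Fin.cons (α := fun _ => S ⟶ oddLine) (zeroD S) d, rfl⟩

theorem ofParams_params (d : Tup m S) : ofParams d.params = d := ext' fun i => by
  induction i using Fin.cases with
  | zero => exact d.2.symm
  | succ i => rfl

theorem params_ofParams (d : Fin m → (S ⟶ oddLine)) : (ofParams d).params = d := rfl

theorem comp_ofParams (u : S' ⟶ S) (d : Fin m → (S ⟶ oddLine)) :
    (ofParams d).comp u = ofParams fun i => u ≫ d i := ext' fun i => by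
  induction i using Fin.cases with
  | zero => exact comp_zeroD u
  | succ i => rfl

/-- Repeating the first vertex makes the first parameter zero; repeating another vertex makes two
neighbouring parameters equal. -/
theorem thetas_degen (r : Fin (m + 1)) (d : Tup m S) : thetas (degen r d).params = 0 := by
  have h := degen_apply_eq r d
  induction r using Fin.cases with
  | zero =>
    refine thetas_eq_zero (i := 0) ?_
    have h0 : (degen 0 d).params 0 = zeroD S := h.symm.trans (degen 0 d).2
    rw [h0, θ_zeroD]
  | succ r => exact thetas_eq_zero_of_eq (i := r.castSucc) (j := r.succ) rfl h

end Tup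

/-- Natural families of functions depending on odd parameters and a morphism to `T`. -/
def IsNat {m : ℕ} {T : SMfd} (c : ∀ {S : SMfd}, Tup m S → (S ⟶ T) → Γ S) : Prop :=
  ∀ {S S' : SMfd} (u : S' ⟶ S) (d : Tup m S) (x : S ⟶ T), c (d.comp u) (u ≫ x) = pb u (c d x)

/-- The two vanishing conditions of `exists_top` say exactly that two neighbouring vertices agree,
the zeroth vertex being zero. -/
theorem exists_top_of_degen {k : ℕ} {T : SMfd} (c : ∀ {S : SMfd}, Tup (k + 1) S → (S ⟶ T) → Γ S)
    (hc : IsNat c) (h : ∀ (r : Fin (k + 1)) (S : SMfd) (d : Tup k S) (x : S ⟶ T), c (d.degen r) x = 0) :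
    ∃ v : Γ T, ∀ {S : SMfd} (d : Tup (k + 1) S) (x : S ⟶ T), c d x = pb x v * thetas d.params := by
  obtain ⟨v, hv⟩ := exists_top (k := k + 1) (T := T) (fun d x => c (Tup.ofParams d) x)
    (fun u d x => by rw [← hc, Tup.comp_ofParams])
    (fun {S} d x i hi hd => by
      obtain rfl : i = 0 := Fin.ext hi
      rw [Tup.eq_degen (r := 0) (d := Tup.ofParams d) (θ_inj ((θ_zeroD S).trans hd.symm)), h])
    (fun {S} d x i j hij hd => by
      have e : j.castSucc = i.succ := Fin.ext hij
      have e' : (Tup.ofParams d).1 j.castSucc = (Tup.ofParams d).1 j.succ := by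
        rw [e]; exact hd
      rw [Tup.eq_degen e', h])
  exact ⟨v, fun d x => by rw [← hv, Tup.ofParams_params]⟩

/-- A family of functions with prescribed values on degenerate parameters. -/
theorem exists_extension {k : ℕ} {T : SMfd} (w : Fin (k + 1) → ∀ {S : SMfd}, Tup k S → (S ⟶ T) → Γ S)
    (hn : ∀ r, IsNat (w r)) (h0 : ∀ r {S : SMfd} (d : Tup k S) (x : S ⟶ T), w r d x ∈ (Γ S).part 0)
    (hw : ∀ (r r' : Fin (k + 1)) (_ : r' < r) {S : SMfd} (d e : Tup k S) (x : S ⟶ T),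
      d.degen r = e.degen r' → w r d x = w r' e x) :
    ∃ γ : ∀ {S : SMfd}, Tup (k + 1) S → (S ⟶ T) → Γ S, IsNat γ ∧
      (∀ {S : SMfd} (d : Tup (k + 1) S) (x : S ⟶ T), γ d x ∈ (Γ S).part 0) ∧
      ∀ (r : Fin (k + 1)) {S : SMfd} (d : Tup k S) (x : S ⟶ T), γ (d.degen r) x = w r d x := by
  have key : ∀ n ≤ k + 1, ∃ γ : ∀ {S : SMfd}, Tup (k + 1) S → (S ⟶ T) → Γ S, IsNat γ ∧
      (∀ {S : SMfd} (d : Tup (k + 1) S) (x : S ⟶ T), γ d x ∈ (Γ S).part 0) ∧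
      ∀ (r : Fin (k + 1)), r.1 < n → ∀ {S : SMfd} (d : Tup k S) (x : S ⟶ T),
        γ (d.degen r) x = w r d x := by
    intro n hn'
    induction n with
    | zero =>
      exact ⟨fun _ _ => 0, fun u _ _ => (pb_zero u).symm, fun _ _ => zero_mem _, fun r hr => by omega⟩
    | succ n ih =>
      obtain ⟨γ, hγ, hγ0, hγw⟩ := ih (by omega)
      let r : Fin (k + 1) := ⟨n, by omega⟩
      -- The error along the `r`-th degeneracy is spread over all tuples by the retraction that
      -- forgets vertex r + 1 and repeats vertex r.
      refine ⟨fun d x => γ d x + (w r (d.face r) x - γ ((d.face r).degen r) x), fun u d x => ?_,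
        fun d x => add_mem (hγ0 _ _) (sub_mem (h0 _ _ _) (hγ0 _ _)), fun r' hr' S d x => ?_⟩
      · rw [pb_add, pb_sub, ← hγ, ← hγ, ← hn r]; rfl
      · rcases Nat.lt_succ_iff_lt_or_eq.1 hr' with hlt | heq
        · have hle : r' ≤ r := hlt.le
          let r₁ : Fin (k + 1) := ⟨r'.1 + 1, by omega⟩
          have hle₁ : r₁ ≤ r := hlt
          set g := (d.degen r').face r with hg
          -- For r' < r the vertices r' and r' + 1 survive the retraction, so it preserves
          -- r'-degenerate tuples. On these the correction vanishes by the compatibility `hw`.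
          have e : (g.degen r).1 r'.castSucc = (g.degen r).1 r'.succ := by
            have e1 : r'.succ = r₁.castSucc := rfl
            rw [e1, Tup.degen_apply_of_le _ _ _ hle, Tup.degen_apply_of_le _ _ _ hle₁, hg,
              Tup.face_apply_of_le _ _ _ hle, Tup.face_apply_of_le _ _ _ hle₁]
            exact Tup.degen_apply_eq r' d
          have e2 := Tup.eq_degen e
          change γ (d.degen r') x + (w r g x - γ (g.degen r) x) = _
          rw [hγw r' hlt, e2, hγw r' hlt, hw r r' hlt g _ x e2, sub_self, add_zero]
        · obtain rfl : r' = r := Fin.ext heq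
          change γ (d.degen r) x + (w r ((d.degen r).face r) x - γ (((d.degen r).face r).degen r) x) = _
          rw [Tup.face_degen_self]; abel
  obtain ⟨γ, h1, h2, h3⟩ := key (k + 1) le_rfl
  exact ⟨γ, h1, h2, fun r => h3 r r.2⟩

section Ext
variable {X : SimplicialObject SMfd} {T : SMfd}

/-- `B` extends the family of simplices `A` to the next dimension. -/
structure IsExt {m : ℕ} (A : Fam (X _⦋m⦌) m T) (B : Fam (X _⦋m + 1⦌) (m + 1) T) : Prop where
  face : ∀ (i : Fin (m + 1)) {S : SMfd} (d : Tup (m + 1) S) (x : S ⟶ T),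
    B.toFun d x ≫ X.δ i.succ = A.toFun (d.face i) x
  degen : ∀ (r : Fin (m + 1)) {S : SMfd} (d : Tup m S) (x : S ⟶ T),
    B.toFun (d.degen r) x = A.toFun d x ≫ X.σ r

theorem IsExt.pull {m : ℕ} {A : Fam (X _⦋m⦌) m T} {B : Fam (X _⦋m + 1⦌) (m + 1) T} (h : IsExt A B)
    {T' : SMfd} (n : T' ⟶ T) : IsExt (A.pull n) (B.pull n) :=
  ⟨fun i _ d x => h.face i d (x ≫ n), fun r _ d x => h.degen r d (x ≫ n)⟩

/-- A family of positive dimension extends some family. -/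
def HasFaces (k : ℕ) : Fam (X _⦋k⦌) k T → Prop :=
  Nat.casesOn (motive := fun k => Fam (X _⦋k⦌) k T → Prop) k (fun _ => True) fun _ A => ∃ A', IsExt A' A

variable {k : ℕ} {A : Fam (X _⦋k⦌) k T}

theorem HasFaces.compat (h : HasFaces k A) {S : SMfd} (d : Tup (k + 1) S) (x : S ⟶ T) :
    Compat X k fun i => A.toFun (d.face i) x := by
  cases k with
  | zero => trivial
  | succ k =>
    obtain ⟨A', hA⟩ := h
    intro i j hij hj
    obtain ⟨i, rfl⟩ : ∃ i' : Fin (k + 1), i = i'.castSucc := ⟨⟨i.1, by omega⟩, rfl⟩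
    obtain ⟨j, rfl⟩ : ∃ j' : Fin (k + 1), j = j'.succ := ⟨⟨j.1 - 1, by omega⟩, Fin.ext (by simp; omega)⟩
    have h1 := hA.face i (d.face j.succ) x
    have h2 := hA.face j (d.face i.castSucc) x
    rw [Tup.face_face (Nat.lt_succ_iff.1 hij)] at h1
    exact h1.trans h2.symm

/-- A tuple degenerate in two ways is doubly degenerate; there `A` is itself a degeneracy of the
lower family, and the identity between iterated degeneracies applies. -/
theorem HasFaces.degen_eq (h : HasFaces k A) {r r' : Fin (k + 1)} (hr : r' < r) {S : SMfd}
    {d e : Tup k S} (hde : d.degen r = e.degen r') (x : S ⟶ T) :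
    A.toFun d x ≫ X.σ r = A.toFun e x ≫ X.σ r' := by
  cases k with
  | zero => omega
  | succ k =>
    obtain ⟨A', hA⟩ := h
    obtain ⟨i, rfl⟩ : ∃ i' : Fin (k + 1), r' = i'.castSucc := ⟨⟨r'.1, by omega⟩, rfl⟩
    obtain ⟨j, rfl⟩ : ∃ j' : Fin (k + 1), r = j'.succ := ⟨⟨r.1 - 1, by omega⟩, Fin.ext (by simp; omega)⟩
    have hij : i ≤ j := Nat.lt_succ_iff.1 hr
    have hd : d.1 i.castSucc = d.1 i.succ := by
      have h1 := Tup.degen_apply_of_le j.succ d i.castSucc hr.le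
      have h2 := Tup.degen_apply_of_le j.succ d i.succ (Fin.succ_le_succ_iff.2 hij)
      rw [← h1, ← h2, hde]
      exact Tup.degen_apply_eq i.castSucc e
    obtain ⟨d', rfl⟩ : ∃ d', d = Tup.degen i d' := ⟨_, Tup.eq_degen hd⟩
    have he : e = d'.degen j := by
      rw [← Tup.face_degen_self i.castSucc e, ← hde, Tup.degen_degen hij, Tup.face_degen_self]
    rw [he, hA.degen, hA.degen, Category.assoc, Category.assoc, X.σ_comp_σ hij]

/-- The values prescribed on degenerate tuples lie over the prescribed horns. Face and degeneracy
either cancel or can be interchanged, and in the latter case the compatibility of `A` with the lower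
family is used. -/
theorem HasFaces.face_degen (h : HasFaces k A) (r i : Fin (k + 1)) {S : SMfd} (d : Tup k S)
    (x : S ⟶ T) : (A.toFun d x ≫ X.σ r) ≫ X.δ i.succ = A.toFun ((d.degen r).face i) x := by
  rw [Category.assoc]
  by_cases h1 : i = r
  · subst h1
    rw [Tup.face_degen_self, X.δ_comp_σ_succ, Category.comp_id]
  by_cases h2 : i.1 + 1 = r.1
  · have e : i.succ = r.castSucc := Fin.ext h2
    rw [Tup.face_degen_pred _ _ h2, e, X.δ_comp_σ_self, Category.comp_id]
  have h1' : i.1 ≠ r.1 := fun h => h1 (Fin.ext h)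
  cases k with
  | zero => omega
  | succ k =>
    obtain ⟨A', hA⟩ := h
    rcases lt_or_gt_of_ne h1' with hlt | hgt
    · obtain ⟨i, rfl⟩ : ∃ i' : Fin (k + 1), i = i'.castSucc := ⟨⟨i.1, by omega⟩, rfl⟩
      obtain ⟨r, rfl⟩ : ∃ r' : Fin (k + 1), r = r'.succ := ⟨⟨r.1 - 1, by omega⟩, Fin.ext (by simp; omega)⟩
      have hir : i < r := by simp at hlt h2; exact Fin.lt_def.2 (by omega)
      have e := X.δ_comp_σ_of_le (i := i.succ) (j := r) hir
      rw [Tup.face_degen_of_lt _ _ hir, hA.degen, ← hA.face, Category.assoc]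
      exact congrArg _ e
    · obtain ⟨i, rfl⟩ : ∃ i' : Fin (k + 1), i = i'.succ := ⟨⟨i.1 - 1, by omega⟩, Fin.ext (by simp; omega)⟩
      obtain ⟨r, rfl⟩ : ∃ r' : Fin (k + 1), r = r'.castSucc := ⟨⟨r.1, by omega⟩, rfl⟩
      have hir : r ≤ i := by simp at hgt; exact Fin.le_def.2 (by omega)
      have e := X.δ_comp_σ_of_gt (i := i.succ) (j := r) (Nat.lt_succ_of_le hir)
      rw [Tup.face_degen_of_gt _ _ hir, hA.degen, ← hA.face, Category.assoc]
      exact congrArg _ e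

end Ext
end SMfd

/-! ### Extensions inside a chart of the submersion to horns -/

namespace SMfd

namespace SubChart
variable {S : ℕ → ℕ → Prop} {Y H : SMfd} {f : Y ⟶ H} {x : Y.obj}

/-- If the data are attained at every point, local lifts exist everywhere, and their uniqueness
makes them glue. -/
theorem exists_hom (K : SubChart S f x) {R : SMfd} (g : R ⟶ H) (γ : R ⟶ std K.s K.t)
    (h : ∀ z, ∃ y, bmap g z = bmap (K.e ≫ f) y ∧ bmap γ z = bmap K.c y) :
    ∃ u : R ⟶ K.E, u ≫ K.e ≫ f = g ∧ u ≫ K.c = γ := by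
  choose y hy1 hy2 using h
  choose E' i hi τ u hτ h1 h2 using fun z => K.exists_lift (y z) g γ z (hy1 z) (hy2 z)
  have hcov : ∀ z, ∃ j : R.obj, z ∈ Set.range (bmap (i j)) := fun z => ⟨z, τ z, hτ z⟩
  obtain ⟨v, hv⟩ := exists_glue i hcov u fun a b Q α β hab => K.inj _ _
    (by rw [Category.assoc, Category.assoc, h1, h1, ← Category.assoc, hab, Category.assoc])
    (by rw [Category.assoc, Category.assoc, h2, h2, ← Category.assoc, hab, Category.assoc])
  exact ⟨v, hom_ext_of_cover i hcov fun j => by rw [← Category.assoc, hv, h1],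
    hom_ext_of_cover i hcov fun j => by rw [← Category.assoc, hv, h2]⟩

theorem even_ext {K : SubChart Even f x} {R : SMfd} {g g' : R ⟶ std K.s K.t}
    (h : ∀ i, pb g (coordX K.s K.t i) = pb g' (coordX K.s K.t i)) : g = g' :=
  std_hom_ext h fun j => (Fin.cast K.dim j).elim0

theorem exists_even_hom (K : SubChart Even f x) {R : SMfd} (F : Fin K.s → Γ R)
    (hF : ∀ i, F i ∈ (Γ R).part 0) : ∃ g : R ⟶ std K.s K.t, ∀ i, pb g (coordX K.s K.t i) = F i := by
  obtain ⟨g, hg, -⟩ := exists_hom_std (q := K.t) F (fun j => (Fin.cast K.dim j).elim0) hF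
    fun j => (Fin.cast K.dim j).elim0
  exact ⟨g, hg⟩

end SubChart

/-- An object representing horns, with the restriction of simplices to horns. -/
structure TopHorn (X : SimplicialObject SMfd) (k : ℕ) where
  N : SMfd
  p : Fin (k + 1) → (N ⟶ X _⦋k⦌)
  isHornObj : IsHornObj X k N p
  f : X _⦋k + 1⦌ ⟶ N
  f_p : ∀ i, f ≫ p i = X.δ i.succ

section Step
variable {X : SimplicialObject SMfd} {k : ℕ} {T : SMfd} {A : Fam (X _⦋k⦌) k T}

theorem HasFaces.exists_hornFam (hA : HasFaces k A) (Q : TopHorn X k) : ∃ b : Fam Q.N (k + 1) T,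
    ∀ {S : SMfd} (d : Tup (k + 1) S) (x : S ⟶ T) (i), b.toFun d x ≫ Q.p i = A.toFun (d.face i) x := by
  choose b hb using fun (S : SMfd) (d : Tup (k + 1) S) (x : S ⟶ T) =>
    Q.isHornObj.exists_hom _ (hA.compat d x)
  refine ⟨⟨fun {S} d x => b S d x, fun {S S'} u d x => Q.isHornObj.hom_ext _ _ fun i => ?_⟩,
    fun d x i => hb _ d x i⟩
  rw [hb, Category.assoc, hb]
  exact A.nat u (d.face i) x

/-- The degenerate simplices of the family lie in the chart `K`. -/
def InChart (A : Fam (X _⦋k⦌) k T) {Q : TopHorn X k} {x₀ : (X _⦋k + 1⦌).obj}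
    (K : SubChart Even Q.f x₀) : Prop :=
  ∀ z, bmap (A.toFun (Tup.zero k T) (𝟙 T) ≫ X.σ 0) z ∈ Set.range (bmap K.e)

variable {Q : TopHorn X k} {x₀ : (X _⦋k + 1⦌).obj} {K : SubChart Even Q.f x₀}

theorem InChart.zero_mem (hK : InChart A K) {S : SMfd} (x : S ⟶ T) (z : S.obj) :
    bmap (A.toFun (Tup.zero k S) x ≫ X.σ 0) z ∈ Set.range (bmap K.e) := by
  have h : A.toFun (Tup.zero k S) x = x ≫ A.toFun (Tup.zero k T) (𝟙 T) := by
    rw [← A.nat, Tup.comp_zero, Category.comp_id]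
  rw [h, Category.assoc, bmap_comp]
  exact hK _

/-- Lying in the chart is a condition on points, where the parameters may be taken to be zero; on
the zero tuple all degeneracies of `A` coincide. -/
theorem InChart.exists_lift_degen (hK : InChart A K) (hA : HasFaces k A) (r : Fin (k + 1)) {S : SMfd}
    (d : Tup k S) (x : S ⟶ T) : ∃ u : S ⟶ K.E, u ≫ K.e = A.toFun d x ≫ X.σ r := by
  refine ⟨lift K.e _ fun z => ?_, lift_fac _ _ _⟩
  rw [bmap_comp, A.bmap_eq d (Tup.zero k S), ← bmap_comp]
  have : A.toFun (Tup.zero k S) x ≫ X.σ r = A.toFun (Tup.zero k S) x ≫ X.σ 0 := by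
    rcases (Fin.zero_le r).lt_or_eq with h | h
    · exact hA.degen_eq h rfl x
    · rw [← h]
  rw [this]
  exact hK.zero_mem x z

theorem InChart.exists_lift (hK : InChart A K) {B : Fam (X _⦋k + 1⦌) (k + 1) T} (hB : IsExt A B)
    {S : SMfd} (d : Tup (k + 1) S) (x : S ⟶ T) : ∃ u : S ⟶ K.E, u ≫ K.e = B.toFun d x := by
  refine ⟨lift K.e _ fun z => ?_, lift_fac _ _ _⟩
  have h := hB.degen 0 (Tup.zero k S) x
  rw [B.bmap_eq d ((Tup.zero k S).degen 0), h]
  exact hK.zero_mem x z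

/-- In the chart a simplex is a pair of a horn and coordinates. The horn is dictated by `A`, so
extending `A` amounts to choosing coordinates with the right values on degenerate tuples. -/
theorem exists_isExt_of_coords (hA : HasFaces k A) (hK : InChart A K) (G : Fam (std K.s K.t) (k + 1) T)
    (hG : ∀ (r : Fin (k + 1)) {S : SMfd} (d : Tup k S) (x : S ⟶ T) (u : S ⟶ K.E),
      u ≫ K.e = A.toFun d x ≫ X.σ r → G.toFun (d.degen r) x = u ≫ K.c) :
    ∃ B : Fam (X _⦋k + 1⦌) (k + 1) T, IsExt A B ∧ ∀ {S : SMfd} (d : Tup (k + 1) S) (x : S ⟶ T)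
      (u : S ⟶ K.E), u ≫ K.e = B.toFun d x → u ≫ K.c = G.toFun d x := by
  obtain ⟨b, hb⟩ := hA.exists_hornFam Q
  have hbd : ∀ (r : Fin (k + 1)) {S : SMfd} (d : Tup k S) (x : S ⟶ T) (u : S ⟶ K.E),
      u ≫ K.e = A.toFun d x ≫ X.σ r → b.toFun (d.degen r) x = u ≫ K.e ≫ Q.f := fun r S d x u hu =>
    Q.isHornObj.hom_ext _ _ fun i => by
      rw [hb, ← hA.face_degen, ← hu]; simp [Q.f_p]
  have hex : ∀ (S : SMfd) (d : Tup (k + 1) S) (x : S ⟶ T), ∃ u : S ⟶ K.E,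
      u ≫ K.e ≫ Q.f = b.toFun d x ∧ u ≫ K.c = G.toFun d x := fun S d x => by
    refine K.exists_hom _ _ fun z => ?_
    -- On points the tuple may be replaced by a degenerate one, for which the pair comes from a
    -- simplex of the chart.
    obtain ⟨u, hu⟩ := hK.exists_lift_degen hA 0 (Tup.zero k S) x
    refine ⟨bmap u z, ?_, ?_⟩
    · rw [b.bmap_eq d ((Tup.zero k S).degen 0), hbd 0 _ _ u hu, bmap_comp]
    · rw [G.bmap_eq d ((Tup.zero k S).degen 0), hG 0 _ _ u hu, bmap_comp]
  choose v hv1 hv2 using hex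
  refine ⟨⟨fun {S} d x => v S d x ≫ K.e, fun {S S'} u d x => ?_⟩, ⟨fun i S d x => ?_, fun r S d x => ?_⟩,
    fun {S} d x u hu => ?_⟩
  · rw [← Category.assoc]
    congr 1
    refine K.inj _ _ ?_ ?_
    · rw [hv1, b.nat, ← hv1, Category.assoc]
    · rw [hv2, G.nat, ← hv2, Category.assoc]
  · rw [← Q.f_p, ← hb, ← hv1]; simp
  · obtain ⟨u, hu⟩ := hK.exists_lift_degen hA r d x
    rw [← hu]
    change v S (d.degen r) x ≫ K.e = _
    congr 1
    refine K.inj _ _ ?_ ?_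
    · rw [hv1, hbd r d x u hu]
    · rw [hv2, hG r d x u hu]
  · have : u = v S d x := by rw [← cancel_mono K.e]; exact hu
    rw [this, hv2]

/-- Families of simplices extend to the next dimension, locally. -/
theorem InChart.exists_isExt (hK : InChart A K) (hA : HasFaces k A) :
    ∃ B : Fam (X _⦋k + 1⦌) (k + 1) T, IsExt A B := by
  choose u hu using fun (r : Fin (k + 1)) (S : SMfd) (d : Tup k S) (x : S ⟶ T) =>
    hK.exists_lift_degen hA r d x
  have hγ : ∀ i : Fin K.s, ∃ γ : ∀ {S : SMfd}, Tup (k + 1) S → (S ⟶ T) → Γ S, IsNat γ ∧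
      (∀ {S : SMfd} (d : Tup (k + 1) S) (x : S ⟶ T), γ d x ∈ (Γ S).part 0) ∧
      ∀ (r : Fin (k + 1)) {S : SMfd} (d : Tup k S) (x : S ⟶ T),
        γ (d.degen r) x = pb (u r S d x ≫ K.c) (coordX K.s K.t i) := fun i => by
    refine exists_extension (fun r {S} d x => pb (u r S d x ≫ K.c) (coordX K.s K.t i))
      (fun r {S S'} v d x => ?_) (fun r S d x => pb_mem _ (coordX_mem _ _ _))
      fun r r' hr S d e x hde => ?_
    · have h1 : u r S' (d.comp v) (v ≫ x) = v ≫ u r S d x := by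
        rw [← cancel_mono K.e, hu, A.nat, Category.assoc, Category.assoc, hu]
      change pb (u r S' (d.comp v) (v ≫ x) ≫ K.c) _ = pb v (pb (u r S d x ≫ K.c) _)
      rw [h1, Category.assoc, pb_comp v]
    · have : u r S d x = u r' S e x := by
        rw [← cancel_mono K.e, hu, hu, hA.degen_eq hr hde]
      rw [this]
  choose γ hγn hγ0 hγd using hγ
  choose g hg using fun (S : SMfd) (d : Tup (k + 1) S) (x : S ⟶ T) =>
    K.exists_even_hom (fun i => γ i d x) fun i => hγ0 i d x
  let G : Fam (std K.s K.t) (k + 1) T := ⟨fun {S} d x => g S d x, fun {S S'} v d x =>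
    SubChart.even_ext fun i => by
      rw [hg, pb_comp v (g S d x), hg]; exact hγn i v d x⟩
  obtain ⟨B, hB, -⟩ := exists_isExt_of_coords hA hK G fun r S d x v hv =>
    SubChart.even_ext fun i => by
      have : v = u r S d x := by rw [← cancel_mono K.e, hv, hu]
      exact (hg _ _ _ i).trans ((hγd i r d x).trans (by rw [this]))
  exact ⟨B, hB⟩

/-- The coordinates of `B` and `B'` differ by the top forms with coefficients `v`. -/
def Diff (K : SubChart Even Q.f x₀) (B B' : Fam (X _⦋k + 1⦌) (k + 1) T) (v : Fin K.s → Γ T) : Prop :=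
  ∀ ⦃S : SMfd⦄ (d : Tup (k + 1) S) (x : S ⟶ T) (u u' : S ⟶ K.E), u ≫ K.e = B.toFun d x →
    u' ≫ K.e = B'.toFun d x → ∀ i, pb (u ≫ K.c) (coordX K.s K.t i) =
      pb (u' ≫ K.c) (coordX K.s K.t i) + pb x (v i) * thetas d.params

variable {B B' B'' : Fam (X _⦋k + 1⦌) (k + 1) T} {v v' : Fin K.s → Γ T}

theorem Diff.pull (h : Diff K B B' v) {T' : SMfd} (n : T' ⟶ T) :
    Diff K (B.pull n) (B'.pull n) fun i => pb n (v i) := fun S d x u u' hu hu' i => by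
  rw [← pb_comp]
  exact h d (x ≫ n) u u' hu hu' i

/-- Two extensions agree on degenerate tuples, so their coordinates differ by multiples of the
product of all parameters. The difference is even, hence each coefficient has the parity of the
number of parameters. -/
theorem InChart.exists_diff (hK : InChart A K) (hB : IsExt A B) (hB' : IsExt A B') :
    ∃ v : Fin K.s → Γ T, (∀ i, v i ∈ (Γ T).part (k + 1 : ℕ)) ∧ Diff K B B' v := by
  choose u hu using fun (S : SMfd) (d : Tup (k + 1) S) (x : S ⟶ T) => hK.exists_lift hB d x
  choose u' hu' using fun (S : SMfd) (d : Tup (k + 1) S) (x : S ⟶ T) => hK.exists_lift hB' d x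
  have hn : ∀ {S S' : SMfd} (w : S' ⟶ S) (d : Tup (k + 1) S) (x : S ⟶ T),
      u S' (d.comp w) (w ≫ x) = w ≫ u S d x ∧ u' S' (d.comp w) (w ≫ x) = w ≫ u' S d x :=
    fun w d x => ⟨by rw [← cancel_mono K.e, hu, B.nat, Category.assoc, hu],
      by rw [← cancel_mono K.e, hu', B'.nat, Category.assoc, hu']⟩
  have hv : ∀ i : Fin K.s, ∃ v : Γ T, ∀ {S : SMfd} (d : Tup (k + 1) S) (x : S ⟶ T),
      pb (u S d x ≫ K.c) (coordX K.s K.t i) - pb (u' S d x ≫ K.c) (coordX K.s K.t i) =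
        pb x v * thetas d.params := fun i => by
    refine exists_top_of_degen (fun {S} d x => pb (u S d x ≫ K.c) (coordX K.s K.t i) -
      pb (u' S d x ≫ K.c) (coordX K.s K.t i)) (fun {S S'} w d x => ?_) fun r S d x => ?_
    · change pb (u S' (d.comp w) (w ≫ x) ≫ K.c) _ - pb (u' S' (d.comp w) (w ≫ x) ≫ K.c) _ =
        pb w (pb (u S d x ≫ K.c) _ - pb (u' S d x ≫ K.c) _)
      rw [(hn w d x).1, (hn w d x).2, pb_sub, Category.assoc, Category.assoc, pb_comp w, pb_comp w]
    · have : u S (d.degen r) x = u' S (d.degen r) x := by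
        rw [← cancel_mono K.e, hu, hu', hB.degen, hB'.degen]
      rw [this, sub_self]
  choose v hv using hv
  refine ⟨v, fun i => ?_, fun S d x w w' hw hw' i => ?_⟩
  · have := top_mem (k := k + 1) (v := v i) (i := 0) fun S d x => by
      rw [← Tup.params_ofParams d, ← hv]
      exact sub_mem (pb_mem _ (coordX_mem _ _ _)) (pb_mem _ (coordX_mem _ _ _))
    rwa [zero_add] at this
  · obtain rfl : w = u S d x := by rw [← cancel_mono K.e, hw, hu]
    obtain rfl : w' = u' S d x := by rw [← cancel_mono K.e, hw', hu']
    rw [← hv]; abel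

theorem InChart.diff_unique (hK : InChart A K) (hB : IsExt A B) (hB' : IsExt A B') (h : Diff K B B' v)
    (h' : Diff K B B' v') : v = v' := funext fun i => sub_eq_zero.1
  (eq_zero_of_mul_thetas (k := k + 1) fun S d x => by
    obtain ⟨u, hu⟩ := hK.exists_lift hB (Tup.ofParams d) x
    obtain ⟨u', hu'⟩ := hK.exists_lift hB' (Tup.ofParams d) x
    have h1 := h _ x u u' hu hu' i
    rw [h' _ x u u' hu hu' i, Tup.params_ofParams] at h1
    rw [pb_sub, sub_mul, sub_eq_zero]
    exact (add_left_cancel h1).symm)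

theorem IsExt.comp_f (hB : IsExt A B) (hB' : IsExt A B') {S : SMfd} (d : Tup (k + 1) S) (x : S ⟶ T) :
    B.toFun d x ≫ Q.f = B'.toFun d x ≫ Q.f := Q.isHornObj.hom_ext _ _ fun i => by
  rw [Category.assoc, Category.assoc, Q.f_p, hB.face, hB'.face]

/-- Both families have the same horns, and in the chart also the same coordinates. -/
theorem InChart.eq_of_diff (hK : InChart A K) (hB : IsExt A B) (hB' : IsExt A B') (hB'' : IsExt A B'')
    (h : Diff K B B'' v) (h' : Diff K B' B'' v) : B = B' := Fam.ext' fun S d x => by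
  obtain ⟨u, hu⟩ := hK.exists_lift hB d x
  obtain ⟨u', hu'⟩ := hK.exists_lift hB' d x
  obtain ⟨u'', hu''⟩ := hK.exists_lift hB'' d x
  rw [← hu, ← hu']
  congr 1
  refine K.inj _ _ ?_ (SubChart.even_ext fun i => ?_)
  · rw [← Category.assoc, ← Category.assoc, hu, hu', hB.comp_f hB']
  · rw [h d x u u'' hu hu'', h' d x u' u'' hu' hu'']

/-- A multiple of the product of the parameters vanishes on degenerate tuples, and the parity of `v`
makes it even, so it may be added to the coordinates. Thus the extensions form a torsor. -/
theorem InChart.exists_isExt_diff (hK : InChart A K) (hA : HasFaces k A) (hB' : IsExt A B')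
    (hv : ∀ i, v i ∈ (Γ T).part (k + 1 : ℕ)) : ∃ B, IsExt A B ∧ Diff K B B' v := by
  choose u' hu' using fun (S : SMfd) (d : Tup (k + 1) S) (x : S ⟶ T) => hK.exists_lift hB' d x
  have htwo : ∀ j : ZMod 2, j + j = 0 := by decide
  choose g hg using fun (S : SMfd) (d : Tup (k + 1) S) (x : S ⟶ T) =>
    K.exists_even_hom (fun i => pb (u' S d x ≫ K.c) (coordX K.s K.t i) + pb x (v i) * thetas d.params)
      fun i => add_mem (pb_mem _ (coordX_mem _ _ _))
        ((Γ S).mul_mem_part (htwo _) (pb_mem x (hv i)) (thetas_mem _))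
  let G : Fam (std K.s K.t) (k + 1) T := ⟨fun {S} d x => g S d x, fun {S S'} w d x =>
    SubChart.even_ext fun i => by
      have h1 : u' S' (d.comp w) (w ≫ x) = w ≫ u' S d x := by
        rw [← cancel_mono K.e, hu', B'.nat, Category.assoc, hu']
      have h2 : thetas (d.comp w).params = pb w (thetas d.params) := (pb_thetas _ _).symm
      rw [hg, pb_comp w (g S d x), hg, pb_add, pb_mul, h1, h2, Category.assoc, pb_comp w, pb_comp w]⟩
  obtain ⟨B, hB, hBG⟩ := exists_isExt_of_coords hA hK G fun r S d x w hw =>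
    SubChart.even_ext fun i => by
      have : w = u' S (d.degen r) x := by rw [← cancel_mono K.e, hw, hu', hB'.degen]
      refine (hg _ _ _ i).trans ?_
      rw [Tup.thetas_degen, mul_zero, add_zero, this]
  refine ⟨B, hB, fun S d x w w' hw hw' i => ?_⟩
  obtain rfl : w' = u' S d x := by rw [← cancel_mono K.e, hw', hu']
  rw [hBG d x w hw]
  exact hg _ _ _ i

end Step
end SMfd

/-! ### Representability of jets of each dimension -/

namespace SMfd

/-- The classifying object is ℝ^{s|0} or ℝ^{0|s}, according to the parity; it is the model of the
fibre in each step of the tower. -/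
theorem exists_classifier (s : ℕ) (ε : ZMod 2) : ∃ (a b : ℕ) (κ : Fin s → Γ (std a b)),
    (∀ i, κ i ∈ (Γ (std a b)).part ε) ∧
    (∀ {S : SMfd} (v : Fin s → Γ S), (∀ i, v i ∈ (Γ S).part ε) → ∃ c : S ⟶ std a b, ∀ i, pb c (κ i) = v i) ∧
    ∀ {S : SMfd} (c c' : S ⟶ std a b), (∀ i, pb c (κ i) = pb c' (κ i)) → c = c' := by
  obtain rfl | rfl : ε = 0 ∨ ε = 1 := by revert ε; decide
  · refine ⟨s, 0, coordX s 0, coordX_mem _ _, fun {S} v hv => ?_, fun {S} c c' h =>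
      std_hom_ext h fun j => j.elim0⟩
    obtain ⟨c, hc, -⟩ := exists_hom_std (q := 0) v (fun j => j.elim0) hv fun j => j.elim0
    exact ⟨c, hc⟩
  · refine ⟨0, s, coordT 0 s, coordT_mem _ _, fun {S} v hv => ?_, fun {S} c c' h =>
      std_hom_ext (fun j => j.elim0) h⟩
    obtain ⟨c, -, hc⟩ := exists_hom_std (p := 0) (fun j => j.elim0) v (fun j => j.elim0) hv
    exact ⟨c, hc⟩

section Jet
variable {X : SimplicialObject SMfd} {k : ℕ} {T : SMfd}

/-- The family one dimension lower which a family of simplices extends. -/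
def Fam.bot (B : Fam (X _⦋k + 1⦌) (k + 1) T) : Fam (X _⦋k⦌) k T where
  toFun d x := B.toFun (d.degen 0) x ≫ X.δ (Fin.succ 0)
  nat u d x := by
    rw [← Category.assoc, ← B.nat]; rfl

theorem IsExt.bot_eq {A : Fam (X _⦋k⦌) k T} {B : Fam (X _⦋k + 1⦌) (k + 1) T} (h : IsExt A B) :
    B.bot = A := Fam.ext' fun S d x => by
  change B.toFun (d.degen 0) x ≫ X.δ (Fin.succ 0) = _
  rw [h.face, Tup.face_degen_self]

/-- Natural families of simplices of dimension `k` with vertices indexed by odd parameters,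
compatible with faces and degeneracies. -/
def IsJet (k : ℕ) : Fam (X _⦋k⦌) k T → Prop :=
  Nat.rec (motive := fun k => Fam (X _⦋k⦌) k T → Prop) (fun _ => True)
    (fun _ P B => P B.bot ∧ IsExt B.bot B) k

theorem IsJet.hasFaces {A : Fam (X _⦋k⦌) k T} (h : IsJet k A) : HasFaces k A := by
  cases k with
  | zero => trivial
  | succ k => exact ⟨_, h.2⟩

theorem IsExt.isJet {A : Fam (X _⦋k⦌) k T} {B : Fam (X _⦋k + 1⦌) (k + 1) T} (hA : IsJet k A)
    (h : IsExt A B) : IsJet (k + 1) B := by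
  rw [← h.bot_eq] at hA h
  exact ⟨hA, h⟩

theorem IsJet.pull {A : Fam (X _⦋k⦌) k T} (h : IsJet k A) {T' : SMfd} (n : T' ⟶ T) :
    IsJet k (A.pull n) := by
  induction k with
  | zero => trivial
  | succ k ih => exact ⟨ih h.1, h.2.pull n⟩

theorem IsExt.of_cover {ι : Type} {E : ι → SMfd} (e : ∀ i, E i ⟶ T) [∀ i, IsOpenImm (e i)]
    (hcov : ∀ x, ∃ i, x ∈ Set.range (bmap (e i))) {A : Fam (X _⦋k⦌) k T}
    {B : Fam (X _⦋k + 1⦌) (k + 1) T} (h : ∀ i, IsExt (A.pull (e i)) (B.pull (e i))) : IsExt A B := by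
  have hl : ∀ {S : SMfd} (x : S ⟶ T) (i), ∃ l, l ≫ e i = restrι S (preim x (opensRange (e i))) ≫ x :=
    fun {S} x i => ⟨lift (e i) (restrι S (preim x (opensRange (e i))) ≫ x) fun y => y.2, lift_fac _ _ _⟩
  have hc : ∀ {S : SMfd} (x : S ⟶ T) (y : S.obj),
      ∃ i, y ∈ Set.range (bmap (restrι S (preim x (opensRange (e i))))) := fun {S} x y =>
    (hcov (bmap x y)).imp fun i hi => ⟨⟨y, hi⟩, rfl⟩
  refine ⟨fun i S d x => hom_ext_of_cover _ (hc x) fun a => ?_,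
    fun r S d x => hom_ext_of_cover _ (hc x) fun a => ?_⟩
  · obtain ⟨l, hl⟩ := hl x a
    rw [← Category.assoc, ← B.nat, ← A.nat, ← hl]
    exact (h a).face i (d.comp _) l
  · obtain ⟨l, hl⟩ := hl x a
    rw [← Category.assoc, ← B.nat, ← A.nat, ← hl]
    exact (h a).degen r (d.comp _) l

theorem IsJet.of_cover {ι : Type} {E : ι → SMfd} (e : ∀ i, E i ⟶ T) [∀ i, IsOpenImm (e i)]
    (hcov : ∀ x, ∃ i, x ∈ Set.range (bmap (e i))) {A : Fam (X _⦋k⦌) k T}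
    (h : ∀ i, IsJet k (A.pull (e i))) : IsJet k A := by
  induction k with
  | zero => trivial
  | succ k ih => exact ⟨ih fun i => (h i).1, IsExt.of_cover e hcov fun i => (h i).2⟩

variable (X k) in
/-- The presheaf of compatible families of simplices of dimension `k`. -/
def jets : SMfdᵒᵖ ⥤ Type 1 where
  obj T := {A : Fam (X _⦋k⦌) k T.unop // IsJet k A}
  map u := ↾fun A => ⟨A.1.pull u.unop, A.2.pull u.unop⟩
  map_id T := by
    refine ConcreteCategory.hom_ext _ _ fun A => ?_
    exact Subtype.ext A.1.pull_id
  map_comp u v := by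
    refine ConcreteCategory.hom_ext _ _ fun A => ?_
    exact Subtype.ext (A.1.pull_pull _ _).symm

theorem jets_isLocal : IsLocal (jets X k) := by
  intro T ι E e he hcov s hs
  obtain ⟨F, hF⟩ := Fam.exists_glue e hcov (fun i => (s i).1) fun i j S a b hab =>
    congrArg Subtype.val (hs i j S a b hab)
  refine ⟨⟨F, IsJet.of_cover e hcov fun i => ?_⟩, fun i => Subtype.ext (hF i), fun G hG =>
    Subtype.ext (Fam.ext_of_cover e hcov fun i => ?_)⟩
  · rw [hF]; exact (s i).2
  · exact (congrArg Subtype.val (hG i)).trans (hF i).symm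

/-- The restriction of jets to lower dimension. -/
def jetBot (B : (jets X (k + 1)).obj (op T)) : (jets X k).obj (op T) := ⟨B.1.bot, B.2.1⟩

/-- In dimension 0 the only tuple is the zero vertex, so a natural family is a morphism by the
Yoneda lemma. -/
theorem jets_zero_representable : Nonempty ((jets X 0).RepresentableBy (X _⦋0⦌)) := by
  have hT : ∀ {S : SMfd} (d : Tup 0 S), d = Tup.zero 0 S := fun d => Tup.ext' fun i => by
    obtain rfl : i = 0 := Fin.ext (by omega)
    exact d.2
  refine ⟨{ homEquiv := fun {T} =>
              { toFun := fun f => ⟨⟨fun _ x => x ≫ f, fun u d x => Category.assoc _ _ _⟩, trivial⟩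
                invFun := fun A => A.1.toFun (Tup.zero 0 T) (𝟙 T)
                left_inv := fun f => Category.id_comp f
                right_inv := fun A => Subtype.ext (Fam.ext' fun S d x => ?_) }
            homEquiv_comp := fun f g => Subtype.ext (Fam.ext' fun S d x => (Category.assoc _ _ _).symm) }⟩
  change x ≫ A.1.toFun (Tup.zero 0 T) (𝟙 T) = _
  rw [← A.1.nat, Category.comp_id, hT d, hT (Tup.comp _ _)]

section Step
variable {M : SMfd} (r : (jets X k).RepresentableBy M)

/-- Jets lie over the supermanifold of jets of lower dimension. -/
def jetsOver : Over (jets X (k + 1)) M M.obj where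
  π B := r.homEquiv.symm (jetBot B)
  π_map u B := r.homEquiv.injective (by
    rw [r.homEquiv_comp, Equiv.apply_symm_apply, Equiv.apply_symm_apply]; rfl)
  -- The lower jets alone can serve as base space: over an open set where an origin is chosen, every
  -- value of the fibre coordinates is realised.
  β B := bmap (r.homEquiv.symm (jetBot B))
  continuous_β B := continuous_bmap _
  β_map u B x := by
    rw [← bmap_comp]
    refine congrArg (fun f => bmap f x) (r.homEquiv.injective ?_)
    rw [r.homEquiv_comp, Equiv.apply_symm_apply, Equiv.apply_symm_apply]; rfl
  ρ := id
  continuous_ρ := continuous_id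
  ρ_β _ _ := rfl

theorem bot_eq_pull (B : (jets X (k + 1)).obj (op T)) :
    B.1.bot = (r.homEquiv (𝟙 M)).1.pull ((jetsOver r).π B) := by
  have h := r.homEquiv_eq ((jetsOver r).π B)
  have h' : r.homEquiv ((jetsOver r).π B) = jetBot B := Equiv.apply_symm_apply _ _
  exact congrArg Subtype.val (h'.symm.trans h)

theorem π_eq {B : (jets X (k + 1)).obj (op T)} {n : T ⟶ M} (h : B.1.bot = (r.homEquiv (𝟙 M)).1.pull n) :
    (jetsOver r).π B = n := r.homEquiv.injective (Subtype.ext (by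
  rw [r.homEquiv_eq n]
  exact (congrArg Subtype.val (Equiv.apply_symm_apply r.homEquiv (jetBot B))).trans h))

theorem inChart_pull {A : Fam (X _⦋k⦌) k M} {Q : TopHorn X k} {x₀ : (X _⦋k + 1⦌).obj}
    (K : SubChart Even Q.f x₀) (n : T ⟶ M) (h : ∀ z, bmap n z ∈
      preim (A.toFun (Tup.zero k M) (𝟙 M) ≫ X.σ 0) (opensRange K.e)) : InChart (A.pull n) K := fun z => by
  have h1 : (A.pull n).toFun (Tup.zero k T) (𝟙 T) = n ≫ A.toFun (Tup.zero k M) (𝟙 M) := by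
    rw [← A.nat, Tup.comp_zero, Category.comp_id]
    exact congrArg _ (Category.id_comp _)
  rw [h1, Category.assoc, bmap_comp]
  exact h z

/-- The fibre coordinate of a jet is the morphism classifying its difference from a fixed local
extension of the universal lower jet. The torsor property of extensions gives injectivity and
lifting. -/
theorem exists_jets_coord (Q : TopHorn X k) (hQ : IsSub Even Q.f) (b : M.obj) :
    Nonempty ((jetsOver r).Coord b fun _ _ => True) := by
  set A := r.homEquiv (𝟙 M) with hA
  obtain ⟨K⟩ := hQ (bmap (A.1.toFun (Tup.zero k M) (𝟙 M) ≫ X.σ 0) b)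
  let W := preim (A.1.toFun (Tup.zero k M) (𝟙 M) ≫ X.σ 0) (opensRange K.e)
  let ι : restr M W ⟶ M := restrι M W
  have hKι : InChart (A.1.pull ι) K := inChart_pull K ι fun z => z.2
  -- `C` is the origin of the torsor over `W`.
  obtain ⟨C, hC⟩ := hKι.exists_isExt (A.2.pull ι).hasFaces
  obtain ⟨a, d, κ, hκ, hκ1, hκ2⟩ := exists_classifier K.s (k + 1 : ℕ)
  have hCl : ∀ {T : SMfd} (n : T ⟶ M) (l : T ⟶ restr M W), l ≫ ι = n →
      IsExt (A.1.pull n) (C.pull l) := fun n l hl => by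
    have := hC.pull l
    rwa [Fam.pull_pull, hl] at this
  have hlift : ∀ {T : SMfd} (n : T ⟶ M), (∀ z, bmap n z ∈ W) → ∃ l, l ≫ ι = n := fun n h =>
    ⟨lift ι n fun z => by rw [range_restrι]; exact h z, lift_fac _ _ _⟩
  have hc : ∀ {T : SMfd} (j : (jets X (k + 1)).obj (op T)), (∀ x, (jetsOver r).β j x ∈ W) →
      ∃ c : T ⟶ std a d, ∀ l, l ≫ ι = (jetsOver r).π j →
        Diff K j.1 (C.pull l) fun i => pb c (κ i) := fun {T} j h => by
    obtain ⟨l, hl⟩ := hlift ((jetsOver r).π j) h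
    have hj := j.2.2
    rw [bot_eq_pull r] at hj
    obtain ⟨v, hv, hvd⟩ := (inChart_pull K ((jetsOver r).π j) h).exists_diff hj (hCl _ l hl)
    obtain ⟨c, hc⟩ := hκ1 v hv
    refine ⟨c, fun l' hl' => ?_⟩
    obtain rfl : l' = l := by rw [← cancel_mono ι, hl', hl]
    simp only [hc]
    exact hvd
  have huniq : ∀ {T : SMfd} (j : (jets X (k + 1)).obj (op T)) (_ : ∀ x, (jetsOver r).β j x ∈ W) (l)
      (_ : l ≫ ι = (jetsOver r).π j) (c c' : T ⟶ std a d), (Diff K j.1 (C.pull l) fun i => pb c (κ i)) →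
      (Diff K j.1 (C.pull l) fun i => pb c' (κ i)) → c = c' := fun j h l hl c c' h1 h2 => by
    have hj := j.2.2
    rw [bot_eq_pull r] at hj
    refine hκ2 _ _ fun i => ?_
    exact congrFun ((inChart_pull K ((jetsOver r).π j) h).diff_unique hj (hCl _ l hl) h1 h2) i
  choose c hcd using @hc
  refine ⟨{ W := W, mem := ⟨_, K.mem.choose_spec⟩, s := a, t := d, dim := trivial,
            c := c, c_map := fun {S T} u j h h' => ?_, inj := fun {T} j j' h h' hπ hcc => ?_,
            lift := fun {T₀ T} j h τ₀ n γ τ hn hγ => ?_ }⟩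
  · obtain ⟨l, hl⟩ := hlift ((jetsOver r).π j) h
    have hl' : (u ≫ l) ≫ ι = (jetsOver r).π ((jets X (k + 1)).map u.op j) := by
      rw [(jetsOver r).π_map, Category.assoc, hl]
    refine huniq _ h' (u ≫ l) hl' _ _ (hcd _ h' _ hl') ?_
    have := (hcd j h l hl).pull u
    rw [Fam.pull_pull] at this
    simp only [pb_comp u]
    exact this
  · obtain ⟨l, hl⟩ := hlift ((jetsOver r).π j) h
    have hj := j.2.2
    have hj' := j'.2.2
    rw [bot_eq_pull r] at hj hj'
    rw [← hπ] at hj'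
    have h1 := hcd j h l hl
    have h2 := hcd j' h' l (hl.trans hπ)
    simp only [← hcc] at h2
    exact Subtype.ext ((inChart_pull K ((jetsOver r).π j) h).eq_of_diff hj hj' (hCl _ l hl) h1 h2)
  · let e := restrι T (preim n W)
    have hτ : bmap n τ ∈ W := by rw [hn]; exact h τ₀
    have hen : ∀ z, bmap (e ≫ n) z ∈ W := fun z => z.2
    obtain ⟨l, hl⟩ := hlift (e ≫ n) hen
    obtain ⟨B, hB, hBd⟩ := (inChart_pull K (e ≫ n) hen).exists_isExt_diff (A.2.pull _).hasFaces
      (hCl _ l hl) (v := fun i => pb (e ≫ γ) (κ i)) fun i => pb_mem _ (hκ i)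
    let j' : (jets X (k + 1)).obj (op (restr T (preim n W))) := ⟨B, hB.isJet (A.2.pull _)⟩
    have hπ : (jetsOver r).π j' = e ≫ n := π_eq r hB.bot_eq
    have h' : ∀ x, (jetsOver r).β j' x ∈ W := fun x => by
      change bmap ((jetsOver r).π j') x ∈ W
      rw [hπ]; exact hen x
    exact ⟨_, e, inferInstance, j', h', ⟨⟨τ, hτ⟩, rfl⟩, hπ,
      huniq j' h' l (hl.trans hπ.symm) _ _ (hcd j' h' l (hl.trans hπ.symm)) hBd⟩

end Step

/-- The presheaves of jets are representable. -/
theorem jets_representable (hX : ∀ m, ∃ Q : TopHorn X m, IsSub Even Q.f) (k : ℕ) :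
    ∃ M, Nonempty ((jets X k).RepresentableBy M) := by
  induction k with
  | zero => exact ⟨_, jets_zero_representable⟩
  | succ k ih =>
    obtain ⟨M, ⟨r⟩⟩ := ih
    obtain ⟨Q, hQ⟩ := hX k
    have h1 : T2Space M.obj := M.property.1
    have h2 : SecondCountableTopology M.obj := M.property.2.1
    -- Dimensions are unrestricted, since odd fibre directions can occur when `k + 1` is odd.
    obtain ⟨M', -, hM'⟩ := (jetsOver r).representable (S := fun _ _ => True) jets_isLocal
      (fun _ _ _ _ _ _ => trivial) M.property.2.2 (exists_jets_coord r Q hQ)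
    exact ⟨M', hM'⟩

theorem jetBot_injective (Q : TopHorn X k) [IsIso Q.f] :
    Function.Injective (jetBot : (jets X (k + 1)).obj (op T) → _) := fun B B' h =>
  Subtype.ext (Fam.ext' fun S d x => by
    have h1 := B.2.2
    rw [show B.1.bot = B'.1.bot from congrArg Subtype.val h] at h1
    rw [← cancel_mono Q.f]
    exact h1.comp_f B'.2.2 d x)

/-- Horns have unique fillers, so the family of horns determined by the lower jet is filled;
compatibility with degeneracies may be checked on horns. -/
theorem jetBot_surjective (Q : TopHorn X k) [IsIso Q.f] :
    Function.Surjective (jetBot : (jets X (k + 1)).obj (op T) → _) := fun A => by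
  obtain ⟨b, hb⟩ := A.2.hasFaces.exists_hornFam Q
  let B : Fam (X _⦋k + 1⦌) (k + 1) T := ⟨fun d x => b.toFun d x ≫ inv Q.f, fun u d x => by
    rw [b.nat, Category.assoc]⟩
  have hB : IsExt A.1 B := by
    refine ⟨fun i S d x => ?_, fun i S d x => ?_⟩
    · change (b.toFun d x ≫ inv Q.f) ≫ _ = _
      rw [← Q.f_p, Category.assoc, IsIso.inv_hom_id_assoc, hb]
    · change b.toFun (d.degen i) x ≫ inv Q.f = _
      rw [IsIso.comp_inv_eq]
      refine Q.isHornObj.hom_ext _ _ fun a => ?_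
      refine (hb _ _ _).trans ((A.2.hasFaces.face_degen i a d x).symm.trans ?_)
      exact (congrArg _ (Q.f_p a).symm).trans (Category.assoc _ _ _).symm
  exact ⟨⟨B, hB.isJet A.2⟩, Subtype.ext hB.bot_eq⟩

end Jet
end SMfd

/-! ### Comparison of the tower with the 1-jet -/

theorem exists_thread {C : ℕ → Type*} (down : ∀ k, C (k + 1) → C k) (n : ℕ)
    (h : ∀ k, n ≤ k → Function.Surjective (down k)) (a : C n) :
    ∃ F : ∀ k, C k, (∀ k, down k (F (k + 1)) = F k) ∧ F n = a := by
  induction n generalizing C with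
  | zero =>
    choose up hup using fun k => h k k.zero_le
    exact ⟨fun k => Nat.rec a up k, fun k => hup _ _, rfl⟩
  | succ n ih =>
    obtain ⟨F, hF, hFn⟩ := ih (C := fun k => C (k + 1)) (fun k => down (k + 1))
      (fun k hk => h _ (Nat.succ_le_succ hk)) a
    refine ⟨fun k => Nat.casesOn k (down 0 (F 0)) F, fun k => ?_, hFn⟩
    cases k with
    | zero => rfl
    | succ k => exact hF k

/-- Below `n` a compatible sequence is obtained by projecting; above `n` it is determined by
injectivity. -/
theorem thread_ext {C : ℕ → Type*} (down : ∀ k, C (k + 1) → C k) (n : ℕ)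
    (h : ∀ k, n ≤ k → Function.Injective (down k)) {F G : ∀ k, C k}
    (hF : ∀ k, down k (F (k + 1)) = F k) (hG : ∀ k, down k (G (k + 1)) = G k) (hn : F n = G n) (k : ℕ) :
    F k = G k := by
  rcases le_total n k with hk | hk
  · induction k, hk using Nat.le_induction with
    | base => exact hn
    | succ k hk ih => exact h k hk (by rw [hF, hG, ih])
  · induction hk using Nat.decreasingInduction with
    | self => exact hn
    | of_succ k _ ih => rw [← hF, ← hG, ih]

namespace SMfd
variable {X : SimplicialObject SMfd} {T : SMfd}

section
variable (Φ : prodObj (pairNerve oddLine) T ⟶ X ⋙ yoneda)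

/-- The value of a point of the 1-jet on vertices in the odd line. -/
def jetVal {S : SMfd} (k : ℕ) (d : Fin (k + 1) → (S ⟶ oddLine)) (x : S ⟶ T) : S ⟶ X _⦋k⦌ :=
  (Φ.app (op ⦋k⦌)).app (op S) (d, x)

theorem jetVal_nat {S S' : SMfd} (u : S' ⟶ S) (k : ℕ) (d : Fin (k + 1) → (S ⟶ oddLine)) (x : S ⟶ T) :
    jetVal Φ k (fun i => u ≫ d i) (u ≫ x) = u ≫ jetVal Φ k d x := by
  have h := ConcreteCategory.congr_hom (C := Type) ((Φ.app (op ⦋k⦌)).naturality u.op)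
  exact h (d, x)

theorem jetVal_map {k l : ℕ} (α : ⦋k⦌ ⟶ ⦋l⦌) {S : SMfd} (d : Fin (l + 1) → (S ⟶ oddLine)) (x : S ⟶ T) :
    jetVal Φ k (fun i => d (α.toOrderHom i)) x = jetVal Φ l d x ≫ X.map α.op := by
  have h := ConcreteCategory.congr_hom (C := Type) (NatTrans.congr_app (Φ.naturality α.op) (op S))
  exact h (d, x)

/-- The family of simplices whose first vertex is zero. -/
def jetFam (k : ℕ) : Fam (X _⦋k⦌) k T := ⟨fun d x => jetVal Φ k d.1 x, fun u d x => jetVal_nat Φ u k d.1 x⟩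

theorem jetFam_isExt (k : ℕ) : IsExt (jetFam Φ k) (jetFam Φ (k + 1)) :=
  ⟨fun i _ d x => (jetVal_map Φ (SimplexCategory.δ i.succ) d.1 x).symm,
    fun r _ d x => jetVal_map Φ (SimplexCategory.σ r) d.1 x⟩

theorem jetFam_isJet (k : ℕ) : IsJet k (jetFam Φ k) := by
  induction k with
  | zero => trivial
  | succ k ih => exact (jetFam_isExt Φ k).isJet ih

end

theorem jet_ext {Φ Ψ : prodObj (pairNerve oddLine) T ⟶ X ⋙ yoneda}
    (h : ∀ (k : ℕ) (S : SMfd) (d : Fin (k + 1) → (S ⟶ oddLine)) (x : S ⟶ T),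
      jetVal Φ k d x = jetVal Ψ k d x) : Φ = Ψ :=
  NatTrans.ext (funext fun k => NatTrans.ext (funext fun S => ConcreteCategory.hom_ext _ _ fun y =>
    h k.unop.len S.unop y.1 y.2))

/-- Cofaces and codegeneracies generate the simplex category, so compatibility with them implies
compatibility with every simplicial operator. -/
theorem exists_jet (f : ∀ (k : ℕ) {S : SMfd}, (Fin (k + 1) → (S ⟶ oddLine)) → (S ⟶ T) → (S ⟶ X _⦋k⦌))
    (hf : ∀ (k : ℕ) {S S' : SMfd} (u : S' ⟶ S) (d : Fin (k + 1) → (S ⟶ oddLine)) (x : S ⟶ T),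
      f k (fun i => u ≫ d i) (u ≫ x) = u ≫ f k d x)
    (hδ : ∀ (k : ℕ) (i : Fin (k + 2)) {S : SMfd} (d : Fin (k + 2) → (S ⟶ oddLine)) (x : S ⟶ T),
      f k (fun j => d (i.succAbove j)) x = f (k + 1) d x ≫ X.δ i)
    (hσ : ∀ (k : ℕ) (i : Fin (k + 1)) {S : SMfd} (d : Fin (k + 1) → (S ⟶ oddLine)) (x : S ⟶ T),
      f (k + 1) (fun j => d (i.predAbove j)) x = f k d x ≫ X.σ i) :
    ∃ Φ : prodObj (pairNerve oddLine) T ⟶ X ⋙ yoneda,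
      ∀ (k : ℕ) {S : SMfd} (d : Fin (k + 1) → (S ⟶ oddLine)) (x : S ⟶ T), jetVal Φ k d x = f k d x := by
  let P : MorphismProperty SimplexCategory := fun a b α =>
    ∀ ⦃S : SMfd⦄ (d : Fin (b.len + 1) → (S ⟶ oddLine)) (x : S ⟶ T),
      f a.len (fun i => d (α.toOrderHom i)) x = f b.len d x ≫ X.map α.op
  have : P.IsMultiplicative :=
    { id_mem := fun a S d x => by
        rw [op_id, X.map_id]
        exact (Category.comp_id (f a.len d x)).symm
      comp_mem := fun {a b c} α β hα hβ S d x => by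
        rw [op_comp, X.map_comp, ← Category.assoc, ← hβ, ← hα]; rfl }
  have htop : P = ⊤ := SimplexCategory.morphismProperty_eq_top P (fun i S d x => hδ _ i d x)
    fun i S d x => hσ _ i d x
  have hP : ∀ {a b : SimplexCategory} (α : a ⟶ b) {S : SMfd} (d : Fin (b.len + 1) → (S ⟶ oddLine))
      (x : S ⟶ T), f a.len (fun i => d (α.toOrderHom i)) x = f b.len d x ≫ X.map α.op :=
    fun {a b} α => by
      have h : P α := by rw [htop]; trivial
      exact fun {S} d x => h d x
  exact ⟨{ app := fun k =>
            { app := fun S => ↾fun y => f k.unop.len y.1 y.2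
              naturality := fun S S' u => ConcreteCategory.hom_ext _ _ fun y => hf _ u.unop y.1 y.2 }
           naturality := fun k l α => NatTrans.ext (funext fun S => ConcreteCategory.hom_ext _ _ fun y =>
            hP α.unop y.1 y.2) }, fun k {S} d x => rfl⟩

theorem ofParams_face {k : ℕ} {S : SMfd} (d : Fin (k + 2) → (S ⟶ oddLine)) (i : Fin (k + 2)) :
    (Tup.ofParams d).face i = Tup.ofParams fun j => d (i.succAbove j) := Tup.ext' fun j => by
  change Fin.cons (α := fun _ => S ⟶ oddLine) (zeroD S) d (i.succ.succAbove j) = _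
  induction j using Fin.cases with
  | zero => rw [Fin.succ_succAbove_zero]; rfl
  | succ j => rw [Fin.succ_succAbove_succ]; rfl

theorem ofParams_degen {k : ℕ} {S : SMfd} (d : Fin (k + 1) → (S ⟶ oddLine)) (r : Fin (k + 1)) :
    (Tup.ofParams d).degen r.succ = Tup.ofParams fun j => d (r.predAbove j) := Tup.ext' fun j => by
  change Fin.cons (α := fun _ => S ⟶ oddLine) (zeroD S) d (r.succ.predAbove j) = _
  induction j using Fin.cases with
  | zero => rw [Fin.predAbove_right_zero]; rfl
  | succ j => rw [Fin.succ_predAbove_succ]; rfl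

/-- A zero vertex put in front of a tuple that already starts with zero repeats its first vertex. -/
theorem ofParams_eq_degen {k : ℕ} {S : SMfd} (d : Tup k S) : Tup.ofParams d.1 = d.degen 0 := by
  rw [Tup.eq_degen (r := 0) (d := Tup.ofParams d.1) d.2.symm]
  refine congrArg _ (Tup.ext' fun j => ?_)
  induction j using Fin.cases with
  | zero => exact d.2.symm
  | succ j => rfl

/-- A simplex with arbitrary vertices is the 0-th face of the simplex with a zero vertex put in
front, so a jet is determined by its families with first vertex zero, and these by the one of
dimension `n`. -/
theorem jetFam_injective (n : ℕ) (hX : ∀ m, n ≤ m → ∃ Q : TopHorn X m, IsIso Q.f)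
    {Φ Ψ : prodObj (pairNerve oddLine) T ⟶ X ⋙ yoneda} (h : jetFam Φ n = jetFam Ψ n) : Φ = Ψ := by
  have h' := thread_ext (C := fun k => (jets X k).obj (op T)) (fun k => jetBot) n
    (fun k hk => by
      obtain ⟨Q, hQ⟩ := hX k hk
      exact jetBot_injective Q)
    (F := fun k => ⟨jetFam Φ k, jetFam_isJet Φ k⟩) (G := fun k => ⟨jetFam Ψ k, jetFam_isJet Ψ k⟩)
    (fun k => Subtype.ext (jetFam_isExt Φ k).bot_eq) (fun k => Subtype.ext (jetFam_isExt Ψ k).bot_eq)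
    (Subtype.ext h)
  have hv : ∀ (Φ : prodObj (pairNerve oddLine) T ⟶ X ⋙ yoneda) (k : ℕ) (S : SMfd)
      (d : Fin (k + 1) → (S ⟶ oddLine)) (x : S ⟶ T),
      jetVal Φ k d x = (jetFam Φ (k + 1)).toFun (Tup.ofParams d) x ≫ X.δ 0 := fun Φ k S d x =>
    jetVal_map Φ (SimplexCategory.δ 0) (Tup.ofParams d).1 x
  refine jet_ext fun k S d x => ?_
  rw [hv, hv, show jetFam Φ (k + 1) = jetFam Ψ (k + 1) from congrArg Subtype.val (h' (k + 1))]

/-- The family is prolonged to all dimensions, and a jet is defined by the 0-th faces of the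
simplices with a zero vertex in front. Its faces and degeneracies correspond, shifted by one, to
those already available. -/
theorem jetFam_surjective (n : ℕ) (hX : ∀ m, n ≤ m → ∃ Q : TopHorn X m, IsIso Q.f)
    (A : (jets X n).obj (op T)) : ∃ Φ : prodObj (pairNerve oddLine) T ⟶ X ⋙ yoneda, jetFam Φ n = A.1 := by
  obtain ⟨G, hG, rfl⟩ := exists_thread (C := fun k => (jets X k).obj (op T)) (fun k => jetBot) n
    (fun k hk => by
      obtain ⟨Q, hQ⟩ := hX k hk
      exact jetBot_surjective Q) A
  have hE : ∀ k, IsExt (G k).1 (G (k + 1)).1 := fun k => by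
    have h := (G (k + 1)).2.2
    rwa [show (G (k + 1)).1.bot = (G k).1 from congrArg Subtype.val (hG k)] at h
  obtain ⟨Φ, hΦ⟩ := exists_jet (X := X) (T := T)
    (fun k {S} d x => (G (k + 1)).1.toFun (Tup.ofParams d) x ≫ X.δ 0)
    (fun k {S S'} u d x => by rw [← Tup.comp_ofParams, (G (k + 1)).1.nat, Category.assoc])
    (fun k i {S} d x => by
      have := X.δ_comp_δ (i := 0) (j := i) (Fin.zero_le _)
      rw [Category.assoc]
      refine Eq.trans ?_ (congrArg ((G (k + 2)).1.toFun (Tup.ofParams d) x ≫ ·) this)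
      rw [← Category.assoc, (hE (k + 1)).face, ofParams_face])
    fun k i {S} d x => by
      have := X.δ_comp_σ_of_le (i := 0) (j := i) (Fin.zero_le _)
      rw [Category.assoc]
      refine Eq.trans ?_ (congrArg ((G (k + 1)).1.toFun (Tup.ofParams d) x ≫ ·) this)
      rw [← Category.assoc, ← (hE (k + 1)).degen, ofParams_degen]; rfl
  refine ⟨Φ, Fam.ext' fun S d x => (hΦ n d.1 x).trans ?_⟩
  rw [ofParams_eq_degen, (hE n).degen, Category.assoc]
  exact (congrArg _ X.δ_comp_σ_self).trans (Category.comp_id _)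

/-- A 1-jet is determined by its simplices of dimension `n` with first vertex zero. -/
def jetIso (n : ℕ) (hX : ∀ m, n ≤ m → ∃ Q : TopHorn X m, IsIso Q.f) :
    simplicialHom (pairNerve oddLine) (X ⋙ yoneda) ≅ jets X n :=
  NatIso.ofComponents (fun T => (Equiv.ofBijective
      (fun Φ : (simplicialHom (pairNerve oddLine) (X ⋙ yoneda)).obj T =>
        (⟨jetFam (T := T.unop) Φ n, jetFam_isJet Φ n⟩ : (jets X n).obj T))
      ⟨fun _ _ h => jetFam_injective n hX (congrArg Subtype.val h), fun A =>
        (jetFam_surjective n hX A).imp fun _ h => Subtype.ext h⟩).toIso)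
    fun _ => rfl

end SMfd

/-! ### The action of the endomorphisms of the odd line -/

namespace SMfd

theorem θ_comp_scale_neg_one {S : SMfd} (d : S ⟶ oddLine) : θ (d ≫ oddLine.scale (-1)) = -θ d := by
  have h : pb (oddLine.scale (-1)) (coordT 0 1 0) = -coordT 0 1 0 := by
    refine Subtype.ext (funext fun x => ?_)
    change ExteriorAlgebra.map ((-1 : ℝ) • LinearMap.id) (ExteriorAlgebra.ι ℝ (Pi.single 0 1)) =
      -ExteriorAlgebra.ι ℝ (Pi.single 0 1)
    rw [ExteriorAlgebra.map_apply_ι, ← map_neg]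
    simp
  rw [θ, pb_comp, h, ← zero_sub, pb_sub, pb_zero, zero_sub]
  rfl

end SMfd

section PairNerve
universe v u
variable {C : Type u} [Category.{v} C] {D S T : C} {Y : SimplexCategoryᵒᵖ ⥤ Cᵒᵖ ⥤ Type v}

theorem pairNerveAct_app (g : EndPoints D T) (f : (simplicialHom (pairNerve D) Y).obj (op T))
    (k : SimplexCategoryᵒᵖ) (Z : Cᵒᵖ) (d : Fin (k.unop.len + 1) → (Z.unop ⟶ D)) (x : Z.unop ⟶ T) :
    ((show prodObj (pairNerve D) T ⟶ Y from pairNerveAct g f).app k).app Z (d, x) =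
      ((show prodObj (pairNerve D) T ⟶ Y from f).app k).app Z (fun i => g.app Z (d i, x), x) := rfl

theorem simplicialHom_ext {f f' : (simplicialHom (pairNerve D) Y).obj (op T)}
    (h : ∀ (k : SimplexCategoryᵒᵖ) (Z : Cᵒᵖ) (d : Fin (k.unop.len + 1) → (Z.unop ⟶ D)) (x : Z.unop ⟶ T),
      ((show prodObj (pairNerve D) T ⟶ Y from f).app k).app Z (d, x) =
        ((show prodObj (pairNerve D) T ⟶ Y from f').app k).app Z (d, x)) : f = f' :=
  NatTrans.ext (funext fun k => NatTrans.ext (funext fun Z => ConcreteCategory.hom_ext _ _ fun y =>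
    h k Z y.1 y.2))

theorem pairNerveAct_one (f : (simplicialHom (pairNerve D) Y).obj (op T)) : pairNerveAct 1 f = f :=
  simplicialHom_ext fun _ _ _ _ => rfl

theorem EndPoints.mul_app (g h : EndPoints D T) (Z : Cᵒᵖ) (d : Z.unop ⟶ D) (x : Z.unop ⟶ T) :
    (g * h).app Z (d, x) = h.app Z (g.app Z (d, x), x) := rfl

theorem pairNerveAct_mul (g h : EndPoints D T) (f : (simplicialHom (pairNerve D) Y).obj (op T)) :
    pairNerveAct (g * h) f = pairNerveAct g (pairNerveAct h f) :=
  simplicialHom_ext fun k Z d x => by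
    rw [pairNerveAct_app, pairNerveAct_app, pairNerveAct_app]
    simp only [EndPoints.mul_app]

theorem pairNerveAct_pullback (u : S ⟶ T) (g : EndPoints D T)
    (f : (simplicialHom (pairNerve D) Y).obj (op T)) :
    pairNerveAct (g.pullback u) ((simplicialHom (pairNerve D) Y).map u.op f) =
      (simplicialHom (pairNerve D) Y).map u.op (pairNerveAct g f) :=
  simplicialHom_ext fun _ _ _ _ => rfl

end PairNerve

section Action
open SMfd
variable {X : SimplicialObject Mfd} {T : SMfd}

theorem oneJetAct_one (Φ : (oneJet X).obj (op T)) : oneJetAct X 1 Φ = Φ := pairNerveAct_one Φ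

theorem oneJetAct_mul (g h : EndPoints oddLine T) (Φ : (oneJet X).obj (op T)) :
    oneJetAct X (g * h) Φ = oneJetAct X g (oneJetAct X h Φ) := pairNerveAct_mul g h Φ

theorem oneJetAct_pullback {S : SMfd} (u : S ⟶ T) (g : EndPoints oddLine T) (Φ : (oneJet X).obj (op T)) :
    oneJetAct X (g.pullback u) ((oneJet X).map u.op Φ) = (oneJet X).map u.op (oneJetAct X g Φ) :=
  pairNerveAct_pullback u g Φ

/-- Naturality along the parity of the test object `S` replaces each odd parameter by its negative
and composes the morphism to `T` with the parity of `T`; on the value it has no effect, because X_k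
is purely even. -/
theorem oneJetAct_neg_one (Φ : (oneJet X).obj (op T)) :
    oneJetAct X (EndPoints.scalar T (-1)) Φ = (oneJet X).map T.parity.op Φ := jet_ext (X := toSMfd X) fun k S d x => by
  change jetVal (X := toSMfd X) Φ k (fun i => d i ≫ oddLine.scale (-1)) x =
    jetVal (X := toSMfd X) Φ k d (x ≫ T.parity)
  have hd : d = fun i => S.parity ≫ d i ≫ oddLine.scale (-1) := funext fun i => θ_inj (by
    rw [← pb_θ, pb_parity, SuperAlg.parityLin_odd _ (θ_mem _), θ_comp_scale_neg_one, neg_neg])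
  have hX : ((toSMfd X) _⦋k⦌).parity = 𝟙 _ := parity_eq_id (X _⦋k⦌).property.2.2
  have h := jetVal_nat (X := toSMfd X) Φ S.parity k (fun i => d i ≫ oddLine.scale (-1)) x
  rw [← hd, parity_comp x] at h
  refine Eq.trans ?_ h.symm
  rw [parity_comp, hX, Category.comp_id]

/-- The action of the endomorphisms of the odd line on a supermanifold representing the 1-jet. -/
def oneJetNQ {M : SMfd} (r : (oneJet X).RepresentableBy M) : NQManifold where
  space := M
  act g f := r.homEquiv.symm (oneJetAct X g (r.homEquiv f))
  act_natural u g f := r.homEquiv.injective (by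
    rw [r.homEquiv_comp, Equiv.apply_symm_apply, r.homEquiv_comp, Equiv.apply_symm_apply,
      oneJetAct_pullback])
  one_act f := by rw [oneJetAct_one, Equiv.symm_apply_apply]
  mul_act g h f := by rw [oneJetAct_mul, Equiv.apply_symm_apply]
  neg_one_act f := r.homEquiv.injective (by
    rw [Equiv.apply_symm_apply, oneJetAct_neg_one, ← parity_comp, r.homEquiv_comp])

theorem SMfd.exists_topHorn {n : ℕ} (hX : IsLieGroupoid n X) (m : ℕ) :
    ∃ Q : TopHorn (toSMfd X) m, IsSub Even Q.f ∧ (n ≤ m → IsIso Q.f) := by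
  obtain ⟨N, p, hp, f, hf, -⟩ := hornSub_of_isLieGroupoid hX m (m + 1) (by omega) le_rfl
  obtain ⟨h1, h2⟩ := isSub_horn hX m hp f hf
  exact ⟨⟨N, p, hp, f, hf⟩, h1, fun h => h2 (Nat.lt_succ_of_le h)⟩

end Action

end Supergeometry
end

open Supergeometry
theorem mainTheorem1 (n : ℕ) (X : SimplicialObject Mfd) (hX : IsLieGroupoid n X) :
    ∃ (M : NQManifold) (r : (oneJet X).RepresentableBy M.space),
      ∀ (T : SMfd) (g : EndPoints oddLine T) (f : T ⟶ M.space),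
        r.homEquiv (M.act g f) = oneJetAct X g (r.homEquiv f) := by
  obtain ⟨M, ⟨r⟩⟩ := SMfd.jets_representable (X := toSMfd X)
    (fun m => (SMfd.exists_topHorn hX m).imp fun _ h => h.1) n
  let r' : (oneJet X).RepresentableBy M := r.ofIso
    (SMfd.jetIso n fun m hm => (SMfd.exists_topHorn hX m).imp fun _ h => h.2 hm).symm
  -- The action on the representing object is defined by transport, so equivariance is immediate.
  exact ⟨oneJetNQ r', r', fun T g f => r'.homEquiv.apply_symm_apply _⟩
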